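/- Let $N\ge 0$ and let the indices $i,j,k,l$ run through $\pm1,\dots,\pm N$, with $\bar\imath=0$ if $i>0$ and $\bar\imath=1$ if $i<0$. Tensor products of $\mathbb Z_2$-graded algebras carry the product $(X\otimes Y)(X'\otimes Y')=(-1)^{\deg X'\deg Y}XX'\otimes YY'$, and $\theta(X\otimes Y)=(-1)^{\deg X\deg Y}\,Y\otimes X$. Square brackets denote supercommutators. **The Yangian.** Let $\mathrm Y(\mathfrak q_N)$ be the unital associative $\mathbb Z_2$-graded $\mathbb C$-algebra with generators $T_{ij}^{(s)}$, $s\ge1$, of degree $\bar\imath+\bar\jmath$, and the relations, for $T_{ij}(u)=\delta_{ij}+\sum_{s\ge1}T_{ij}^{(s)}u^{-s}$, $$(u^2-v^2)\,[T_{ij}(u),T_{kl}(v)]\,(-1)^{\bar\imath\bar k+\bar\imath\bar l+\bar k\bar l}=(u+v)\bigl(T_{kj}(u)T_{il}(v)-T_{kj}(v)T_{il}(u)\bigr)-(u-v)\bigl(T_{-k,j}(u)T_{-i,l}(v)-T_{k,-j}(v)T_{i,-l}(u)\bigr)(-1)^{\bar k+\bar l},$$ $$T_{ij}(-u)=T_{-i,-j}(u).$$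 It is a Hopf superalgebra with $\Delta(T_{ij}(u))=\sum_k T_{ik}(u)\otimes T_{kj}(u)\,(-1)^{(\bar\imath+\bar k)(\bar\jmath+\bar k)}$ and $\varepsilon(T_{ij}^{(s)})=0$ for $s\ge1$. Let $\mathrm Y(\mathfrak q_N,h)$ be the unital $\mathbb C[[h]]$-subalgebra of $\mathbb C[[h]]\otimes\mathrm Y(\mathfrak q_N)$ (with $h$ even) generated by the elements $H_{ij}^{(s)}=T_{ij}^{(s)}h^{s-1}$, $s\ge1$. The $\mathbb C[[h]]$-linear extension of $\Delta$ makes it a Hopf superalgebra over $\mathbb C[[h]]$. Put $\Delta^\circ=\theta\circ\Delta$. **The classical limit.** Let $\mathfrak g=\{X(u)\in\mathfrak{gl}_{N|N}[u]:\eta(X(u))=X(-u)\}$ with $\eta(E_{ij})=E_{-i,-j}$; it is spanned by the elements $F_{ij}^{(s)}=E_{ij}u^s+E_{-i,-j}(-u)^s$, $s\ge0$. Its universal enveloping algebra $\mathrm U(\mathfrak g)$ is a Hopf superalgebra in which the elements of $\mathfrak g$ are primitive. Let $$r(u,v)=\sum_{i,j}E_{ij}\otimes E_{ji}\,\frac{(-1)^{\bar\jmath}}{u-v}+\sum_{i,j}E_{ij}\otimes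 E_{-j,-i}\,\frac{(-1)^{\bar\jmath}}{u+v}.$$ The formula $\varphi(X(u))=[X(u)\otimes1+1\otimes X(v),\,r(u,v)]$ defines a map $\varphi:\mathfrak g\to\mathfrak g\otimes\mathfrak g\subset\mathfrak{gl}_{N|N}[u]\otimes\mathfrak{gl}_{N|N}[v]$. It extends, by the rule $\varphi(ab)=\varphi(a)\Delta(b)+\Delta(a)\varphi(b)$, to a linear map $\varphi:\mathrm U(\mathfrak g)\to\mathrm U(\mathfrak g)\otimes\mathrm U(\mathfrak g)$, and this makes $\mathrm U(\mathfrak g)$ a co-Poisson Hopf superalgebra: $\Delta$ is supercocommutative, and $\varphi$ is even and super-antisymmetric and satisfies the super co-Jacobi and co-Leibniz identities. **Proposition 2.4.** There is a surjective homomorphism $\psi:\mathrm Y(\mathfrak q_N,h)\to\mathrm U(\mathfrak g)$ of $\mathbb Z_2$-graded rings, linear over $\mathbb C[[h]]\to\mathbb C$, $h\mapsto0$, with $$\psi(H_{ij}^{(s)})=-(-1)^{\bar\jmath}\,F_{ji}^{(s-1)}\qquad(s\ge1),$$ whose kernel is $h\,\mathrm Y(\mathfrak q_N,h)$ and which respects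 the comultiplications, counits and antipodes. For every $X\in\mathrm Y(\mathfrak q_N,h)$ the element $\Delta(X)-\Delta^\circ(X)$ is divisible by $h$ in $\mathrm Y(\mathfrak q_N,h)\otimes_{\mathbb C[[h]]}\mathrm Y(\mathfrak q_N,h)$, with a unique quotient, and $$(\psi\otimes\psi)\bigl((\Delta(X)-\Delta^\circ(X))/h\bigr)=\varphi(\psi(X)).$$ Moreover $\mathrm Y(\mathfrak q_N,h)$ is a free $\mathbb C[[h]]$-module. Hence $\mathrm Y(\mathfrak q_N,h)$ is a quantisation of the co-Poisson Hopf superalgebra $\mathrm U(\mathfrak g)$. The existence of all the structures described above is part of the statement. -/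

import Mathlib

open scoped TensorProduct PowerSeries Polynomial

noncomputable section

/-! ### Superalgebras -/

/-- A `ℤ/2`-graded associative unital algebra over a commutative ring in which `2` is invertible,
given by its parity automorphism, `x ↦ (-1) ^ deg x • x` on homogeneous `x`. -/
class SuperAlgebra (R A : Type*) [CommRing R] [Ring A] [Algebra R A] where
  parity : A →ₐ[R] A
  parity_parity : ∀ a, parity (parity a) = a

namespace SuperAlgebra

theorem half_smul_two (R : Type*) {A : Type*} [CommRing R] [Ring A] [Algebra R A] [Algebra ℚ R]
    (x : A) : algebraMap ℚ R (1 / 2) • (x + x) = x := by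
  rw [smul_add, ← add_smul, ← map_add]; norm_num

section

variable (R A : Type*) [CommRing R] [Ring A] [Algebra R A] [SuperAlgebra R A]

/-- The homogeneous component of degree `i`: all `x` with `parity x = (-1) ^ i x`. -/
def degree (i : ZMod 2) : Submodule R A :=
  LinearMap.eqLocus (parity : A →ₐ[R] A).toLinearMap ((-1 : ℤˣ) ^ i • LinearMap.id)

variable {R A}

theorem mem_degree {i : ZMod 2} {x : A} :
    x ∈ degree R A i ↔ parity (R := R) x = (-1 : ℤˣ) ^ i • x := Iff.rfl

variable (R A)

instance gradedMonoid : SetLike.GradedMonoid (degree R A) where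
  one_mem := by simp [mem_degree]
  mul_mem i j x y hx hy := by
    rw [mem_degree] at *
    rw [map_mul, hx, hy, smul_mul_smul_comm, uzpow_add]

variable [Algebra ℚ R]

/-- The even part `(x + parity x) / 2`. -/
def evenPart : A →ₗ[R] degree R A 0 :=
  LinearMap.codRestrict (degree R A 0)
    (algebraMap ℚ R (1 / 2) • (LinearMap.id + (parity : A →ₐ[R] A).toLinearMap)) (fun x => by
      simp [mem_degree, parity_parity, add_comm])

/-- The odd part `(x - parity x) / 2`. -/
def oddPart : A →ₗ[R] degree R A 1 :=
  LinearMap.codRestrict (degree R A 1)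
    (algebraMap ℚ R (1 / 2) • (LinearMap.id - (parity : A →ₐ[R] A).toLinearMap)) (fun x => by
      simp [mem_degree, parity_parity, ← smul_neg])

theorem coe_evenPart (x : A) : (evenPart R A x : A) =
    algebraMap ℚ R (1 / 2) • (x + parity (R := R) x) := rfl

theorem coe_oddPart (x : A) : (oddPart R A x : A) =
    algebraMap ℚ R (1 / 2) • (x - parity (R := R) x) := rfl

/-- An element, as the sum of its even and its odd part. -/
def split : A →ₗ[R] DirectSum (ZMod 2) (fun i => degree R A i) :=
  (DirectSum.lof R (ZMod 2) (fun i => degree R A i) 0) ∘ₗ evenPart R A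
    + (DirectSum.lof R (ZMod 2) (fun i => degree R A i) 1) ∘ₗ oddPart R A

theorem coe_split (x : A) : DirectSum.coeLinearMap (degree R A) (split R A x) = x := by
  simp only [split, LinearMap.comp_apply, LinearMap.add_apply, map_add,
    DirectSum.coeLinearMap_lof, coe_evenPart, coe_oddPart]
  rw [← smul_add, add_add_sub_cancel, half_smul_two]

theorem split_coe (i : ZMod 2) (x : degree R A i) :
    split R A x = DirectSum.lof R (ZMod 2) (fun i => degree R A i) i x := by
  obtain ⟨x, hx⟩ := x
  have hi : i = 0 ∨ i = 1 := by clear hx; revert i; decide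
  rcases hi with rfl | rfl
  · have h0 : parity (R := R) x = x := by simpa using mem_degree.1 hx
    have h1 : evenPart R A x = ⟨x, hx⟩ := Subtype.ext (by
      rw [coe_evenPart, h0, half_smul_two])
    have h2 : oddPart R A x = 0 := Subtype.ext (by
      rw [coe_oddPart, h0, sub_self, smul_zero]; rfl)
    rw [split, LinearMap.add_apply, LinearMap.comp_apply, LinearMap.comp_apply, h1, h2, map_zero,
      add_zero]
  · have h0 : parity (R := R) x = -x := by simpa using mem_degree.1 hx
    have h1 : evenPart R A x = 0 := Subtype.ext (by
      rw [coe_evenPart, h0, add_neg_cancel, smul_zero]; rfl)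
    have h2 : oddPart R A x = ⟨x, hx⟩ := Subtype.ext (by
      rw [coe_oddPart, h0, sub_neg_eq_add, half_smul_two])
    rw [split, LinearMap.add_apply, LinearMap.comp_apply, LinearMap.comp_apply, h1, h2, map_zero,
      zero_add]

instance gradedAlgebra : GradedAlgebra (degree R A) where
  toGradedMonoid := gradedMonoid R A
  toDecomposition := DirectSum.Decomposition.ofLinearMap _ (split R A)
    (LinearMap.ext fun x => coe_split R A x)
    (DirectSum.linearMap_ext R fun i => LinearMap.ext fun x => by
      simp only [LinearMap.comp_apply, DirectSum.coeLinearMap_lof, split_coe, LinearMap.id_apply])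

/-- The tensor square of a superalgebra, with the product
`(x ⊗ y) (x' ⊗ y') = (-1) ^ (deg x' deg y) (x x' ⊗ y y')`. -/
abbrev TensorSq : Type _ := degree R A ᵍ⊗[R] degree R A

/-- The identity map from the tensor square as a module to the tensor square as an algebra. -/
abbrev toSq : A ⊗[R] A ≃ₗ[R] TensorSq R A := GradedTensorProduct.of R (degree R A) (degree R A)

/-- The flip `θ`, `x ⊗ y ↦ (-1) ^ (deg x deg y) y ⊗ x`. -/
def flip : A ⊗[R] A →ₗ[R] A ⊗[R] A :=
  (toSq R A).symm.toLinearMap ∘ₗ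
    (GradedTensorProduct.comm (degree R A) (degree R A)).toLinearMap ∘ₗ (toSq R A).toLinearMap

/-- The flip of the first two factors of a triple tensor product. -/
def flip₁₂ : A ⊗[R] (A ⊗[R] A) →ₗ[R] A ⊗[R] (A ⊗[R] A) :=
  (TensorProduct.assoc R A A A).toLinearMap ∘ₗ (flip R A).rTensor A ∘ₗ
    (TensorProduct.assoc R A A A).symm.toLinearMap

/-- The flip of the last two factors of a triple tensor product. -/
def flip₂₃ : A ⊗[R] (A ⊗[R] A) →ₗ[R] A ⊗[R] (A ⊗[R] A) := (flip R A).lTensor A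

end

end SuperAlgebra

open SuperAlgebra

/-! ### Hopf superalgebras, co-Poisson structures, quantisations -/

/-- A Hopf superalgebra structure on a superalgebra `A`. The comultiplication is an algebra
homomorphism to the tensor square with its signed product; all structure maps are even, so that
the coalgebra and the antipode axioms contain no further signs. -/
structure HopfSuperalgebra (R A : Type*) [CommRing R] [Algebra ℚ R] [Ring A] [Algebra R A]
    [SuperAlgebra R A] where
  comulHom : A →ₐ[R] TensorSq R A
  counit : A →ₐ[R] R
  antipode : A →ₗ[R] A
  comul : A →ₗ[R] A ⊗[R] A
  toSq_comul : ∀ a, toSq R A (comul a) = comulHom a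
  comul_parity : ∀ a, comul (parity (R := R) a) =
    TensorProduct.map (parity (R := R)).toLinearMap (parity (R := R)).toLinearMap (comul a)
  counit_parity : ∀ a, counit (parity (R := R) a) = counit a
  antipode_parity : ∀ a, antipode (parity (R := R) a) = parity (R := R) (antipode a)
  coassoc : ∀ a, TensorProduct.assoc R A A A (comul.rTensor A (comul a)) =
    comul.lTensor A (comul a)
  counit_left : ∀ a, counit.toLinearMap.rTensor A (comul a) = 1 ⊗ₜ a
  counit_right : ∀ a, counit.toLinearMap.lTensor A (comul a) = a ⊗ₜ 1
  antipode_left : ∀ a, LinearMap.mul' R A (antipode.rTensor A (comul a)) =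
    algebraMap R A (counit a)
  antipode_right : ∀ a, LinearMap.mul' R A (antipode.lTensor A (comul a)) =
    algebraMap R A (counit a)

section

variable {R A : Type*} [CommRing R] [Algebra ℚ R] [Ring A] [Algebra R A] [SuperAlgebra R A]

/-- `φ` makes the Hopf superalgebra `H` into a co-Poisson Hopf superalgebra: `H` is
(super-)cocommutative, and `φ` is an even map which is co-antisymmetric and satisfies the
co-Jacobi identity, the co-Leibniz rule, and `φ (a b) = φ a Δ b + Δ a φ b`. -/
structure IsCoPoisson (H : HopfSuperalgebra R A) (φ : A →ₗ[R] A ⊗[R] A) : Prop where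
  cocommutative : ∀ a, flip R A (H.comul a) = H.comul a
  map_parity : ∀ a, φ (parity (R := R) a) =
    TensorProduct.map (parity (R := R)).toLinearMap (parity (R := R)).toLinearMap (φ a)
  antisymm : ∀ a, flip R A (φ a) = - φ a
  jacobi : ∀ a, φ.lTensor A (φ a)
    + flip₂₃ R A (flip₁₂ R A (φ.lTensor A (φ a)))
    + flip₂₃ R A (flip₁₂ R A (flip₂₃ R A (flip₁₂ R A (φ.lTensor A (φ a))))) = 0
  leibniz : ∀ a, H.comul.lTensor A (φ a) =
    TensorProduct.assoc R A A A (φ.rTensor A (H.comul a))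
      + flip₁₂ R A (φ.lTensor A (H.comul a))
  map_mul : ∀ a b, toSq R A (φ (a * b)) =
    toSq R A (φ a) * H.comulHom b + H.comulHom a * toSq R A (φ b)

end

/-- The Hopf superalgebra `Hh` over `ℂ⟦h⟧` is, via `ψ`, a quantisation of the co-Poisson Hopf
superalgebra `(H, φ)` over `ℂ`. -/
structure IsQuantisation {A B : Type*} [Ring A] [Algebra ℂ A] [SuperAlgebra ℂ A]
    [Ring B] [Algebra ℂ⟦X⟧ B] [SuperAlgebra ℂ⟦X⟧ B]
    (H : HopfSuperalgebra ℂ A) (φ : A →ₗ[ℂ] A ⊗[ℂ] A) (Hh : HopfSuperalgebra ℂ⟦X⟧ B)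
    (ψ : B →ₛₗ[(PowerSeries.constantCoeff : ℂ⟦X⟧ →+* ℂ)] A) : Prop where
  isCoPoisson : IsCoPoisson H φ
  free : Module.Free ℂ⟦X⟧ B
  -- `ψ` induces an isomorphism of superalgebras from `B / h B` to `A`
  map_one : ψ 1 = 1
  map_mul : ∀ x y, ψ (x * y) = ψ x * ψ y
  map_parity : ∀ x, ψ (parity (R := ℂ⟦X⟧) x) = parity (R := ℂ) (ψ x)
  surjective : Function.Surjective ψ
  eq_zero_iff : ∀ x, ψ x = 0 ↔ ∃ y, x = (PowerSeries.X : ℂ⟦X⟧) • y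
  -- this isomorphism respects the Hopf structures
  map_comul : ∀ x, TensorProduct.map ψ ψ (Hh.comul x) = H.comul (ψ x)
  map_counit : ∀ x, PowerSeries.constantCoeff (Hh.counit x) = H.counit (ψ x)
  map_antipode : ∀ x, ψ (Hh.antipode x) = H.antipode (ψ x)
  -- `Δ x - Δ° x` is uniquely divisible by `h`, and the quotient reduces to `φ (ψ x)`
  cobracket : ∀ x, ∃ D : B ⊗[ℂ⟦X⟧] B,
    (∀ D', (PowerSeries.X : ℂ⟦X⟧) • D' = Hh.comul x - flip ℂ⟦X⟧ B (Hh.comul x) ↔ D' = D) ∧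
    TensorProduct.map ψ ψ D = φ (ψ x)

/-! ### Indices -/

/-- The index set `{±1, …, ±N}`: the index `a + 1 > 0` is `(a, 0)` and `-(a + 1)` is `(a, 1)`, so
that the second component is the parity of the index. -/
abbrev Idx (N : ℕ) : Type := Fin N × ZMod 2

/-- The index `-i`. -/
def opp {N : ℕ} (i : Idx N) : Idx N := (i.1, i.2 + 1)

theorem opp_opp {N : ℕ} (i : Idx N) : opp (opp i) = i := by
  have h : (1 : ZMod 2) + 1 = 0 := by decide
  simp [opp, add_assoc, h]

theorem sign_smul_sign_smul {M : Type*} [AddCommGroup M] (a : ZMod 2) (x : M) :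
    (-1 : ℤˣ) ^ a • (-1 : ℤˣ) ^ a • x = x := by
  rw [smul_smul, Int.units_mul_self, one_smul]

theorem sign_map {R A B : Type*} [CommRing R] [Ring A] [Ring B] [Algebra R A] [Algebra R B]
    (f : A →ₐ[R] B) (a : ℤˣ) (x : A) : f (a • x) = a • f x := by
  rw [Units.smul_def, Units.smul_def, map_zsmul]

/-! ### The twisted polynomial current Lie superalgebra -/

/-- The algebra `𝔤𝔩_{N|N}[u]` of polynomial functions with values in `End ℂ^{N|N}`. -/
abbrev Current (N : ℕ) : Type := Matrix (Idx N) (Idx N) ℂ[X]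

/-- The grading of `𝔤𝔩_{N|N}[u]`: `E i j` has degree `i.2 + j.2`, and `u` has degree `0`. -/
instance Current.superAlgebra (N : ℕ) : SuperAlgebra ℂ (Current N) where
  parity := AlgHom.ofLinearMap
    { toFun := fun M => Matrix.of fun i j => (-1 : ℤˣ) ^ (i.2 + j.2) • M i j
      map_add' := fun M M' => Matrix.ext fun i j => by
        simp only [Matrix.of_apply, Matrix.add_apply, smul_add]
      map_smul' := fun c M => Matrix.ext fun i j => by
        simp only [Matrix.of_apply, Matrix.smul_apply, RingHom.id_apply]
        rw [smul_comm] }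
    (by
      refine Matrix.ext fun i j => ?_
      by_cases h : i = j
      · subst h; simp [CharTwo.add_self_eq_zero]
      · simp [Matrix.one_apply_ne h])
    (fun M M' => by
      refine Matrix.ext fun i j => ?_
      simp only [LinearMap.coe_mk, AddHom.coe_mk, Matrix.of_apply, Matrix.mul_apply,
        Finset.smul_sum]
      refine Finset.sum_congr rfl fun k _ => ?_
      rw [smul_mul_smul_comm, ← uzpow_add]
      congr 2
      have h : k.2 + k.2 = 0 := CharTwo.add_self_eq_zero _
      linear_combination (-1 : ZMod 2) * h)
  parity_parity M := Matrix.ext fun i j => sign_smul_sign_smul _ _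

/-- The Lie superalgebra `𝔤` of all `M(u)` in `𝔤𝔩_{N|N}[u]` with `η (M(u)) = M(-u)`, where
`η (E i j) = E (-i) (-j)`. -/
def twistedCurrent (N : ℕ) : Submodule ℂ (Current N) where
  carrier := {M | ∀ i j, M (opp i) (opp j) = (M i j).comp (-Polynomial.X)}
  zero_mem' := by simp
  add_mem' h h' i j := by simp [h i j, h' i j]
  smul_mem' c M h i j := by simp [h i j]

theorem twistedCurrent_mul_mem {N : ℕ} {x y : Current N} (hx : x ∈ twistedCurrent N)
    (hy : y ∈ twistedCurrent N) : x * y ∈ twistedCurrent N := by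
  intro i j
  have e : ∑ k, x (opp i) k * y k (opp j) = ∑ k, x (opp i) (opp k) * y (opp k) (opp j) :=
    (Equiv.sum_comp (Function.Involutive.toPerm opp opp_opp)
      (fun k => x (opp i) k * y k (opp j))).symm
  rw [Matrix.mul_apply, e, Matrix.mul_apply, Polynomial.sum_comp]
  exact Finset.sum_congr rfl fun k _ => by rw [hx i k, hy k j, Polynomial.mul_comp]

theorem twistedCurrent_sign_mem {N : ℕ} {x : Current N} (a : ℤˣ) (hx : x ∈ twistedCurrent N) :
    a • x ∈ twistedCurrent N := by
  rcases Int.units_eq_one_or a with rfl | rfl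
  · simpa using hx
  · simpa using hx

theorem twistedCurrent_parity_mem {N : ℕ} {x : Current N} (hx : x ∈ twistedCurrent N) :
    parity (R := ℂ) x ∈ twistedCurrent N := by
  intro i j
  have h : (opp i).2 + (opp j).2 = i.2 + j.2 := by
    have h2 : (1 : ZMod 2) + 1 = 0 := by decide
    simp only [opp]
    linear_combination h2
  change (-1 : ℤˣ) ^ ((opp i).2 + (opp j).2) • x (opp i) (opp j) =
    ((-1 : ℤˣ) ^ (i.2 + j.2) • x i j).comp (-Polynomial.X)
  rw [h, hx i j]
  rcases Int.units_eq_one_or ((-1 : ℤˣ) ^ (i.2 + j.2)) with h | h <;> simp [h]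

/-- The supercommutator `[x, y] = x y - (-1) ^ (a b) y x` of elements `x`, `y` of `𝔤` that are
homogeneous of degrees `a`, `b`. -/
def twistedBracket {N : ℕ} (a b : ZMod 2) (x y : twistedCurrent N) : twistedCurrent N :=
  ⟨(x : Current N) * y - (-1 : ℤˣ) ^ (a * b) • ((y : Current N) * x),
    sub_mem (twistedCurrent_mul_mem x.2 y.2)
      (twistedCurrent_sign_mem _ (twistedCurrent_mul_mem y.2 x.2))⟩

/-- The element `F i j ^ (s) = E i j u ^ s + E (-i) (-j) (-u) ^ s` of `𝔤`. -/
def twistedF {N : ℕ} (i j : Idx N) (s : ℕ) : twistedCurrent N :=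
  ⟨Matrix.single i j (Polynomial.X ^ s) +
      Matrix.single (opp i) (opp j) ((-Polynomial.X) ^ s), by
    have inj : ∀ k l : Idx N, opp k = opp l ↔ k = l := fun k l =>
      (Function.Involutive.injective opp_opp).eq_iff
    have sw : ∀ k l : Idx N, k = opp l ↔ opp k = l := fun k l =>
      ⟨fun h => by rw [h, opp_opp], fun h => by rw [← h, opp_opp]⟩
    intro k l
    simp only [Matrix.add_apply, Matrix.single_apply, inj, Polynomial.add_comp, sw]
    rw [add_comm]
    congr 1
    · split_ifs <;> simp
    · split_ifs <;> simp⟩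

/-! ### The universal enveloping superalgebra of `𝔤` -/

/-- The defining relations `x y - (-1) ^ (deg x deg y) y x = [x, y]` of `U(𝔤)`. -/
inductive EnvRel (N : ℕ) :
    TensorAlgebra ℂ (twistedCurrent N) → TensorAlgebra ℂ (twistedCurrent N) → Prop
  | bracket (a b : ZMod 2) (x y : twistedCurrent N)
      (hx : (x : Current N) ∈ degree ℂ (Current N) a)
      (hy : (y : Current N) ∈ degree ℂ (Current N) b) :
      EnvRel N
        (TensorAlgebra.ι ℂ x * TensorAlgebra.ι ℂ y
          - (-1 : ℤˣ) ^ (a * b) • (TensorAlgebra.ι ℂ y * TensorAlgebra.ι ℂ x))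
        (TensorAlgebra.ι ℂ (twistedBracket a b x y))

/-- The universal enveloping algebra `U(𝔤)`. -/
def Env (N : ℕ) : Type := RingQuot (EnvRel N)

instance Env.ring (N : ℕ) : Ring (Env N) := inferInstanceAs (Ring (RingQuot (EnvRel N)))

instance Env.algebra (N : ℕ) : Algebra ℂ (Env N) :=
  inferInstanceAs (Algebra ℂ (RingQuot (EnvRel N)))

/-- The canonical map `𝔤 → U(𝔤)`. -/
def Env.ι (N : ℕ) : twistedCurrent N →ₗ[ℂ] Env N :=
  (RingQuot.mkAlgHom ℂ (EnvRel N)).toLinearMap ∘ₗ TensorAlgebra.ι ℂ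

theorem Env.ι_bracket {N : ℕ} (a b : ZMod 2) (x y : twistedCurrent N)
    (hx : (x : Current N) ∈ degree ℂ (Current N) a)
    (hy : (y : Current N) ∈ degree ℂ (Current N) b) :
    Env.ι N x * Env.ι N y - (-1 : ℤˣ) ^ (a * b) • (Env.ι N y * Env.ι N x) =
      Env.ι N (twistedBracket a b x y) := by
  have h := RingQuot.mkAlgHom_rel ℂ (EnvRel.bracket a b x y hx hy)
  rw [map_sub, map_mul, sign_map, map_mul] at h
  exact h

/-- The parity automorphism of `𝔤`. -/
def twistedParity (N : ℕ) : twistedCurrent N →ₗ[ℂ] twistedCurrent N :=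
  (parity : Current N →ₐ[ℂ] Current N).toLinearMap.restrict
    (fun _ hx => twistedCurrent_parity_mem hx)

theorem Env.parity_rel {N : ℕ} ⦃u v : TensorAlgebra ℂ (twistedCurrent N)⦄ (h : EnvRel N u v) :
    TensorAlgebra.lift ℂ (Env.ι N ∘ₗ twistedParity N) u =
      TensorAlgebra.lift ℂ (Env.ι N ∘ₗ twistedParity N) v := by
  obtain ⟨a, b, x, y, hx, hy⟩ := h
  have key : ∀ (z : twistedCurrent N),
      ((twistedParity N z : twistedCurrent N) : Current N) = parity (R := ℂ) (z : Current N) :=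
    fun z => rfl
  have hx' : ((twistedParity N x : twistedCurrent N) : Current N) ∈ degree ℂ (Current N) a := by
    rw [mem_degree, key] at *
    rw [hx, sign_map, hx]
  have hy' : ((twistedParity N y : twistedCurrent N) : Current N) ∈ degree ℂ (Current N) b := by
    rw [mem_degree, key] at *
    rw [hy, sign_map, hy]
  have hb : twistedParity N (twistedBracket a b x y) =
      twistedBracket a b (twistedParity N x) (twistedParity N y) := by
    apply Subtype.ext
    rw [key]
    simp only [twistedBracket]
    rw [map_sub, map_mul, sign_map, map_mul]
    rfl
  rw [map_sub, map_mul, sign_map, map_mul]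
  simp only [TensorAlgebra.lift_ι_apply, LinearMap.comp_apply]
  rw [hb]
  exact Env.ι_bracket a b _ _ hx' hy'

/-- The parity automorphism of `U(𝔤)`, extending that of `𝔤`. -/
def Env.parityHom (N : ℕ) : Env N →ₐ[ℂ] Env N :=
  RingQuot.liftAlgHom ℂ ⟨TensorAlgebra.lift ℂ (Env.ι N ∘ₗ twistedParity N), Env.parity_rel⟩

theorem Env.parityHom_ι {N : ℕ} (x : twistedCurrent N) :
    Env.parityHom N (Env.ι N x) = Env.ι N (twistedParity N x) := by
  have h := RingQuot.liftAlgHom_mkAlgHom_apply ℂ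
    (TensorAlgebra.lift ℂ (Env.ι N ∘ₗ twistedParity N)) (s := EnvRel N) Env.parity_rel
    (TensorAlgebra.ι ℂ x)
  rw [TensorAlgebra.lift_ι_apply] at h
  exact h

instance Env.superAlgebra (N : ℕ) : SuperAlgebra ℂ (Env N) where
  parity := Env.parityHom N
  parity_parity a := by
    have h : (Env.parityHom N).comp (Env.parityHom N) = AlgHom.id ℂ (Env N) := by
      refine RingQuot.ringQuot_ext' ℂ _ _ (TensorAlgebra.hom_ext (LinearMap.ext fun x => ?_))
      change Env.parityHom N (Env.parityHom N (Env.ι N x)) = Env.ι N x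
      rw [Env.parityHom_ι, Env.parityHom_ι]
      congr 1
      exact Subtype.ext (parity_parity (R := ℂ) (x : Current N))
    exact DFunLike.congr_fun h a

/-! ### The co-supercommutator of `𝔤` -/

/-- The simple tensor `x ⊗ y` in the superalgebra `𝔤𝔩_{N|N}[u] ⊗ 𝔤𝔩_{N|N}[v]`. -/
def ctmul {N : ℕ} (x y : Current N) : TensorSq ℂ (Current N) := toSq ℂ (Current N) (x ⊗ₜ y)

/-- The variable `u` of the first tensor factor. -/
def varU (N : ℕ) : TensorSq ℂ (Current N) := ctmul (algebraMap ℂ[X] (Current N) Polynomial.X) 1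

/-- The variable `v` of the second tensor factor. -/
def varV (N : ℕ) : TensorSq ℂ (Current N) := ctmul 1 (algebraMap ℂ[X] (Current N) Polynomial.X)

/-- The element `(u² - v²) r(u, v)` for the twisted rational `r`-matrix
`r(u, v) = ∑ E i j ⊗ E j i (-1) ^ j / (u - v) + ∑ E i j ⊗ E (-j) (-i) (-1) ^ j / (u + v)`. -/
def rNumerator (N : ℕ) : TensorSq ℂ (Current N) :=
  (varU N + varV N) * ∑ i : Idx N, ∑ j : Idx N,
      (-1 : ℤˣ) ^ j.2 • ctmul (Matrix.single i j 1) (Matrix.single j i 1)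
    + (varU N - varV N) * ∑ i : Idx N, ∑ j : Idx N,
      (-1 : ℤˣ) ^ j.2 • ctmul (Matrix.single i j 1) (Matrix.single (opp j) (opp i) 1)

/-- `δ : 𝔤 → 𝔤 ⊗ 𝔤` is the co-supercommutator `δ x = [x(u) ⊗ 1 + 1 ⊗ x(v), r(u, v)]`; both sides
are multiplied by the central non-zero-divisor `u² - v²`. As `r` is even, the supercommutator with
`r` is the ordinary one. -/
def IsTwistedCobracket {N : ℕ}
    (δ : twistedCurrent N →ₗ[ℂ] twistedCurrent N ⊗[ℂ] twistedCurrent N) : Prop :=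
  ∀ x : twistedCurrent N,
    (varU N ^ 2 - varV N ^ 2) * toSq ℂ (Current N)
        (TensorProduct.map (twistedCurrent N).subtype (twistedCurrent N).subtype (δ x)) =
      (ctmul (x : Current N) 1 + ctmul 1 (x : Current N)) * rNumerator N
        - rNumerator N * (ctmul (x : Current N) 1 + ctmul 1 (x : Current N))

/-- The standard Hopf structure of an enveloping superalgebra: the elements of `𝔤` are primitive.
The counit and the antipode are then determined. -/
def IsEnvelopingHopf {N : ℕ} (H : HopfSuperalgebra ℂ (Env N)) : Prop :=
  ∀ x : twistedCurrent N,
    H.comul (Env.ι N x) = Env.ι N x ⊗ₜ 1 + 1 ⊗ₜ Env.ι N x ∧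
    H.counit (Env.ι N x) = 0 ∧ H.antipode (Env.ι N x) = - Env.ι N x

/-- `φ` is the extension of the co-supercommutator of `𝔤` to `U(𝔤)`. By the rule for products it
is determined by its values on `𝔤`. -/
def IsTwistedCoPoisson {N : ℕ} (H : HopfSuperalgebra ℂ (Env N))
    (φ : Env N →ₗ[ℂ] Env N ⊗[ℂ] Env N) : Prop :=
  (∃ δ : twistedCurrent N →ₗ[ℂ] twistedCurrent N ⊗[ℂ] twistedCurrent N,
    IsTwistedCobracket δ ∧
    ∀ x, φ (Env.ι N x) = TensorProduct.map (Env.ι N) (Env.ι N) (δ x)) ∧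
  ∀ a b, toSq ℂ (Env N) (φ (a * b)) =
    toSq ℂ (Env N) (φ a) * H.comulHom b + H.comulHom a * toSq ℂ (Env N) (φ b)

/-! ### The Yangian -/

/-- The generators: `(i, j, n)` stands for `T i j ^ (n + 1)`. -/
abbrev YangianGen (N : ℕ) : Type := Idx N × Idx N × ℕ

/-- The coefficient of `u ^ (-s)` in `T i j (u) = δ i j + T i j ^ (1) u⁻¹ + T i j ^ (2) u⁻² + …`,
for every integer `s`. -/
def freeT {N : ℕ} (i j : Idx N) : ℤ → FreeAlgebra ℂ (YangianGen N)
  | Int.ofNat 0 => if i = j then 1 else 0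
  | Int.ofNat (n + 1) => FreeAlgebra.ι ℂ (i, j, n)
  | Int.negSucc _ => 0

/-- The supercommutator of the coefficients of `u ^ (-p)` in `T i j (u)` and of `v ^ (-q)` in
`T k l (v)`. -/
def freeComm {N : ℕ} (i j k l : Idx N) (p q : ℤ) : FreeAlgebra ℂ (YangianGen N) :=
  freeT i j p * freeT k l q
    - (-1 : ℤˣ) ^ ((i.2 + j.2) * (k.2 + l.2)) • (freeT k l q * freeT i j p)

/-- The coefficient of `u ^ (-p) v ^ (-q)` in `T k j (u) T i l (v) - T k j (v) T i l (u)`. -/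
def freeSwap {N : ℕ} (i j k l : Idx N) (p q : ℤ) : FreeAlgebra ℂ (YangianGen N) :=
  freeT k j p * freeT i l q - freeT k j q * freeT i l p

/-- The coefficient of `u ^ (-p) v ^ (-q)` in
`T (-k) j (u) T (-i) l (v) - T k (-j) (v) T i (-l) (u)`. -/
def freeTwist {N : ℕ} (i j k l : Idx N) (p q : ℤ) : FreeAlgebra ℂ (YangianGen N) :=
  freeT (opp k) j p * freeT (opp i) l q - freeT k (opp j) q * freeT i (opp l) p

/-- The defining relations of the Yangian: the coefficients at `u ^ (-p) v ^ (-q)` of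
`(u² - v²) [T i j (u), T k l (v)] (-1) ^ (i k + i l + k l)
  = (u + v) (T k j (u) T i l (v) - T k j (v) T i l (u))
    - (u - v) (T (-k) j (u) T (-i) l (v) - T k (-j) (v) T i (-l) (u)) (-1) ^ (k + l)`,
and those of `T i j (-u) = T (-i) (-j) (u)`. -/
inductive YangianRel (N : ℕ) :
    FreeAlgebra ℂ (YangianGen N) → FreeAlgebra ℂ (YangianGen N) → Prop
  | comm (i j k l : Idx N) (p q : ℤ) :
      YangianRel N
        ((-1 : ℤˣ) ^ (i.2 * k.2 + i.2 * l.2 + k.2 * l.2) •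
          (freeComm i j k l (p + 2) q - freeComm i j k l p (q + 2)))
        ((freeSwap i j k l (p + 1) q + freeSwap i j k l p (q + 1))
          - (-1 : ℤˣ) ^ (k.2 + l.2) •
            (freeTwist i j k l (p + 1) q - freeTwist i j k l p (q + 1)))
  | twist (i j : Idx N) (s : ℕ) :
      YangianRel N ((-1 : ℤˣ) ^ s • freeT i j s) (freeT (opp i) (opp j) s)

/-- The Yangian `Y(𝔮_N)`. -/
def Yangian (N : ℕ) : Type := RingQuot (YangianRel N)

instance Yangian.ring (N : ℕ) : Ring (Yangian N) := inferInstanceAs (Ring (RingQuot (YangianRel N)))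

instance Yangian.algebra (N : ℕ) : Algebra ℂ (Yangian N) :=
  inferInstanceAs (Algebra ℂ (RingQuot (YangianRel N)))

/-- The coefficient `T i j ^ (s)` of `u ^ (-s)` in `T i j (u)`; for `s ≥ 1` these are the
generators, and `T i j ^ (0) = δ i j`. -/
def Yangian.T {N : ℕ} (i j : Idx N) (s : ℕ) : Yangian N :=
  RingQuot.mkAlgHom ℂ (YangianRel N) (freeT i j s)

/-- The parity automorphism of the free algebra, with `T i j ^ (s)` of degree `i.2 + j.2`. -/
def freeParity (N : ℕ) : FreeAlgebra ℂ (YangianGen N) →ₐ[ℂ] FreeAlgebra ℂ (YangianGen N) :=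
  FreeAlgebra.lift ℂ fun x => (-1 : ℤˣ) ^ (x.1.2 + x.2.1.2) • FreeAlgebra.ι ℂ x

theorem freeParity_freeT {N : ℕ} (i j : Idx N) (s : ℤ) :
    freeParity N (freeT i j s) = (-1 : ℤˣ) ^ (i.2 + j.2) • freeT i j s := by
  match s with
  | Int.ofNat 0 =>
    by_cases h : i = j
    · subst h; simp [freeT, CharTwo.add_self_eq_zero]
    · simp [freeT, h]
  | Int.ofNat (n + 1) => simp [freeT, freeParity]
  | Int.negSucc _ => simp [freeT]

theorem freeParity_sign {N : ℕ} (a : ℤˣ) (x : FreeAlgebra ℂ (YangianGen N)) :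
    freeParity N (a • x) = a • freeParity N x := by
  rw [sign_map]

theorem freeParity_freeT_mul {N : ℕ} (i j k l : Idx N) (p q : ℤ) :
    freeParity N (freeT i j p * freeT k l q) =
      (-1 : ℤˣ) ^ (i.2 + j.2 + k.2 + l.2) • (freeT i j p * freeT k l q) := by
  rw [map_mul, freeParity_freeT, freeParity_freeT, smul_mul_smul_comm, ← uzpow_add]
  congr 2
  ring

theorem freeParity_freeComm {N : ℕ} (i j k l : Idx N) (p q : ℤ) :
    freeParity N (freeComm i j k l p q) =
      (-1 : ℤˣ) ^ (i.2 + j.2 + k.2 + l.2) • freeComm i j k l p q := by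
  rw [freeComm, map_sub, freeParity_sign, freeParity_freeT_mul, freeParity_freeT_mul, smul_sub,
    smul_comm ((-1 : ℤˣ) ^ ((i.2 + j.2) * (k.2 + l.2))),
    show k.2 + l.2 + i.2 + j.2 = i.2 + j.2 + k.2 + l.2 by ring]

theorem freeParity_freeSwap {N : ℕ} (i j k l : Idx N) (p q : ℤ) :
    freeParity N (freeSwap i j k l p q) =
      (-1 : ℤˣ) ^ (i.2 + j.2 + k.2 + l.2) • freeSwap i j k l p q := by
  rw [freeSwap, map_sub, freeParity_freeT_mul, freeParity_freeT_mul, smul_sub,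
    show k.2 + j.2 + i.2 + l.2 = i.2 + j.2 + k.2 + l.2 by ring]

theorem freeParity_freeTwist {N : ℕ} (i j k l : Idx N) (p q : ℤ) :
    freeParity N (freeTwist i j k l p q) =
      (-1 : ℤˣ) ^ (i.2 + j.2 + k.2 + l.2) • freeTwist i j k l p q := by
  have h : (1 : ZMod 2) + 1 = 0 := by decide
  rw [freeTwist, map_sub, freeParity_freeT_mul, freeParity_freeT_mul, smul_sub,
    show (opp k).2 + j.2 + (opp i).2 + l.2 = i.2 + j.2 + k.2 + l.2 by
      simp only [opp]; linear_combination h,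
    show k.2 + (opp j).2 + i.2 + (opp l).2 = i.2 + j.2 + k.2 + l.2 by
      simp only [opp]; linear_combination h]

theorem freeParity_rel {N : ℕ} {x y : FreeAlgebra ℂ (YangianGen N)} (h : YangianRel N x y) :
    ((RingQuot.mkAlgHom ℂ (YangianRel N)).comp (freeParity N)) x =
      ((RingQuot.mkAlgHom ℂ (YangianRel N)).comp (freeParity N)) y := by
  have key : ∃ a : ℤˣ, freeParity N x = a • x ∧ freeParity N y = a • y := by
    cases h with
    | comm i j k l p q =>
      refine ⟨(-1 : ℤˣ) ^ (i.2 + j.2 + k.2 + l.2), ?_, ?_⟩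
      · rw [freeParity_sign, map_sub, freeParity_freeComm, freeParity_freeComm, ← smul_sub,
          smul_comm]
      · rw [map_sub, freeParity_sign, map_sub, map_add, freeParity_freeSwap, freeParity_freeSwap,
          freeParity_freeTwist, freeParity_freeTwist, ← smul_sub, ← smul_add,
          smul_comm ((-1 : ℤˣ) ^ (k.2 + l.2)), ← smul_sub]
    | twist i j s =>
      have h2 : (1 : ZMod 2) + 1 = 0 := by decide
      refine ⟨(-1 : ℤˣ) ^ (i.2 + j.2), ?_, ?_⟩
      · rw [freeParity_sign, freeParity_freeT, smul_comm]
      · rw [freeParity_freeT, show (opp i).2 + (opp j).2 = i.2 + j.2 by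
          simp only [opp]; linear_combination h2]
  obtain ⟨a, hx, hy⟩ := key
  rw [AlgHom.comp_apply, AlgHom.comp_apply, hx, hy, sign_map, sign_map,
    RingQuot.mkAlgHom_rel ℂ h]

/-- The parity automorphism of the Yangian. -/
def Yangian.parityHom (N : ℕ) : Yangian N →ₐ[ℂ] Yangian N :=
  RingQuot.liftAlgHom ℂ ⟨(RingQuot.mkAlgHom ℂ (YangianRel N)).comp (freeParity N),
    fun _ _ h => freeParity_rel h⟩

theorem Yangian.parityHom_T {N : ℕ} (i j : Idx N) (s : ℕ) :
    Yangian.parityHom N (Yangian.T i j s) = (-1 : ℤˣ) ^ (i.2 + j.2) • Yangian.T i j s := by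
  have h := RingQuot.liftAlgHom_mkAlgHom_apply ℂ
    ((RingQuot.mkAlgHom ℂ (YangianRel N)).comp (freeParity N)) (s := YangianRel N)
    (fun _ _ h => freeParity_rel h) (freeT i j s)
  rw [AlgHom.comp_apply, freeParity_freeT, sign_map] at h
  exact h

instance Yangian.superAlgebra (N : ℕ) : SuperAlgebra ℂ (Yangian N) where
  parity := Yangian.parityHom N
  parity_parity a := by
    have h : (Yangian.parityHom N).comp (Yangian.parityHom N) = AlgHom.id ℂ (Yangian N) := by
      refine RingQuot.ringQuot_ext' ℂ _ _ (FreeAlgebra.hom_ext (funext fun x => ?_))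
      obtain ⟨i, j, n⟩ := x
      change Yangian.parityHom N (Yangian.parityHom N (Yangian.T i j (n + 1))) =
        Yangian.T i j (n + 1)
      rw [Yangian.parityHom_T, sign_map, Yangian.parityHom_T,
        sign_smul_sign_smul]
    exact DFunLike.congr_fun h a

/-- The Hopf structure of the Yangian:
`Δ (T i j (u)) = ∑ T i k (u) ⊗ T k j (u) (-1) ^ ((i + k) (j + k))`
and `ε (T i j (u)) = δ i j`. The antipode is then determined. -/
def IsYangianHopf {N : ℕ} (H : HopfSuperalgebra ℂ (Yangian N)) : Prop :=
  ∀ (i j : Idx N) (s : ℕ),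
    H.comul (Yangian.T i j s) =
      ∑ k : Idx N, ∑ ab ∈ Finset.HasAntidiagonal.antidiagonal s,
        (-1 : ℤˣ) ^ ((i.2 + k.2) * (j.2 + k.2)) • (Yangian.T i k ab.1 ⊗ₜ Yangian.T k j ab.2) ∧
    H.counit (Yangian.T i j (s + 1)) = 0

/-! ### The algebra `Y(𝔮_N, h)` -/

/-- The element `T i j ^ (n + 1) h ^ n` of `ℂ⟦h⟧ ⊗ Y(𝔮_N)`. -/
def scaledT {N : ℕ} (x : YangianGen N) : ℂ⟦X⟧ ⊗[ℂ] Yangian N :=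
  (PowerSeries.X ^ x.2.2 : ℂ⟦X⟧) ⊗ₜ Yangian.T x.1 x.2.1 (x.2.2 + 1)

/-- The `ℂ⟦h⟧`-algebra `Y(𝔮_N, h)`: the unital `ℂ⟦h⟧`-subalgebra of `ℂ⟦h⟧ ⊗ Y(𝔮_N)` generated by
the elements `T i j ^ (s) h ^ (s - 1)`, `s ≥ 1`. -/
def yangianSubalgebra (N : ℕ) : Subalgebra ℂ⟦X⟧ (ℂ⟦X⟧ ⊗[ℂ] Yangian N) :=
  Algebra.adjoin ℂ⟦X⟧ (Set.range scaledT)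

/-- The type of elements of `Y(𝔮_N, h)`. -/
abbrev YangianH (N : ℕ) : Type := yangianSubalgebra N

/-- The generator `H i j ^ (n + 1) = T i j ^ (n + 1) h ^ n`. -/
def YangianH.gen {N : ℕ} (i j : Idx N) (n : ℕ) : YangianH N :=
  ⟨scaledT (i, j, n), Algebra.subset_adjoin ⟨(i, j, n), rfl⟩⟩

/-- The parity automorphism of `ℂ⟦h⟧ ⊗ Y(𝔮_N)`, where `h` is even. -/
def scalarParity (N : ℕ) : ℂ⟦X⟧ ⊗[ℂ] Yangian N →ₐ[ℂ⟦X⟧] ℂ⟦X⟧ ⊗[ℂ] Yangian N :=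
  Algebra.TensorProduct.map (AlgHom.id ℂ⟦X⟧ ℂ⟦X⟧) (parity : Yangian N →ₐ[ℂ] Yangian N)

theorem scalarParity_scaledT {N : ℕ} (x : YangianGen N) :
    scalarParity N (scaledT x) = (-1 : ℤˣ) ^ (x.1.2 + x.2.1.2) • scaledT x := by
  have h : parity (R := ℂ) (Yangian.T x.1 x.2.1 (x.2.2 + 1)) =
      (-1 : ℤˣ) ^ (x.1.2 + x.2.1.2) • Yangian.T x.1 x.2.1 (x.2.2 + 1) := Yangian.parityHom_T _ _ _
  rw [scalarParity, scaledT, Algebra.TensorProduct.map_tmul, h]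
  rcases Int.units_eq_one_or ((-1 : ℤˣ) ^ (x.1.2 + x.2.1.2)) with h | h <;>
    simp [h, TensorProduct.tmul_neg]

theorem scalarParity_mem {N : ℕ} {x : ℂ⟦X⟧ ⊗[ℂ] Yangian N} (hx : x ∈ yangianSubalgebra N) :
    scalarParity N x ∈ yangianSubalgebra N := by
  have h : yangianSubalgebra N ≤ (yangianSubalgebra N).comap (scalarParity N) := by
    refine Algebra.adjoin_le ?_
    rintro _ ⟨x, rfl⟩
    change scalarParity N (scaledT x) ∈ yangianSubalgebra N
    have hx : scaledT x ∈ yangianSubalgebra N := Algebra.subset_adjoin ⟨x, rfl⟩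
    rw [scalarParity_scaledT]
    rcases Int.units_eq_one_or ((-1 : ℤˣ) ^ (x.1.2 + x.2.1.2)) with h | h <;> simpa [h] using hx
  exact h hx

theorem scalarParity_scalarParity {N : ℕ} (x : ℂ⟦X⟧ ⊗[ℂ] Yangian N) :
    scalarParity N (scalarParity N x) = x := by
  have h : (scalarParity N).comp (scalarParity N) = AlgHom.id ℂ⟦X⟧ _ := by
    refine Algebra.TensorProduct.ext (by ext) (AlgHom.ext fun a => ?_)
    simp [scalarParity, parity_parity]
  exact DFunLike.congr_fun h x

instance YangianH.superAlgebra (N : ℕ) : SuperAlgebra ℂ⟦X⟧ (YangianH N) where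
  parity := ((scalarParity N).comp (yangianSubalgebra N).val).codRestrict (yangianSubalgebra N)
    (fun x => scalarParity_mem x.2)
  parity_parity a := Subtype.ext (scalarParity_scalarParity (a : ℂ⟦X⟧ ⊗[ℂ] Yangian N))

/-- The comultiplication of `Hh` is the restriction to `Y(𝔮_N, h)` of the `ℂ⟦h⟧`-linear extension
of the comultiplication of `H`; here `ℂ⟦h⟧ ⊗ (Y ⊗ Y)` is identified with the tensor square of
`ℂ⟦h⟧ ⊗ Y` over `ℂ⟦h⟧`. -/
def IsLinearExtension {N : ℕ} (H : HopfSuperalgebra ℂ (Yangian N))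
    (Hh : HopfSuperalgebra ℂ⟦X⟧ (YangianH N)) : Prop :=
  ∀ x : YangianH N,
    TensorProduct.map (yangianSubalgebra N).val.toLinearMap (yangianSubalgebra N).val.toLinearMap
        (Hh.comul x) =
      TensorProduct.AlgebraTensorModule.distribBaseChange ℂ ℂ⟦X⟧ (Yangian N) (Yangian N)
        (H.comul.baseChange ℂ⟦X⟧ (x : ℂ⟦X⟧ ⊗[ℂ] Yangian N))

end

/-! The ternary relation says `R T₁ T₂ = T₂ T₁ R` for a matrix `R` acting on indices. Products of
supercommuting solutions and the identity matrix are again solutions (`rtt_superMul`,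
`ternaryRel_one`), which gives the comultiplication and the counit of the Yangian. The bialgebra
axioms compare algebra homomorphisms, so it suffices to check them on generators. Antipodes of the
Yangian and of `Y(𝔮_N, h)` come from a filtration whose bottom piece consists of scalars: there `η ε
- id` is locally nilpotent for convolution, and the geometric series inverts the identity
(`Bialg.IsConnected.toHopf`).

As a module, `Y(𝔮_N, h)` is the Rees module of the filtration in which `T^(n+1)` has degree `n`. A
filtered vector space has an adapted basis, so this module is free over `ℂ⟦h⟧` (`free_rees`). Hence
`h` is regular on it and on its tensor powers, and identities may be divided by `h`. In particular
the comultiplication restricts: on `T^(s) h^s` it is the product of matrices, and one factor `h` is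
cancelled.

The ternary relation, rescaled and divided by `h²`, shows by induction that modulo `h` the
generators satisfy the commutation relations of `𝔤` (`signedComm_gen_modEq`). This yields a
surjection from `U(𝔤)` onto the reduction of `Y(𝔮_N, h)` modulo `h`. Its injectivity is the heart of
the matter, and it is proved without any PBW theorem. The surjection is a coalgebra map, and `U(𝔤)`
is generated by primitive elements. Comultiplication followed by multiplication acts as `2^n` on the
`n`-th graded piece and as `2` on primitive elements; therefore a coalgebra map is injective as soon
as it is so on the span of `1` and `𝔤` (`IsPrimitivelyGenerated.injective`). On that span, scalars
are detected by the counit. Elements of `𝔤` are detected by the evaluation representation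
`T_ij^(n+1) ↦ -(-1)^j F_ji^(n)` of the Yangian in `𝔤𝔩_{N|N}[u]`: pairing the coefficient of `h^n`
with that of `u^n` gives a linear map that kills multiples of `h` and recovers the elements of `𝔤`
(`ternaryRel_evalT`, `detectHat_smul`).

The cocommutator `Δ - Δ°` is divisible by `h` on generators, hence everywhere. It satisfies the
co-Jacobi and co-Leibniz identities because `Δ` is even and coassociative; division by powers of `h`
and reduction modulo `h` transfer them to `U(𝔤)`. So the co-Poisson axioms on `U(𝔤)`, its
cocommutativity and its antipode are all inherited from the deformation.

It remains to see that the resulting cobracket on `𝔤` is the one given by the `r`-matrix. On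
generators it is an explicit sum over `u^a v^b` with `a + b` fixed; multiplication by `u² - v²`
telescopes this sum into the commutator with the numerator of `r(u, v)`
(`sq_sub_sq_mul_toSq_cobracketGen`). -/

set_option linter.unusedSectionVars false
set_option linter.unusedVariables false

noncomputable section

open SuperAlgebra

/-! ### Tensor products of superalgebras -/

namespace SuperAlgebra

section Homogeneous

variable {R A B C M : Type*} [CommRing R] [Algebra ℚ R] [Ring A] [Algebra R A] [SuperAlgebra R A]
  [Ring B] [Algebra R B] [SuperAlgebra R B] [Ring C] [Algebra R C] [SuperAlgebra R C]
  [AddCommGroup M] [Module R M]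

theorem zmod_two_cases (i : ZMod 2) : i = 0 ∨ i = 1 := by
  revert i; decide

theorem map_units_smul {F M N : Type*} [AddCommGroup M] [AddCommGroup N] [FunLike F M N]
    [AddMonoidHomClass F M N] (f : F) (a : ℤˣ) (x : M) : f (a • x) = a • f x := by
  rw [Units.smul_def, Units.smul_def, map_zsmul]

theorem units_smul_tmul {M N : Type*} [AddCommGroup M] [AddCommGroup N] [Module R M] [Module R N]
    (a : ℤˣ) (x : M) (y : N) : (a • x) ⊗ₜ[R] y = a • (x ⊗ₜ[R] y) := by
  rcases Int.units_eq_one_or a with rfl | rfl <;> simp [TensorProduct.neg_tmul]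

theorem tmul_units_smul {M N : Type*} [AddCommGroup M] [AddCommGroup N] [Module R M] [Module R N]
    (a : ℤˣ) (x : M) (y : N) : x ⊗ₜ[R] (a • y) = a • (x ⊗ₜ[R] y) := by
  rcases Int.units_eq_one_or a with rfl | rfl <;> simp [TensorProduct.tmul_neg]

theorem units_smul_mul {A : Type*} [Ring A] (a : ℤˣ) (x y : A) : (a • x) * y = a • (x * y) := by
  rcases Int.units_eq_one_or a with rfl | rfl <;> simp

theorem mul_units_smul {A : Type*} [Ring A] (a : ℤˣ) (x y : A) : x * (a • y) = a • (x * y) := by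
  rcases Int.units_eq_one_or a with rfl | rfl <;> simp

variable (R) in
-- Signs make sense only for homogeneous elements; since `2` is invertible, every element is the sum
-- of its even and odd parts, and additive statements with signs may be checked on these.
theorem homogeneous_induction {P : A → Prop} (add : ∀ x y, P x → P y → P (x + y))
    (mem : ∀ i, ∀ x ∈ degree R A i, P x) (x : A) : P x := by
  have h : x = (evenPart R A x : A) + oddPart R A x := by
    rw [coe_evenPart, coe_oddPart, ← smul_add, add_add_sub_cancel, half_smul_two]
  rw [h]
  exact add _ _ (mem 0 _ (evenPart R A x).2) (mem 1 _ (oddPart R A x).2)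

@[elab_as_elim]
theorem homogeneous_tmul_induction {P : A ⊗[R] B → Prop}
    (zero : P 0) (add : ∀ x y, P x → P y → P (x + y))
    (tmul : ∀ i j, ∀ a ∈ degree R A i, ∀ b ∈ degree R B j, P (a ⊗ₜ b)) (x : A ⊗[R] B) : P x := by
  induction x with
  | zero => exact zero
  | add x y hx hy => exact add x y hx hy
  | tmul a b =>
    refine homogeneous_induction R (P := fun a => P (a ⊗ₜ b))
      (fun x y hx hy => by rw [TensorProduct.add_tmul]; exact add _ _ hx hy) (fun i a ha => ?_) a
    exact homogeneous_induction R (P := fun b => P (a ⊗ₜ b))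
      (fun x y hx hy => by rw [TensorProduct.tmul_add]; exact add _ _ hx hy)
      (fun j b hb => tmul i j a ha b hb) b

theorem mul_mem_degree {i j : ZMod 2} {x y : A} (hx : x ∈ degree R A i) (hy : y ∈ degree R A j) :
    x * y ∈ degree R A (i + j) := (gradedMonoid R A).mul_mem hx hy

theorem one_mem_degree : (1 : A) ∈ degree R A 0 := (gradedMonoid R A).one_mem

theorem units_smul_mem_degree {i : ZMod 2} {x : A} (a : ℤˣ) (hx : x ∈ degree R A i) :
    a • x ∈ degree R A i := by
  rcases Int.units_eq_one_or a with rfl | rfl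
  · simpa using hx
  · simpa using hx

/-- The two base rings may differ, so that this also applies to reduction modulo `h`, which is only
semilinear. -/
theorem map_mem_degree {S F B : Type*} [CommRing S] [Ring B] [Algebra S B] [SuperAlgebra S B]
    [FunLike F A B] [AddMonoidHomClass F A B] {f : F}
    (hf : ∀ a, f (parity (R := R) a) = parity (R := S) (f a))
    {i : ZMod 2} {a : A} (ha : a ∈ degree R A i) : f a ∈ degree S B i := by
  rw [mem_degree, ← hf, mem_degree.1 ha, map_units_smul]

end Homogeneous

section Tensor

variable (R A B : Type*) [CommRing R] [Algebra ℚ R] [Ring A] [Algebra R A] [SuperAlgebra R A]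
  [Ring B] [Algebra R B] [SuperAlgebra R B]

/-- The tensor product of two superalgebras, with its signed product. -/
abbrev STensor : Type _ := degree R A ᵍ⊗[R] degree R B

/-- The identity map from the tensor product as a module to the tensor product as an algebra. -/
abbrev toST : A ⊗[R] B ≃ₗ[R] STensor R A B := GradedTensorProduct.of R (degree R A) (degree R B)

variable {R A B}
variable {A' B' C D : Type*} [Ring A'] [Algebra R A'] [SuperAlgebra R A']
  [Ring B'] [Algebra R B'] [SuperAlgebra R B'] [Ring C] [Algebra R C] [SuperAlgebra R C]
  [Ring D] [Algebra R D]

theorem toST_mul {i j : ZMod 2} (a : A) {b : B} (hb : b ∈ degree R B j) {a' : A}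
    (ha' : a' ∈ degree R A i) (b' : B) :
    toST R A B (a ⊗ₜ b) * toST R A B (a' ⊗ₜ b') =
      (-1 : ℤˣ) ^ (j * i) • toST R A B ((a * a') ⊗ₜ (b * b')) :=
  GradedTensorProduct.tmul_coe_mul_coe_tmul (degree R A) (degree R B) a ⟨b, hb⟩ ⟨a', ha'⟩ b'

theorem toST_one_left_mul (b : B) (a : A) (b' : B) :
    toST R A B (a ⊗ₜ 1) * toST R A B (1 ⊗ₜ b) = toST R A B (a ⊗ₜ b) :=
  GradedTensorProduct.tmul_one_mul_one_tmul _ _ a b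

@[elab_as_elim]
theorem STensor.induction {P : STensor R A B → Prop}
    (zero : P 0) (add : ∀ x y, P x → P y → P (x + y))
    (tmul : ∀ i j, ∀ a ∈ degree R A i, ∀ b ∈ degree R B j, P (toST R A B (a ⊗ₜ b)))
    (x : STensor R A B) : P x :=
  homogeneous_tmul_induction (P := fun x => P (toST R A B x)) zero add tmul
    ((toST R A B).symm x)

/-- A linear map out of a tensor product of superalgebras is multiplicative if it is so on
homogeneous simple tensors. -/
theorem STensor.map_mul_of_homogeneous (F : STensor R A B →ₗ[R] D)
    (h : ∀ i j i' j', ∀ a ∈ degree R A i, ∀ b ∈ degree R B j, ∀ a' ∈ degree R A i',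
      ∀ b' ∈ degree R B j', (-1 : ℤˣ) ^ (j * i') • F (toST R A B ((a * a') ⊗ₜ (b * b'))) =
        F (toST R A B (a ⊗ₜ b)) * F (toST R A B (a' ⊗ₜ b')))
    (x y : STensor R A B) : F (x * y) = F x * F y := by
  induction x using STensor.induction with
  | zero => simp
  | add x x' hx hx' => rw [add_mul, map_add, map_add, add_mul, hx, hx']
  | tmul i j a ha b hb =>
    induction y using STensor.induction with
    | zero => simp
    | add x x' hx hx' => rw [mul_add, map_add, map_add, mul_add, hx, hx']
    | tmul i' j' a' ha' b' hb' =>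
      rw [toST_mul a hb ha' b', map_units_smul, h i j i' j' a ha b hb a' ha' b' hb']

/-- The tensor product of two even homomorphisms. -/
def STensor.map (f : A →ₐ[R] A') (g : B →ₐ[R] B')
    (hf : ∀ a, f (parity (R := R) a) = parity (R := R) (f a))
    (hg : ∀ b, g (parity (R := R) b) = parity (R := R) (g b)) :
    STensor R A B →ₐ[R] STensor R A' B' :=
  AlgHom.ofLinearMap ((toST R A' B').toLinearMap ∘ₗ TensorProduct.map f.toLinearMap g.toLinearMap ∘ₗ
      (toST R A B).symm.toLinearMap)
    (by
      change toST R A' B' (f 1 ⊗ₜ g 1) = 1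
      rw [map_one, map_one]; rfl)
    (STensor.map_mul_of_homogeneous _ fun i j i' j' a ha b hb a' ha' b' hb' => by
      change _ • toST R A' B' (f (a * a') ⊗ₜ g (b * b')) =
        toST R A' B' (f a ⊗ₜ g b) * toST R A' B' (f a' ⊗ₜ g b')
      rw [map_mul, map_mul,
        toST_mul (f a) (map_mem_degree hg hb)
          (map_mem_degree hf ha') (g b')])

theorem STensor.map_toST (f : A →ₐ[R] A') (g : B →ₐ[R] B') (hf hg) (x : A ⊗[R] B) :
    STensor.map f g hf hg (toST R A B x) =
      toST R A' B' (TensorProduct.map f.toLinearMap g.toLinearMap x) := rfl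

variable (R A B) in
/-- The parity automorphism of a tensor product. -/
def STensor.parityHom : STensor R A B →ₐ[R] STensor R A B :=
  STensor.map parity parity (fun _ => rfl) (fun _ => rfl)

instance STensor.superAlgebra : SuperAlgebra R (STensor R A B) where
  parity := STensor.parityHom R A B
  parity_parity x := by
    induction x using STensor.induction with
    | zero => simp
    | add x y hx hy => rw [map_add, map_add, hx, hy]
    | tmul i j a _ b _ =>
      change toST R A B (parity (R := R) (parity (R := R) a) ⊗ₜ
        parity (R := R) (parity (R := R) b)) = _
      rw [parity_parity, parity_parity]

theorem STensor.parity_toST (x : A ⊗[R] B) :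
    parity (R := R) (toST R A B x) = toST R A B
      (TensorProduct.map (parity (R := R)).toLinearMap (parity (R := R)).toLinearMap x) := rfl

theorem toST_mem_degree {i j : ZMod 2} {a : A} (ha : a ∈ degree R A i) {b : B}
    (hb : b ∈ degree R B j) : toST R A B (a ⊗ₜ b) ∈ degree R (STensor R A B) (i + j) := by
  rw [mem_degree, STensor.parity_toST, TensorProduct.map_tmul, AlgHom.toLinearMap_apply,
    AlgHom.toLinearMap_apply, mem_degree.1 ha, mem_degree.1 hb, units_smul_tmul, tmul_units_smul,
    smul_smul, ← uzpow_add]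
  exact map_units_smul (toST R A B) _ _

variable (R A B C) in
/-- The associativity isomorphism of tensor products, as a linear map. -/
def STensor.assocLinear : STensor R (STensor R A B) C →ₗ[R] STensor R A (STensor R B C) :=
  (toST R A (STensor R B C)).toLinearMap ∘ₗ (toST R B C).toLinearMap.lTensor A ∘ₗ
    (TensorProduct.assoc R A B C).toLinearMap ∘ₗ (toST R A B).symm.toLinearMap.rTensor C ∘ₗ
      (toST R (STensor R A B) C).symm.toLinearMap

theorem STensor.assocLinear_toST (a : A) (b : B) (c : C) :
    STensor.assocLinear R A B C (toST R (STensor R A B) C (toST R A B (a ⊗ₜ b) ⊗ₜ c)) =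
      toST R A (STensor R B C) (a ⊗ₜ toST R B C (b ⊗ₜ c)) := rfl

@[elab_as_elim]
theorem STensor.induction₃ {P : STensor R (STensor R A B) C → Prop}
    (zero : P 0) (add : ∀ x y, P x → P y → P (x + y))
    (tmul : ∀ i j k, ∀ a ∈ degree R A i, ∀ b ∈ degree R B j, ∀ c ∈ degree R C k,
      P (toST R (STensor R A B) C (toST R A B (a ⊗ₜ b) ⊗ₜ c)))
    (x : STensor R (STensor R A B) C) : P x := by
  induction x using STensor.induction with
  | zero => exact zero
  | add x y hx hy => exact add x y hx hy
  | tmul i j a ha c hc =>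
    clear ha
    induction a using STensor.induction with
    | zero => rw [TensorProduct.zero_tmul, map_zero]; exact zero
    | add x y hx hy => rw [TensorProduct.add_tmul, map_add]; exact add _ _ hx hy
    | tmul i' j' a ha b hb => exact tmul i' j' j a ha b hb c hc

/-- Moving `a'` and `b'` to the left past `b` and `c` costs the same sign however the factors are
grouped: `k (i' + j') + j i' = (j + k) i' + k j'`. -/
theorem STensor.assocLinear_mul (x y : STensor R (STensor R A B) C) :
    STensor.assocLinear R A B C (x * y) =
      STensor.assocLinear R A B C x * STensor.assocLinear R A B C y := by
  induction x using STensor.induction₃ with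
  | zero => simp
  | add x x' hx hx' => rw [add_mul, map_add, map_add, add_mul, hx, hx']
  | tmul i j k a ha b hb c hc =>
    induction y using STensor.induction₃ with
    | zero => simp
    | add x x' hx hx' => rw [mul_add, map_add, map_add, mul_add, hx, hx']
    | tmul i' j' k' a' ha' b' hb' c' hc' =>
      rw [toST_mul _ hc (toST_mem_degree ha' hb') c', toST_mul a hb ha' b', map_units_smul,
        units_smul_tmul, map_units_smul (toST R (STensor R A B) C), map_units_smul]
      change _ • _ • STensor.assocLinear R A B C (toST R (STensor R A B) C
        (toST R A B ((a * a') ⊗ₜ (b * b')) ⊗ₜ (c * c'))) = _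
      rw [STensor.assocLinear_toST, STensor.assocLinear_toST, STensor.assocLinear_toST,
        toST_mul a (toST_mem_degree hb hc) ha' _, toST_mul b hc hb' c', tmul_units_smul,
        map_units_smul (toST R A (STensor R B C)), smul_smul, smul_smul, ← uzpow_add,
        ← uzpow_add]
      congr 2
      ring

end Tensor

end SuperAlgebra

/-! ### Flips -/

namespace SuperAlgebra

section Flip

variable {R S A B : Type*} [CommRing R] [Algebra ℚ R] [Ring A] [Algebra R A] [SuperAlgebra R A]
  [CommRing S] [Algebra ℚ S] [Ring B] [Algebra S B] [SuperAlgebra S B] {σ : R →+* S}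

theorem flip_tmul {i j : ZMod 2} {a b : A} (ha : a ∈ degree R A i) (hb : b ∈ degree R A j) :
    flip R A (a ⊗ₜ b) = (-1 : ℤˣ) ^ (j * i) • (b ⊗ₜ a) :=
  GradedTensorProduct.comm_coe_tmul_coe (degree R A) (degree R A) ⟨a, ha⟩ ⟨b, hb⟩

theorem toSq_flip_mul (x y : TensorSq R A) :
    toSq R A (flip R A ((toSq R A).symm (x * y))) =
      toSq R A (flip R A ((toSq R A).symm x)) * toSq R A (flip R A ((toSq R A).symm y)) :=
  map_mul (GradedTensorProduct.comm (degree R A) (degree R A)) x y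

theorem flip_flip (x : A ⊗[R] A) : flip R A (flip R A x) = x := by
  induction x using homogeneous_tmul_induction with
  | zero => simp
  | add x y hx hy => rw [map_add, map_add, hx, hy]
  | tmul i j a ha b hb =>
    rw [flip_tmul ha hb, map_units_smul, flip_tmul hb ha, mul_comm i j, sign_smul_sign_smul]

theorem flip_map (f : A →ₛₗ[σ] B) (hf : ∀ a, f (parity (R := R) a) = parity (R := S) (f a))
    (x : A ⊗[R] A) : flip S B (TensorProduct.map f f x) = TensorProduct.map f f (flip R A x) := by
  induction x using homogeneous_tmul_induction with
  | zero => simp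
  | add x y hx hy => simp only [map_add, hx, hy]
  | tmul i j a ha b hb =>
    rw [flip_tmul ha hb, map_units_smul, TensorProduct.map_tmul, TensorProduct.map_tmul,
      flip_tmul (map_mem_degree hf ha) (map_mem_degree hf hb)]

@[elab_as_elim]
theorem homogeneous_tmul_induction₃ {P : A ⊗[R] (A ⊗[R] A) → Prop}
    (zero : P 0) (add : ∀ x y, P x → P y → P (x + y))
    (tmul : ∀ i j k, ∀ a ∈ degree R A i, ∀ b ∈ degree R A j, ∀ c ∈ degree R A k,
      P (a ⊗ₜ (b ⊗ₜ c))) (x : A ⊗[R] (A ⊗[R] A)) : P x := by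
  induction x with
  | zero => exact zero
  | add x y hx hy => exact add x y hx hy
  | tmul a x =>
    refine homogeneous_induction R (P := fun a => P (a ⊗ₜ x))
      (fun x y hx hy => by rw [TensorProduct.add_tmul]; exact add _ _ hx hy) (fun i a ha => ?_) a
    exact homogeneous_tmul_induction (P := fun x => P (a ⊗ₜ x))
      (by rw [TensorProduct.tmul_zero]; exact zero)
      (fun x y hx hy => by rw [TensorProduct.tmul_add]; exact add _ _ hx hy)
      (fun j k b hb c hc => tmul i j k a ha b hb c hc) x

theorem flip₁₂_tmul {i j : ZMod 2} {a b : A} (ha : a ∈ degree R A i) (hb : b ∈ degree R A j)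
    (c : A) : flip₁₂ R A (a ⊗ₜ (b ⊗ₜ c)) = (-1 : ℤˣ) ^ (j * i) • (b ⊗ₜ (a ⊗ₜ c)) := by
  simp only [flip₁₂, LinearMap.comp_apply, LinearEquiv.coe_coe, TensorProduct.assoc_symm_tmul,
    LinearMap.rTensor_tmul, flip_tmul ha hb]
  rw [units_smul_tmul, map_units_smul, TensorProduct.assoc_tmul]

theorem flip₂₃_tmul {j k : ZMod 2} (a : A) {b c : A} (hb : b ∈ degree R A j)
    (hc : c ∈ degree R A k) :
    flip₂₃ R A (a ⊗ₜ (b ⊗ₜ c)) = (-1 : ℤˣ) ^ (k * j) • (a ⊗ₜ (c ⊗ₜ b)) := by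
  rw [flip₂₃, LinearMap.lTensor_tmul, flip_tmul hb hc, tmul_units_smul]

theorem flip₁₂_flip₁₂ (x : A ⊗[R] (A ⊗[R] A)) : flip₁₂ R A (flip₁₂ R A x) = x := by
  induction x using homogeneous_tmul_induction₃ with
  | zero => simp
  | add x y hx hy => rw [map_add, map_add, hx, hy]
  | tmul i j k a ha b hb c hc =>
    rw [flip₁₂_tmul ha hb, map_units_smul, flip₁₂_tmul hb ha, mul_comm i j, sign_smul_sign_smul]

theorem flip₂₃_flip₂₃ (x : A ⊗[R] (A ⊗[R] A)) : flip₂₃ R A (flip₂₃ R A x) = x := by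
  induction x using homogeneous_tmul_induction₃ with
  | zero => simp
  | add x y hx hy => rw [map_add, map_add, hx, hy]
  | tmul i j k a ha b hb c hc =>
    rw [flip₂₃_tmul a hb hc, map_units_smul, flip₂₃_tmul a hc hb, mul_comm j k,
      sign_smul_sign_smul]

/-- Both sides reverse the three factors with the sign of exponent `i j + i k + j k`. Together with
the involutivity of the flips, this gives an action of the symmetric group on three letters. -/
theorem flip_braid (x : A ⊗[R] (A ⊗[R] A)) :
    flip₁₂ R A (flip₂₃ R A (flip₁₂ R A x)) = flip₂₃ R A (flip₁₂ R A (flip₂₃ R A x)) := by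
  induction x using homogeneous_tmul_induction₃ with
  | zero => simp
  | add x y hx hy => simp only [map_add, hx, hy]
  | tmul i j k a ha b hb c hc =>
    rw [flip₁₂_tmul ha hb, map_units_smul, flip₂₃_tmul b ha hc, map_units_smul, map_units_smul,
      flip₁₂_tmul hb hc, flip₂₃_tmul a hb hc, map_units_smul, flip₁₂_tmul ha hc, map_units_smul,
      map_units_smul, flip₂₃_tmul c ha hb]
    simp only [smul_smul, ← uzpow_add]
    congr 2
    ring

theorem flip₁₂_assoc (x : (A ⊗[R] A) ⊗[R] A) :
    flip₁₂ R A (TensorProduct.assoc R A A A x) =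
      TensorProduct.assoc R A A A ((flip R A).rTensor A x) := by
  simp [flip₁₂]

/-- Moving the last factor to the front. -/
theorem flip₁₂_flip₂₃_assoc {t : A ⊗[R] A} {i : ZMod 2}
    (ht : toSq R A t ∈ degree R (STensor R A A) i) {b : A} {j : ZMod 2} (hb : b ∈ degree R A j) :
    flip₁₂ R A (flip₂₃ R A (TensorProduct.assoc R A A A (t ⊗ₜ b))) =
      (-1 : ℤˣ) ^ (j * i) • (b ⊗ₜ t) := by
  -- The sign depends on the degree of `t`; expressed through the parity automorphism, the claim
  -- becomes additive in `t` and can be checked on simple tensors.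
  have key : ∀ t : A ⊗[R] A,
      flip₁₂ R A (flip₂₃ R A (TensorProduct.assoc R A A A (t ⊗ₜ b))) =
      if j = 0 then b ⊗ₜ t else
        b ⊗ₜ ((toSq R A).symm (parity (R := R) (toSq R A t))) := by
    intro t
    induction t using homogeneous_tmul_induction with
    | zero => simp
    | add x y hx hy =>
      rw [TensorProduct.add_tmul, map_add, map_add, map_add, hx, hy]
      split_ifs <;> simp only [TensorProduct.tmul_add, map_add]
    | tmul k l a ha c hc =>
      rw [TensorProduct.assoc_tmul, flip₂₃_tmul a hc hb, map_units_smul, flip₁₂_tmul ha hb,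
        smul_smul, ← uzpow_add, mem_degree.1 (toST_mem_degree ha hc), map_units_smul,
        LinearEquiv.symm_apply_apply, tmul_units_smul]
      rcases zmod_two_cases j with rfl | rfl
      · simp
      · simp [add_comm]
  rw [key, mem_degree.1 ht, map_units_smul, LinearEquiv.symm_apply_apply, tmul_units_smul]
  rcases zmod_two_cases j with rfl | rfl <;> simp

/-- As `Δ` is even, `Δ a` has the degree of `a`, so moving `b` past `a` costs the same sign as
moving it past both factors of `Δ a`. -/
theorem lTensor_flip {Δ : A →ₗ[R] A ⊗[R] A} (hΔ : ∀ a, Δ (parity (R := R) a) =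
      TensorProduct.map (parity (R := R)).toLinearMap (parity (R := R)).toLinearMap (Δ a))
    (x : A ⊗[R] A) : Δ.lTensor A (flip R A x) =
    flip₁₂ R A (flip₂₃ R A (TensorProduct.assoc R A A A (Δ.rTensor A x))) := by
  induction x using homogeneous_tmul_induction with
  | zero => simp
  | add x y hx hy => simp only [map_add, hx, hy]
  | tmul i j a ha b hb =>
    have h : toSq R A (Δ a) ∈ degree R (STensor R A A) i :=
      map_mem_degree (f := (toSq R A).toLinearMap ∘ₗ Δ) (fun a => by
        rw [LinearMap.comp_apply, hΔ]; rfl) ha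
    rw [LinearMap.rTensor_tmul, flip₁₂_flip₂₃_assoc h hb, flip_tmul ha hb, map_units_smul,
      LinearMap.lTensor_tmul]

/-- The super-cocommutator `Δ - θ Δ`. -/
def cocomm (Δ : A →ₗ[R] A ⊗[R] A) : A →ₗ[R] A ⊗[R] A := Δ - flip R A ∘ₗ Δ

theorem cocomm_apply (Δ : A →ₗ[R] A ⊗[R] A) (a : A) : cocomm Δ a = Δ a - flip R A (Δ a) := rfl

theorem flip_cocomm (Δ : A →ₗ[R] A ⊗[R] A) (a : A) : flip R A (cocomm Δ a) = - cocomm Δ a := by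
  rw [cocomm_apply, map_sub, flip_flip, neg_sub]

theorem lTensor_cocomm (Δ : A →ₗ[R] A ⊗[R] A) (x : A ⊗[R] A) : (cocomm Δ).lTensor A x =
    Δ.lTensor A x - flip₂₃ R A (Δ.lTensor A x) := by
  rw [cocomm, LinearMap.lTensor_sub, LinearMap.lTensor_comp]
  rfl

theorem assoc_rTensor_cocomm (Δ : A →ₗ[R] A ⊗[R] A) (x : A ⊗[R] A) :
    TensorProduct.assoc R A A A ((cocomm Δ).rTensor A x) =
      TensorProduct.assoc R A A A (Δ.rTensor A x) -
        flip₁₂ R A (TensorProduct.assoc R A A A (Δ.rTensor A x)) := by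
  rw [cocomm, LinearMap.rTensor_sub, LinearMap.rTensor_comp, LinearMap.sub_apply, map_sub,
    flip₁₂_assoc]
  rfl

/-- The cocommutator of an even coassociative comultiplication satisfies the co-Jacobi identity. -/
theorem cocomm_jacobi {Δ : A →ₗ[R] A ⊗[R] A} (hΔ : ∀ a, Δ (parity (R := R) a) =
      TensorProduct.map (parity (R := R)).toLinearMap (parity (R := R)).toLinearMap (Δ a))
    (coassoc : ∀ a, TensorProduct.assoc R A A A (Δ.rTensor A (Δ a)) = Δ.lTensor A (Δ a)) (a : A) :
    (cocomm Δ).lTensor A (cocomm Δ a)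
      + flip₂₃ R A (flip₁₂ R A ((cocomm Δ).lTensor A (cocomm Δ a)))
      + flip₂₃ R A (flip₁₂ R A (flip₂₃ R A (flip₁₂ R A ((cocomm Δ).lTensor A (cocomm Δ a))))) =
        0 := by
  rw [lTensor_cocomm, cocomm_apply, map_sub, lTensor_flip hΔ, coassoc]
  -- By coassociativity every term is a signed permutation of the iterated comultiplication `t`, and
  -- what remains is an identity in the group ring of the symmetric group on three letters.
  generalize Δ.lTensor A (Δ a) = t
  simp only [map_sub, flip_braid, flip₂₃_flip₂₃, flip₁₂_flip₁₂]
  simp only [← flip_braid]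
  abel

/-- The cocommutator of an even coassociative comultiplication satisfies the co-Leibniz rule. -/
theorem cocomm_leibniz {Δ : A →ₗ[R] A ⊗[R] A} (hΔ : ∀ a, Δ (parity (R := R) a) =
      TensorProduct.map (parity (R := R)).toLinearMap (parity (R := R)).toLinearMap (Δ a))
    (coassoc : ∀ a, TensorProduct.assoc R A A A (Δ.rTensor A (Δ a)) = Δ.lTensor A (Δ a)) (a : A) :
    Δ.lTensor A (cocomm Δ a) = TensorProduct.assoc R A A A ((cocomm Δ).rTensor A (Δ a))
      + flip₁₂ R A ((cocomm Δ).lTensor A (Δ a)) := by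
  rw [lTensor_cocomm, cocomm_apply, map_sub, lTensor_flip hΔ, assoc_rTensor_cocomm, coassoc,
    map_sub]
  abel

end Flip

/-! ### Superbialgebras -/

/-- A superbialgebra: a Hopf superalgebra without its antipode. -/
structure Bialg (R A : Type*) [CommRing R] [Algebra ℚ R] [Ring A] [Algebra R A]
    [SuperAlgebra R A] where
  comulHom : A →ₐ[R] TensorSq R A
  counit : A →ₐ[R] R
  comulHom_parity : ∀ a, comulHom (parity (R := R) a) = parity (R := R) (comulHom a)
  counit_parity : ∀ a, counit (parity (R := R) a) = counit a
  coassoc : ∀ a, STensor.assocLinear R A A A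
      (STensor.map comulHom (AlgHom.id R A) comulHom_parity (fun _ => rfl) (comulHom a)) =
    STensor.map (AlgHom.id R A) comulHom (fun _ => rfl) comulHom_parity (comulHom a)
  counit_left : ∀ a, counit.toLinearMap.rTensor A ((toSq R A).symm (comulHom a)) = 1 ⊗ₜ a
  counit_right : ∀ a, counit.toLinearMap.lTensor A ((toSq R A).symm (comulHom a)) = a ⊗ₜ 1

section Bialg

variable {R A : Type*} [CommRing R] [Algebra ℚ R] [Ring A] [Algebra R A] [SuperAlgebra R A]

theorem degree_one_eq_zero_of_even (ε : A →ₐ[R] R) (hε : ∀ a, ε (parity (R := R) a) = ε a) {a : A}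
    (ha : a ∈ degree R A 1) : ε a = 0 := by
  have h := hε a
  rw [mem_degree.1 ha, map_units_smul] at h
  have h2 : ε a + ε a = 0 := by
    have h' : -ε a = ε a := by simpa [Units.smul_def] using h
    rw [add_eq_zero_iff_eq_neg, h']
  rw [← half_smul_two R (ε a), h2, smul_zero]

/-- The sign is nontrivial only for odd `a`, and there `ε` vanishes. This is why contraction with
the counit is multiplicative for the signed product. -/
theorem even_smul {i j : ZMod 2} (ε : A →ₐ[R] R) (hε : ∀ a, ε (parity (R := R) a) = ε a) {a : A}
    (ha : a ∈ degree R A i) {M : Type*} [AddCommGroup M] [Module R M] (x : M) :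
    (-1 : ℤˣ) ^ (j * i) • (ε a • x) = ε a • x := by
  rcases zmod_two_cases i with rfl | rfl
  · simp
  · rw [degree_one_eq_zero_of_even ε hε ha, zero_smul, smul_zero]

/-- `x ⊗ y ↦ ε x y` for an even character `ε`. -/
def counitLeftHom (ε : A →ₐ[R] R) (hε : ∀ a, ε (parity (R := R) a) = ε a) : TensorSq R A →ₐ[R] A :=
  AlgHom.ofLinearMap ((TensorProduct.lid R A).toLinearMap ∘ₗ ε.toLinearMap.rTensor A ∘ₗ
      (toSq R A).symm.toLinearMap)
    (by
      change ε 1 • (1 : A) = 1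
      rw [map_one, one_smul])
    (STensor.map_mul_of_homogeneous _ fun i j i' j' a ha b hb a' ha' b' hb' => by
      change _ • ε (a * a') • (b * b') = (ε a • b) * (ε a' • b')
      rw [map_mul, mul_smul, smul_comm, even_smul ε hε ha', smul_mul_smul_comm, mul_smul])

/-- `x ⊗ y ↦ ε y x` for an even character `ε`. -/
def counitRightHom (ε : A →ₐ[R] R) (hε : ∀ a, ε (parity (R := R) a) = ε a) : TensorSq R A →ₐ[R] A :=
  AlgHom.ofLinearMap ((TensorProduct.rid R A).toLinearMap ∘ₗ ε.toLinearMap.lTensor A ∘ₗ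
      (toSq R A).symm.toLinearMap)
    (by
      change ε 1 • (1 : A) = 1
      rw [map_one, one_smul])
    (STensor.map_mul_of_homogeneous _ fun i j i' j' a ha b hb a' ha' b' hb' => by
      change _ • ε (b * b') • (a * a') = (ε b • a) * (ε b' • a')
      rw [mul_comm j, map_mul, mul_smul, even_smul ε hε hb, smul_mul_smul_comm, mul_smul])

/-- Translates between two forms of coassociativity: the one with algebra homomorphisms between
signed tensor products, which can be checked on generators, and the one with plain tensor products
of modules. -/
theorem coassoc_iff (f : A →ₐ[R] TensorSq R A)
    (hf : ∀ a, f (parity (R := R) a) = parity (R := R) (f a)) (t : A ⊗[R] A) :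
    STensor.assocLinear R A A A (STensor.map f (AlgHom.id R A) hf (fun _ => rfl) (toSq R A t)) =
      STensor.map (AlgHom.id R A) f (fun _ => rfl) hf (toSq R A t) ↔
    TensorProduct.assoc R A A A (((toSq R A).symm.toLinearMap ∘ₗ f.toLinearMap).rTensor A t) =
      ((toSq R A).symm.toLinearMap ∘ₗ f.toLinearMap).lTensor A t := by
  have h1 : STensor.assocLinear R A A A
      (STensor.map f (AlgHom.id R A) hf (fun _ => rfl) (toSq R A t)) =
      toST R A (TensorSq R A) (((toSq R A).lTensor A) (TensorProduct.assoc R A A A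
        (((toSq R A).symm.toLinearMap ∘ₗ f.toLinearMap).rTensor A t))) := by
    induction t with
    | zero => simp
    | add x y hx hy => simp only [map_add, hx, hy]
    | tmul a b => rfl
  have h2 : STensor.map (AlgHom.id R A) f (fun _ => rfl) hf (toSq R A t) =
      toST R A (TensorSq R A) (((toSq R A).lTensor A)
        (((toSq R A).symm.toLinearMap ∘ₗ f.toLinearMap).lTensor A t)) := by
    clear h1
    induction t with
    | zero => simp
    | add x y hx hy => simp only [map_add, hx, hy]
    | tmul a b => rfl
  rw [h1, h2, (toST R A (TensorSq R A)).injective.eq_iff, ((toSq R A).lTensor A).injective.eq_iff]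

/-- The axioms of a superbialgebra may be checked on algebra generators. -/
def Bialg.ofGenerators (comulHom : A →ₐ[R] TensorSq R A) (counit : A →ₐ[R] R) (s : Set A)
    (hs : Algebra.adjoin R s = ⊤)
    (comulHom_parity : ∀ a ∈ s, comulHom (parity (R := R) a) = parity (R := R) (comulHom a))
    (counit_parity : ∀ a ∈ s, counit (parity (R := R) a) = counit a)
    (coassoc : ∀ a ∈ s, TensorProduct.assoc R A A A
      (((toSq R A).symm.toLinearMap ∘ₗ comulHom.toLinearMap).rTensor A
        ((toSq R A).symm (comulHom a))) =
      ((toSq R A).symm.toLinearMap ∘ₗ comulHom.toLinearMap).lTensor A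
        ((toSq R A).symm (comulHom a)))
    (counit_left : ∀ a ∈ s, counit.toLinearMap.rTensor A ((toSq R A).symm (comulHom a)) = 1 ⊗ₜ a)
    (counit_right : ∀ a ∈ s, counit.toLinearMap.lTensor A ((toSq R A).symm (comulHom a)) =
      a ⊗ₜ 1) : Bialg R A :=
  have hp : ∀ a, comulHom (parity (R := R) a) = parity (R := R) (comulHom a) := by
    have h : comulHom.comp parity = parity.comp comulHom :=
      AlgHom.ext_of_adjoin_eq_top hs comulHom_parity
    exact fun a => DFunLike.congr_fun h a
  have hε : ∀ a, counit (parity (R := R) a) = counit a := by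
    have h : counit.comp parity = counit := AlgHom.ext_of_adjoin_eq_top hs counit_parity
    exact fun a => DFunLike.congr_fun h a
  { comulHom := comulHom
    counit := counit
    comulHom_parity := hp
    counit_parity := hε
    coassoc := by
      let F : A →ₐ[R] STensor R A (TensorSq R A) :=
        (AlgHom.ofLinearMap (STensor.assocLinear R A A A) rfl STensor.assocLinear_mul).comp
          ((STensor.map comulHom (AlgHom.id R A) hp (fun _ => rfl)).comp comulHom)
      have h : F = (STensor.map (AlgHom.id R A) comulHom (fun _ => rfl) hp).comp comulHom :=
        AlgHom.ext_of_adjoin_eq_top hs fun a ha => (coassoc_iff comulHom hp _).2 (coassoc a ha)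
      exact fun a => DFunLike.congr_fun h a
    counit_left := by
      have h : (counitLeftHom counit hε).comp comulHom = AlgHom.id R A :=
        AlgHom.ext_of_adjoin_eq_top hs fun a ha => by
          change TensorProduct.lid R A (counit.toLinearMap.rTensor A _) = a
          erw [counit_left a ha]
          rw [TensorProduct.lid_tmul, one_smul]
      intro a
      refine (TensorProduct.lid R A).injective ?_
      rw [TensorProduct.lid_tmul, one_smul]
      exact DFunLike.congr_fun h a
    counit_right := by
      have h : (counitRightHom counit hε).comp comulHom = AlgHom.id R A :=
        AlgHom.ext_of_adjoin_eq_top hs fun a ha => by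
          change TensorProduct.rid R A (counit.toLinearMap.lTensor A _) = a
          erw [counit_right a ha]
          rw [TensorProduct.rid_tmul, one_smul]
      intro a
      refine (TensorProduct.rid R A).injective ?_
      rw [TensorProduct.rid_tmul, one_smul]
      exact DFunLike.congr_fun h a }

namespace Bialg

variable (H : Bialg R A)

/-- The comultiplication as a linear map. -/
def comul : A →ₗ[R] A ⊗[R] A := (toSq R A).symm.toLinearMap ∘ₗ H.comulHom.toLinearMap

theorem toSq_comul (a : A) : toSq R A (H.comul a) = H.comulHom a := rfl

theorem comul_parity (a : A) : H.comul (parity (R := R) a) =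
    TensorProduct.map (parity (R := R)).toLinearMap (parity (R := R)).toLinearMap (H.comul a) :=
  H.comulHom_parity a

theorem comul_coassoc (a : A) : TensorProduct.assoc R A A A (H.comul.rTensor A (H.comul a)) =
    H.comul.lTensor A (H.comul a) :=
  (coassoc_iff H.comulHom H.comulHom_parity _).1 (H.coassoc a)

/-- The underlying coalgebra of a superbialgebra. -/
abbrev toCoalgebra : Coalgebra R A where
  comul := H.comul
  counit := H.counit.toLinearMap
  coassoc := LinearMap.ext H.comul_coassoc
  rTensor_counit_comp_comul := LinearMap.ext H.counit_left
  lTensor_counit_comp_comul := LinearMap.ext H.counit_right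

end Bialg

end Bialg

end SuperAlgebra

/-! ### Filtrations by words -/

section WordFil

variable {R A T ι : Type*} [CommRing R] [Ring A] [Algebra R A] [Ring T] [Algebra R T]

/-- The span of all products of the elements `x i` of total weight at most `n`. -/
def wordFil (R : Type*) {A ι : Type*} [CommRing R] [Ring A] [Algebra R A] (x : ι → A) (w : ι → ℕ)
    (n : ℕ) : Submodule R A :=
  Submodule.span R {a | ∃ l : List ι, (l.map w).sum ≤ n ∧ (l.map x).prod = a}

variable {x : ι → A} {w : ι → ℕ}

theorem wordFil_mono {m n : ℕ} (h : m ≤ n) : wordFil R x w m ≤ wordFil R x w n :=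
  Submodule.span_mono fun _ ⟨l, hl, e⟩ => ⟨l, hl.trans h, e⟩

theorem list_prod_mem_wordFil (l : List ι) : (l.map x).prod ∈ wordFil R x w (l.map w).sum :=
  Submodule.subset_span ⟨l, le_rfl, rfl⟩

theorem one_mem_wordFil (n : ℕ) : (1 : A) ∈ wordFil R x w n :=
  Submodule.subset_span ⟨[], by simp, by simp⟩

theorem gen_mem_wordFil (i : ι) : x i ∈ wordFil R x w (w i) :=
  Submodule.subset_span ⟨[i], by simp, by simp⟩

theorem mul_mem_wordFil {m n : ℕ} {a b : A} (ha : a ∈ wordFil R x w m) (hb : b ∈ wordFil R x w n) :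
    a * b ∈ wordFil R x w (m + n) := by
  have h := Submodule.mul_mem_mul ha hb
  rw [wordFil, wordFil, Submodule.span_mul_span] at h
  refine Submodule.span_mono ?_ h
  rintro _ ⟨_, ⟨l, hl, rfl⟩, _, ⟨l', hl', rfl⟩, rfl⟩
  exact ⟨l ++ l', by simpa using add_le_add hl hl', by simp⟩

theorem exists_mem_wordFil (h : Algebra.adjoin R (Set.range x) = ⊤) (a : A) :
    ∃ n, a ∈ wordFil R x w n := by
  have ha : a ∈ Algebra.adjoin R (Set.range x) := by rw [h]; trivial
  induction ha using Algebra.adjoin_induction with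
  | mem a ha =>
    obtain ⟨i, rfl⟩ := ha
    exact ⟨_, gen_mem_wordFil i⟩
  | algebraMap r =>
    rw [Algebra.algebraMap_eq_smul_one]
    exact ⟨0, Submodule.smul_mem _ _ (one_mem_wordFil 0)⟩
  | add a b _ _ ha hb =>
    obtain ⟨m, ha⟩ := ha
    obtain ⟨n, hb⟩ := hb
    exact ⟨m + n, add_mem (wordFil_mono (Nat.le_add_right _ _) ha)
      (wordFil_mono (Nat.le_add_left _ _) hb)⟩
  | mul a b _ _ ha hb =>
    obtain ⟨m, ha⟩ := ha
    obtain ⟨n, hb⟩ := hb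
    exact ⟨m + n, mul_mem_wordFil ha hb⟩

/-- When all weights are positive, only the empty word has weight zero. -/
theorem wordFil_zero (hw : ∀ i, 1 ≤ w i) {a : A} (ha : a ∈ wordFil R x w 0) :
    ∃ r : R, a = algebraMap R A r := by
  have h : wordFil R x w 0 ≤ Submodule.span R {1} := by
    refine Submodule.span_le.2 ?_
    rintro _ ⟨l, hl, rfl⟩
    cases l with
    | nil => exact Submodule.subset_span (by simp)
    | cons i l =>
      have := hw i
      simp at hl
      omega
  obtain ⟨r, hr⟩ := Submodule.mem_span_singleton.1 (h ha)
  exact ⟨r, by rw [← hr, Algebra.algebraMap_eq_smul_one]⟩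

/-- A homomorphism respects filtrations if it does so on generators. -/
theorem wordFil_le_comap (f : A →ₐ[R] T) (G : ℕ → Submodule R T) (mono : Monotone G)
    (one_mem : 1 ∈ G 0) (mul_mem : ∀ m n, ∀ a ∈ G m, ∀ b ∈ G n, a * b ∈ G (m + n))
    (hf : ∀ i, f (x i) ∈ G (w i)) (n : ℕ) {a : A} (ha : a ∈ wordFil R x w n) : f a ∈ G n := by
  have h : wordFil R x w n ≤ (G n).comap f.toLinearMap := by
    refine Submodule.span_le.2 ?_
    rintro _ ⟨l, hl, rfl⟩
    refine mono hl ?_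
    clear hl
    change f (l.map x).prod ∈ _
    induction l with
    | nil => simpa using one_mem
    | cons i l ih =>
      rw [List.map_cons (f := x), List.prod_cons, map_mul, List.map_cons, List.sum_cons]
      exact mul_mem _ _ _ (hf i) _ ih
  exact h ha

end WordFil

namespace SuperAlgebra

variable {R A : Type*} [CommRing R] [Algebra ℚ R] [Ring A] [Algebra R A] [SuperAlgebra R A]

/-- An exhaustive filtration of a superalgebra. -/
structure IsFil (F : ℕ → Submodule R A) : Prop where
  mono : Monotone F
  one_mem : 1 ∈ F 0
  mul_mem : ∀ m n, ∀ a ∈ F m, ∀ b ∈ F n, a * b ∈ F (m + n)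
  exhaust : ∀ a, ∃ n, a ∈ F n
  parity_mem : ∀ n, ∀ a ∈ F n, parity (R := R) a ∈ F n

theorem isFil_wordFil {ι : Type*} {x : ι → A} {w : ι → ℕ}
    (h : Algebra.adjoin R (Set.range x) = ⊤)
    (hx : ∀ i, ∃ e : ℤˣ, parity (R := R) (x i) = e • x i) : IsFil (wordFil R x w) where
  mono _ _ := wordFil_mono
  one_mem := one_mem_wordFil 0
  mul_mem _ _ _ ha _ hb := mul_mem_wordFil ha hb
  exhaust := exists_mem_wordFil h
  parity_mem n a ha := wordFil_le_comap parity _ (fun _ _ => wordFil_mono) (one_mem_wordFil 0)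
    (fun _ _ _ ha _ hb => mul_mem_wordFil ha hb) (fun i => by
      obtain ⟨e, he⟩ := hx i
      rw [he]
      rcases Int.units_eq_one_or e with rfl | rfl
      · simpa using gen_mem_wordFil i
      · simpa using gen_mem_wordFil i) n ha

/-- The induced filtration of the tensor square. -/
def tensorFil (F : ℕ → Submodule R A) (n : ℕ) : Submodule R (TensorSq R A) :=
  Submodule.span R {t | ∃ p q, p + q ≤ n ∧ ∃ a ∈ F p, ∃ b ∈ F q, t = toSq R A (a ⊗ₜ b)}

theorem tensorFil_mono (F : ℕ → Submodule R A) : Monotone (tensorFil F) := fun m n h =>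
  Submodule.span_mono fun _ ⟨p, q, hpq, e⟩ => ⟨p, q, hpq.trans h, e⟩

theorem tmul_mem_tensorFil {F : ℕ → Submodule R A} {p q n : ℕ} (h : p + q ≤ n) {a b : A}
    (ha : a ∈ F p) (hb : b ∈ F q) : toSq R A (a ⊗ₜ b) ∈ tensorFil F n :=
  Submodule.subset_span ⟨p, q, h, a, ha, b, hb, rfl⟩

theorem units_smul_mem {M : Type*} [AddCommGroup M] [Module R M] (P : Submodule R M) (e : ℤˣ)
    {a : M} (ha : a ∈ P) : e • a ∈ P := by
  rcases Int.units_eq_one_or e with rfl | rfl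
  · simpa using ha
  · simpa using ha

theorem exists_homogeneous_parts {P : Submodule R A}
    (hP : ∀ a ∈ P, parity (R := R) a ∈ P) {a : A} (ha : a ∈ P) :
    ∃ a₀ ∈ P, ∃ a₁ ∈ P, a₀ ∈ degree R A 0 ∧ a₁ ∈ degree R A 1 ∧ a = a₀ + a₁ := by
  refine ⟨evenPart R A a, ?_, oddPart R A a, ?_, (evenPart R A a).2, (oddPart R A a).2, ?_⟩
  · rw [coe_evenPart]
    exact P.smul_mem _ (add_mem ha (hP a ha))
  · rw [coe_oddPart]
    exact P.smul_mem _ (sub_mem ha (hP a ha))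
  · rw [coe_evenPart, coe_oddPart, ← smul_add, add_add_sub_cancel, half_smul_two]

namespace IsFil

variable {F : ℕ → Submodule R A} (hF : IsFil F)

/-- The signed product is explicit only on homogeneous factors; stability of the filtration under
parity guarantees that homogeneous parts stay in the same piece. -/
theorem tensor_mul_mem (hF : IsFil F) (m n : ℕ) (s : TensorSq R A) (hs : s ∈ tensorFil F m)
    (t : TensorSq R A) (ht : t ∈ tensorFil F n) : s * t ∈ tensorFil F (m + n) := by
  induction hs using Submodule.span_induction with
  | zero => simp
  | add x y _ _ hx hy => rw [add_mul]; exact add_mem hx hy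
  | smul r x _ hx => rw [smul_mul_assoc]; exact Submodule.smul_mem _ _ hx
  | mem x hx =>
    obtain ⟨p, q, hpq, a, ha, b, hb, rfl⟩ := hx
    induction ht using Submodule.span_induction with
    | zero => simp
    | add x y _ _ hx hy => rw [mul_add]; exact add_mem hx hy
    | smul r x _ hx => rw [mul_smul_comm]; exact Submodule.smul_mem _ _ hx
    | mem x hx =>
      obtain ⟨p', q', hpq', a', ha', b', hb', rfl⟩ := hx
      have key : ∀ i j, ∀ b ∈ F q, b ∈ degree R A j → ∀ a' ∈ F p', a' ∈ degree R A i →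
          toSq R A (a ⊗ₜ b) * toSq R A (a' ⊗ₜ b') ∈ tensorFil F (m + n) := by
        intro i j b hb hbj a' ha' hai
        rw [toST_mul a hbj hai b']
        exact units_smul_mem _ _ (tmul_mem_tensorFil (p := p + p') (q := q + q') (by omega)
          (hF.mul_mem _ _ _ ha _ ha') (hF.mul_mem _ _ _ hb _ hb'))
      obtain ⟨b₀, hb₀, b₁, hb₁, h₀, h₁, rfl⟩ := exists_homogeneous_parts (hF.parity_mem q) hb
      obtain ⟨a₀, ha₀, a₁, ha₁, k₀, k₁, rfl⟩ := exists_homogeneous_parts (hF.parity_mem p') ha'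
      rw [TensorProduct.tmul_add, TensorProduct.add_tmul, map_add, map_add, add_mul, mul_add,
        mul_add]
      exact add_mem (add_mem (key 0 0 b₀ hb₀ h₀ a₀ ha₀ k₀) (key 1 0 b₀ hb₀ h₀ a₁ ha₁ k₁))
        (add_mem (key 0 1 b₁ hb₁ h₁ a₀ ha₀ k₀) (key 1 1 b₁ hb₁ h₁ a₁ ha₁ k₁))

theorem one_mem_tensorFil (hF : IsFil F) : (1 : TensorSq R A) ∈ tensorFil F 0 :=
  tmul_mem_tensorFil (p := 0) (q := 0) le_rfl hF.one_mem hF.one_mem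

end IsFil

/-- The comultiplication respects the filtration by words if it does so on generators. -/
theorem comulHom_mem_tensorFil {ι : Type*} {x : ι → A} {w : ι → ℕ} (hF : IsFil (wordFil R x w))
    (f : A →ₐ[R] TensorSq R A) (hf : ∀ i, f (x i) ∈ tensorFil (wordFil R x w) (w i)) (n : ℕ) {a : A}
    (ha : a ∈ wordFil R x w n) : f a ∈ tensorFil (wordFil R x w) n :=
  wordFil_le_comap f _ (tensorFil_mono _) hF.one_mem_tensorFil hF.tensor_mul_mem hf n ha

/-! ### The antipode of a connected filtered superbialgebra -/

/-- Two linear maps out of the tensor square that agree on a piece of its filtration. -/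
theorem eqOn_tensorFil {F : ℕ → Submodule R A} {M : Type*} [AddCommGroup M] [Module R M] {n : ℕ}
    {f g : A ⊗[R] A →ₗ[R] M}
    (h : ∀ p q, p + q ≤ n → ∀ a ∈ F p, ∀ b ∈ F q, f (a ⊗ₜ b) = g (a ⊗ₜ b)) {t : A ⊗[R] A}
    (ht : toSq R A t ∈ tensorFil F n) : f t = g t := by
  have h' : tensorFil F n ≤ LinearMap.eqLocus (f ∘ₗ (toSq R A).symm.toLinearMap)
      (g ∘ₗ (toSq R A).symm.toLinearMap) := by
    refine Submodule.span_le.2 ?_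
    rintro _ ⟨p, q, hpq, a, ha, b, hb, rfl⟩
    exact h p q hpq a ha b hb
  exact h' ht

/-- A superbialgebra is connected for an exhaustive filtration that its comultiplication respects
and whose bottom piece consists of scalars. -/
structure Bialg.IsConnected (H : Bialg R A) (F : ℕ → Submodule R A) : Prop extends IsFil F where
  comul_mem : ∀ n, ∀ a ∈ F n, H.comulHom a ∈ tensorFil F n
  zero : ∀ a ∈ F 0, ∃ r, a = algebraMap R A r

namespace Bialg

variable (H : Bialg R A) {F : ℕ → Submodule R A}

/-- The `n`-th convolution power of `η ε - id`. -/
def convPow (n : ℕ) : A →ₗ[R] A :=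
  letI := H.toCoalgebra
  ((1 - WithConv.toConv LinearMap.id) ^ n : WithConv (A →ₗ[R] A)).ofConv

theorem convPow_zero (a : A) : H.convPow 0 a = algebraMap R A (H.counit a) := rfl

theorem convPow_one (a : A) : H.convPow 1 a = algebraMap R A (H.counit a) - a := by
  let _ := H.toCoalgebra
  rw [convPow, pow_one]
  rfl

theorem convPow_succ (n : ℕ) (a : A) : H.convPow (n + 1) a =
    LinearMap.mul' R A (TensorProduct.map (H.convPow 1) (H.convPow n) (H.comul a)) := by
  let _ := H.toCoalgebra
  rw [convPow, convPow, pow_succ', pow_one]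
  rfl

theorem convPow_parity (n : ℕ) (a : A) :
    H.convPow n (parity (R := R) a) = parity (R := R) (H.convPow n a) := by
  have h1 : ∀ a, H.convPow 1 (parity (R := R) a) = parity (R := R) (H.convPow 1 a) := fun a => by
    rw [convPow_one, convPow_one, H.counit_parity, map_sub, AlgHom.commutes]
  induction n generalizing a with
  | zero => rw [convPow_zero, convPow_zero, H.counit_parity, AlgHom.commutes]
  | succ n ih =>
    rw [convPow_succ, convPow_succ, comul_parity]
    generalize H.comul a = t
    induction t with
    | zero => simp
    | add x y hx hy => simp only [map_add, hx, hy]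
    | tmul b c => simp [h1, ih]

/-- Partial sums of the geometric series for the antipode. -/
def geom (n : ℕ) : A →ₗ[R] A := ∑ i ∈ Finset.range n, H.convPow i

theorem toConv_geom (n : ℕ) : letI := H.toCoalgebra
    WithConv.toConv (H.geom n) =
      ∑ i ∈ Finset.range n, (1 - WithConv.toConv LinearMap.id : WithConv (A →ₗ[R] A)) ^ i := by
  let _ := H.toCoalgebra
  rw [geom]
  induction n with
  | zero => rfl
  | succ n ih =>
    rw [Finset.sum_range_succ, Finset.sum_range_succ, ← ih]
    rfl

/-- In the convolution algebra the identity map is `1 - (1 - id)`, where `1 = η ε`, so its product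
with the partial geometric sum telescopes. -/
theorem mul_geom (n : ℕ) (a : A) :
    LinearMap.mul' R A ((H.geom n).lTensor A (H.comul a)) =
      algebraMap R A (H.counit a) - H.convPow n a := by
  let _ := H.toCoalgebra
  have h := mul_neg_geom_sum (1 - WithConv.toConv LinearMap.id : WithConv (A →ₗ[R] A)) n
  rw [sub_sub_cancel, ← toConv_geom] at h
  exact congrArg (fun f => f.ofConv a) h

theorem geom_mul (n : ℕ) (a : A) :
    LinearMap.mul' R A ((H.geom n).rTensor A (H.comul a)) =
      algebraMap R A (H.counit a) - H.convPow n a := by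
  let _ := H.toCoalgebra
  have h := geom_sum_mul_neg (1 - WithConv.toConv LinearMap.id : WithConv (A →ₗ[R] A)) n
  rw [sub_sub_cancel, ← toConv_geom] at h
  exact congrArg (fun f => f.ofConv a) h

namespace IsConnected

variable {H} (h : H.IsConnected F)

/-- The map `η ε - id` kills scalars, that is, the bottom piece. A first tensor factor that survives
therefore uses up at least one unit of filtration, which leaves less than `k` for the remaining
power. -/
theorem convPow_eq_zero (h : H.IsConnected F) {n k : ℕ} (hk : n < k) {a : A} (ha : a ∈ F n) :
    H.convPow k a = 0 := by
  induction k generalizing n a with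
  | zero => omega
  | succ k ih =>
    rw [convPow_succ]
    have := eqOn_tensorFil (f := LinearMap.mul' R A ∘ₗ TensorProduct.map (H.convPow 1) (H.convPow k))
      (g := 0) (n := n) (t := H.comul a) (fun p q hpq b hb c hc => by
        rcases Nat.eq_zero_or_pos p with rfl | hp
        · obtain ⟨r, rfl⟩ := h.zero b hb
          simp [convPow_one]
        · simp [ih (n := q) (by omega) hc]) (h.comul_mem n a ha)
    exact this

theorem geom_eq (h : H.IsConnected F) {n k l : ℕ} (hk : n < k) (hl : k ≤ l) {a : A}
    (ha : a ∈ F n) : H.geom k a = H.geom l a := by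
  induction l, hl using Nat.le_induction with
  | base => rfl
  | succ l hl ih =>
    rw [ih, geom, geom, Finset.sum_range_succ, LinearMap.add_apply,
      h.convPow_eq_zero (hk.trans_le hl) ha, add_zero]

/-- The antipode. -/
def antipode (h : H.IsConnected F) : A →ₗ[R] A where
  toFun a := H.geom ((h.exhaust a).choose + 1) a
  map_add' a b := by
    -- The partial sums become stationary beyond the filtration degree, so any bound above all three
    -- chosen degrees computes all three values.
    let N := (h.exhaust a).choose + (h.exhaust b).choose + (h.exhaust (a + b)).choose + 1
    rw [h.geom_eq (l := N) (Nat.lt_succ_self _) (by omega) (h.exhaust (a + b)).choose_spec,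
      h.geom_eq (l := N) (Nat.lt_succ_self _) (by omega) (h.exhaust a).choose_spec,
      h.geom_eq (l := N) (Nat.lt_succ_self _) (by omega) (h.exhaust b).choose_spec, map_add]
  map_smul' r a := by
    let N := (h.exhaust a).choose + (h.exhaust (r • a)).choose + 1
    rw [h.geom_eq (l := N) (Nat.lt_succ_self _) (by omega) (h.exhaust (r • a)).choose_spec,
      h.geom_eq (l := N) (Nat.lt_succ_self _) (by omega) (h.exhaust a).choose_spec, map_smul]
    rfl

theorem antipode_eq (h : H.IsConnected F) {n k : ℕ} (hk : n < k) {a : A} (ha : a ∈ F n) :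
    h.antipode a = H.geom k a := by
  change H.geom ((h.exhaust a).choose + 1) a = _
  rw [h.geom_eq (l := k + (h.exhaust a).choose + 1) (Nat.lt_succ_self _) (by omega)
    (h.exhaust a).choose_spec, ← h.geom_eq hk (by omega) ha]

/-- A connected superbialgebra is a Hopf superalgebra. -/
def toHopf (h : H.IsConnected F) : HopfSuperalgebra R A where
  comulHom := H.comulHom
  counit := H.counit
  antipode := h.antipode
  comul := H.comul
  toSq_comul := H.toSq_comul
  comul_parity := H.comul_parity
  counit_parity := H.counit_parity
  antipode_parity a := by
    obtain ⟨n, ha⟩ := h.exhaust a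
    rw [h.antipode_eq (Nat.lt_succ_self n) ha,
      h.antipode_eq (Nat.lt_succ_self n) (h.parity_mem n a ha), geom, LinearMap.sum_apply,
      LinearMap.sum_apply, map_sum]
    exact Finset.sum_congr rfl fun i _ => H.convPow_parity i a
  coassoc := H.comul_coassoc
  counit_left := H.counit_left
  counit_right := H.counit_right
  antipode_left a := by
    obtain ⟨n, ha⟩ := h.exhaust a
    have e := eqOn_tensorFil (f := (h.antipode).rTensor A) (g := (H.geom (n + 1)).rTensor A)
      (n := n) (t := H.comul a) (fun p q hpq b hb c hc => by
        rw [LinearMap.rTensor_tmul, LinearMap.rTensor_tmul,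
          h.antipode_eq (n := p) (k := n + 1) (by omega) hb]) (h.comul_mem n a ha)
    rw [e, geom_mul, h.convPow_eq_zero (Nat.lt_succ_self n) ha, sub_zero]
  antipode_right a := by
    obtain ⟨n, ha⟩ := h.exhaust a
    have e := eqOn_tensorFil (f := (h.antipode).lTensor A) (g := (H.geom (n + 1)).lTensor A)
      (n := n) (t := H.comul a) (fun p q hpq b hb c hc => by
        rw [LinearMap.lTensor_tmul, LinearMap.lTensor_tmul,
          h.antipode_eq (n := q) (k := n + 1) (by omega) hc]) (h.comul_mem n a ha)
    rw [e, mul_geom, h.convPow_eq_zero (Nat.lt_succ_self n) ha, sub_zero]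

end IsConnected

end Bialg

end SuperAlgebra

/-! ### The ternary relation of the Yangian in matrix form -/

section RTT

variable {S : Type*} [Ring S] {N : ℕ}

/-- The row side of the ternary relation. -/
def rttRow (α β γ : S) (U V : Idx N → Idx N → S) (i j k l : Idx N) : S :=
  α * (U i j * V k l) - (-1 : ℤˣ) ^ (i.2 * k.2 + i.2 * l.2 + k.2 * l.2) • (β * (U k j * V i l))
    + (-1 : ℤˣ) ^ (i.2 * k.2 + i.2 * l.2 + k.2 * l.2 + (k.2 + l.2)) •
      (γ * (U (opp k) j * V (opp i) l))

/-- The column side of the ternary relation. -/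
def rttCol (α β γ : S) (U V : Idx N → Idx N → S) (i j k l : Idx N) : S :=
  (-1 : ℤˣ) ^ ((i.2 + j.2) * (k.2 + l.2)) • (α * (V k l * U i j))
    - (-1 : ℤˣ) ^ (i.2 * k.2 + i.2 * l.2 + k.2 * l.2) • (β * (V k j * U i l))
    + (-1 : ℤˣ) ^ (i.2 * k.2 + i.2 * l.2 + k.2 * l.2 + (k.2 + l.2)) •
      (γ * (V k (opp j) * U i (opp l)))

/-- The entries of the product of two matrices with entries in supercommuting algebras. -/
def superMul (P Q : Idx N → Idx N → S) (i j : Idx N) : S :=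
  ∑ a, (-1 : ℤˣ) ^ ((i.2 + a.2) * (j.2 + a.2)) • (P i a * Q a j)

theorem superMul_mul_superMul {P₁ P₂ Q₁ Q₂ : Idx N → Idx N → S}
    (h : ∀ a j k b, P₂ a j * Q₁ k b = (-1 : ℤˣ) ^ ((a.2 + j.2) * (k.2 + b.2)) • (Q₁ k b * P₂ a j))
    (i j k l : Idx N) : superMul P₁ P₂ i j * superMul Q₁ Q₂ k l =
      ∑ a, ∑ b, (-1 : ℤˣ) ^ ((i.2 + a.2) * (j.2 + a.2) + (k.2 + b.2) * (l.2 + b.2) +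
        (a.2 + j.2) * (k.2 + b.2)) • (P₁ i a * Q₁ k b * (P₂ a j * Q₂ b l)) := by
  rw [superMul, superMul, Finset.sum_mul_sum]
  refine Finset.sum_congr rfl fun a _ => Finset.sum_congr rfl fun b _ => ?_
  rw [units_smul_mul, mul_units_smul, smul_smul, mul_assoc (P₁ i a), ← mul_assoc (P₂ a j), h,
    units_smul_mul, mul_units_smul, smul_smul, ← uzpow_add, ← uzpow_add]
  simp only [mul_assoc]

theorem sum_opp {M : Type*} [AddCommMonoid M] (f : Idx N → M) : ∑ a, f (opp a) = ∑ a, f a :=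
  Equiv.sum_comp (Function.Involutive.toPerm opp opp_opp) f

/-- This is `R T₁ T₂ = T₂ T₁ R` for a product of matrices, with `α`, `β`, `γ` in the roles of `u² -
v²`, `u + v`, `u - v`. The row side permutes row indices only and thus involves the left matrices
`U₁`, `V₁`; the column side involves only the right matrices `U₂`, `V₂`. After the middle factors
have been supercommuted, `h₁` carries `R` across the left pair and `h₂` across the right pair. -/
theorem rtt_superMul {α β γ : S} (hα : ∀ x, x * α = α * x) (hβ : ∀ x, x * β = β * x)
    (hγ : ∀ x, x * γ = γ * x) {U₁ U₂ V₁ V₂ : Idx N → Idx N → S}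
    (h₁ : ∀ i j k l, rttRow α β γ U₁ V₁ i j k l = rttCol α β γ U₁ V₁ i j k l)
    (h₂ : ∀ i j k l, rttRow α β γ U₂ V₂ i j k l = rttCol α β γ U₂ V₂ i j k l)
    (hUV : ∀ a j k b, U₂ a j * V₁ k b =
      (-1 : ℤˣ) ^ ((a.2 + j.2) * (k.2 + b.2)) • (V₁ k b * U₂ a j))
    (hVU : ∀ a j k b, V₂ a j * U₁ k b =
      (-1 : ℤˣ) ^ ((a.2 + j.2) * (k.2 + b.2)) • (U₁ k b * V₂ a j)) (i j k l : Idx N) :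
    rttRow α β γ (superMul U₁ U₂) (superMul V₁ V₂) i j k l =
      rttCol α β γ (superMul U₁ U₂) (superMul V₁ V₂) i j k l := by
  have e₁ : rttRow α β γ (superMul U₁ U₂) (superMul V₁ V₂) i j k l = ∑ a, ∑ b,
      (-1 : ℤˣ) ^ ((i.2 + a.2) * (j.2 + a.2) + (k.2 + b.2) * (l.2 + b.2) +
        (a.2 + j.2) * (k.2 + b.2)) • (rttRow α β γ U₁ V₁ i a k b * (U₂ a j * V₂ b l)) := by
    simp only [rttRow, superMul_mul_superMul hUV, Finset.mul_sum, Finset.smul_sum,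
      ← Finset.sum_add_distrib, ← Finset.sum_sub_distrib]
    refine Finset.sum_congr rfl fun a _ => Finset.sum_congr rfl fun b _ => ?_
    simp only [add_mul, sub_mul, smul_add, smul_sub, units_smul_mul, mul_units_smul, smul_smul,
      ← uzpow_add, mul_assoc, opp]
    -- The remaining goals compare exponents of `-1`, which are polynomials in six parities: a
    -- finite check.
    refine congrArg₂ (· + ·) (congrArg₂ (· - ·) ?_ ?_) ?_ <;>
      congr 2 <;>
      (generalize i.2 = i; generalize j.2 = j; generalize k.2 = k; generalize l.2 = l
       generalize a.2 = a; generalize b.2 = b; revert i j k l a b; decide)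
  -- Here `R` passes from the columns of the left pair to the rows of the right pair. The first
  -- terms match as they stand, the second after exchanging `a` and `b`, and the third after
  -- exchanging them and replacing both by their opposites.
  have e₂ : ∑ a, ∑ b, (-1 : ℤˣ) ^ ((i.2 + a.2) * (j.2 + a.2) + (k.2 + b.2) * (l.2 + b.2) +
        (a.2 + j.2) * (k.2 + b.2)) • (rttCol α β γ U₁ V₁ i a k b * (U₂ a j * V₂ b l)) =
      ∑ a, ∑ b, (-1 : ℤˣ) ^ ((i.2 + a.2) * (j.2 + a.2) + (k.2 + b.2) * (l.2 + b.2) +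
        (a.2 + j.2) * (k.2 + b.2) + (i.2 + a.2) * (k.2 + b.2)) •
          ((V₁ k b * U₁ i a) * rttRow α β γ U₂ V₂ a j b l) := by
    simp only [rttRow, rttCol, add_mul, sub_mul, mul_add, mul_sub, smul_add, smul_sub,
      units_smul_mul, mul_units_smul, smul_smul, ← uzpow_add, Finset.sum_add_distrib,
      Finset.sum_sub_distrib]
    congr 1
    · congr 1
      · refine Finset.sum_congr rfl fun a _ => Finset.sum_congr rfl fun b _ => ?_
        rw [← mul_assoc _ α, hα, mul_assoc, mul_assoc]
      · rw [Finset.sum_comm]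
        refine Finset.sum_congr rfl fun a _ => Finset.sum_congr rfl fun b _ => ?_
        rw [← mul_assoc _ β, hβ]
        simp only [mul_assoc]
        congr 2
        generalize i.2 = i; generalize j.2 = j; generalize k.2 = k; generalize l.2 = l
        generalize a.2 = a; generalize b.2 = b; revert i j k l a b; decide
    · rw [← sum_opp, Finset.sum_congr rfl fun a _ => (sum_opp _).symm, Finset.sum_comm]
      refine Finset.sum_congr rfl fun a _ => Finset.sum_congr rfl fun b _ => ?_
      rw [← mul_assoc _ γ, hγ]
      simp only [mul_assoc, opp_opp]
      congr 2
      simp only [opp]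
      generalize i.2 = i; generalize j.2 = j; generalize k.2 = k; generalize l.2 = l
      generalize a.2 = a; generalize b.2 = b; revert i j k l a b; decide
  have e₃ : rttCol α β γ (superMul U₁ U₂) (superMul V₁ V₂) i j k l = ∑ a, ∑ b,
      (-1 : ℤˣ) ^ ((i.2 + a.2) * (j.2 + a.2) + (k.2 + b.2) * (l.2 + b.2) +
        (a.2 + j.2) * (k.2 + b.2) + (i.2 + a.2) * (k.2 + b.2)) •
          ((V₁ k b * U₁ i a) * rttCol α β γ U₂ V₂ a j b l) := by
    rw [Finset.sum_comm]
    simp only [rttCol, superMul_mul_superMul hVU, Finset.mul_sum, Finset.smul_sum,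
      ← Finset.sum_add_distrib, ← Finset.sum_sub_distrib]
    refine Finset.sum_congr rfl fun b _ => Finset.sum_congr rfl fun a _ => ?_
    simp only [mul_add, mul_sub, smul_add, smul_sub, mul_units_smul, smul_smul, ← uzpow_add]
    rw [← mul_assoc _ α, hα, ← mul_assoc _ β, hβ, ← mul_assoc _ γ, hγ]
    simp only [mul_assoc, opp]
    refine congrArg₂ (· + ·) (congrArg₂ (· - ·) ?_ ?_) ?_ <;>
      congr 2 <;>
      (generalize i.2 = i; generalize j.2 = j; generalize k.2 = k; generalize l.2 = l
       generalize a.2 = a; generalize b.2 = b; revert i j k l a b; decide)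
  rw [e₁, e₃]
  simp only [h₁, ← h₂]
  exact e₂

end RTT

/-! ### Laurent series in two variables -/

section Series

variable {S : Type*} [Ring S] {N : ℕ}

/-- The extension by zero of a sequence to all integers. -/
def extendZero (t : ℕ → S) : ℤ → S
  | Int.ofNat n => t n
  | Int.negSucc _ => 0

theorem extendZero_of_neg (t : ℕ → S) {p : ℤ} (hp : p < 0) : extendZero t p = 0 := by
  obtain ⟨n, rfl⟩ := Int.eq_negSucc_of_lt_zero hp
  rfl

theorem map_extendZero {S' F : Type*} [Ring S'] [FunLike F S S'] [AddMonoidHomClass F S S'] (f : F)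
    (t : ℕ → S) (p : ℤ) : f (extendZero t p) = extendZero (fun n => f (t n)) p := by
  cases p
  · rfl
  · exact map_zero f

/-- The Laurent series in `u⁻¹` with coefficients Laurent series in `v⁻¹`. -/
abbrev Laurent₂ (S : Type*) [Ring S] : Type _ := HahnSeries ℤ (HahnSeries ℤ S)

/-- The coefficient at `u ^ (-p) v ^ (-q)`. -/
def coeff₂ (p q : ℤ) : Laurent₂ S →+ S where
  toFun x := (x.coeff p).coeff q
  map_zero' := rfl
  map_add' _ _ := rfl

theorem laurent₂_ext {x y : Laurent₂ S} (h : ∀ p q, coeff₂ p q x = coeff₂ p q y) : x = y :=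
  HahnSeries.ext (funext fun p => HahnSeries.ext (funext fun q => h p q))

/-- Substitution of `u⁻¹`. -/
def seriesU : S⟦X⟧ →+* Laurent₂ S :=
  (HahnSeries.ofPowerSeries ℤ (HahnSeries ℤ S)).comp (PowerSeries.map HahnSeries.C)

/-- Substitution of `v⁻¹`. -/
def seriesV : S⟦X⟧ →+* Laurent₂ S := HahnSeries.C.comp (HahnSeries.ofPowerSeries ℤ S)

theorem coeff_ofPowerSeries (t : S⟦X⟧) (p : ℤ) : (HahnSeries.ofPowerSeries ℤ S t).coeff p =
    extendZero (fun n => PowerSeries.coeff n t) p := by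
  cases p with
  | ofNat n => exact HahnSeries.ofPowerSeries_apply_coeff t n
  | negSucc n =>
    rw [HahnSeries.ofPowerSeries_apply]
    refine HahnSeries.embDomain_of_notMem_range ?_
    rintro ⟨m, hm⟩
    have h : (m : ℤ) = Int.negSucc n := hm
    have := Int.negSucc_lt_zero n
    omega

theorem coeff_seriesU (t : S⟦X⟧) (p : ℤ) :
    (seriesU t).coeff p = HahnSeries.C (extendZero (fun n => PowerSeries.coeff n t) p) := by
  rw [seriesU, RingHom.comp_apply, coeff_ofPowerSeries, map_extendZero]
  simp only [PowerSeries.coeff_map]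

theorem coeff₂_seriesU_mul_seriesV (s t : S⟦X⟧) (p q : ℤ) :
    coeff₂ p q (seriesU s * seriesV t) = extendZero (fun n => PowerSeries.coeff n s) p *
      extendZero (fun n => PowerSeries.coeff n t) q := by
  change (HahnSeries.coeff (seriesU s * HahnSeries.single 0 _) p).coeff q = _
  rw [HahnSeries.coeff_mul_single_zero, coeff_seriesU]
  change (HahnSeries.coeff (HahnSeries.single 0 _ * _) q) = _
  rw [HahnSeries.coeff_single_zero_mul, coeff_ofPowerSeries]

theorem coeff₂_seriesV_mul_seriesU (s t : S⟦X⟧) (p q : ℤ) :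
    coeff₂ p q (seriesV t * seriesU s) = extendZero (fun n => PowerSeries.coeff n t) q *
      extendZero (fun n => PowerSeries.coeff n s) p := by
  change (HahnSeries.coeff (HahnSeries.single 0 _ * seriesU s) p).coeff q = _
  rw [HahnSeries.coeff_single_zero_mul, coeff_seriesU]
  change (HahnSeries.coeff (_ * HahnSeries.single 0 _) q) = _
  rw [HahnSeries.coeff_mul_single_zero, coeff_ofPowerSeries]

variable (S) in
/-- The power `u ^ a`. -/
def powU (a : ℤ) : Laurent₂ S := HahnSeries.single (-a) 1

variable (S) in
/-- The power `v ^ a`. -/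
def powV (a : ℤ) : Laurent₂ S := HahnSeries.C (HahnSeries.single (-a) 1)

theorem coeff₂_powU_mul (a p q : ℤ) (x : Laurent₂ S) :
    coeff₂ p q (powU S a * x) = coeff₂ (p + a) q x := by
  change (HahnSeries.coeff (HahnSeries.single _ _ * x) p).coeff q = (x.coeff (p + a)).coeff q
  rw [HahnSeries.coeff_single_mul, one_mul, sub_neg_eq_add]

theorem coeff₂_mul_powU (a p q : ℤ) (x : Laurent₂ S) :
    coeff₂ p q (x * powU S a) = coeff₂ (p + a) q x := by
  change (HahnSeries.coeff (x * HahnSeries.single _ _) p).coeff q = (x.coeff (p + a)).coeff q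
  rw [HahnSeries.coeff_mul_single, mul_one, sub_neg_eq_add]

theorem coeff₂_powV_mul (a p q : ℤ) (x : Laurent₂ S) :
    coeff₂ p q (powV S a * x) = coeff₂ p (q + a) x := by
  change (HahnSeries.coeff (HahnSeries.single 0 _ * x) p).coeff q = (x.coeff p).coeff (q + a)
  rw [HahnSeries.coeff_single_zero_mul, HahnSeries.coeff_single_mul, one_mul, sub_neg_eq_add]

theorem coeff₂_mul_powV (a p q : ℤ) (x : Laurent₂ S) :
    coeff₂ p q (x * powV S a) = coeff₂ p (q + a) x := by
  change (HahnSeries.coeff (x * HahnSeries.single 0 _) p).coeff q = (x.coeff p).coeff (q + a)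
  rw [HahnSeries.coeff_mul_single_zero, HahnSeries.coeff_mul_single, mul_one, sub_neg_eq_add]

theorem mul_powU (a : ℤ) (x : Laurent₂ S) : x * powU S a = powU S a * x :=
  laurent₂_ext fun p q => by rw [coeff₂_powU_mul, coeff₂_mul_powU]

theorem mul_powV (a : ℤ) (x : Laurent₂ S) : x * powV S a = powV S a * x :=
  laurent₂_ext fun p q => by rw [coeff₂_powV_mul, coeff₂_mul_powV]

/-- The ternary relation of the Yangian for the coefficients of a matrix of Laurent series. -/
def TernaryRel (t : Idx N → Idx N → ℤ → S) : Prop :=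
  ∀ (i j k l : Idx N) (p q : ℤ),
    (-1 : ℤˣ) ^ (i.2 * k.2 + i.2 * l.2 + k.2 * l.2) •
      ((t i j (p + 2) * t k l q
          - (-1 : ℤˣ) ^ ((i.2 + j.2) * (k.2 + l.2)) • (t k l q * t i j (p + 2)))
        - (t i j p * t k l (q + 2)
          - (-1 : ℤˣ) ^ ((i.2 + j.2) * (k.2 + l.2)) • (t k l (q + 2) * t i j p))) =
    ((t k j (p + 1) * t i l q - t k j q * t i l (p + 1))
        + (t k j p * t i l (q + 1) - t k j (q + 1) * t i l p))
      - (-1 : ℤˣ) ^ (k.2 + l.2) •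
        ((t (opp k) j (p + 1) * t (opp i) l q - t k (opp j) q * t i (opp l) (p + 1))
          - (t (opp k) j p * t (opp i) l (q + 1) - t k (opp j) (q + 1) * t i (opp l) p))

/-- Multiplication by `u^a` or `v^a` shifts the index of the coefficients by `a`. In iterated
Laurent series `u` and `v` are central, so the coefficientwise relations become a single identity of
the kind treated by `rtt_superMul`. -/
theorem ternaryRel_iff (t : Idx N → Idx N → S⟦X⟧) :
    TernaryRel (fun i j => extendZero fun n => PowerSeries.coeff n (t i j)) ↔
      ∀ i j k l, rttRow (powU S 2 - powV S 2) (powU S 1 + powV S 1) (powU S 1 - powV S 1)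
          (fun i j => seriesU (t i j)) (fun i j => seriesV (t i j)) i j k l =
        rttCol (powU S 2 - powV S 2) (powU S 1 + powV S 1) (powU S 1 - powV S 1)
          (fun i j => seriesU (t i j)) (fun i j => seriesV (t i j)) i j k l := by
  -- The relation is multiplied by its sign `s`, and the products in the order `T(u) T(v)` are
  -- separated from those in the order `T(v) T(u)`.
  have aux : ∀ (s e f : ℤˣ) (a a' b b' c c' d d' g g' h h' : S),
      (s • ((a - e • a') - (b - e • b')) =
        ((c - c') + (d - d')) - f • ((g - g') - (h - h')) ↔
      (a - b) - s • (c + d) + (s * f) • (g - h) =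
        e • (a' - b') - s • (c' + d') + (s * f) • (g' - h')) := by
    intro s e f a a' b b' c c' d d' g g' h h'
    rw [← sub_eq_zero, ← sub_eq_zero (a := a - b - _ + _)]
    rcases Int.units_eq_one_or s with rfl | rfl
    · refine Iff.of_eq (congrArg (· = 0) ?_)
      simp only [one_smul, one_mul, smul_sub]
      abel
    · rw [← neg_eq_zero]
      refine Iff.of_eq (congrArg (· = 0) ?_)
      simp only [Units.neg_smul, one_smul, neg_mul, one_mul, smul_sub]
      abel
  constructor
  · intro h i j k l
    refine laurent₂_ext fun p q => ?_
    have h' := (aux _ _ _ _ _ _ _ _ _ _ _ _ _ _ _).1 (h i j k l p q)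
    simp only [rttRow, rttCol, map_add, map_sub, map_units_smul, add_mul, sub_mul,
      coeff₂_powU_mul, coeff₂_powV_mul, coeff₂_seriesU_mul_seriesV, coeff₂_seriesV_mul_seriesU]
    rw [uzpow_add _ (i.2 * k.2 + i.2 * l.2 + k.2 * l.2) (k.2 + l.2), ← add_mul i.2 j.2]
    exact h'
  · intro h i j k l p q
    refine (aux _ _ _ _ _ _ _ _ _ _ _ _ _ _ _).2 ?_
    have h' := congrArg (coeff₂ p q) (h i j k l)
    simp only [rttRow, rttCol, map_add, map_sub, map_units_smul, add_mul, sub_mul,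
      coeff₂_powU_mul, coeff₂_powV_mul, coeff₂_seriesU_mul_seriesV,
      coeff₂_seriesV_mul_seriesU] at h'
    rw [uzpow_add _ (i.2 * k.2 + i.2 * l.2 + k.2 * l.2) (k.2 + l.2), ← add_mul i.2 j.2] at h'
    exact h'

theorem map_superMul {S' : Type*} [Ring S'] (f : S →+* S') (P Q : Idx N → Idx N → S)
    (i j : Idx N) : superMul (fun i j => f (P i j)) (fun i j => f (Q i j)) i j =
      f (superMul P Q i j) := by
  simp only [superMul, map_sum, map_units_smul, map_mul]

theorem coeff_superMul (P Q : Idx N → Idx N → S⟦X⟧) (i j : Idx N) (n : ℕ) :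
    PowerSeries.coeff n (superMul P Q i j) =
      ∑ k, ∑ ab ∈ Finset.HasAntidiagonal.antidiagonal n, (-1 : ℤˣ) ^ ((i.2 + k.2) * (j.2 + k.2)) •
        (PowerSeries.coeff ab.1 (P i k) * PowerSeries.coeff ab.2 (Q k j)) := by
  simp only [superMul, map_sum, map_units_smul, PowerSeries.coeff_mul, Finset.smul_sum]

theorem extendZero_mul_comm {s t : ℕ → S} {e : ℤˣ} (h : ∀ m n, s m * t n = e • (t n * s m))
    (p q : ℤ) : extendZero s p * extendZero t q = e • (extendZero t q * extendZero s p) := by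
  cases p with
  | negSucc n => rw [extendZero_of_neg s (Int.negSucc_lt_zero n)]; simp
  | ofNat m =>
    cases q with
    | negSucc n => rw [extendZero_of_neg t (Int.negSucc_lt_zero n)]; simp
    | ofNat n => exact h m n

/-- The product of two supercommuting solutions of the ternary relation is a solution. -/
theorem ternaryRel_superMul {P Q : Idx N → Idx N → S⟦X⟧}
    (hP : TernaryRel (fun i j => extendZero fun n => PowerSeries.coeff n (P i j)))
    (hQ : TernaryRel (fun i j => extendZero fun n => PowerSeries.coeff n (Q i j)))
    (h : ∀ a j k b m n, PowerSeries.coeff m (Q a j) * PowerSeries.coeff n (P k b) =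
      (-1 : ℤˣ) ^ ((a.2 + j.2) * (k.2 + b.2)) •
        (PowerSeries.coeff n (P k b) * PowerSeries.coeff m (Q a j))) :
    TernaryRel (fun i j => extendZero fun n => PowerSeries.coeff n (superMul P Q i j)) := by
  rw [ternaryRel_iff] at *
  simp only [← map_superMul]
  refine rtt_superMul (fun x => ?_) (fun x => ?_) (fun x => ?_) hP hQ
    (fun a j k b => laurent₂_ext fun p q => ?_) (fun a j k b => laurent₂_ext fun p q => ?_)
  · rw [mul_sub, sub_mul, mul_powU, mul_powV]
  · rw [mul_add, add_mul, mul_powU, mul_powV]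
  · rw [mul_sub, sub_mul, mul_powU, mul_powV]
  · rw [map_units_smul, coeff₂_seriesU_mul_seriesV, coeff₂_seriesV_mul_seriesU]
    exact extendZero_mul_comm (h a j k b) p q
  · rw [map_units_smul, coeff₂_seriesU_mul_seriesV, coeff₂_seriesV_mul_seriesU]
    exact extendZero_mul_comm (h a j k b) q p

end Series

/-! ### Comultiplication of matrices of generators -/

section MatComul

variable {R A : Type*} [CommRing R] [Algebra ℚ R] [Ring A] [Algebra R A] [SuperAlgebra R A]
  {N : ℕ}

variable (R) in
/-- The entries of the comultiplication of a matrix of power series. -/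
def matComul (t : Idx N → Idx N → ℕ → A) (i j : Idx N) (s : ℕ) : A ⊗[R] A :=
  ∑ k : Idx N, ∑ ab ∈ Finset.HasAntidiagonal.antidiagonal s,
    (-1 : ℤˣ) ^ ((i.2 + k.2) * (j.2 + k.2)) • (t i k ab.1 ⊗ₜ t k j ab.2)

variable {t : Idx N → Idx N → ℕ → A}

theorem sum_antidiagonal_assoc {M : Type*} [AddCommMonoid M] (f : ℕ → ℕ → ℕ → M) (n : ℕ) :
    ∑ x ∈ Finset.HasAntidiagonal.antidiagonal n, ∑ y ∈ Finset.HasAntidiagonal.antidiagonal x.1,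
        f y.1 y.2 x.2 =
      ∑ x ∈ Finset.HasAntidiagonal.antidiagonal n, ∑ y ∈ Finset.HasAntidiagonal.antidiagonal x.2,
        f x.1 y.1 y.2 := by
  rw [Finset.sum_sigma', Finset.sum_sigma']
  refine Finset.sum_nbij' (fun x => ⟨(x.2.1, x.2.2 + x.1.2), (x.2.2, x.1.2)⟩)
    (fun x => ⟨(x.1.1 + x.2.1, x.2.2), (x.1.1, x.2.1)⟩) ?_ ?_ ?_ ?_ ?_
  · rintro ⟨⟨a, b⟩, ⟨c, d⟩⟩ h
    simp only [Finset.mem_sigma, Finset.HasAntidiagonal.mem_antidiagonal] at h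
    exact Finset.mem_sigma.2 ⟨Finset.HasAntidiagonal.mem_antidiagonal.2 (by dsimp only; omega),
      Finset.HasAntidiagonal.mem_antidiagonal.2 (by dsimp only)⟩
  · rintro ⟨⟨a, b⟩, ⟨c, d⟩⟩ h
    simp only [Finset.mem_sigma, Finset.HasAntidiagonal.mem_antidiagonal] at h
    exact Finset.mem_sigma.2 ⟨Finset.HasAntidiagonal.mem_antidiagonal.2 (by dsimp only; omega),
      Finset.HasAntidiagonal.mem_antidiagonal.2 (by dsimp only)⟩
  · rintro ⟨⟨a, b⟩, ⟨c, d⟩⟩ h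
    simp only [Finset.mem_sigma, Finset.HasAntidiagonal.mem_antidiagonal] at h
    obtain ⟨h1, rfl⟩ := h
    rfl
  · rintro ⟨⟨a, b⟩, ⟨c, d⟩⟩ h
    simp only [Finset.mem_sigma, Finset.HasAntidiagonal.mem_antidiagonal] at h
    obtain ⟨h1, rfl⟩ := h
    rfl
  · rintro ⟨⟨a, b⟩, ⟨c, d⟩⟩ h
    rfl

/-- Both sides are the sum of `t_im ⊗ t_mk ⊗ t_kj` over `m`, `k` and over triples of indices with
sum `s`; the two sign exponents agree modulo `2`. -/
theorem matComul_coassoc {Δ : A →ₗ[R] A ⊗[R] A} (hΔ : ∀ i j s, Δ (t i j s) = matComul R t i j s)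
    (i j : Idx N) (s : ℕ) :
    TensorProduct.assoc R A A A (Δ.rTensor A (matComul R t i j s)) =
      Δ.lTensor A (matComul R t i j s) := by
  have e₁ : TensorProduct.assoc R A A A (Δ.rTensor A (matComul R t i j s)) =
      ∑ k : Idx N, ∑ m : Idx N, ∑ x ∈ Finset.HasAntidiagonal.antidiagonal s,
        ∑ y ∈ Finset.HasAntidiagonal.antidiagonal x.1,
          (-1 : ℤˣ) ^ ((i.2 + k.2) * (j.2 + k.2) + (i.2 + m.2) * (k.2 + m.2)) •
            (t i m y.1 ⊗ₜ[R] (t m k y.2 ⊗ₜ[R] t k j x.2)) := by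
    simp only [matComul, map_sum, map_units_smul, LinearMap.rTensor_tmul, hΔ,
      TensorProduct.sum_tmul, units_smul_tmul, TensorProduct.assoc_tmul, Finset.smul_sum, smul_smul,
      uzpow_add]
    exact Finset.sum_congr rfl fun k _ => Finset.sum_comm
  have e₂ : Δ.lTensor A (matComul R t i j s) =
      ∑ m : Idx N, ∑ k : Idx N, ∑ x ∈ Finset.HasAntidiagonal.antidiagonal s,
        ∑ y ∈ Finset.HasAntidiagonal.antidiagonal x.2,
          (-1 : ℤˣ) ^ ((i.2 + m.2) * (j.2 + m.2) + (m.2 + k.2) * (j.2 + k.2)) •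
            (t i m x.1 ⊗ₜ[R] (t m k y.1 ⊗ₜ[R] t k j y.2)) := by
    simp only [matComul, map_sum, map_units_smul, LinearMap.lTensor_tmul, hΔ,
      TensorProduct.tmul_sum, tmul_units_smul, Finset.smul_sum, smul_smul, uzpow_add]
    exact Finset.sum_congr rfl fun k _ => Finset.sum_comm
  rw [e₁, e₂, Finset.sum_comm]
  refine Finset.sum_congr rfl fun m _ => Finset.sum_congr rfl fun k _ => ?_
  have h : (i.2 + k.2) * (j.2 + k.2) + (i.2 + m.2) * (k.2 + m.2) =
      (i.2 + m.2) * (j.2 + m.2) + (m.2 + k.2) * (j.2 + k.2) := by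
    generalize i.2 = i; generalize j.2 = j; generalize k.2 = k; generalize m.2 = m
    revert i j k m; decide
  rw [h]
  exact sum_antidiagonal_assoc (fun a b c =>
    (-1 : ℤˣ) ^ ((i.2 + m.2) * (j.2 + m.2) + (m.2 + k.2) * (j.2 + k.2)) •
      (t i m a ⊗ₜ[R] (t m k b ⊗ₜ[R] t k j c))) s

theorem matComul_counit_left {ε : A →ₗ[R] R} (h₀ : ∀ i j, ε (t i j 0) = if i = j then 1 else 0)
    (hs : ∀ i j s, ε (t i j (s + 1)) = 0) (i j : Idx N) (s : ℕ) :
    ε.rTensor A (matComul R t i j s) = 1 ⊗ₜ t i j s := by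
  simp only [matComul, map_sum, map_units_smul, LinearMap.rTensor_tmul]
  rw [Finset.sum_eq_single i, Finset.sum_eq_single (0, s)]
  · simp [h₀, CharTwo.add_self_eq_zero]
  · rintro ⟨a, b⟩ hab h
    cases a with
    | zero => simp_all
    | succ a => rw [hs, TensorProduct.zero_tmul, smul_zero]
  · simp
  · intro k _ hk
    refine Finset.sum_eq_zero fun x _ => ?_
    have h : ε (t i k x.1) = 0 := by
      cases x.1 with
      | zero => rw [h₀, if_neg (Ne.symm hk)]
      | succ n => exact hs _ _ _
    rw [h, TensorProduct.zero_tmul, smul_zero]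
  · simp

theorem matComul_counit_right {ε : A →ₗ[R] R} (h₀ : ∀ i j, ε (t i j 0) = if i = j then 1 else 0)
    (hs : ∀ i j s, ε (t i j (s + 1)) = 0) (i j : Idx N) (s : ℕ) :
    ε.lTensor A (matComul R t i j s) = t i j s ⊗ₜ 1 := by
  simp only [matComul, map_sum, map_units_smul, LinearMap.lTensor_tmul]
  rw [Finset.sum_eq_single j, Finset.sum_eq_single (s, 0)]
  · simp [h₀, CharTwo.add_self_eq_zero]
  · rintro ⟨a, b⟩ hab h
    cases b with
    | zero => simp_all
    | succ a => rw [hs, TensorProduct.tmul_zero, smul_zero]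
  · simp
  · intro k _ hk
    refine Finset.sum_eq_zero fun x _ => ?_
    have h : ε (t k j x.2) = 0 := by
      cases x.2 with
      | zero => rw [h₀, if_neg hk]
      | succ n => exact hs _ _ _
    rw [h, TensorProduct.tmul_zero, smul_zero]
  · simp

theorem matComul_mem_degree (ht : ∀ i j s, t i j s ∈ degree R A (i.2 + j.2)) (i j : Idx N) (s : ℕ) :
    toSq R A (matComul R t i j s) ∈ degree R (TensorSq R A) (i.2 + j.2) := by
  rw [matComul, map_sum]
  refine sum_mem fun k _ => ?_
  rw [map_sum]
  refine sum_mem fun x _ => ?_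
  rw [map_units_smul]
  have h := toST_mem_degree (ht i k x.1) (ht k j x.2)
  have e : i.2 + k.2 + (k.2 + j.2) = i.2 + j.2 := by
    have := CharTwo.add_self_eq_zero k.2
    linear_combination this
  rw [e] at h
  exact units_smul_mem_degree _ h

end MatComul

/-! ### The Hopf structure of the Yangian -/

namespace Yangian

variable {N : ℕ}

theorem T_zero (i j : Idx N) : T i j 0 = if i = j then 1 else 0 := by
  change RingQuot.mkAlgHom ℂ (YangianRel N) (if i = j then 1 else 0) = _
  split_ifs
  · exact map_one _
  · exact map_zero _

theorem lift_freeT {A : Type*} [Ring A] [Algebra ℂ A] (t : Idx N → Idx N → ℕ → A)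
    (h₀ : ∀ i j, t i j 0 = if i = j then 1 else 0) (i j : Idx N) (p : ℤ) :
    FreeAlgebra.lift ℂ (fun x : YangianGen N => t x.1 x.2.1 (x.2.2 + 1)) (freeT i j p) =
      extendZero (t i j) p := by
  match p with
  | Int.ofNat 0 =>
    change FreeAlgebra.lift ℂ _ (if i = j then 1 else 0) = t i j 0
    rw [h₀]
    split_ifs <;> simp
  | Int.ofNat (n + 1) => exact FreeAlgebra.lift_ι_apply _ _
  | Int.negSucc _ => exact map_zero _

theorem mkAlgHom_freeT (i j : Idx N) (p : ℤ) :
    RingQuot.mkAlgHom ℂ (YangianRel N) (freeT i j p) = extendZero (T i j) p := by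
  cases p
  · rfl
  · exact map_zero _

theorem ternaryRel : TernaryRel (fun i j : Idx N => extendZero (T i j)) := by
  intro i j k l p q
  have h := RingQuot.mkAlgHom_rel ℂ (YangianRel.comm i j k l p q)
  simp only [freeComm, freeSwap, freeTwist, map_sub, map_add, map_units_smul, map_mul,
    mkAlgHom_freeT] at h
  exact h

theorem T_opp (i j : Idx N) (s : ℕ) : T (opp i) (opp j) s = (-1 : ℤˣ) ^ s • T i j s := by
  have h := RingQuot.mkAlgHom_rel ℂ (YangianRel.twist i j s)
  rw [map_units_smul] at h
  exact h.symm

/-- The universal property of the Yangian. -/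
def lift {A : Type*} [Ring A] [Algebra ℂ A] (t : Idx N → Idx N → ℕ → A)
    (h₀ : ∀ i j, t i j 0 = if i = j then 1 else 0)
    (h : TernaryRel (fun i j => extendZero (t i j)))
    (h' : ∀ i j s, t (opp i) (opp j) s = (-1 : ℤˣ) ^ s • t i j s) : Yangian N →ₐ[ℂ] A :=
  RingQuot.liftAlgHom ℂ ⟨FreeAlgebra.lift ℂ fun x => t x.1 x.2.1 (x.2.2 + 1), by
    rintro _ _ (⟨i, j, k, l, p, q⟩ | ⟨i, j, s⟩)
    · simp only [freeComm, freeSwap, freeTwist, map_sub, map_add, map_units_smul, map_mul,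
        lift_freeT t h₀]
      exact h i j k l p q
    · rw [map_units_smul, lift_freeT t h₀, lift_freeT t h₀]
      exact (h' i j s).symm⟩

theorem lift_T {A : Type*} [Ring A] [Algebra ℂ A] (t : Idx N → Idx N → ℕ → A)
    (h₀ h h') (i j : Idx N) (s : ℕ) : lift t h₀ h h' (T i j s) = t i j s := by
  change RingQuot.liftAlgHom ℂ _ (RingQuot.mkAlgHom ℂ (YangianRel N) (freeT i j s)) = _
  rw [RingQuot.liftAlgHom_mkAlgHom_apply, lift_freeT t h₀]
  rfl

/-- The generators of the Yangian. -/
def gen (x : YangianGen N) : Yangian N := T x.1 x.2.1 (x.2.2 + 1)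

theorem adjoin_gen : Algebra.adjoin ℂ (Set.range (gen (N := N))) = ⊤ := by
  have h := congrArg (Subalgebra.map (RingQuot.mkAlgHom ℂ (YangianRel N)))
    (FreeAlgebra.adjoin_range_ι (R := ℂ) (X := YangianGen N))
  rw [AlgHom.map_adjoin, ← Set.range_comp, Algebra.map_top,
    (AlgHom.range_eq_top _).2 (RingQuot.mkAlgHom_surjective ℂ (YangianRel N))] at h
  exact h

theorem parity_T (i j : Idx N) (s : ℕ) :
    parity (R := ℂ) (T i j s) = (-1 : ℤˣ) ^ (i.2 + j.2) • T i j s := parityHom_T i j s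

theorem T_mem_degree (i j : Idx N) (s : ℕ) : T i j s ∈ degree ℂ (Yangian N) (i.2 + j.2) :=
  parity_T i j s

theorem sum_sign_delta {M : Type*} [AddCommGroup M] (f : Idx N → Idx N → Idx N → M)
    (i j : Idx N) (h : ∀ k, i ≠ k ∨ k ≠ j → f i k j = 0) :
    ∑ k, (-1 : ℤˣ) ^ ((i.2 + k.2) * (j.2 + k.2)) • f i k j = if i = j then f i i i else 0 := by
  split_ifs with hij
  · subst hij
    rw [Finset.sum_eq_single i]
    · simp [CharTwo.add_self_eq_zero]
    · intro k _ hk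
      rw [h k (Or.inr hk), smul_zero]
    · simp
  · refine Finset.sum_eq_zero fun k _ => ?_
    rw [h k, smul_zero]
    by_contra! hk
    exact hij (hk.1.trans hk.2)

/-- The entries of the comultiplication. -/
abbrev comulT (i j : Idx N) (s : ℕ) : Yangian N ⊗[ℂ] Yangian N := matComul ℂ T i j s

theorem comulT_zero (i j : Idx N) : comulT i j 0 = if i = j then 1 else 0 := by
  simp only [matComul, Finset.Nat.antidiagonal_zero, Finset.sum_singleton]
  rw [sum_sign_delta (fun i k j => T i k 0 ⊗ₜ[ℂ] T k j 0)]
  · simp [T_zero, Algebra.TensorProduct.one_def]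
  · rintro k (h | h)
    · simp [T_zero, h]
    · simp [T_zero, h]

/-- The generating series `T i j (u) ⊗ 1`. -/
def seriesLeft (i j : Idx N) : (TensorSq ℂ (Yangian N))⟦X⟧ :=
  PowerSeries.mk fun n => GradedTensorProduct.includeLeft (degree ℂ (Yangian N))
    (degree ℂ (Yangian N)) (T i j n)

/-- The generating series `1 ⊗ T i j (u)`. -/
def seriesRight (i j : Idx N) : (TensorSq ℂ (Yangian N))⟦X⟧ :=
  PowerSeries.mk fun n => GradedTensorProduct.includeRight (degree ℂ (Yangian N))
    (degree ℂ (Yangian N)) (T i j n)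

/-- The signs in the comultiplication are those of the product of two matrices with supercommuting
entries: `Δ T(u)` is the product of `T(u) ⊗ 1` and `1 ⊗ T(u)`, to which `ternaryRel_superMul`
applies. -/
theorem toSq_comulT (i j : Idx N) (s : ℕ) :
    toSq ℂ (Yangian N) (comulT i j s) = PowerSeries.coeff s (superMul seriesLeft seriesRight i j) := by
  rw [coeff_superMul, comulT, matComul, map_sum]
  refine Finset.sum_congr rfl fun k _ => ?_
  rw [map_sum]
  refine Finset.sum_congr rfl fun ab _ => ?_
  rw [map_units_smul, seriesLeft, seriesRight, PowerSeries.coeff_mk, PowerSeries.coeff_mk]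
  congr 1
  exact (toST_one_left_mul _ _ (T k j ab.2)).symm

theorem map_ternaryRel {A F : Type*} [Ring A] [Algebra ℂ A] (f : Yangian N →ₐ[ℂ] A) :
    TernaryRel (fun i j : Idx N => extendZero fun n => f (T i j n)) := by
  intro i j k l p q
  have h := congrArg f (ternaryRel i j k l p q)
  simp only [map_sub, map_add, map_units_smul, map_mul, map_extendZero] at h
  exact h

theorem ternaryRel_comulT :
    TernaryRel (fun i j : Idx N => extendZero fun n => toSq ℂ (Yangian N) (comulT i j n)) := by
  simp only [toSq_comulT]
  refine ternaryRel_superMul ?_ ?_ ?_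
  · simp only [seriesLeft, PowerSeries.coeff_mk]
    exact map_ternaryRel (F := ℂ) (GradedTensorProduct.includeLeft _ _)
  · simp only [seriesRight, PowerSeries.coeff_mk]
    exact map_ternaryRel (F := ℂ) (GradedTensorProduct.includeRight _ _)
  · intro a j k b m n
    simp only [seriesLeft, seriesRight, PowerSeries.coeff_mk]
    change toST ℂ _ _ (1 ⊗ₜ T a j m) * toST ℂ _ _ (T k b n ⊗ₜ 1) =
      _ • (toST ℂ _ _ (T k b n ⊗ₜ 1) * toST ℂ _ _ (1 ⊗ₜ T a j m))
    rw [toST_mul 1 (T_mem_degree a j m) (T_mem_degree k b n) 1, toST_one_left_mul _ _ (T a j m),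
      one_mul, mul_one]

theorem comulT_opp (i j : Idx N) (s : ℕ) :
    comulT (opp i) (opp j) s = (-1 : ℤˣ) ^ s • comulT i j s := by
  rw [comulT, matComul, ← sum_opp, comulT, matComul, Finset.smul_sum]
  refine Finset.sum_congr rfl fun k _ => ?_
  rw [Finset.smul_sum]
  refine Finset.sum_congr rfl fun ab hab => ?_
  rw [T_opp, T_opp, units_smul_tmul, tmul_units_smul, smul_smul, smul_smul, smul_smul,
    ← Finset.HasAntidiagonal.mem_antidiagonal.1 hab, pow_add]
  congr 1
  have h : ((opp i).2 + (opp k).2) * ((opp j).2 + (opp k).2) = (i.2 + k.2) * (j.2 + k.2) := by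
    simp only [opp]
    generalize i.2 = i; generalize j.2 = j; generalize k.2 = k; revert i j k; decide
  rw [h]
  rw [mul_assoc, mul_comm]

/-- The comultiplication of the Yangian. -/
def comulHom (N : ℕ) : Yangian N →ₐ[ℂ] TensorSq ℂ (Yangian N) :=
  lift (fun i j s => toSq ℂ (Yangian N) (comulT i j s))
    (fun i j => by rw [comulT_zero]; split_ifs <;> simp) ternaryRel_comulT
    (fun i j s => by rw [comulT_opp, map_units_smul])

theorem comulHom_T (i j : Idx N) (s : ℕ) :
    comulHom N (T i j s) = toSq ℂ (Yangian N) (comulT i j s) := lift_T _ _ _ _ i j s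

/-- For the identity matrix both sides are the same combination of Kronecker deltas; the extra sign
is trivial where they are supported. This gives the counit. -/
theorem ternaryRel_one {S : Type*} [Ring S] : TernaryRel (fun i j : Idx N =>
    extendZero fun n => PowerSeries.coeff n (if i = j then 1 else 0 : S⟦X⟧)) := by
  rw [ternaryRel_iff]
  intro i j k l
  have sw : ∀ k l : Idx N, k = opp l ↔ opp k = l := fun k l =>
    ⟨fun h => by rw [h, opp_opp], fun h => by rw [← h, opp_opp]⟩
  have h : ∀ i j : Idx N, ∀ x : Laurent₂ S,
      (-1 : ℤˣ) ^ ((i.2 + j.2) * (k.2 + l.2)) • (if i = j then x else 0) =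
        if i = j then x else 0 := by
    intro i j x
    split_ifs with h
    · simp [h, CharTwo.add_self_eq_zero]
    · exact smul_zero _
  simp only [rttRow, rttCol, apply_ite seriesU, apply_ite seriesV, map_one, map_zero, mul_ite,
    mul_one, mul_zero, sw]
  congr 2
  split_ifs with h₁ h₂
  · simp [h₁, CharTwo.add_self_eq_zero]
  all_goals exact (smul_zero _).symm

/-- The counit of the Yangian. -/
def counit (N : ℕ) : Yangian N →ₐ[ℂ] ℂ :=
  lift (fun i j s => PowerSeries.coeff s (if i = j then 1 else 0 : ℂ⟦X⟧))
    (fun i j => by split_ifs <;> simp) ternaryRel_one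
    (fun i j s => by
      have inj : opp i = opp j ↔ i = j := (Function.Involutive.injective opp_opp).eq_iff
      simp only [inj]
      split_ifs
      · rw [PowerSeries.coeff_one]
        split_ifs with h
        · simp [h]
        · rw [smul_zero]
      · simp)

theorem counit_T (i j : Idx N) (s : ℕ) :
    counit N (T i j s) = PowerSeries.coeff s (if i = j then 1 else 0 : ℂ⟦X⟧) :=
  lift_T _ _ _ _ i j s

theorem counit_T_zero (i j : Idx N) : counit N (T i j 0) = if i = j then 1 else 0 := by
  rw [counit_T]
  split_ifs <;> simp

theorem counit_T_succ (i j : Idx N) (s : ℕ) : counit N (T i j (s + 1)) = 0 := by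
  rw [counit_T]
  split_ifs
  · simp [PowerSeries.coeff_one]
  · simp

/-- The superbialgebra structure of the Yangian. -/
def bialg (N : ℕ) : Bialg ℂ (Yangian N) :=
  Bialg.ofGenerators (comulHom N) (counit N) (Set.range gen) adjoin_gen
    (by
      rintro _ ⟨⟨i, j, n⟩, rfl⟩
      rw [gen, parity_T, map_units_smul, comulHom_T,
        mem_degree.1 (matComul_mem_degree T_mem_degree i j (n + 1))])
    (by
      rintro _ ⟨⟨i, j, n⟩, rfl⟩
      rw [gen, parity_T, map_units_smul, counit_T_succ, smul_zero])
    (by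
      rintro _ ⟨⟨i, j, n⟩, rfl⟩
      rw [gen, comulHom_T]
      exact matComul_coassoc (fun i j s => congrArg (toSq ℂ (Yangian N)).symm
        (comulHom_T i j s)) i j (n + 1))
    (by
      rintro _ ⟨⟨i, j, n⟩, rfl⟩
      rw [gen, comulHom_T]
      exact matComul_counit_left (ε := (counit N).toLinearMap) counit_T_zero counit_T_succ
        i j (n + 1))
    (by
      rintro _ ⟨⟨i, j, n⟩, rfl⟩
      rw [gen, comulHom_T]
      exact matComul_counit_right (ε := (counit N).toLinearMap) counit_T_zero counit_T_succ
        i j (n + 1))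

theorem comul_T (i j : Idx N) (s : ℕ) : (bialg N).comul (T i j s) = comulT i j s :=
  congrArg (toSq ℂ (Yangian N)).symm (comulHom_T i j s)

/-- The weight `n + 1` of the generator `T i j ^ (n + 1)`. -/
def weight (x : YangianGen N) : ℕ := x.2.2 + 1

theorem T_mem_wordFil (i j : Idx N) (s : ℕ) : T i j s ∈ wordFil ℂ gen weight s := by
  cases s with
  | zero =>
    rw [T_zero]
    split_ifs
    · exact one_mem_wordFil 0
    · exact zero_mem _
  | succ n => exact gen_mem_wordFil (R := ℂ) (x := gen) (w := weight) (i, j, n)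

/-- For the antipode `T^(s)` must have weight `s`: then no generator lies in the bottom piece, and
the two indices in every term of its comultiplication add up to `s`. -/
theorem isConnected_bialg (N : ℕ) : (bialg N).IsConnected (wordFil ℂ gen weight) where
  toIsFil := isFil_wordFil adjoin_gen fun x => ⟨_, parity_T x.1 x.2.1 (x.2.2 + 1)⟩
  comul_mem n a ha := comulHom_mem_tensorFil
    (isFil_wordFil adjoin_gen fun x => ⟨_, parity_T x.1 x.2.1 (x.2.2 + 1)⟩) (comulHom N)
    (fun x => by
      rw [gen, comulHom_T, comulT, matComul, map_sum]
      refine sum_mem fun k _ => ?_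
      rw [map_sum]
      refine sum_mem fun ab hab => ?_
      rw [map_units_smul]
      exact units_smul_mem _ _ (tmul_mem_tensorFil
        (Finset.HasAntidiagonal.mem_antidiagonal.1 hab).le (T_mem_wordFil _ _ _)
        (T_mem_wordFil _ _ _))) n ha
  zero a ha := wordFil_zero (fun x => Nat.le_add_left 1 _) ha

/-- The Hopf superalgebra structure of the Yangian. -/
def hopf (N : ℕ) : HopfSuperalgebra ℂ (Yangian N) := (isConnected_bialg N).toHopf

theorem isYangianHopf_hopf : IsYangianHopf (hopf N) := fun i j s =>
  ⟨comul_T i j s, counit_T_succ i j s⟩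

end Yangian

/-! ### Rees modules of filtered vector spaces are free -/

section Rees

variable {K V : Type*} [Field K] [AddCommGroup V] [Module K V]

/-- A basis adapted to an exhaustive filtration. -/
theorem exists_adapted_basis {F : ℕ → Submodule K V} (mono : Monotone F)
    (exhaust : ∀ x, ∃ n, x ∈ F n) : ∃ (B : Set V) (d : V → ℕ), LinearIndepOn K id B ∧
      ∀ n, F n = Submodule.span K {x ∈ B | d x ≤ n} := by
  classical
  -- A basis of `F n` extends to one of `F (n + 1)`; iteration gives an increasing chain of bases.
  have step : ∀ (n : ℕ) (s : {s : Set V // LinearIndepOn K id s ∧ s ⊆ F n ∧ ↑(F n) ⊆ (Submodule.span K s : Set V)}),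
      ∃ t : {s : Set V // LinearIndepOn K id s ∧ s ⊆ F (n + 1) ∧
        ↑(F (n + 1)) ⊆ (Submodule.span K s : Set V)}, s.1 ⊆ t.1 := by
    rintro n ⟨s, hs, hsF, -⟩
    obtain ⟨t, htF, hst, hF, ht⟩ := exists_linearIndepOn_id_extension hs
      (hsF.trans (mono (Nat.le_succ n)))
    exact ⟨⟨t, ht, htF, hF⟩, hst⟩
  choose next hnext using step
  obtain ⟨b, hbF, -, hF, hb⟩ := exists_linearIndepOn_id_extension (K := K) (V := V)
    (linearIndepOn_empty K id) (Set.empty_subset (F 0 : Set V))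
  let S : ∀ n, {s : Set V // LinearIndepOn K id s ∧ s ⊆ F n ∧ ↑(F n) ⊆ (Submodule.span K s : Set V)} :=
    fun n => Nat.rec ⟨b, hb, hbF, hF⟩ next n
  have hS : Monotone fun n => (S n).1 := monotone_nat_of_le_succ fun n => hnext n (S n)
  -- The degree of a basis vector is the first stage at which it appears. The default `0` concerns
  -- only vectors outside the union of the stages.
  let d : V → ℕ := fun x => if h : ∃ n, x ∈ (S n).1 then Nat.find h else 0
  refine ⟨⋃ n, (S n).1, d, ?_, fun n => ?_⟩
  · exact linearIndepOn_iUnion_of_directed hS.directed_le fun n => (S n).2.1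
  · have h : {x ∈ ⋃ n, (S n).1 | d x ≤ n} = (S n).1 := by
      ext x
      simp only [Set.mem_iUnion, Set.mem_ofPred_eq]
      constructor
      · rintro ⟨hx, hd⟩
        have hx' : d x = Nat.find hx := dif_pos hx
        exact hS (hx' ▸ hd) (Nat.find_spec hx)
      · intro hx
        refine ⟨⟨n, hx⟩, ?_⟩
        have hx' : d x = Nat.find ⟨n, hx⟩ := dif_pos (⟨n, hx⟩ : ∃ n, x ∈ (S n).1)
        rw [hx']
        exact Nat.find_min' _ hx
    rw [h]
    exact le_antisymm (S n).2.2.2 (Submodule.span_le.2 (S n).2.2.1)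

/-- The Rees module of a filtration, over the power series ring. -/
def rees (F : ℕ → Submodule K V) : Submodule K⟦X⟧ (K⟦X⟧ ⊗[K] V) :=
  Submodule.span K⟦X⟧ {x | ∃ n, ∃ y ∈ F n, x = (PowerSeries.X ^ n : K⟦X⟧) ⊗ₜ y}

/-- For an adapted basis with degrees `d`, the elements `X ^ d b ⊗ b` form a basis. They are
independent, being nonzero multiples of the basis vectors `1 ⊗ b`; they span, because an element of
`F n` involves only basis vectors of degree at most `n`, and surplus powers of `X` are scalars. -/
theorem free_rees {F : ℕ → Submodule K V} (mono : Monotone F) (exhaust : ∀ x, ∃ n, x ∈ F n) :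
    Module.Free K⟦X⟧ (rees F) := by
  obtain ⟨B, d, hB, hF⟩ := exists_adapted_basis mono exhaust
  have htop : ⊤ ≤ Submodule.span K (Set.range (fun x : B => (x : V))) := by
    intro x _
    obtain ⟨n, hn⟩ := exhaust x
    rw [hF] at hn
    refine Submodule.span_mono ?_ hn
    rintro y ⟨hy, -⟩
    exact ⟨⟨y, hy⟩, rfl⟩
  let b : Module.Basis B K V := Module.Basis.mk hB htop
  have hb : ∀ x : B, b x = x := fun x => by simp [b]
  let e : B → K⟦X⟧ ⊗[K] V := fun x => (PowerSeries.X ^ d x : K⟦X⟧) ⊗ₜ (x : V)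
  have he : ∀ x, e x = (PowerSeries.X ^ d x : K⟦X⟧) • b.baseChange K⟦X⟧ x := fun x => by
    rw [Module.Basis.baseChange_apply, hb, TensorProduct.smul_tmul', smul_eq_mul, mul_one]
  have hli : LinearIndependent K⟦X⟧ e := by
    rw [linearIndependent_iff']
    intro s g hg i hi
    have h := linearIndependent_iff'.1 (b.baseChange K⟦X⟧).linearIndependent s
      (fun x => g x * PowerSeries.X ^ d x) (by
        rw [← hg]
        exact Finset.sum_congr rfl fun x _ => by rw [he, mul_smul]) i hi
    exact (mul_eq_zero.1 h).resolve_right (pow_ne_zero _ PowerSeries.X_ne_zero)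
  have hspan : rees F = Submodule.span K⟦X⟧ (Set.range e) := by
    apply le_antisymm
    · refine Submodule.span_le.2 ?_
      rintro _ ⟨n, y, hy, rfl⟩
      rw [hF] at hy
      induction hy using Submodule.span_induction with
      | zero => simp
      | add y z _ _ hy hz => rw [TensorProduct.tmul_add]; exact add_mem hy hz
      | smul r y _ hy =>
        rw [TensorProduct.tmul_smul, ← algebraMap_smul K⟦X⟧ r]
        exact Submodule.smul_mem _ _ hy
      | mem y hy =>
        obtain ⟨hyB, hd⟩ := hy
        have h : (PowerSeries.X ^ n : K⟦X⟧) ⊗ₜ[K] y =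
            (PowerSeries.X ^ (n - d y) : K⟦X⟧) • e ⟨y, hyB⟩ := by
          rw [TensorProduct.smul_tmul', smul_eq_mul, ← pow_add, Nat.sub_add_cancel hd]
        rw [h]
        exact Submodule.smul_mem _ _ (Submodule.subset_span ⟨_, rfl⟩)
    · refine Submodule.span_le.2 ?_
      rintro _ ⟨⟨y, hy⟩, rfl⟩
      refine Submodule.subset_span ⟨d y, y, ?_, rfl⟩
      rw [hF]
      exact Submodule.subset_span ⟨hy, le_rfl⟩
  rw [hspan]
  exact Module.Free.of_basis (Module.Basis.span hli)

theorem rees_mul_mem {A : Type*} [Ring A] [Algebra K A] {F : ℕ → Submodule K A}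
    (mul_mem : ∀ m n, ∀ a ∈ F m, ∀ b ∈ F n, a * b ∈ F (m + n)) {x y : K⟦X⟧ ⊗[K] A}
    (hx : x ∈ rees F) (hy : y ∈ rees F) : x * y ∈ rees F := by
  have h := Submodule.mul_mem_mul hx hy
  rw [rees, Submodule.span_mul_span] at h
  refine Submodule.span_mono ?_ h
  rintro _ ⟨_, ⟨m, a, ha, rfl⟩, _, ⟨n, b, hb, rfl⟩, rfl⟩
  exact ⟨m + n, a * b, mul_mem m n a ha b hb, by
    rw [pow_add]; exact Algebra.TensorProduct.tmul_mul_tmul _ _ _ _⟩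

end Rees

/-! ### The algebra `Y(𝔮_N, h)` as a module -/

namespace YangianH

variable {N : ℕ}

/-- The power `n` of `h` in the generator `T i j ^ (n + 1) h ^ n`. -/
def hDegree (x : YangianGen N) : ℕ := x.2.2

/-- Here `T^(n+1)` has weight `n`, the exponent of `h` that accompanies it, and not `n + 1` as for
the antipode. A word of weight below `n` is matched by moving the surplus power of `h` into the
scalars. -/
theorem toSubmodule_eq_rees :
    Subalgebra.toSubmodule (yangianSubalgebra N) = rees (wordFil ℂ Yangian.gen hDegree) := by
  apply le_antisymm
  · intro x hx
    change x ∈ yangianSubalgebra N at hx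
    induction hx using Algebra.adjoin_induction with
    | mem x hx =>
      obtain ⟨x, rfl⟩ := hx
      exact Submodule.subset_span ⟨x.2.2, Yangian.gen x,
        gen_mem_wordFil (R := ℂ) (x := Yangian.gen) (w := hDegree) x, rfl⟩
    | algebraMap r =>
      rw [Algebra.algebraMap_eq_smul_one]
      exact Submodule.smul_mem _ _ (Submodule.subset_span ⟨0, 1, one_mem_wordFil 0, by
        rw [pow_zero, Algebra.TensorProduct.one_def]⟩)
    | add x y _ _ hx hy => exact add_mem hx hy
    | mul x y _ _ hx hy =>
      exact rees_mul_mem (fun _ _ _ ha _ hb => mul_mem_wordFil ha hb) hx hy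
  · refine Submodule.span_le.2 ?_
    rintro _ ⟨n, y, hy, rfl⟩
    change _ ∈ yangianSubalgebra N
    induction hy using Submodule.span_induction with
    | zero => rw [TensorProduct.tmul_zero]; exact zero_mem _
    | add y z _ _ hy hz => rw [TensorProduct.tmul_add]; exact add_mem hy hz
    | smul r y _ hy =>
      rw [TensorProduct.tmul_smul, ← algebraMap_smul ℂ⟦X⟧ r]
      exact Subalgebra.smul_mem _ hy _
    | mem y hy =>
      obtain ⟨l, hl, rfl⟩ := hy
      have h : (PowerSeries.X ^ (l.map hDegree).sum : ℂ⟦X⟧) ⊗ₜ[ℂ] (l.map Yangian.gen).prod ∈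
          yangianSubalgebra N := by
        clear hl
        induction l with
        | nil => exact one_mem _
        | cons x l ih =>
          rw [List.map_cons (f := hDegree), List.sum_cons, List.map_cons (f := Yangian.gen),
            List.prod_cons, pow_add, ← Algebra.TensorProduct.tmul_mul_tmul]
          exact mul_mem (Algebra.subset_adjoin ⟨x, rfl⟩) ih
      have e : (PowerSeries.X ^ n : ℂ⟦X⟧) ⊗ₜ[ℂ] (l.map Yangian.gen).prod =
          (PowerSeries.X ^ (n - (l.map hDegree).sum) : ℂ⟦X⟧) •
            ((PowerSeries.X ^ (l.map hDegree).sum : ℂ⟦X⟧) ⊗ₜ[ℂ] (l.map Yangian.gen).prod) := by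
        rw [TensorProduct.smul_tmul', smul_eq_mul, ← pow_add, Nat.sub_add_cancel hl]
      rw [e]
      exact Subalgebra.smul_mem _ h _

instance free : Module.Free ℂ⟦X⟧ (YangianH N) := by
  have h : Module.Free ℂ⟦X⟧ (Subalgebra.toSubmodule (yangianSubalgebra N)) := by
    rw [toSubmodule_eq_rees]
    exact free_rees (fun _ _ => wordFil_mono) (exists_mem_wordFil Yangian.adjoin_gen)
  exact h

end YangianH

/-! ### Extension of scalars from `ℂ` to `ℂ⟦h⟧` -/

namespace Yangian

variable {N : ℕ}

instance hatSuperAlgebra (N : ℕ) : SuperAlgebra ℂ⟦X⟧ (ℂ⟦X⟧ ⊗[ℂ] Yangian N) where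
  parity := scalarParity N
  parity_parity := scalarParity_scalarParity

theorem parity_tmul (r : ℂ⟦X⟧) (a : Yangian N) :
    parity (R := ℂ⟦X⟧) (r ⊗ₜ[ℂ] a) = r ⊗ₜ[ℂ] parity (R := ℂ) a := rfl

theorem tmul_mem_degree (r : ℂ⟦X⟧) {i : ZMod 2} {a : Yangian N} (ha : a ∈ degree ℂ (Yangian N) i) :
    r ⊗ₜ[ℂ] a ∈ degree ℂ⟦X⟧ (ℂ⟦X⟧ ⊗[ℂ] Yangian N) i := by
  rw [mem_degree, parity_tmul, mem_degree.1 ha, tmul_units_smul]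

/-- The map `a ⊗ b ↦ (1 ⊗ a) ⊗ (1 ⊗ b)`. -/
def tensorHat : Yangian N ⊗[ℂ] Yangian N →+
    (ℂ⟦X⟧ ⊗[ℂ] Yangian N) ⊗[ℂ⟦X⟧] (ℂ⟦X⟧ ⊗[ℂ] Yangian N) :=
  (TensorProduct.AlgebraTensorModule.distribBaseChange ℂ ℂ⟦X⟧ (Yangian N)
    (Yangian N)).toLinearMap.toAddMonoidHom.comp
      (TensorProduct.mk ℂ ℂ⟦X⟧ (Yangian N ⊗[ℂ] Yangian N) 1).toAddMonoidHom

theorem tensorHat_tmul (a b : Yangian N) :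
    tensorHat (a ⊗ₜ b) = ((1 : ℂ⟦X⟧) ⊗ₜ[ℂ] a) ⊗ₜ[ℂ⟦X⟧] ((1 : ℂ⟦X⟧) ⊗ₜ[ℂ] b) := rfl

theorem toSq_tensorHat_mul (s t : TensorSq ℂ (Yangian N)) :
    toSq ℂ⟦X⟧ _ (tensorHat ((toSq ℂ (Yangian N)).symm (s * t))) =
      toSq ℂ⟦X⟧ _ (tensorHat ((toSq ℂ (Yangian N)).symm s)) *
        toSq ℂ⟦X⟧ _ (tensorHat ((toSq ℂ (Yangian N)).symm t)) := by
  induction s using STensor.induction with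
  | zero => simp
  | add x y hx hy => simp only [add_mul, map_add, hx, hy]
  | tmul i j a ha b hb =>
    induction t using STensor.induction with
    | zero => simp
    | add x y hx hy => simp only [mul_add, map_add, hx, hy]
    | tmul i' j' a' ha' b' hb' =>
      rw [toST_mul a hb ha' b', map_units_smul, map_units_smul, map_units_smul,
        LinearEquiv.symm_apply_apply, LinearEquiv.symm_apply_apply, LinearEquiv.symm_apply_apply,
        tensorHat_tmul, tensorHat_tmul, tensorHat_tmul,
        toST_mul _ (tmul_mem_degree 1 hb) (tmul_mem_degree 1 ha') _,
        Algebra.TensorProduct.tmul_mul_tmul, Algebra.TensorProduct.tmul_mul_tmul, mul_one]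

/-- The `ℂ⟦h⟧`-linear extension of the comultiplication. -/
def comulHat (N : ℕ) : ℂ⟦X⟧ ⊗[ℂ] Yangian N →ₗ[ℂ⟦X⟧]
    (ℂ⟦X⟧ ⊗[ℂ] Yangian N) ⊗[ℂ⟦X⟧] (ℂ⟦X⟧ ⊗[ℂ] Yangian N) :=
  (TensorProduct.AlgebraTensorModule.distribBaseChange ℂ ℂ⟦X⟧ (Yangian N) (Yangian N)).toLinearMap ∘ₗ
    (bialg N).comul.baseChange ℂ⟦X⟧

theorem comulHat_tmul (r : ℂ⟦X⟧) (a : Yangian N) :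
    comulHat N (r ⊗ₜ a) = r • tensorHat ((bialg N).comul a) := by
  rw [comulHat, LinearMap.comp_apply, LinearMap.baseChange_tmul, tensorHat]
  change _ = r • TensorProduct.AlgebraTensorModule.distribBaseChange ℂ ℂ⟦X⟧ (Yangian N) (Yangian N)
    (1 ⊗ₜ (bialg N).comul a)
  rw [← map_smul, TensorProduct.smul_tmul', smul_eq_mul, mul_one]
  rfl

/-- The `ℂ⟦h⟧`-linear extension of the comultiplication, as a homomorphism. -/
def comulHatHom (N : ℕ) : ℂ⟦X⟧ ⊗[ℂ] Yangian N →ₐ[ℂ⟦X⟧] TensorSq ℂ⟦X⟧ (ℂ⟦X⟧ ⊗[ℂ] Yangian N) :=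
  AlgHom.ofLinearMap ((toSq ℂ⟦X⟧ _).toLinearMap ∘ₗ comulHat N)
    (by
      rw [Algebra.TensorProduct.one_def, LinearMap.comp_apply, comulHat_tmul, one_smul]
      change toSq ℂ⟦X⟧ _ (tensorHat ((toSq ℂ (Yangian N)).symm (comulHom N 1))) = _
      rw [map_one]
      rfl)
    (fun x y => by
      induction x with
      | zero => simp
      | add x x' hx hx' => rw [add_mul, map_add, map_add, hx, hx', add_mul]
      | tmul r a =>
        induction y with
        | zero => simp
        | add x x' hx hx' => rw [mul_add, map_add, map_add, hx, hx', mul_add]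
        | tmul s b =>
          simp only [Algebra.TensorProduct.tmul_mul_tmul, LinearMap.comp_apply, comulHat_tmul,
            map_smul, LinearEquiv.coe_coe]
          rw [smul_mul_smul_comm]
          congr 1
          change toSq ℂ⟦X⟧ _ (tensorHat ((toSq ℂ (Yangian N)).symm (comulHom N (a * b)))) = _
          rw [map_mul, toSq_tensorHat_mul]
          rfl)

end Yangian

/-! ### Scaled matrices of generators -/

section Scaled

variable {R A : Type*} [CommRing R] [Algebra ℚ R] [Ring A] [Algebra R A] [SuperAlgebra R A]
  {N : ℕ} (h : R) (g : Idx N → Idx N → ℕ → A)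

/-- The coefficients of `δ i j + h ∑ g i j n u ^ (-n - 1)`. -/
def scaled (i j : Idx N) : ℕ → A
  | 0 => if i = j then 1 else 0
  | s + 1 => h • g i j s

variable (R) in
/-- The cross terms of the comultiplication of `g i j n`, divided by `h`. -/
def comulRest (i j : Idx N) : ℕ → A ⊗[R] A
  | 0 => 0
  | n + 1 => matComul R g i j n

/-- The comultiplication of `g i j n`. -/
def comulGen (i j : Idx N) (n : ℕ) : A ⊗[R] A :=
  g i j n ⊗ₜ 1 + 1 ⊗ₜ g i j n + h • comulRest R g i j n

/-- In the comultiplication of `δ + h g`, the terms with one index equal to `0` carry a single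
factor `h` and give `g ⊗ 1` and `1 ⊗ g`; all others carry `h²`. One factor `h` can thus be taken out
of the whole. -/
theorem smul_comulGen (i j : Idx N) (n : ℕ) :
    h • comulGen h g i j n = matComul R (scaled h g) i j (n + 1) := by
  have key : ∀ k : Idx N, ∑ ab ∈ Finset.HasAntidiagonal.antidiagonal (n + 1),
      (-1 : ℤˣ) ^ ((i.2 + k.2) * (j.2 + k.2)) • (scaled h g i k ab.1 ⊗ₜ[R] scaled h g k j ab.2) =
      (if k = j then h • (g i j n ⊗ₜ[R] 1) else 0) + (if i = k then h • (1 ⊗ₜ[R] g i j n) else 0) +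
        h • h • (match n with
          | 0 => 0
          | n + 1 => ∑ ab ∈ Finset.HasAntidiagonal.antidiagonal n,
            (-1 : ℤˣ) ^ ((i.2 + k.2) * (j.2 + k.2)) • (g i k ab.1 ⊗ₜ[R] g k j ab.2)) := by
    intro k
    have e₁ : (-1 : ℤˣ) ^ ((i.2 + k.2) * (j.2 + k.2)) •
        (scaled h g i k (n + 1) ⊗ₜ[R] scaled h g k j 0) =
        if k = j then h • (g i j n ⊗ₜ[R] 1) else 0 := by
      split_ifs with hk
      · subst hk
        simp [scaled, CharTwo.add_self_eq_zero, TensorProduct.smul_tmul']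
      · simp [scaled, hk]
    have e₂ : (-1 : ℤˣ) ^ ((i.2 + k.2) * (j.2 + k.2)) •
        (scaled h g i k 0 ⊗ₜ[R] scaled h g k j (n + 1)) =
        if i = k then h • (1 ⊗ₜ[R] g i j n) else 0 := by
      split_ifs with hk
      · subst hk
        simp [scaled, CharTwo.add_self_eq_zero, TensorProduct.tmul_smul]
      · simp [scaled, hk]
    cases n with
    | zero =>
      rw [Finset.Nat.antidiagonal_succ]
      simp only [Finset.Nat.antidiagonal_zero, Finset.map_singleton, Finset.cons_eq_insert]
      rw [Finset.sum_insert (by simp), Finset.sum_singleton]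
      simp only [Function.Embedding.prodMap, Function.Embedding.coeFn_mk, Prod.map_apply,
        Function.Embedding.refl_apply, Nat.succ_eq_add_one]
      rw [e₁, e₂, smul_zero, smul_zero, add_zero, add_comm]
    | succ n =>
      rw [Finset.Nat.antidiagonal_succ_succ', Finset.sum_cons, Finset.sum_cons, Finset.sum_map, e₁,
        e₂, Finset.smul_sum, Finset.smul_sum, ← add_assoc, add_comm (ite (i = k) _ _)]
      congr 1
      refine Finset.sum_congr rfl fun ab _ => ?_
      change _ • ((h • g i k ab.1) ⊗ₜ[R] (h • g k j ab.2)) = _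
      rw [← TensorProduct.smul_tmul', TensorProduct.tmul_smul, smul_comm _ h, smul_comm _ h]
  simp only [matComul, key, comulGen, Finset.sum_add_distrib, Finset.sum_ite_eq,
    Finset.sum_ite_eq', Finset.mem_univ, if_true, smul_add, ← Finset.smul_sum]
  cases n with
  | zero => simp [comulRest]
  | succ n => simp only [comulRest, matComul, Finset.smul_sum]

variable {h g}

theorem scaled_mem_degree (hg : ∀ i j n, g i j n ∈ degree R A (i.2 + j.2)) (i j : Idx N) (s : ℕ) :
    scaled h g i j s ∈ degree R A (i.2 + j.2) := by
  cases s with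
  | zero =>
    rw [scaled]
    split_ifs with hij
    · rw [hij, CharTwo.add_self_eq_zero]
      exact one_mem_degree
    · exact zero_mem _
  | succ s => exact Submodule.smul_mem _ _ (hg i j s)

/-- A superbialgebra whose generators are comultiplied as the entries of a matrix, after
multiplication by the regular scalar `h`. -/
def Bialg.ofScaled (hA : IsSMulRegular A h) (hA₂ : IsSMulRegular (A ⊗[R] A) h)
    (hA₃ : IsSMulRegular (A ⊗[R] (A ⊗[R] A)) h)
    (hg : ∀ i j n, g i j n ∈ degree R A (i.2 + j.2))
    (comulHom : A →ₐ[R] TensorSq R A) (counit : A →ₐ[R] R)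
    (hs : Algebra.adjoin R (Set.range fun x : YangianGen N => g x.1 x.2.1 x.2.2) = ⊤)
    (comulHom_gen : ∀ i j n, comulHom (g i j n) = toSq R A (comulGen h g i j n))
    (counit_gen : ∀ i j n, counit (g i j n) = 0) : Bialg R A :=
  have hΔ : ∀ i j s, ((toSq R A).symm.toLinearMap ∘ₗ comulHom.toLinearMap) (scaled h g i j s) =
      matComul R (scaled h g) i j s := fun i j s => by
    cases s with
    | zero =>
      simp only [matComul, Finset.Nat.antidiagonal_zero, Finset.sum_singleton]
      rw [Yangian.sum_sign_delta (fun i k j => scaled h g i k 0 ⊗ₜ[R] scaled h g k j 0)]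
      · simp only [scaled, if_true]
        split_ifs
        · exact (congrArg (toSq R A).symm (map_one comulHom)).trans rfl
        · simp
      · rintro k (hk | hk)
        · simp [scaled, hk]
        · simp [scaled, hk]
    | succ n =>
      rw [scaled, map_smul, ← smul_comulGen]
      exact congrArg (fun t => h • (toSq R A).symm t) (comulHom_gen i j n)
  have hε₀ : ∀ i j, counit.toLinearMap (scaled h g i j 0) = if i = j then 1 else 0 := fun i j => by
    rw [scaled]
    split_ifs
    · exact map_one counit
    · exact map_zero counit
  have hεs : ∀ i j s, counit.toLinearMap (scaled h g i j (s + 1)) = 0 := fun i j s => by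
    rw [scaled, map_smul]
    exact (congrArg (h • ·) (counit_gen i j s)).trans (smul_zero h)
  have hC : ∀ i j n, (toSq R A).symm (comulHom (g i j n)) = comulGen h g i j n := fun i j n => by
    rw [comulHom_gen, LinearEquiv.symm_apply_apply]
  Bialg.ofGenerators comulHom counit _ hs
    (by
      rintro _ ⟨⟨i, j, n⟩, rfl⟩
      -- The evenness of the comultiplication, coassociativity and the counit axioms are known for
      -- the entries of `scaled`, which are `h` times the generators; the regularity of `h` on the
      -- relevant module cancels this factor.
      have k := mem_degree.1 (matComul_mem_degree (scaled_mem_degree (h := h) hg) i j (n + 1))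
      rw [← smul_comulGen, map_smul, map_smul, smul_comm] at k
      rw [mem_degree.1 (hg i j n), map_units_smul, comulHom_gen]
      exact (hA₂ k).symm)
    (by
      rintro _ ⟨⟨i, j, n⟩, rfl⟩
      rw [mem_degree.1 (hg i j n), map_units_smul, counit_gen, smul_zero])
    (by
      rintro _ ⟨⟨i, j, n⟩, rfl⟩
      have k := matComul_coassoc hΔ i j (n + 1)
      rw [← smul_comulGen, map_smul, map_smul, map_smul] at k
      rw [hC]
      exact hA₃ k)
    (by
      rintro _ ⟨⟨i, j, n⟩, rfl⟩
      have k := matComul_counit_left hε₀ hεs i j (n + 1)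
      rw [← smul_comulGen, map_smul, scaled, TensorProduct.tmul_smul] at k
      rw [hC]
      refine (TensorProduct.lid R A).injective (hA ?_)
      simpa only [map_smul] using congrArg (TensorProduct.lid R A) k)
    (by
      rintro _ ⟨⟨i, j, n⟩, rfl⟩
      have k := matComul_counit_right hε₀ hεs i j (n + 1)
      rw [← smul_comulGen, map_smul, scaled, ← TensorProduct.smul_tmul'] at k
      rw [hC]
      refine (TensorProduct.rid R A).injective (hA ?_)
      simpa only [map_smul] using congrArg (TensorProduct.rid R A) k)

theorem isConnected_of_scaled (H : Bialg R A) (hg : ∀ i j n, g i j n ∈ degree R A (i.2 + j.2))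
    (hs : Algebra.adjoin R (Set.range fun x : YangianGen N => g x.1 x.2.1 x.2.2) = ⊤)
    (comulHom_gen : ∀ i j n, H.comulHom (g i j n) = toSq R A (comulGen h g i j n)) :
    H.IsConnected (wordFil R (fun x : YangianGen N => g x.1 x.2.1 x.2.2) Yangian.weight) where
  toIsFil := isFil_wordFil hs fun x => ⟨_, hg x.1 x.2.1 x.2.2⟩
  comul_mem n a ha := comulHom_mem_tensorFil
    (isFil_wordFil hs fun x => ⟨_, hg x.1 x.2.1 x.2.2⟩) H.comulHom
    (fun x => by
      obtain ⟨i, j, n⟩ := x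
      have hm : ∀ i j n, g i j n ∈ wordFil R (fun x : YangianGen N => g x.1 x.2.1 x.2.2)
          Yangian.weight (n + 1) := fun i j n =>
        gen_mem_wordFil (R := R) (x := fun x : YangianGen N => g x.1 x.2.1 x.2.2)
          (w := Yangian.weight) (i, j, n)
      dsimp only
      rw [comulHom_gen, comulGen, map_add, map_add, map_smul]
      refine add_mem (add_mem (tmul_mem_tensorFil (q := 0) le_rfl (hm i j n) (one_mem_wordFil 0))
        (tmul_mem_tensorFil (p := 0) (by rw [zero_add]; exact le_rfl) (one_mem_wordFil 0)
          (hm i j n))) (Submodule.smul_mem _ _ ?_)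
      cases n with
      | zero => rw [comulRest, map_zero]; exact zero_mem _
      | succ n =>
        rw [comulRest, matComul, map_sum]
        refine sum_mem fun k _ => ?_
        rw [map_sum]
        refine sum_mem fun ab hab => ?_
        have hab := Finset.HasAntidiagonal.mem_antidiagonal.1 hab
        rw [map_units_smul]
        -- The two indices add up to `n`, so the weights, each larger by one, add up to `n + 2`,
        -- exactly the weight of the generator with index `n + 1`.
        exact units_smul_mem _ _ (tmul_mem_tensorFil
          (p := ab.1 + 1) (q := ab.2 + 1) (by simp only [Yangian.weight]; omega) (hm _ _ _)
          (hm _ _ _))) n ha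
  zero a ha := wordFil_zero (fun x => Nat.le_add_left 1 _) ha

theorem map_matComul {S B : Type*} [CommRing S] [Algebra ℚ S] [Ring B] [Algebra S B]
    [SuperAlgebra S B] {σ : R →+* S} (f : A →ₛₗ[σ] B) (t : Idx N → Idx N → ℕ → A) (i j : Idx N)
    (s : ℕ) :
    TensorProduct.map f f (matComul R t i j s) = matComul S (fun i j n => f (t i j n)) i j s := by
  simp only [matComul, map_sum, map_units_smul, TensorProduct.map_tmul]

end Scaled

/-! ### The Hopf structure of `Y(𝔮_N, h)` -/

theorem isSMulRegular_X (M : Type*) [AddCommGroup M] [Module ℂ⟦X⟧ M] [Module.Free ℂ⟦X⟧ M] :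
    IsSMulRegular M (PowerSeries.X : ℂ⟦X⟧) :=
  smul_right_injective M PowerSeries.X_ne_zero

theorem matComul_pow_smul {R A : Type*} [CommRing R] [Algebra ℚ R] [Ring A] [Algebra R A]
    [SuperAlgebra R A] {N : ℕ} (h : R) (t : Idx N → Idx N → ℕ → A) (i j : Idx N) (s : ℕ) :
    matComul R (fun i j n => h ^ n • t i j n) i j s = h ^ s • matComul R t i j s := by
  simp only [matComul, Finset.smul_sum]
  refine Finset.sum_congr rfl fun k _ => Finset.sum_congr rfl fun ab hab => ?_
  rw [TensorProduct.tmul_smul, ← TensorProduct.smul_tmul', smul_smul, ← pow_add,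
    add_comm ab.2, Finset.HasAntidiagonal.mem_antidiagonal.1 hab, smul_comm]

section Restrict

variable {A B : Type*} [Ring A] [Algebra ℂ⟦X⟧ A] [SuperAlgebra ℂ⟦X⟧ A] [Module.Free ℂ⟦X⟧ A]
  [Ring B] [Algebra ℂ⟦X⟧ B] [SuperAlgebra ℂ⟦X⟧ B] [Module.Free ℂ⟦X⟧ B] (f : A →ₐ[ℂ⟦X⟧] B)
  (hf : ∀ a, f (parity (R := ℂ⟦X⟧) a) = parity (R := ℂ⟦X⟧) (f a))
  (hi : Function.Injective f) (Δ : B →ₐ[ℂ⟦X⟧] TensorSq ℂ⟦X⟧ B) (ε : B →ₐ[ℂ⟦X⟧] ℂ⟦X⟧)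
  {N : ℕ} (g : Idx N → Idx N → ℕ → A)
  (hg : ∀ i j n, g i j n ∈ degree ℂ⟦X⟧ A (i.2 + j.2))
  (hs : Algebra.adjoin ℂ⟦X⟧ (Set.range fun x : YangianGen N => g x.1 x.2.1 x.2.2) = ⊤)
  (hΔ : ∀ i j s, Δ (f (scaled (PowerSeries.X : ℂ⟦X⟧) g i j s)) =
    toSq ℂ⟦X⟧ B (matComul ℂ⟦X⟧ (fun i j s => f (scaled (PowerSeries.X : ℂ⟦X⟧) g i j s)) i j s))
  (hε : ∀ i j n, ε (f (g i j n)) = 0)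

/-- Free modules are flat. The tensor square of a subalgebra may therefore be regarded as a
subalgebra of the larger tensor square, in which the restricted comultiplication is constructed. -/
theorem STensor.map_injective (hi : Function.Injective f) : Function.Injective (STensor.map f f hf hf) :=
  TensorProduct.map_injective_of_flat_flat f.toLinearMap f.toLinearMap hi hi

theorem map_comulGen
    (hΔ : ∀ i j s, Δ (f (scaled (PowerSeries.X : ℂ⟦X⟧) g i j s)) =
      toSq ℂ⟦X⟧ B (matComul ℂ⟦X⟧ (fun i j s => f (scaled (PowerSeries.X : ℂ⟦X⟧) g i j s)) i j s))
    (i j : Idx N) (n : ℕ) :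
    STensor.map f f hf hf (toSq ℂ⟦X⟧ A (comulGen (PowerSeries.X : ℂ⟦X⟧) g i j n)) =
      Δ (f (g i j n)) := by
  refine isSMulRegular_X (B ⊗[ℂ⟦X⟧] B) ?_
  have h1 := map_matComul f.toLinearMap (scaled (PowerSeries.X : ℂ⟦X⟧) g) i j (n + 1)
  have h2 := hΔ i j (n + 1)
  rw [← smul_comulGen, map_smul] at h1
  rw [scaled, map_smul, map_smul] at h2
  exact (congrArg (toSq ℂ⟦X⟧ B) h1).trans h2.symm

/-- The range is a subalgebra, so only generators matter; there `map_comulGen` exhibits a preimage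
after cancelling `h`. -/
theorem comul_mem_range
    (hs : Algebra.adjoin ℂ⟦X⟧ (Set.range fun x : YangianGen N => g x.1 x.2.1 x.2.2) = ⊤)
    (hΔ : ∀ i j s, Δ (f (scaled (PowerSeries.X : ℂ⟦X⟧) g i j s)) =
      toSq ℂ⟦X⟧ B (matComul ℂ⟦X⟧ (fun i j s => f (scaled (PowerSeries.X : ℂ⟦X⟧) g i j s)) i j s))
    (x : A) : Δ (f x) ∈ (STensor.map f f hf hf).range := by
  have h' : (⊤ : Subalgebra ℂ⟦X⟧ A) ≤ (STensor.map f f hf hf).range.comap (Δ.comp f) := by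
    rw [← hs, Algebra.adjoin_le_iff]
    rintro _ ⟨⟨i, j, n⟩, rfl⟩
    exact ⟨_, map_comulGen f hf Δ g hΔ i j n⟩
  exact h' trivial

/-- The restriction of a comultiplication to a subalgebra. -/
def restrictComul : A →ₐ[ℂ⟦X⟧] TensorSq ℂ⟦X⟧ A :=
  (AlgEquiv.ofInjective (STensor.map f f hf hf) (STensor.map_injective f hf hi)).symm.toAlgHom.comp
    ((Δ.comp f).codRestrict (STensor.map f f hf hf).range (comul_mem_range f hf Δ g hs hΔ))

theorem map_restrictComul (x : A) :
    STensor.map f f hf hf (restrictComul f hf hi Δ g hs hΔ x) = Δ (f x) :=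
  congrArg Subtype.val ((AlgEquiv.ofInjective (STensor.map f f hf hf)
    (STensor.map_injective f hf hi)).apply_symm_apply
    ⟨Δ (f x), comul_mem_range f hf Δ g hs hΔ x⟩)

theorem restrictComul_gen (i j : Idx N) (n : ℕ) : restrictComul f hf hi Δ g hs hΔ (g i j n) =
    toSq ℂ⟦X⟧ A (comulGen (PowerSeries.X : ℂ⟦X⟧) g i j n) :=
  STensor.map_injective f hf hi
    ((map_restrictComul f hf hi Δ g hs hΔ _).trans (map_comulGen f hf Δ g hΔ i j n).symm)

/-- The restriction of a superbialgebra to a subalgebra with generators `g i j n`. -/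
def restrictBialg : Bialg ℂ⟦X⟧ A :=
  Bialg.ofScaled (isSMulRegular_X A) (isSMulRegular_X (A ⊗[ℂ⟦X⟧] A))
    (isSMulRegular_X (A ⊗[ℂ⟦X⟧] (A ⊗[ℂ⟦X⟧] A))) hg
    (restrictComul f hf hi Δ g hs hΔ) (ε.comp f) hs (restrictComul_gen f hf hi Δ g hs hΔ) hε

/-- The restriction of a superbialgebra to a subalgebra with generators `g i j n`, with its
antipode. -/
def restrictHopf : HopfSuperalgebra ℂ⟦X⟧ A :=
  (isConnected_of_scaled (restrictBialg f hf hi Δ ε g hg hs hΔ hε) hg hs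
    (restrictComul_gen f hf hi Δ g hs hΔ)).toHopf

theorem restrictHopf_comul_gen (i j : Idx N) (n : ℕ) :
    (restrictHopf f hf hi Δ ε g hg hs hΔ hε).comul (g i j n) =
      comulGen (PowerSeries.X : ℂ⟦X⟧) g i j n :=
  congrArg (toSq ℂ⟦X⟧ A).symm (restrictComul_gen f hf hi Δ g hs hΔ i j n)

theorem map_restrictHopf_comul (x : A) : TensorProduct.map f.toLinearMap f.toLinearMap
    ((restrictHopf f hf hi Δ ε g hg hs hΔ hε).comul x) = (toSq ℂ⟦X⟧ B).symm (Δ (f x)) :=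
  congrArg (toSq ℂ⟦X⟧ B).symm (map_restrictComul f hf hi Δ g hs hΔ x)

end Restrict

theorem Yangian.comulHat_matComul {N : ℕ} (i j : Idx N) (s : ℕ) :
    Yangian.comulHat N ((PowerSeries.X ^ s : ℂ⟦X⟧) ⊗ₜ[ℂ] Yangian.T i j s) =
      matComul ℂ⟦X⟧ (fun i j s => (PowerSeries.X ^ s : ℂ⟦X⟧) ⊗ₜ[ℂ] Yangian.T i j s) i j s := by
  have e : (fun (i j : Idx N) s => (PowerSeries.X ^ s : ℂ⟦X⟧) ⊗ₜ[ℂ] Yangian.T i j s) =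
      fun i j s => (PowerSeries.X ^ s : ℂ⟦X⟧) • ((1 : ℂ⟦X⟧) ⊗ₜ[ℂ] Yangian.T i j s) :=
    funext fun i => funext fun j => funext fun s => by
      rw [TensorProduct.smul_tmul', smul_eq_mul, mul_one]
  rw [e, Yangian.comulHat_tmul, Yangian.comul_T, Yangian.comulT]
  refine Eq.trans ?_ (matComul_pow_smul (PowerSeries.X : ℂ⟦X⟧)
    (fun i j s => (1 : ℂ⟦X⟧) ⊗ₜ[ℂ] Yangian.T i j s) i j s).symm
  congr 1
  simp only [matComul, map_sum, map_units_smul, Yangian.tensorHat_tmul]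

namespace YangianH

variable {N : ℕ}

/-- The inclusion of `Y(𝔮_N, h)` into `ℂ⟦h⟧ ⊗ Y(𝔮_N)`. -/
abbrev val (N : ℕ) : YangianH N →ₐ[ℂ⟦X⟧] ℂ⟦X⟧ ⊗[ℂ] Yangian N := (yangianSubalgebra N).val

theorem val_gen (i j : Idx N) (n : ℕ) :
    val N (gen i j n) = (PowerSeries.X ^ n : ℂ⟦X⟧) ⊗ₜ[ℂ] Yangian.T i j (n + 1) := rfl

theorem val_parity (x : YangianH N) :
    val N ((YangianH.superAlgebra N).parity x) = (Yangian.hatSuperAlgebra N).parity (val N x) := rfl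

/-- With one more factor `h`, the elements `T^(s) h^s` are comultiplied as matrix entries for all `s
≥ 0`, since the exponents of `h` add up in the same way as the indices. -/
theorem val_scaled (i j : Idx N) (s : ℕ) : val N (scaled (PowerSeries.X : ℂ⟦X⟧) gen i j s) =
    (PowerSeries.X ^ s : ℂ⟦X⟧) ⊗ₜ[ℂ] Yangian.T i j s := by
  cases s with
  | zero =>
    rw [scaled, Yangian.T_zero, pow_zero]
    split_ifs
    · rw [map_one, Algebra.TensorProduct.one_def]
    · rw [map_zero, TensorProduct.tmul_zero]
  | succ s => rw [scaled, map_smul, val_gen, TensorProduct.smul_tmul', smul_eq_mul, pow_succ']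

theorem adjoin_gen : Algebra.adjoin ℂ⟦X⟧
    (Set.range fun x : YangianGen N => gen x.1 x.2.1 x.2.2) = ⊤ := by
  refine Subalgebra.map_injective (f := val N) Subtype.val_injective ?_
  rw [AlgHom.map_adjoin, ← Set.range_comp, Algebra.map_top, Subalgebra.range_val]
  rfl

theorem gen_mem_degree (i j : Idx N) (n : ℕ) :
    gen i j n ∈ degree ℂ⟦X⟧ (YangianH N) (i.2 + j.2) := by
  rw [mem_degree]
  refine Subtype.ext ((scalarParity_scaledT (i, j, n)).trans ?_)
  exact (map_units_smul (val N) _ (gen i j n)).symm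

theorem comulHat_scaled (i j : Idx N) (s : ℕ) :
    Yangian.comulHatHom N (val N (scaled (PowerSeries.X : ℂ⟦X⟧) gen i j s)) =
      toSq ℂ⟦X⟧ (ℂ⟦X⟧ ⊗[ℂ] Yangian N) (matComul ℂ⟦X⟧
        (fun i j s => val N (scaled (PowerSeries.X : ℂ⟦X⟧) gen i j s)) i j s) := by
  simp only [val_scaled]
  exact Yangian.comulHat_matComul i j s

/-- The counit of `ℂ⟦h⟧ ⊗ Y(𝔮_N)`. -/
def counitHat (N : ℕ) : ℂ⟦X⟧ ⊗[ℂ] Yangian N →ₐ[ℂ⟦X⟧] ℂ⟦X⟧ :=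
  (Algebra.TensorProduct.rid ℂ ℂ⟦X⟧ ℂ⟦X⟧).toAlgHom.comp
    (Algebra.TensorProduct.map (AlgHom.id ℂ⟦X⟧ ℂ⟦X⟧) (Yangian.counit N))

theorem counitHat_gen (i j : Idx N) (n : ℕ) : counitHat N (val N (gen i j n)) = 0 := by
  rw [val_gen, counitHat, AlgHom.comp_apply, Algebra.TensorProduct.map_tmul, Yangian.counit_T_succ,
    TensorProduct.tmul_zero, map_zero]

/-- The Hopf superalgebra structure of `Y(𝔮_N, h)`. -/
theorem exists_hopf (N : ℕ) : ∃ H : HopfSuperalgebra ℂ⟦X⟧ (YangianH N),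
    IsLinearExtension (Yangian.hopf N) H ∧
    (∀ (i j : Idx N) (n : ℕ), H.comul (gen i j n) = comulGen (PowerSeries.X : ℂ⟦X⟧) gen i j n) ∧
    ∀ (i j : Idx N) (n : ℕ), H.counit (gen i j n) = 0 :=
  ⟨restrictHopf (val N) val_parity Subtype.val_injective (Yangian.comulHatHom N) (counitHat N) gen
      gen_mem_degree adjoin_gen comulHat_scaled counitHat_gen,
    @map_restrictHopf_comul (YangianH N) (ℂ⟦X⟧ ⊗[ℂ] Yangian N) _ _ (YangianH.superAlgebra N) _ _ _
      (Yangian.hatSuperAlgebra N) _ (val N) val_parity Subtype.val_injective (Yangian.comulHatHom N)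
      (counitHat N) N gen gen_mem_degree adjoin_gen comulHat_scaled counitHat_gen,
    @restrictHopf_comul_gen (YangianH N) (ℂ⟦X⟧ ⊗[ℂ] Yangian N) _ _ (YangianH.superAlgebra N) _ _ _
      (Yangian.hatSuperAlgebra N) _ (val N) val_parity Subtype.val_injective (Yangian.comulHatHom N)
      (counitHat N) N gen gen_mem_degree adjoin_gen comulHat_scaled counitHat_gen,
    counitHat_gen⟩

end YangianH

/-! ### The evaluation representation of the Yangian -/

namespace Current

variable {N : ℕ}

theorem opp_ne (i : Idx N) : opp i ≠ i := fun h => by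
  have := congrArg Prod.snd h
  simp [opp] at this

theorem opp_inj {i j : Idx N} : opp i = opp j ↔ i = j :=
  (Function.Involutive.injective opp_opp).eq_iff

theorem eq_opp_iff {i j : Idx N} : i = opp j ↔ opp i = j :=
  ⟨fun h => by rw [h, opp_opp], fun h => by rw [← h, opp_opp]⟩

theorem neg_X_pow (n : ℕ) : (-Polynomial.X : ℂ[X]) ^ n = (-1 : ℤˣ) ^ n • Polynomial.X ^ n := by
  rw [neg_pow, Units.smul_def]
  simp

theorem single_units_smul (i j : Idx N) (e : ℤˣ) (p : ℂ[X]) :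
    Matrix.single i j (e • p) = e • Matrix.single i j p := by
  rw [Matrix.smul_single]

theorem twistedF_opp (i j : Idx N) (n : ℕ) :
    twistedF (opp i) (opp j) n = (-1 : ℤˣ) ^ n • twistedF i j n := by
  refine Subtype.ext ?_
  have h : ((((-1 : ℤˣ) ^ n • twistedF i j n : twistedCurrent N)) : Current N) =
    (-1 : ℤˣ) ^ n • (twistedF i j n : Current N) := map_units_smul (twistedCurrent N).subtype _ _
  rw [h]
  simp only [twistedF, opp_opp, smul_add, neg_X_pow, single_units_smul, smul_smul, ← mul_pow,
    Int.units_mul_self, one_pow, one_smul]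
  rw [add_comm]

theorem twistedF_mul (i j k l : Idx N) (a b : ℕ) :
    (twistedF j i a : Current N) * twistedF l k b =
      (if i = l then (twistedF j k (a + b) : Current N) else 0) +
      (if i = opp l then (-1 : ℤˣ) ^ b • (twistedF j (opp k) (a + b) : Current N) else 0) := by
  simp only [twistedF, mul_add, add_mul]
  by_cases h : i = l
  · subst h
    rw [if_pos rfl, if_neg (opp_ne i).symm, Matrix.single_mul_single_same,
      Matrix.single_mul_single_same, Matrix.single_mul_single_of_ne _ _ _ _ (opp_ne i),
      Matrix.single_mul_single_of_ne _ _ _ _ (opp_ne i).symm, pow_add, pow_add]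
    abel
  · rw [if_neg h, Matrix.single_mul_single_of_ne _ _ _ _ h,
      Matrix.single_mul_single_of_ne _ _ _ _ (fun e => h (opp_inj.1 e))]
    by_cases h' : i = opp l
    · subst h'
      rw [if_pos rfl, opp_opp, Matrix.single_mul_single_same, Matrix.single_mul_single_same,
        opp_opp, neg_X_pow, neg_X_pow, neg_X_pow, smul_add, ← single_units_smul,
        ← single_units_smul, pow_add, pow_add, smul_mul_assoc, mul_smul_comm, smul_smul, mul_left_comm,
        Int.units_mul_self, mul_one]
      abel
    · rw [if_neg h', Matrix.single_mul_single_of_ne _ _ _ _ h',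
        Matrix.single_mul_single_of_ne _ _ _ _ (fun e => h' (eq_opp_iff.2 e))]
      abel

/-- The image `-(-1) ^ j F j i ^ (n)` of the generator `T i j ^ (n + 1)`. -/
def evalGen (i j : Idx N) (n : ℕ) : twistedCurrent N := -((-1 : ℤˣ) ^ j.2 • twistedF j i n)

theorem coe_units_smul (e : ℤˣ) (x : twistedCurrent N) :
    ((e • x : twistedCurrent N) : Current N) = e • (x : Current N) :=
  map_units_smul (twistedCurrent N).subtype _ _

theorem sign_opp (i : Idx N) : (-1 : ℤˣ) ^ (opp i).2 = -(-1 : ℤˣ) ^ i.2 := by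
  rw [opp, uzpow_add]
  simp

theorem evalGen_opp (i j : Idx N) (n : ℕ) :
    evalGen (opp i) (opp j) n = (-1 : ℤˣ) ^ (n + 1) • evalGen i j n := by
  rw [evalGen, evalGen, twistedF_opp, sign_opp, smul_smul, smul_neg, smul_smul]
  congr 2
  rw [pow_succ, mul_neg_one, neg_mul, neg_mul, mul_comm]

theorem evalGen_mul (i j k l : Idx N) (a b : ℕ) :
    (evalGen i j a : Current N) * evalGen k l b =
      -((if i = l then (-1 : ℤˣ) ^ i.2 • (evalGen k j (a + b) : Current N) else 0) +
      (if i = opp l then (-1 : ℤˣ) ^ (b + 1) • (-1 : ℤˣ) ^ i.2 •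
        (evalGen (opp k) j (a + b) : Current N) else 0)) := by
  simp only [evalGen, NegMemClass.coe_neg, coe_units_smul, neg_mul_neg, smul_mul_smul_comm, twistedF_mul]
  split_ifs with h₁ h₂ h₂
  · exact absurd (h₁.symm.trans h₂).symm (opp_ne l)
  · subst h₁
    simp only [add_zero, smul_neg, smul_smul, neg_neg, mul_comm]
  · subst h₂
    simp only [zero_add, smul_neg, smul_smul, neg_neg, sign_opp, pow_succ, mul_neg, neg_mul, mul_comm]
    simp
  · simp

theorem ite_units_smul {M : Type*} [AddCommGroup M] (c : Prop) [Decidable c] (e e' : ℤˣ) (x : M)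
    (h : c → e = e') : e • (if c then x else 0) = e' • (if c then x else 0) := by
  split_ifs with hc
  · rw [h hc]
  · rw [smul_zero, smul_zero]

/-- Each product of two images contributes one term for equal and one for opposite inner indices.
The outcome depends on `a` and `b` only through `a + b` and the sign `(-1) ^ a`, which makes the
differences in the ternary relation cancel. -/
theorem evalGen_comm (i j k l : Idx N) (a b : ℕ) :
    (-1 : ℤˣ) ^ (i.2 * k.2 + i.2 * l.2 + k.2 * l.2) •
        ((evalGen i j a : Current N) * evalGen k l b
          - (-1 : ℤˣ) ^ ((i.2 + j.2) * (k.2 + l.2)) • ((evalGen k l b : Current N) * evalGen i j a)) =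
      ((if k = j then (evalGen i l (a + b) : Current N) else 0)
        - (if i = l then (evalGen k j (a + b) : Current N) else 0))
      - (-1 : ℤˣ) ^ (k.2 + l.2) • (-1 : ℤˣ) ^ a •
        ((if opp k = j then (evalGen (opp i) l (a + b) : Current N) else 0)
          - (if opp i = l then (evalGen k (opp j) (a + b) : Current N) else 0)) := by
  have key : ∀ k j : Idx N, (-1 : ℤˣ) ^ (a + b + 1) • (evalGen (opp k) j (a + b) : Current N) =
      evalGen k (opp j) (a + b) := fun k j => by
    have := evalGen_opp (opp k) j (a + b)
    rw [opp_opp] at this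
    rw [this, coe_units_smul]
  simp only [← key, evalGen_mul, eq_opp_iff, smul_sub, smul_add, smul_neg]
  have p : ∀ (c : Prop) [Decidable c] (e : ℤˣ) (x : Current N),
      (if c then e • x else 0) = e • (if c then x else 0) := fun c _ e x => by
    split_ifs
    · rfl
    · rw [smul_zero]
  simp only [p, smul_smul, ← uzpow_add, sub_neg_eq_add, add_comm b a]
  have h2 : (1 : ZMod 2) + 1 = 0 := by decide
  have sq : ∀ (e : ℤˣ) , e * e = 1 := Int.units_mul_self
  rw [ite_units_smul (i = l) _ 1 _ ?_, ite_units_smul (k = j) _ 1 _ ?_,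
    ite_units_smul (opp i = l) _ (-((-1) ^ (k.2 + l.2) * (-1) ^ (a + (a + b + 1)))) _ ?_,
    ite_units_smul (opp k = j) _ (-((-1) ^ (k.2 + l.2) * (-1) ^ a)) _ ?_]
  · simp only [one_smul, Units.neg_smul]
    abel
  all_goals rintro rfl
  · rcases Int.units_eq_one_or ((-1 : ℤˣ) ^ a) with h | h <;> simp only [pow_succ, h, opp] <;>
    · generalize i.2 = i; generalize l.2 = l; generalize k.2 = k
      clear * -
      revert i l k
      decide
  · rcases Int.units_eq_one_or ((-1 : ℤˣ) ^ a) with h | h <;>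
    rcases Int.units_eq_one_or ((-1 : ℤˣ) ^ b) with h' | h' <;>
    simp only [pow_succ, pow_add, h, h', opp] <;>
    · generalize i.2 = i; generalize k.2 = k
      clear * -
      revert i k
      decide
  · generalize i.2 = i; generalize l.2 = l; generalize k.2 = k
    clear * -
    revert i l k
    decide
  · generalize i.2 = i; generalize k.2 = k
    clear * -
    revert i k
    decide

/-- The common factor of the quadratic terms of the ternary relation. -/
def evalQuad (i j k l : Idx N) (n : ℕ) : Current N :=
  if opp k = l then (-1 : ℤˣ) ^ k.2 • (evalGen (opp i) j n : Current N) else 0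

/-- The terms with `k = l` are symmetric and cancel; those with `opp k = l` remain. The same happens
in `evalGen_twist`, so both kinds of quadratic terms are multiples of the single matrix `evalQuad`
and can cancel each other. -/
theorem evalGen_swap (i j k l : Idx N) (a b : ℕ) :
    ((evalGen k j a : Current N) * evalGen i l b - (evalGen k j b : Current N) * evalGen i l a) =
      (-1 : ℤˣ) ^ b • evalQuad i j k l (a + b) - (-1 : ℤˣ) ^ a • evalQuad i j k l (a + b) := by
  simp only [evalGen_mul, evalQuad, eq_opp_iff, add_comm b a]
  split_ifs with h₁ h₂
  · exact absurd (h₂.trans h₁.symm) (opp_ne k)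
  · simp
  · simp only [pow_succ, mul_neg_one, Units.neg_smul]
    abel
  · simp

theorem evalGen_twist (i j k l : Idx N) (a b : ℕ) :
    (-1 : ℤˣ) ^ (k.2 + l.2) •
        ((evalGen (opp k) j a : Current N) * evalGen (opp i) l b
          - (evalGen k (opp j) b : Current N) * evalGen i (opp l) a) =
      (-1 : ℤˣ) ^ (a + b) • evalQuad i j k l (a + b) - evalQuad i j k l (a + b) := by
  have q : ∀ (i j : Idx N) n, (evalGen i (opp j) n : Current N) =
      (-1 : ℤˣ) ^ (n + 1) • (evalGen (opp i) j n : Current N) := fun i j n => by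
    have := evalGen_opp (opp i) j n
    rw [opp_opp] at this
    rw [this, coe_units_smul]
  simp only [evalGen_mul, evalQuad, eq_opp_iff (j := l), opp_opp, add_comm b a]
  split_ifs with h₁ h₂ h₃
  · exact absurd (h₁.trans h₂.symm) (opp_ne k)
  · subst h₁
    simp only [q, sign_opp, uzpow_add, pow_succ, Units.neg_smul, smul_neg, smul_smul,
      neg_neg, add_zero, smul_sub, neg_mul, mul_neg, Int.units_mul_self, one_mul]
    simp only [mul_comm, ← mul_assoc, one_mul]
    abel
  · rw [show (evalGen (opp i) (opp j) (a + b) : Current N) =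
      (-1 : ℤˣ) ^ (a + b + 1) • (evalGen i j (a + b) : Current N) by
        rw [evalGen_opp, coe_units_smul], sign_opp]
    rcases Int.units_eq_one_or ((-1 : ℤˣ) ^ a) with h | h <;>
    rcases Int.units_eq_one_or ((-1 : ℤˣ) ^ b) with h' | h' <;>
    simp [pow_succ, pow_add, h, h']
  · simp

/-- The image of the coefficient `T i j ^ (s)` under the evaluation representation. -/
def evalT (i j : Idx N) : ℕ → Current N
  | 0 => if i = j then 1 else 0
  | n + 1 => evalGen i j n

theorem evalT_opp (i j : Idx N) (s : ℕ) : evalT (opp i) (opp j) s = (-1 : ℤˣ) ^ s • evalT i j s := by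
  cases s with
  | zero => simp only [evalT, opp_inj, pow_zero, one_smul]
  | succ n => rw [evalT, evalGen_opp, coe_units_smul, evalT]

theorem int_cases (p : ℤ) : p ≤ -2 ∨ p = -1 ∨ p = 0 ∨ ∃ a : ℕ, p = a + 1 := by
  rcases le_or_gt p 0 with h | h
  · have : p ≤ -2 ∨ p = -1 ∨ p = 0 := by omega
    tauto
  · exact Or.inr (Or.inr (Or.inr ⟨(p - 1).toNat, by omega⟩))

set_option maxHeartbeats 1000000 in
-- For positive `p` and `q` the two supercommutators cancel, as they depend only on the total degree
-- and on a sign unchanged by a shift of two; the quadratic terms cancel through `evalQuad`. When an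
-- index is `-1` or `0`, the entry `δ` of index zero produces linear terms, and these are exactly
-- the supercommutator in `evalGen_comm`.
theorem ternaryRel_evalT : TernaryRel (fun i j : Idx N => extendZero (evalT i j)) := by
  intro i j k l p q
  have hneg : ∀ (i j : Idx N) (p : ℤ), p < 0 → extendZero (evalT i j) p = 0 := fun i j p hp =>
    extendZero_of_neg _ hp
  have h0 : ∀ (i j : Idx N), extendZero (evalT i j) 0 = if i = j then 1 else 0 := fun _ _ => rfl
  have hs : ∀ (i j : Idx N) (a : ℕ), extendZero (evalT i j) (a + 1) = evalGen i j a :=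
    fun _ _ _ => rfl
  have hz : ∀ (i j : Idx N) (p : ℤ), p ≤ 0 → ∃ c : Prop, ∃ _ : Decidable c,
      extendZero (evalT i j) p = (if c then 1 else 0) ∧ (c → i = j) := fun i j p hp => by
    rcases hp.lt_or_eq with h | rfl
    · exact ⟨False, inferInstance, by rw [hneg i j p h, if_neg not_false], False.elim⟩
    · exact ⟨i = j, inferInstance, h0 i j, id⟩
  -- A coefficient of index at most `0` is `0` or a Kronecker delta and supercommutes with
  -- everything.
  have hc : ∀ (i j k l : Idx N) (p q : ℤ), p ≤ 0 →
      extendZero (evalT i j) p * extendZero (evalT k l) q - (-1 : ℤˣ) ^ ((i.2 + j.2) * (k.2 + l.2)) •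
        (extendZero (evalT k l) q * extendZero (evalT i j) p) = 0 := fun i j k l p q hp => by
    obtain ⟨c, _, h, hij⟩ := hz i j p hp
    rw [h]
    split_ifs with hc
    · rw [hij hc, CharTwo.add_self_eq_zero, zero_mul, uzpow_zero, one_smul, one_mul, mul_one,
        sub_self]
    · rw [zero_mul, mul_zero, smul_zero, sub_zero]
  have hc' : ∀ (i j k l : Idx N) (p q : ℤ), q ≤ 0 →
      extendZero (evalT i j) p * extendZero (evalT k l) q - (-1 : ℤˣ) ^ ((i.2 + j.2) * (k.2 + l.2)) •
        (extendZero (evalT k l) q * extendZero (evalT i j) p) = 0 := fun i j k l p q hp => by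
    obtain ⟨c, _, h, hij⟩ := hz k l q hp
    rw [h]
    split_ifs with hc
    · rw [hij hc, CharTwo.add_self_eq_zero, mul_zero, uzpow_zero, one_smul, one_mul, mul_one,
        sub_self]
    · rw [zero_mul, mul_zero, smul_zero, sub_zero]
  have key : ∀ (k j : Idx N) n, (evalGen k (opp j) n : Current N) =
      (-1 : ℤˣ) ^ (n + 1) • (evalGen (opp k) j n : Current N) := fun k j n => by
    have := evalGen_opp (opp k) j n
    rw [opp_opp] at this
    rw [this, coe_units_smul]
  have hp : ∀ (c : Prop) [Decidable c] (e : ℤˣ) (x : Current N),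
      (if c then e • x else 0) = e • (if c then x else 0) := fun c _ e x => by
    split_ifs
    · rfl
    · rw [smul_zero]
  dsimp only
  -- The shifts in the relation are at most two, so each index ranges over four cases: everything
  -- trivial, `-1`, `0`, or positive.
  rcases int_cases p with hp | rfl | rfl | ⟨a, rfl⟩
  · rw [hc _ _ _ _ (p + 2) _ (by omega), hc _ _ _ _ p _ (by omega)]
    simp only [hneg _ _ p (by omega), hneg _ _ (p + 1) (by omega), zero_mul, mul_zero, sub_zero,
      smul_zero, add_zero]
  · rw [hc _ _ _ _ (-1) _ (by omega)]
    simp only [hneg _ _ (-1) (by omega), show (-1 : ℤ) + 1 = 0 from rfl, h0, zero_mul, mul_zero,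
      sub_zero, add_zero]
    rcases le_or_gt q 0 with hq | hq
    · rw [hc' _ _ _ _ _ _ hq]
      rcases hq.lt_or_eq with hq | rfl
      · simp only [hneg _ _ _ hq, zero_mul, mul_zero, sub_zero, smul_zero]
      · simp only [h0, eq_opp_iff]
        by_cases h₁ : k = j <;> by_cases h₂ : i = l <;> by_cases h₃ : opp k = j <;>
          by_cases h₄ : opp i = l <;> simp [h₁, h₂, h₃, h₄]
    · obtain ⟨b, rfl⟩ : ∃ b : ℕ, q = b + 1 := ⟨(q - 1).toNat, by omega⟩
      have h := evalGen_comm i j k l 0 b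
      simp only [hs, show (-1 : ℤ) + 2 = ((0 : ℕ) : ℤ) + 1 from rfl]
      rw [h]
      simp only [zero_add, pow_zero, one_smul, ite_mul, one_mul, zero_mul, mul_ite, mul_one,
        mul_zero, eq_opp_iff]
  · rw [hc _ _ _ _ 0 _ le_rfl]
    rcases int_cases q with hq | rfl | rfl | ⟨b, rfl⟩
    · rw [hc' _ _ _ _ _ q (by omega)]
      simp only [hneg _ _ q (by omega), hneg _ _ (q + 1) (by omega), zero_mul, mul_zero, sub_zero,
        smul_zero, add_zero]
    · rw [hc' _ _ _ _ _ (-1) (by omega)]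
      simp only [hneg _ _ (-1) (by omega), show (-1 : ℤ) + 1 = 0 from rfl, h0, eq_opp_iff, mul_zero,
        zero_mul, sub_zero, smul_zero, zero_add]
      by_cases h₁ : k = j <;> by_cases h₂ : i = l <;> by_cases h₃ : opp k = j <;>
        by_cases h₄ : opp i = l <;> simp [h₁, h₂, h₃, h₄]
    · rw [hc' _ _ _ _ _ 0 le_rfl]
      simp only [show (0 : ℤ) + 1 = ((0 : ℕ) : ℤ) + 1 from rfl, hs, h0, eq_opp_iff, key, ite_mul,
        one_mul, zero_mul, mul_ite, mul_one, mul_zero, zero_add, pow_one, hp, smul_sub]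
      simp only [Units.neg_smul, one_smul, smul_neg, smul_zero]
      abel
    · simp only [show (0 : ℤ) + 1 = ((0 : ℕ) : ℤ) + 1 from rfl,
        show (0 : ℤ) + 2 = ((1 : ℕ) : ℤ) + 1 from rfl,
        show (b : ℤ) + 1 + 1 = ((b + 1 : ℕ) : ℤ) + 1 by push_cast; ring, hs, h0, sub_zero]
      rw [evalGen_comm, evalGen_swap, smul_sub _ _ (_ - _), evalGen_twist]
      simp only [ite_mul, one_mul, zero_mul, mul_ite, mul_one, mul_zero, eq_opp_iff, pow_zero,
        pow_one, one_smul, zero_add, add_comm 1 b, Units.neg_smul, smul_neg]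
      abel
  · rcases int_cases q with hq | rfl | rfl | ⟨b, rfl⟩
    · rw [hc' _ _ _ _ _ q (by omega), hc' _ _ _ _ _ (q + 2) (by omega)]
      simp only [hneg _ _ q (by omega), hneg _ _ (q + 1) (by omega), zero_mul, mul_zero, sub_zero,
        smul_zero, add_zero]
    · rw [hc' _ _ _ _ _ (-1) (by omega)]
      simp only [hneg _ _ (-1) (by omega), show (-1 : ℤ) + 1 = 0 from rfl, h0, mul_zero, zero_mul,
        sub_zero, zero_sub, hs, show (-1 : ℤ) + 2 = ((0 : ℕ) : ℤ) + 1 from rfl, smul_neg]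
      rw [evalGen_comm]
      simp only [ite_mul, one_mul, zero_mul, mul_ite, mul_one, mul_zero, eq_opp_iff, add_zero, key]
      simp only [hp]
      rcases Int.units_eq_one_or ((-1 : ℤˣ) ^ a) with h | h <;>
      · simp only [h, pow_succ, smul_sub, smul_neg, mul_neg_one, neg_neg, Units.neg_smul,
          one_smul]
        abel
    · rw [hc' _ _ _ _ _ 0 (by omega)]
      simp only [show (0 : ℤ) + 1 = ((0 : ℕ) : ℤ) + 1 from rfl,
        show (0 : ℤ) + 2 = ((1 : ℕ) : ℤ) + 1 from rfl,
        show (a : ℤ) + 1 + 1 = ((a + 1 : ℕ) : ℤ) + 1 by push_cast; ring, hs, h0,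
        zero_sub, smul_neg]
      rw [evalGen_comm, evalGen_swap, smul_sub _ _ (_ - _), evalGen_twist]
      simp only [ite_mul, one_mul, zero_mul, mul_ite, mul_one, mul_zero, eq_opp_iff, pow_zero,
        one_smul, add_zero, key]
      simp only [hp]
      rcases Int.units_eq_one_or ((-1 : ℤˣ) ^ a) with h | h <;>
      · simp only [h, pow_succ, smul_sub, smul_neg, mul_neg_one, neg_neg, Units.neg_smul,
          one_smul]
        abel
    · simp only [show (a : ℤ) + 1 + 1 = ((a + 1 : ℕ) : ℤ) + 1 by push_cast; ring,
        show (b : ℤ) + 1 + 1 = ((b + 1 : ℕ) : ℤ) + 1 by push_cast; ring,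
        show (a : ℤ) + 1 + 2 = ((a + 2 : ℕ) : ℤ) + 1 by push_cast; ring,
        show (b : ℤ) + 1 + 2 = ((b + 2 : ℕ) : ℤ) + 1 by push_cast; ring, hs]
      rw [smul_sub, evalGen_comm, evalGen_comm, evalGen_swap, evalGen_swap, smul_sub _ _ (_ - _),
        evalGen_twist, evalGen_twist]
      rw [show a + 2 + b = a + (b + 2) by ring, show a + 1 + b = a + (b + 1) by ring, sub_self]
      simp only [pow_succ, mul_neg_one, neg_neg, sub_self, Units.neg_smul]
      abel

end Current

/-! ### The generators of `Y(𝔮_N, h)` modulo `h` -/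

section BracketForm

variable {N : ℕ}

/-- The right-hand side of the commutation relations of `𝔤`, where `f i j n` has degree `n`. -/
def bracketForm {M : Type*} [AddCommGroup M] (f : Idx N → Idx N → ℕ → M) (i j k l : Idx N)
    (a b : ℕ) : M :=
  ((if k = j then f i l (a + b) else 0) - (if i = l then f k j (a + b) else 0))
    - (-1 : ℤˣ) ^ (k.2 + l.2) • (-1 : ℤˣ) ^ a •
      ((if opp k = j then f (opp i) l (a + b) else 0)
        - (if opp i = l then f k (opp j) (a + b) else 0))

theorem map_bracketForm {M M' F : Type*} [AddCommGroup M] [AddCommGroup M'] [FunLike F M M']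
    [AddMonoidHomClass F M M'] (φ : F) (f : Idx N → Idx N → ℕ → M) (i j k l : Idx N) (a b : ℕ) :
    φ (bracketForm f i j k l a b) = bracketForm (fun i j n => φ (f i j n)) i j k l a b := by
  simp only [bracketForm, map_sub, map_units_smul, apply_ite φ, map_zero]

/-- The supercommutator of `x` of degree `i + j` and `y` of degree `k + l`, with the sign of the
Yangian relations. -/
def signedComm {A : Type*} [Ring A] (i j k l : Idx N) (x y : A) : A :=
  (-1 : ℤˣ) ^ (i.2 * k.2 + i.2 * l.2 + k.2 * l.2) •
    (x * y - (-1 : ℤˣ) ^ ((i.2 + j.2) * (k.2 + l.2)) • (y * x))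

section

variable {R A : Type*} [CommRing R] [Ring A] [Algebra R A]

theorem signedComm_smul_smul (i j k l : Idx N) (r s : R) (x y : A) :
    signedComm i j k l (r • x) (s • y) = (r * s) • signedComm i j k l x y := by
  simp only [signedComm, smul_mul_smul_comm, mul_comm s r, smul_sub]
  rw [smul_comm _ (r * s), smul_comm _ (r * s), smul_comm _ (r * s)]

theorem signedComm_delta (i j k l : Idx N) (y : A) :
    signedComm i j k l (if i = j then 1 else 0) y = 0 := by
  rw [signedComm]
  split_ifs with h
  · rw [h, CharTwo.add_self_eq_zero, zero_mul, uzpow_zero, one_smul, one_mul, mul_one, sub_self,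
      smul_zero]
  · rw [zero_mul, mul_zero, smul_zero, sub_zero, smul_zero]

/-- The right-hand side of the ternary relation. -/
def ternaryRhs (t : Idx N → Idx N → ℤ → A) (i j k l : Idx N) (p q : ℤ) : A :=
  ((t k j (p + 1) * t i l q - t k j q * t i l (p + 1))
      + (t k j p * t i l (q + 1) - t k j (q + 1) * t i l p))
    - (-1 : ℤˣ) ^ (k.2 + l.2) •
      ((t (opp k) j (p + 1) * t (opp i) l q - t k (opp j) q * t i (opp l) (p + 1))
        - (t (opp k) j p * t (opp i) l (q + 1) - t k (opp j) (q + 1) * t i (opp l) p))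

/-- The ternary relation for coefficients scaled by powers of `h`. -/
def ScaledRel (h : R) (s : Idx N → Idx N → ℤ → A) : Prop :=
  ∀ (i j k l : Idx N) (p q : ℤ), -1 ≤ p → 0 ≤ q →
    signedComm i j k l (s i j (p + 2)) (s k l q) - signedComm i j k l (s i j p) (s k l (q + 2)) =
      h • ternaryRhs s i j k l p q

theorem ScaledRel.of_injective {B : Type*} [Ring B] [Algebra R B] {h : R}
    {s : Idx N → Idx N → ℤ → A} (f : A →ₐ[R] B) (hf : Function.Injective f)
    (hs : ScaledRel h fun i j p => f (s i j p)) : ScaledRel h s := by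
  intro i j k l p q hp hq
  apply hf
  have H := hs i j k l p q hp hq
  simp only [signedComm, ternaryRhs, ← map_mul, ← map_units_smul f, ← map_sub, ← map_add,
    ← map_smul f] at H
  exact H

end

variable {R A : Type*} [CommRing R] [Algebra ℚ R] [Ring A] [Algebra R A] [SuperAlgebra R A]
  {h : R} {g : Idx N → Idx N → ℕ → A}

/-- The relation at `(p, q)` links commutators with first index `p + 2` and `p`, so the induction on
`a` goes in steps of two, starting from `p = -1` and `p = 0`. After division by `h²`, the linear
terms come from the entries `δ` of index zero, while quadratic terms retain a factor `h`. For `a =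
0` there is no correction at all. -/
theorem signedComm_gen_modEq (hreg : IsSMulRegular A h)
    (hrel : ScaledRel h fun i j => extendZero (scaled h g i j))
    (i j k l : Idx N) (a b : ℕ) :
    ∃ y, signedComm i j k l (g i j a) (g k l b) = bracketForm g i j k l a b + h • y := by
  have hs : ∀ (i j : Idx N) (n : ℕ), extendZero (scaled h g i j) (n + 1) = h • g i j n :=
    fun _ _ _ => rfl
  have h0 : ∀ (i j : Idx N), extendZero (scaled h g i j) 0 = if i = j then 1 else 0 :=
    fun _ _ => rfl
  have hn : ∀ (i j : Idx N), extendZero (scaled h g i j) (-1) = 0 := fun _ _ => rfl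
  have hreg2 : IsSMulRegular A (h * h) := hreg.mul hreg
  have hp : ∀ (c : Prop) [Decidable c] (x : A),
      (if c then h • x else 0) = h • (if c then x else 0) := fun c _ x => by
    split_ifs
    · rfl
    · rw [smul_zero]
  have sw : ∀ k l : Idx N, k = opp l ↔ opp k = l := fun k l =>
    ⟨fun h => by rw [h, opp_opp], fun h => by rw [← h, opp_opp]⟩
  induction a using Nat.twoStepInduction generalizing b with
  | zero =>
    refine ⟨0, hreg2 ?_⟩
    have H := hrel i j k l (-1) (b + 1) le_rfl (by omega)
    dsimp only [ternaryRhs] at H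
    rw [show (-1 : ℤ) + 2 = ((0 : ℕ) : ℤ) + 1 from rfl, hs, hs, hn, signedComm_smul_smul] at H
    simp only [show (-1 : ℤ) + 1 = 0 from rfl, hn, hs, h0, ite_mul, mul_ite, one_mul, mul_one,
      zero_mul, mul_zero, add_zero, sub_zero, sw] at H
    have z : ∀ y : A, signedComm i j k l 0 y = 0 := fun y => by simp [signedComm]
    rw [z, sub_zero] at H
    dsimp only
    rw [H, smul_zero, add_zero, mul_smul, bracketForm]
    simp only [hp, zero_add, pow_zero, one_smul, smul_sub]
    simp only [smul_comm (_ : ℤˣ) h]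
  | one =>
    refine ⟨(g k j 0 * g i l b - g k j b * g i l 0)
      - (-1 : ℤˣ) ^ (k.2 + l.2) •
        (g (opp k) j 0 * g (opp i) l b - g k (opp j) b * g i (opp l) 0), hreg2 ?_⟩
    have H := hrel i j k l 0 (b + 1) (by omega) (by omega)
    dsimp only [ternaryRhs] at H
    rw [h0, signedComm_delta, sub_zero, show (0 : ℤ) + 2 = ((1 : ℕ) : ℤ) + 1 from rfl, hs, hs,
      signedComm_smul_smul] at H
    simp only [show (0 : ℤ) + 1 = ((0 : ℕ) : ℤ) + 1 from rfl,
      show (b : ℤ) + 1 + 1 = ((b + 1 : ℕ) : ℤ) + 1 by push_cast; ring, hs, h0, ite_mul, mul_ite,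
      one_mul, mul_one, zero_mul, mul_zero, sw, smul_mul_smul_comm] at H
    dsimp only
    rw [H, bracketForm]
    simp only [hp, smul_sub, smul_add, mul_smul, smul_comm (_ : ℤˣ) h, pow_one, Units.neg_smul,
      one_smul, smul_neg, add_comm 1 b]
    abel
  | more a ih _ =>
    obtain ⟨y, hy⟩ := ih (b + 2)
    refine ⟨y + ternaryRhs (fun i j p => g i j (p - 1).toNat) i j k l (a + 1) (b + 1),
      hreg2 ?_⟩
    have H := hrel i j k l (a + 1) (b + 1) (by omega) (by omega)
    have e : bracketForm g i j k l (a + 2) b = bracketForm g i j k l a (b + 2) := by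
      rw [bracketForm, bracketForm, show a + 2 + b = a + (b + 2) by ring, pow_add]
      simp
    have r : ternaryRhs (fun i j => extendZero (scaled h g i j)) i j k l (a + 1) (b + 1) =
        (h * h) • ternaryRhs (fun i j p => g i j (p - 1).toNat) i j k l (a + 1) (b + 1) := by
      have ht : ∀ n : ℕ, ((n : ℤ) + 1 - 1).toNat = n := fun n => by omega
      simp only [ternaryRhs, show (b : ℤ) + 1 + 1 = ((b + 1 : ℕ) : ℤ) + 1 by push_cast; ring,
        show (a : ℤ) + 1 + 1 = ((a + 1 : ℕ) : ℤ) + 1 by push_cast; ring, hs, ht,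
        smul_mul_smul_comm, smul_sub, smul_add, smul_comm (_ : ℤˣ) (h * h)]
    rw [r, show (a : ℤ) + 1 + 2 = ((a + 2 : ℕ) : ℤ) + 1 by push_cast; ring,
      show (b : ℤ) + 1 + 2 = ((b + 2 : ℕ) : ℤ) + 1 by push_cast; ring] at H
    dsimp only at H ⊢
    rw [hs, hs, hs, hs, signedComm_smul_smul, signedComm_smul_smul, hy, sub_eq_iff_eq_add] at H
    rw [H, e]
    simp only [smul_add, mul_smul]
    abel

end BracketForm

/-! ### Leading terms under the evaluation representation. -/

namespace Current

variable {N : ℕ}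

/-- The evaluation representation of the Yangian. -/
def evalHom (N : ℕ) : Yangian N →ₐ[ℂ] Current N :=
  Yangian.lift evalT (fun _ _ => rfl) ternaryRel_evalT evalT_opp

theorem evalHom_gen (x : YangianGen N) :
    evalHom N (Yangian.gen x) = evalGen x.1 x.2.1 x.2.2 := Yangian.lift_T _ _ _ _ _ _ _

/-- The matrices with polynomial entries of degree at most `n`. -/
def degreeLE (n : ℕ) : Submodule ℂ (Current N) where
  carrier := {M | ∀ i j, (M i j).natDegree ≤ n}
  zero_mem' := by simp
  add_mem' h h' i j := (Polynomial.natDegree_add_le _ _).trans (max_le (h i j) (h' i j))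
  smul_mem' c M h i j := (Polynomial.natDegree_smul_le _ _).trans (h i j)

theorem twistedF_mem_degreeLE (i j : Idx N) (n : ℕ) : (twistedF i j n : Current N) ∈ degreeLE n := by
  refine add_mem (fun k l => ?_) (fun k l => ?_)
  · rw [Matrix.single_apply]
    split_ifs <;> simp
  · rw [Matrix.single_apply]
    split_ifs
    · refine Polynomial.natDegree_pow_le.trans ?_
      simp
    · simp

theorem evalGen_mem_degreeLE (i j : Idx N) (n : ℕ) : (evalGen i j n : Current N) ∈ degreeLE n :=
  neg_mem (SuperAlgebra.units_smul_mem _ _ (twistedF_mem_degreeLE j i n))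

/-- The evaluation representation takes the filtration that governs powers of `h` to the filtration
by the degree in `u`. -/
theorem evalHom_mem_degreeLE {n : ℕ} {y : Yangian N}
    (hy : y ∈ wordFil ℂ Yangian.gen YangianH.hDegree n) : evalHom N y ∈ degreeLE n := by
  refine wordFil_le_comap (evalHom N) degreeLE ?_ ?_ ?_ ?_ n hy
  · exact fun m n h M hM i j => (hM i j).trans h
  · intro i j
    rw [Matrix.one_apply]
    split_ifs <;> simp
  · intro m n x hx y hy i j
    rw [Matrix.mul_apply]
    exact Polynomial.natDegree_sum_le_of_forall_le _ _ fun k _ =>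
      Polynomial.natDegree_mul_le.trans (add_le_add (hx i k) (hy k j))
  · intro x
    rw [evalHom_gen]
    exact evalGen_mem_degreeLE _ _ _

/-- The coefficients of the entries of a matrix. -/
def coeffs (N : ℕ) : Current N →ₗ[ℂ] Idx N → Idx N → ℕ → ℂ where
  toFun M i j n := (M i j).coeff n
  map_add' M M' := by ext; simp
  map_smul' c M := by ext; simp

theorem coeffs_injective : Function.Injective (coeffs N) := fun M M' h =>
  Matrix.ext fun i j => Polynomial.ext fun n => congrFun (congrFun (congrFun h i) j) n

/-- The map sending `h ^ n ⊗ y` to the coefficients of `u ^ n` in the image of `y`. -/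
def detectHat (N : ℕ) : ℂ⟦X⟧ ⊗[ℂ] Yangian N →ₗ[ℂ] Idx N → Idx N → ℕ → ℂ :=
  TensorProduct.lift (LinearMap.mk₂ ℂ
    (fun f y i j n => PowerSeries.coeff n f * coeffs N (evalHom N y) i j n)
    (fun f f' y => by ext; simp [add_mul]) (fun c f y => by ext; simp [mul_assoc])
    (fun f y y' => by ext; simp [mul_add]) (fun c f y => by ext; simp [mul_left_comm]))

theorem detectHat_tmul (f : ℂ⟦X⟧) (y : Yangian N) (i j : Idx N) (n : ℕ) :
    detectHat N (f ⊗ₜ y) i j n = PowerSeries.coeff n f * coeffs N (evalHom N y) i j n := rfl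

/-- For `y` in the `m`-th piece, the image of `y` has degree at most `m` in `u`, whereas `f X^m`
starts in degree `m`. Only the coefficient of index `m` survives the pairing, and there `f` acts by
its constant term. Hence multiples of `h` are killed. -/
theorem detectHat_smul (f : ℂ⟦X⟧) {z : ℂ⟦X⟧ ⊗[ℂ] Yangian N}
    (hz : z ∈ rees (wordFil ℂ Yangian.gen YangianH.hDegree)) :
    detectHat N (f • z) = PowerSeries.constantCoeff f • detectHat N z := by
  induction hz using Submodule.span_induction generalizing f with
  | zero => simp
  | add x y _ _ hx hy => rw [smul_add, map_add, map_add, hx, hy, smul_add]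
  | smul g x _ hx => rw [smul_smul, hx, hx, map_mul, mul_smul]
  | mem x hx =>
    obtain ⟨m, y, hy, rfl⟩ := hx
    funext i j n
    rw [TensorProduct.smul_tmul', smul_eq_mul]
    change detectHat N _ i j n = PowerSeries.constantCoeff f * detectHat N _ i j n
    rw [detectHat_tmul, detectHat_tmul, PowerSeries.coeff_mul_X_pow', PowerSeries.coeff_X_pow]
    rcases lt_trichotomy m n with h | rfl | h
    · have := Polynomial.coeff_eq_zero_of_natDegree_lt
        ((evalHom_mem_degreeLE hy i j).trans_lt h)
      rw [show coeffs N (evalHom N y) i j n = 0 from this, mul_zero, mul_zero, mul_zero]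
    · rw [if_pos le_rfl, if_pos rfl, Nat.sub_self, one_mul, PowerSeries.coeff_zero_eq_constantCoeff]
    · rw [if_neg (by omega), if_neg (by omega), zero_mul, mul_zero]

end Current

/-! ### Leading terms and scaled relations in the deformed algebra. -/

namespace YangianH

variable {N : ℕ}

/-- The entries of `evalGen i j n` are multiples of `u^n`, so pairing with the coefficient of `h^n`
loses nothing. This map shows that no linear relation among the generators arises modulo `h` beyond
those in `𝔤`. -/
theorem exists_detect (N : ℕ) :
    ∃ L : YangianH N →ₛₗ[(PowerSeries.constantCoeff : ℂ⟦X⟧ →+* ℂ)] Idx N → Idx N → ℕ → ℂ,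
      ∀ i j n, L (gen i j n) = Current.coeffs N (Current.evalGen i j n) := by
  have hmem : ∀ x : YangianH N,
      (x : ℂ⟦X⟧ ⊗[ℂ] Yangian N) ∈ rees (wordFil ℂ Yangian.gen hDegree) := fun x => by
    rw [← toSubmodule_eq_rees]
    exact x.2
  refine ⟨⟨⟨fun x => Current.detectHat N x, fun x y => map_add _ _ _⟩, fun f x =>
    Current.detectHat_smul f (hmem x)⟩, fun i j n => ?_⟩
  change Current.detectHat N ((PowerSeries.X ^ n : ℂ⟦X⟧) ⊗ₜ Yangian.T i j (n + 1)) = _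
  funext k l m
  rw [Current.detectHat_tmul, PowerSeries.coeff_X_pow]
  change _ * Current.coeffs N (Current.evalHom N (Yangian.gen (i, j, n))) k l m = _
  rw [Current.evalHom_gen]
  split_ifs with h
  · rw [one_mul]
  · have e : ∀ (c : ℂ[X]) (a : ℕ), ((-1 : ℤˣ) ^ j.2 • c).coeff a = (-1 : ℤˣ) ^ j.2 • c.coeff a :=
      fun c a => map_units_smul (Polynomial.lcoeff ℂ a) _ c
    have t : ((Current.evalGen i j n : Current N) k l).coeff m = 0 := by
      change (-((-1 : ℤˣ) ^ j.2 • (twistedF j i n : Current N) k l)).coeff m = 0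
      rw [Polynomial.coeff_neg, e]
      simp only [twistedF, Matrix.add_apply, Matrix.single_apply, Polynomial.coeff_add,
        Current.neg_X_pow, apply_ite (fun c : ℂ[X] => c.coeff m), Polynomial.coeff_zero]
      have e' := map_units_smul (Polynomial.lcoeff ℂ m) ((-1 : ℤˣ) ^ n) (Polynomial.X ^ n : ℂ[X])
      simp only [Polynomial.lcoeff_apply] at e'
      rw [e', Polynomial.coeff_X_pow, if_neg h]
      simp
    rw [zero_mul]
    exact t.symm

theorem gen_opp (i j : Idx N) (n : ℕ) :
    gen (opp i) (opp j) n = (-1 : ℤˣ) ^ (n + 1) • gen i j n := by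
  refine Subtype.ext (Eq.trans ?_ (map_units_smul (val N) _ (gen i j n)).symm)
  change (PowerSeries.X ^ n : ℂ⟦X⟧) ⊗ₜ[ℂ] Yangian.T (opp i) (opp j) (n + 1) =
    _ • (PowerSeries.X ^ n : ℂ⟦X⟧) ⊗ₜ[ℂ] Yangian.T i j (n + 1)
  rw [Yangian.T_opp, tmul_units_smul]

theorem val_extendZero (i j : Idx N) (p : ℤ) :
    val N (extendZero (scaled (PowerSeries.X : ℂ⟦X⟧) gen i j) p) =
      (PowerSeries.X ^ p.toNat : ℂ⟦X⟧) ⊗ₜ[ℂ] extendZero (Yangian.T i j) p := by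
  cases p with
  | ofNat n => exact val_scaled i j n
  | negSucc n => exact (TensorProduct.tmul_zero _ _).symm

/-- The scaled ternary relation in `ℂ⟦h⟧ ⊗ Y`. -/
theorem scaledRel_tmul {A : Type*} [Ring A] [Algebra ℂ A] {t : Idx N → Idx N → ℤ → A}
    (ht : TernaryRel t) (hneg : ∀ i j p, p < 0 → t i j p = 0) :
    ScaledRel (PowerSeries.X : ℂ⟦X⟧)
      (fun i j p => (PowerSeries.X ^ p.toNat : ℂ⟦X⟧) ⊗ₜ[ℂ] t i j p) := by
  intro i j k l p q hp hq
  -- The relation is multiplied by `h^(p+q+2)`. Products on the left have total index `p + q + 2`;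
  -- those on the right have `p + q + 1`, and this difference is the factor `h` of the scaled
  -- relation.
  have H := congrArg (fun y : A => (PowerSeries.X ^ (p + q + 2).toNat : ℂ⟦X⟧) ⊗ₜ[ℂ] y)
    (ht i j k l p q)
  have e : ∀ (p' q' : ℤ) (x y : A), 0 ≤ p' → 0 ≤ q' → p' + q' = p + q + 2 →
      ((PowerSeries.X ^ p'.toNat : ℂ⟦X⟧) ⊗ₜ[ℂ] x) * ((PowerSeries.X ^ q'.toNat : ℂ⟦X⟧) ⊗ₜ[ℂ] y) =
      (PowerSeries.X ^ (p + q + 2).toNat : ℂ⟦X⟧) ⊗ₜ[ℂ] (x * y) := by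
    intro p' q' x y h h' e
    rw [Algebra.TensorProduct.tmul_mul_tmul, ← pow_add, ← e]
    congr 2
    omega
  have e' : ∀ (p' q' : ℤ) (x y : A), 0 ≤ p' → 0 ≤ q' → p' + q' = p + q + 1 →
      (PowerSeries.X : ℂ⟦X⟧) • (((PowerSeries.X ^ p'.toNat : ℂ⟦X⟧) ⊗ₜ[ℂ] x) *
        ((PowerSeries.X ^ q'.toNat : ℂ⟦X⟧) ⊗ₜ[ℂ] y)) =
      (PowerSeries.X ^ (p + q + 2).toNat : ℂ⟦X⟧) ⊗ₜ[ℂ] (x * y) := by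
    intro p' q' x y h h' e
    rw [Algebra.TensorProduct.tmul_mul_tmul, ← pow_add, TensorProduct.smul_tmul', smul_eq_mul,
      ← pow_succ']
    congr 2
    omega
  have el : ∀ (p' q' : ℤ) (x y : A), 0 ≤ p' → 0 ≤ q' → p' + q' = p + q + 2 →
      signedComm i j k l ((PowerSeries.X ^ p'.toNat : ℂ⟦X⟧) ⊗ₜ[ℂ] x)
        ((PowerSeries.X ^ q'.toNat : ℂ⟦X⟧) ⊗ₜ[ℂ] y) =
      (PowerSeries.X ^ (p + q + 2).toNat : ℂ⟦X⟧) ⊗ₜ[ℂ] signedComm i j k l x y := by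
    intro p' q' x y h h' e''
    rw [signedComm, e _ _ _ _ h h' e'', e _ _ _ _ h' h (by omega), signedComm, tmul_units_smul,
      TensorProduct.tmul_sub, tmul_units_smul]
  dsimp only
  rw [el _ _ _ _ (by omega) hq (by omega)]
  -- For `p = -1` the truncation in `toNat` does no harm, since coefficients of negative index
  -- vanish.
  rcases lt_or_ge p 0 with h | h
  · obtain rfl : p = -1 := by omega
    simp only [hneg _ _ (-1) h, zero_mul, mul_zero, sub_zero, add_zero, smul_zero,
      TensorProduct.tmul_zero] at H ⊢
    simp only [signedComm, ternaryRhs, hneg _ _ (-1) h, zero_mul, mul_zero, sub_zero, add_zero,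
      smul_zero, TensorProduct.tmul_zero, smul_sub, smul_comm (PowerSeries.X : ℂ⟦X⟧) (_ : ℤˣ)]
    simp only [e' _ _ _ _ (le_refl (-1 + 1)) hq (by omega),
      e' _ _ _ _ hq (le_refl (-1 + 1)) (by omega)]
    rw [← smul_sub, H]
    simp only [TensorProduct.tmul_sub, tmul_units_smul, smul_sub]
  · rw [el _ _ _ _ h (by omega) (by omega), ← TensorProduct.tmul_sub, signedComm, signedComm,
      ← smul_sub, H]
    simp only [ternaryRhs, smul_sub, smul_add, smul_comm (PowerSeries.X : ℂ⟦X⟧) (_ : ℤˣ),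
      e' (p + 1) q _ _ (by omega) hq (by omega), e' q (p + 1) _ _ hq (by omega) (by omega),
      e' p (q + 1) _ _ h (by omega) (by omega), e' (q + 1) p _ _ (by omega) h (by omega),
      TensorProduct.tmul_sub, TensorProduct.tmul_add, tmul_units_smul]

theorem scaledRel : ScaledRel (PowerSeries.X : ℂ⟦X⟧)
    (fun i j => extendZero (scaled (PowerSeries.X : ℂ⟦X⟧) (gen (N := N)) i j)) := by
  refine ScaledRel.of_injective (val N) Subtype.val_injective ?_
  simp only [val_extendZero]
  exact scaledRel_tmul Yangian.ternaryRel fun i j p hp => extendZero_of_neg _ hp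

end YangianH

/-! ### The cobracket of a deformation -/

/-- The properties of the Hopf superalgebra `Y(𝔮_N, h)` and its generators. -/
structure IsDeformedCurrent {Y : Type*} [Ring Y] [Algebra ℂ⟦X⟧ Y] [SuperAlgebra ℂ⟦X⟧ Y] {N : ℕ}
    (H : HopfSuperalgebra ℂ⟦X⟧ Y) (g : Idx N → Idx N → ℕ → Y) : Prop where
  free : Module.Free ℂ⟦X⟧ Y
  gen_mem_degree : ∀ i j n, g i j n ∈ degree ℂ⟦X⟧ Y (i.2 + j.2)
  adjoin : Algebra.adjoin ℂ⟦X⟧ (Set.range fun x : YangianGen N => g x.1 x.2.1 x.2.2) = ⊤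
  comul_gen : ∀ i j n, H.comul (g i j n) = comulGen (PowerSeries.X : ℂ⟦X⟧) g i j n
  counit_gen : ∀ i j n, H.counit (g i j n) = 0
  gen_opp : ∀ i j n, g (opp i) (opp j) n = (-1 : ℤˣ) ^ (n + 1) • g i j n
  comm : ∀ i j k l a b, ∃ y, signedComm i j k l (g i j a) (g k l b) =
    bracketForm g i j k l a b + (PowerSeries.X : ℂ⟦X⟧) • y
  detect : ∃ L : Y →ₛₗ[(PowerSeries.constantCoeff : ℂ⟦X⟧ →+* ℂ)] Idx N → Idx N → ℕ → ℂ,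
    ∀ i j n, L (g i j n) = Current.coeffs N (Current.evalGen i j n)

namespace YangianH

/-- The classical limit and its co-Poisson structure are derived from these properties alone,
without returning to the Yangian. -/
theorem exists_isDeformedCurrent (N : ℕ) : ∃ H : HopfSuperalgebra ℂ⟦X⟧ (YangianH N),
    IsLinearExtension (Yangian.hopf N) H ∧ IsDeformedCurrent H (gen (N := N)) := by
  obtain ⟨H, h, hΔ, hε⟩ := exists_hopf N
  exact ⟨H, h, free, gen_mem_degree, adjoin_gen, hΔ, hε, gen_opp,
    signedComm_gen_modEq (isSMulRegular_X (YangianH N)) scaledRel, exists_detect N⟩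

end YangianH

/-! ### Divisibility of cocommutators of products. -/

namespace HopfSuperalgebra

section

variable {R A : Type*} [CommRing R] [Algebra ℚ R] [Ring A] [Algebra R A] [SuperAlgebra R A]
  (H : HopfSuperalgebra R A)

theorem toSq_flip_comul_mul (x y : A) : toSq R A (flip R A (H.comul (x * y))) =
    toSq R A (flip R A (H.comul x)) * toSq R A (flip R A (H.comul y)) := by
  have h := toSq_flip_mul (H.comulHom x) (H.comulHom y)
  rw [← map_mul, ← H.toSq_comul, ← H.toSq_comul, ← H.toSq_comul] at h
  simpa only [LinearEquiv.symm_apply_apply] using h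

/-- The quotient by `h` of the cocommutator of a product. -/
theorem smul_eq_cocomm_mul {h : R} {x y : A} {D E : A ⊗[R] A} (hD : h • D = cocomm H.comul x)
    (hE : h • E = cocomm H.comul y) :
    h • (toSq R A).symm (toSq R A D * H.comulHom y + toSq R A (flip R A (H.comul x)) * toSq R A E) =
      cocomm H.comul (x * y) := by
  apply (toSq R A).injective
  rw [map_smul, LinearEquiv.apply_symm_apply, smul_add, ← smul_mul_assoc, ← mul_smul_comm,
    ← map_smul, ← map_smul, hD, hE, cocomm_apply, cocomm_apply, cocomm_apply, map_sub, map_sub,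
    map_sub, toSq_flip_comul_mul, H.toSq_comul, H.toSq_comul, H.toSq_comul, map_mul]
  noncomm_ring

end

end HopfSuperalgebra

namespace IsDeformedCurrent

variable {Y : Type*} [Ring Y] [Algebra ℂ⟦X⟧ Y] [SuperAlgebra ℂ⟦X⟧ Y] {N : ℕ}
  {H : HopfSuperalgebra ℂ⟦X⟧ Y} {g : Idx N → Idx N → ℕ → Y}

theorem regular (hY : IsDeformedCurrent H g) : IsSMulRegular (Y ⊗[ℂ⟦X⟧] Y) (PowerSeries.X : ℂ⟦X⟧) :=
  haveI := hY.free
  isSMulRegular_X (Y ⊗[ℂ⟦X⟧] Y)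

theorem regular₃ (hY : IsDeformedCurrent H g) :
    IsSMulRegular (Y ⊗[ℂ⟦X⟧] (Y ⊗[ℂ⟦X⟧] Y)) (PowerSeries.X : ℂ⟦X⟧) :=
  haveI := hY.free
  isSMulRegular_X (Y ⊗[ℂ⟦X⟧] (Y ⊗[ℂ⟦X⟧] Y))

/-- The part `g ⊗ 1 + 1 ⊗ g` is invariant under the flip, and the rest of the comultiplication is a
multiple of `h`. -/
theorem smul_eq_cocomm_gen (hY : IsDeformedCurrent H g) (i j : Idx N) (n : ℕ) :
    (PowerSeries.X : ℂ⟦X⟧) • (comulRest ℂ⟦X⟧ g i j n - flip ℂ⟦X⟧ Y (comulRest ℂ⟦X⟧ g i j n)) =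
      cocomm H.comul (g i j n) := by
  rw [cocomm_apply, hY.comul_gen, comulGen, map_add, map_add, map_smul,
    flip_tmul (hY.gen_mem_degree i j n) one_mem_degree, flip_tmul one_mem_degree (hY.gen_mem_degree i j n),
    zero_mul, mul_zero, uzpow_zero, one_smul, one_smul, smul_sub]
  abel

theorem exists_smul_eq_cocomm (hY : IsDeformedCurrent H g) (x : Y) :
    ∃ D, (PowerSeries.X : ℂ⟦X⟧) • D = cocomm H.comul x := by
  have hx : x ∈ Algebra.adjoin ℂ⟦X⟧ (Set.range fun x : YangianGen N => g x.1 x.2.1 x.2.2) := by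
    rw [hY.adjoin]; trivial
  induction hx using Algebra.adjoin_induction with
  | mem x hx =>
    obtain ⟨x, rfl⟩ := hx
    exact ⟨_, hY.smul_eq_cocomm_gen _ _ _⟩
  | algebraMap r =>
    refine ⟨0, ?_⟩
    have h1 : H.comul 1 = 1 ⊗ₜ 1 := (toSq ℂ⟦X⟧ Y).injective (by
      rw [H.toSq_comul, map_one]; rfl)
    rw [Algebra.algebraMap_eq_smul_one, map_smul, cocomm_apply, h1,
      flip_tmul one_mem_degree one_mem_degree, zero_mul, uzpow_zero, one_smul, sub_self, smul_zero,
      smul_zero]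
  | add x y _ _ hx hy =>
    obtain ⟨D, hD⟩ := hx
    obtain ⟨E, hE⟩ := hy
    exact ⟨D + E, by rw [smul_add, hD, hE, map_add]⟩
  | mul x y _ _ hx hy =>
    obtain ⟨D, hD⟩ := hx
    obtain ⟨E, hE⟩ := hy
    exact ⟨_, H.smul_eq_cocomm_mul hD hE⟩

/-- The quotient by `h` of the cocommutator. -/
def cobracket (hY : IsDeformedCurrent H g) : Y →ₗ[ℂ⟦X⟧] Y ⊗[ℂ⟦X⟧] Y where
  toFun x := (hY.exists_smul_eq_cocomm x).choose
  map_add' x y := hY.regular <| by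
    dsimp only
    rw [smul_add, (hY.exists_smul_eq_cocomm x).choose_spec,
      (hY.exists_smul_eq_cocomm y).choose_spec, (hY.exists_smul_eq_cocomm (x + y)).choose_spec,
      map_add]
  map_smul' r x := hY.regular <| by
    dsimp only
    rw [RingHom.id_apply, smul_comm _ r, (hY.exists_smul_eq_cocomm x).choose_spec,
      (hY.exists_smul_eq_cocomm (r • x)).choose_spec, map_smul]

theorem X_smul_cobracket (hY : IsDeformedCurrent H g) (x : Y) :
    (PowerSeries.X : ℂ⟦X⟧) • hY.cobracket x = cocomm H.comul x :=
  (hY.exists_smul_eq_cocomm x).choose_spec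

theorem cobracket_gen (hY : IsDeformedCurrent H g) (i j : Idx N) (n : ℕ) :
    hY.cobracket (g i j n) =
      comulRest ℂ⟦X⟧ g i j n - flip ℂ⟦X⟧ Y (comulRest ℂ⟦X⟧ g i j n) :=
  hY.regular ((hY.X_smul_cobracket _).trans (hY.smul_eq_cocomm_gen i j n).symm)

/-- The rule is asymmetric: `Δ°` occurs in the second term. It becomes the derivation rule only
modulo `h`, where `Δ°` and `Δ` coincide. -/
theorem cobracket_mul (hY : IsDeformedCurrent H g) (x y : Y) :
    toSq ℂ⟦X⟧ Y (hY.cobracket (x * y)) = toSq ℂ⟦X⟧ Y (hY.cobracket x) * H.comulHom y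
      + toSq ℂ⟦X⟧ Y (flip ℂ⟦X⟧ Y (H.comul x)) * toSq ℂ⟦X⟧ Y (hY.cobracket y) := by
  rw [← LinearEquiv.eq_symm_apply]
  exact hY.regular ((hY.X_smul_cobracket _).trans (H.smul_eq_cocomm_mul (hY.X_smul_cobracket x)
    (hY.X_smul_cobracket y)).symm)

theorem flip_cobracket (hY : IsDeformedCurrent H g) (x : Y) :
    flip ℂ⟦X⟧ Y (hY.cobracket x) = -hY.cobracket x := by
  refine hY.regular ?_
  dsimp only
  rw [smul_neg, ← map_smul, hY.X_smul_cobracket, flip_cocomm]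

theorem cobracket_parity (hY : IsDeformedCurrent H g) (x : Y) :
    hY.cobracket (parity (R := ℂ⟦X⟧) x) = TensorProduct.map (parity (R := ℂ⟦X⟧)).toLinearMap
      (parity (R := ℂ⟦X⟧)).toLinearMap (hY.cobracket x) := by
  refine hY.regular ?_
  dsimp only
  rw [hY.X_smul_cobracket, ← LinearMap.map_smul, hY.X_smul_cobracket, cocomm_apply, cocomm_apply,
    H.comul_parity, map_sub]
  congr 1
  exact flip_map _ (fun _ => rfl) _

theorem cobracket_jacobi (hY : IsDeformedCurrent H g) (a : Y) :
    hY.cobracket.lTensor Y (hY.cobracket a)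
      + flip₂₃ ℂ⟦X⟧ Y (flip₁₂ ℂ⟦X⟧ Y (hY.cobracket.lTensor Y (hY.cobracket a)))
      + flip₂₃ ℂ⟦X⟧ Y (flip₁₂ ℂ⟦X⟧ Y (flip₂₃ ℂ⟦X⟧ Y (flip₁₂ ℂ⟦X⟧ Y
        (hY.cobracket.lTensor Y (hY.cobracket a))))) = 0 := by
  have e : cocomm H.comul = (PowerSeries.X : ℂ⟦X⟧) • hY.cobracket :=
    LinearMap.ext fun x => (hY.X_smul_cobracket x).symm
  have h := cocomm_jacobi H.comul_parity H.coassoc a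
  rw [e] at h
  simp only [LinearMap.lTensor_smul, LinearMap.smul_apply, map_smul, ← smul_add] at h
  have h0 : ∀ t : Y ⊗[ℂ⟦X⟧] (Y ⊗[ℂ⟦X⟧] Y), (PowerSeries.X : ℂ⟦X⟧) • t = 0 → t = 0 := fun t ht =>
    hY.regular₃ (ht.trans (smul_zero _).symm)
  -- The co-Jacobi identity is quadratic in the cocommutator, so two factors `h` are cancelled.
  exact h0 _ (h0 _ h)

theorem cobracket_leibniz (hY : IsDeformedCurrent H g) (a : Y) :
    H.comul.lTensor Y (hY.cobracket a) =
      TensorProduct.assoc ℂ⟦X⟧ Y Y Y (hY.cobracket.rTensor Y (H.comul a))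
        + flip₁₂ ℂ⟦X⟧ Y (hY.cobracket.lTensor Y (H.comul a)) := by
  have e : cocomm H.comul = (PowerSeries.X : ℂ⟦X⟧) • hY.cobracket :=
    LinearMap.ext fun x => (hY.X_smul_cobracket x).symm
  have h := cocomm_leibniz H.comul_parity H.coassoc a
  rw [e] at h
  simp only [LinearMap.lTensor_smul, LinearMap.rTensor_smul, LinearMap.smul_apply, map_smul,
    ← smul_add] at h
  exact hY.regular₃ h

end IsDeformedCurrent

/-! ### Coalgebra maps out of a primitively generated superbialgebra -/

namespace SuperAlgebra

section Twist

variable {R A : Type*} [CommRing R] [Algebra ℚ R] [Ring A] [Algebra R A] [SuperAlgebra R A]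

variable (R A) in
/-- The automorphism `a ↦ (-1) ^ (d deg a) a`. -/
def twist (d : ZMod 2) : A →ₐ[R] A := if d = 0 then AlgHom.id R A else parity

theorem twist_of_mem {d i : ZMod 2} {a : A} (ha : a ∈ degree R A i) :
    twist R A d a = (-1 : ℤˣ) ^ (d * i) • a := by
  rcases zmod_two_cases d with rfl | rfl
  · simp [twist]
  · rw [twist, if_neg one_ne_zero, mem_degree.1 ha, one_mul]

theorem tmul_one_mul (c : A) (t : A ⊗[R] A) :
    toSq R A (c ⊗ₜ 1) * toSq R A t = toSq R A ((LinearMap.mulLeft R c).rTensor A t) := by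
  induction t using homogeneous_tmul_induction with
  | zero => simp
  | add x y hx hy => rw [map_add, map_add, map_add, mul_add, hx, hy]
  | tmul i j a ha b hb =>
    rw [toST_mul c one_mem_degree ha, zero_mul, uzpow_zero, one_smul, one_mul]
    rfl

theorem one_tmul_mul {d : ZMod 2} {c : A} (hc : c ∈ degree R A d) (t : A ⊗[R] A) :
    toSq R A (1 ⊗ₜ c) * toSq R A t =
      toSq R A (TensorProduct.map (twist R A d).toLinearMap (LinearMap.mulLeft R c) t) := by
  induction t using homogeneous_tmul_induction with
  | zero => simp
  | add x y hx hy => rw [map_add, map_add, map_add, mul_add, hx, hy]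
  | tmul i j a ha b hb =>
    rw [toST_mul 1 hc ha, TensorProduct.map_tmul, AlgHom.toLinearMap_apply, twist_of_mem ha,
      units_smul_tmul, map_units_smul, one_mul]
    rfl

variable (R) in
/-- The supercommutator with an element `c` of degree `d`. -/
def superAd (d : ZMod 2) (c : A) : A →ₗ[R] A :=
  LinearMap.mulLeft R c - LinearMap.mulRight R c ∘ₗ (twist R A d).toLinearMap

theorem superAd_apply (d : ZMod 2) (c a : A) : superAd R d c a = c * a - twist R A d a * c := rfl

end Twist

section Primitive

variable {K U ι : Type*} [Field K] [Algebra ℚ K] [Ring U] [Algebra K U] [SuperAlgebra K U]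
  {H : Bialg K U} {x : ι → U} {d : ι → ZMod 2}

/-- The generators `x i` of degrees `d i` are primitive, and their supercommutators are linear in
the generators. -/
structure IsPrimitivelyGenerated (H : Bialg K U) (x : ι → U) (d : ι → ZMod 2) : Prop where
  mem_degree : ∀ i, x i ∈ degree K U (d i)
  adjoin : Algebra.adjoin K (Set.range x) = ⊤
  comul : ∀ i, H.comul (x i) = x i ⊗ₜ 1 + 1 ⊗ₜ x i
  comm : ∀ i j, x i * x j - (-1 : ℤˣ) ^ (d i * d j) • (x j * x i) ∈ wordFil K x (fun _ => 1) 1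

namespace IsPrimitivelyGenerated

theorem isFil (h : IsPrimitivelyGenerated H x d) : IsFil (wordFil K x (fun _ => 1)) :=
  isFil_wordFil h.adjoin fun i => ⟨_, SuperAlgebra.mem_degree.1 (h.mem_degree i)⟩

theorem comulHom_gen (h : IsPrimitivelyGenerated H x d) (i : ι) :
    H.comulHom (x i) = toSq K U (x i ⊗ₜ 1) + toSq K U (1 ⊗ₜ x i) := by
  rw [← H.toSq_comul, h.comul, map_add]

theorem comulHom_mem (h : IsPrimitivelyGenerated H x d) {n : ℕ} {a : U}
    (ha : a ∈ wordFil K x (fun _ => 1) n) :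
    H.comulHom a ∈ tensorFil (wordFil K x (fun _ => 1)) n := by
  refine comulHom_mem_tensorFil h.isFil H.comulHom (fun i => ?_) n ha
  have hi : x i ∈ wordFil K x (fun _ => 1) 1 := gen_mem_wordFil (w := fun _ => 1) i
  rw [h.comulHom_gen]
  exact add_mem (tmul_mem_tensorFil (p := 1) (q := 0) le_rfl hi (one_mem_wordFil 0))
    (tmul_mem_tensorFil (p := 0) (q := 1) le_rfl (one_mem_wordFil 0) hi)

/-- The supercommutator with a generator is a superderivation that sends generators into the first
piece, so it does not raise the filtration. -/
theorem superAd_mem (h : IsPrimitivelyGenerated H x d) (i : ι) {n : ℕ} {a : U}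
    (ha : a ∈ wordFil K x (fun _ => 1) n) :
    superAd K (d i) (x i) a ∈ wordFil K x (fun _ => 1) n := by
  have h' : wordFil K x (fun _ => 1) n ≤
      (wordFil K x (fun _ => 1) n).comap (superAd K (d i) (x i)) := by
    refine Submodule.span_le.2 ?_
    rintro _ ⟨l, hl, rfl⟩
    refine wordFil_mono hl ?_
    clear hl ha
    induction l with
    | nil => simp [superAd_apply]
    | cons j l ih =>
      rw [List.map_cons (f := x), List.prod_cons, List.map_cons, List.sum_cons]
      have e : superAd K (d i) (x i) (x j * (l.map x).prod) =
          (x i * x j - (-1 : ℤˣ) ^ (d i * d j) • (x j * x i)) * (l.map x).prod +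
            (-1 : ℤˣ) ^ (d i * d j) • (x j * superAd K (d i) (x i) (l.map x).prod) := by
        rw [superAd_apply, superAd_apply, map_mul, twist_of_mem (h.mem_degree j), mul_sub, smul_sub,
          sub_mul, units_smul_mul, units_smul_mul, units_smul_mul]
        simp only [mul_assoc]
        abel
      rw [e]
      exact add_mem (mul_mem_wordFil (h.comm i j) (list_prod_mem_wordFil (w := fun _ => 1) l))
        (units_smul_mem _ _ (mul_mem_wordFil (gen_mem_wordFil (w := fun _ => 1) j) ih))
  exact h' ha

/-- Pulling `x i` out in front of the product differs from leaving it between the two factors by a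
supercommutator, which has filtration `n` rather than `n + 1`. -/
theorem mul'_one_tmul_mul (h : IsPrimitivelyGenerated H x d) (i : ι) {n : ℕ} {t : U ⊗[K] U}
    (ht : toSq K U t ∈ tensorFil (wordFil K x (fun _ => 1)) n) :
    LinearMap.mul' K U ((toSq K U).symm (toSq K U (1 ⊗ₜ x i) * toSq K U t)) -
      x i * LinearMap.mul' K U t ∈ wordFil K x (fun _ => 1) n := by
  rw [one_tmul_mul (h.mem_degree i), LinearEquiv.symm_apply_apply]
  have key : tensorFil (wordFil K x (fun _ => 1)) n ≤ (wordFil K x (fun _ => 1) n).comap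
      ((LinearMap.mul' K U ∘ₗ TensorProduct.map (twist K U (d i)).toLinearMap
        (LinearMap.mulLeft K (x i)) - LinearMap.mulLeft K (x i) ∘ₗ LinearMap.mul' K U) ∘ₗ
          (toSq K U).symm.toLinearMap) := by
    refine Submodule.span_le.2 ?_
    rintro _ ⟨p, q, hpq, a, ha, b, hb, rfl⟩
    have e : twist K U (d i) a * (x i * b) - x i * (a * b) = -(superAd K (d i) (x i) a * b) := by
      rw [superAd_apply]
      noncomm_ring
    refine wordFil_mono hpq ?_
    change twist K U (d i) a * (x i * b) - x i * (a * b) ∈ _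
    rw [e]
    exact neg_mem (mul_mem_wordFil (h.superAd_mem i ha) hb)
  exact key ht

/-- Each letter is primitive and goes to the left or to the right factor, which makes `2^length`
terms. Up to supercommutators, hence up to shorter words, all of them multiply back to the original
word. -/
theorem mul'_comul_list_prod (h : IsPrimitivelyGenerated H x d) (l : List ι) :
    LinearMap.mul' K U (H.comul (l.map x).prod) - (2 : K) ^ l.length • (l.map x).prod ∈
      wordFil K x (fun _ => 1) (l.length - 1) := by
  induction l with
  | nil =>
    have e : H.comul (1 : U) = 1 ⊗ₜ 1 := (toSq K U).injective (by
      rw [H.toSq_comul, map_one]; rfl)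
    simp [e]
  | cons i l ih =>
    rw [List.map_cons, List.prod_cons, List.length_cons, Nat.add_sub_cancel]
    -- A word of one letter is treated apart: for the empty tail the truncated index is `0` instead
    -- of `-1`, and the induction hypothesis would be too weak.
    rcases Nat.eq_zero_or_pos l.length with hl | hl
    · rw [List.eq_nil_of_length_eq_zero hl]
      have : LinearMap.mul' K U (H.comul (x i)) = (2 : K) • x i := by
        rw [h.comul, map_add, LinearMap.mul'_apply, LinearMap.mul'_apply, mul_one, one_mul, two_smul]
      simp [this]
    · have hl' : ∀ l : List ι, (l.map fun _ => 1).sum = l.length := fun l => by simp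
      have hy : (l.map x).prod ∈ wordFil K x (fun _ => 1) l.length := by
        have := list_prod_mem_wordFil (R := K) (x := x) (w := fun _ => 1) l
        rwa [hl'] at this
      have e : LinearMap.mul' K U (H.comul (x i * (l.map x).prod)) =
          x i * LinearMap.mul' K U (H.comul (l.map x).prod) +
          LinearMap.mul' K U ((toSq K U).symm
            (toSq K U (1 ⊗ₜ x i) * toSq K U (H.comul (l.map x).prod))) := by
        have e1 : H.comul (x i * (l.map x).prod) = (toSq K U).symm
            (toSq K U (x i ⊗ₜ 1) * toSq K U (H.comul (l.map x).prod)) + (toSq K U).symm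
            (toSq K U (1 ⊗ₜ x i) * toSq K U (H.comul (l.map x).prod)) := by
          rw [← map_add, ← add_mul, LinearEquiv.eq_symm_apply, H.toSq_comul, map_mul,
            h.comulHom_gen, H.toSq_comul]
        rw [e1, map_add, tmul_one_mul, LinearEquiv.symm_apply_apply]
        congr 1
        generalize H.comul (l.map x).prod = t
        induction t with
        | zero => simp
        | add s t hs ht => rw [map_add, map_add, hs, ht, map_add, mul_add]
        | tmul a b => exact mul_assoc _ _ _
      have h1 := h.mul'_one_tmul_mul i (t := H.comul (l.map x).prod) (h.comulHom_mem hy)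
      have h2 := mul_mem_wordFil (gen_mem_wordFil (R := K) (x := x) (w := fun _ => 1) i) ih
      rw [Nat.add_sub_cancel' hl] at h2
      have h3 := add_mem h1 (Submodule.smul_mem _ (2 : K) h2)
      rw [e]
      convert h3 using 1
      rw [mul_sub, mul_smul_comm, smul_sub, smul_smul, pow_succ', two_smul]
      abel

theorem mul'_comul (h : IsPrimitivelyGenerated H x d) {n : ℕ} {a : U}
    (ha : a ∈ wordFil K x (fun _ => 1) (n + 1)) :
    LinearMap.mul' K U (H.comul a) - (2 : K) ^ (n + 1) • a ∈ wordFil K x (fun _ => 1) n := by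
  have key : wordFil K x (fun _ => 1) (n + 1) ≤ (wordFil K x (fun _ => 1) n).comap
      (LinearMap.mul' K U ∘ₗ H.comul - (2 : K) ^ (n + 1) • LinearMap.id) := by
    refine Submodule.span_le.2 ?_
    rintro _ ⟨l, hl, rfl⟩
    have hl' : (l.map fun _ => 1).sum = l.length := by simp
    rw [hl'] at hl
    have hw := h.mul'_comul_list_prod l
    change LinearMap.mul' K U (H.comul (l.map x).prod) - (2 : K) ^ (n + 1) • (l.map x).prod ∈ wordFil K x (fun _ => 1) n
    rcases hl.lt_or_eq with hl | hl
    · have hy : (l.map x).prod ∈ wordFil K x (fun _ => 1) l.length := by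
        have := list_prod_mem_wordFil (R := K) (x := x) (w := fun _ => 1) l
        rwa [hl'] at this
      have hy' := wordFil_mono (Nat.lt_succ_iff.1 hl) hy
      have hw' := wordFil_mono (show l.length - 1 ≤ n by omega) hw
      have := add_mem hw' (Submodule.smul_mem _ ((2 : K) ^ l.length) hy')
      rw [sub_add_cancel] at this
      exact sub_mem this (Submodule.smul_mem _ _ hy')
    · rw [← hl]
      exact wordFil_mono (by omega) hw
  exact key ha

/-- A tensor of total filtration `n + 1` has both factors in the `n`-th piece unless one of them is
a scalar. The counit axioms then force the factors opposite to `1` to agree with `a` up to the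
`n`-th piece. -/
theorem exists_comul_eq (h : IsPrimitivelyGenerated H x d) {n : ℕ} {a : U}
    (ha : a ∈ wordFil K x (fun _ => 1) (n + 1)) :
    ∃ r : wordFil K x (fun _ => 1) n ⊗[K] wordFil K x (fun _ => 1) n,
      H.comul a = a ⊗ₜ 1 + 1 ⊗ₜ a + TensorProduct.map (Submodule.subtype _) (Submodule.subtype _) r := by
  set F := wordFil K x (fun _ => 1)
  have key : ∀ t ∈ tensorFil F (n + 1), ∃ b c : U, ∃ r : F n ⊗[K] F n,
      (toSq K U).symm t = b ⊗ₜ 1 + 1 ⊗ₜ c +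
        TensorProduct.map (F n).subtype (F n).subtype r := by
    intro t ht
    induction ht using Submodule.span_induction with
    | zero => exact ⟨0, 0, 0, by simp⟩
    | add s t _ _ hs ht =>
      obtain ⟨b, c, r, hs⟩ := hs
      obtain ⟨b', c', r', ht⟩ := ht
      refine ⟨b + b', c + c', r + r', ?_⟩
      rw [map_add, hs, ht, TensorProduct.add_tmul, TensorProduct.tmul_add, map_add]
      abel
    | smul k t _ ht =>
      obtain ⟨b, c, r, ht⟩ := ht
      refine ⟨k • b, k • c, k • r, ?_⟩
      rw [map_smul, ht, smul_add, smul_add, map_smul, TensorProduct.smul_tmul',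
        TensorProduct.tmul_smul]
    | mem t ht =>
      obtain ⟨p, q, hpq, a, ha, b, hb, rfl⟩ := ht
      rw [LinearEquiv.symm_apply_apply]
      rcases Nat.eq_zero_or_pos q with rfl | hq
      · obtain ⟨k, rfl⟩ := wordFil_zero (fun _ => le_rfl) hb
        exact ⟨k • a, 0, 0, by
          rw [Algebra.algebraMap_eq_smul_one, TensorProduct.tmul_smul, TensorProduct.smul_tmul']
          simp⟩
      rcases Nat.eq_zero_or_pos p with rfl | hp
      · obtain ⟨k, rfl⟩ := wordFil_zero (fun _ => le_rfl) ha
        exact ⟨0, k • b, 0, by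
          rw [Algebra.algebraMap_eq_smul_one, ← TensorProduct.smul_tmul', TensorProduct.tmul_smul]
          simp⟩
      · exact ⟨0, 0, (⟨a, wordFil_mono (by omega) ha⟩ : F n) ⊗ₜ
          (⟨b, wordFil_mono (by omega) hb⟩ : F n), by simp⟩
  obtain ⟨b, c, r, hr⟩ := key _ (h.comulHom_mem ha)
  have hr' : H.comul a = b ⊗ₜ 1 + 1 ⊗ₜ c +
    TensorProduct.map (F n).subtype (F n).subtype r := hr
  have hε : ∀ k : K, algebraMap K U k ∈ F n := fun k => by
    rw [Algebra.algebraMap_eq_smul_one]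
    exact Submodule.smul_mem _ _ (one_mem_wordFil n)
  have hl : TensorProduct.lid K U (H.counit.toLinearMap.rTensor U
      (TensorProduct.map (F n).subtype (F n).subtype r)) ∈ F n := by
    clear hr hr'
    induction r with
    | zero => simp
    | add s t hs ht => rw [map_add, map_add, map_add]; exact add_mem hs ht
    | tmul s t => exact Submodule.smul_mem _ _ t.2
  have hR : TensorProduct.rid K U (H.counit.toLinearMap.lTensor U
      (TensorProduct.map (F n).subtype (F n).subtype r)) ∈ F n := by
    clear hr hr' hl
    induction r with
    | zero => simp
    | add s t hs ht => rw [map_add, map_add, map_add]; exact add_mem hs ht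
    | tmul s t => exact Submodule.smul_mem _ _ s.2
  have h1 : a - b ∈ F n := by
    have e := congrArg (TensorProduct.rid K U) (H.counit_right a)
    change TensorProduct.rid K U (H.counit.toLinearMap.lTensor U (H.comul a)) = _ at e
    rw [hr', map_add, map_add, map_add, map_add, LinearMap.lTensor_tmul, LinearMap.lTensor_tmul,
      TensorProduct.rid_tmul, TensorProduct.rid_tmul, TensorProduct.rid_tmul,
      AlgHom.toLinearMap_apply, AlgHom.toLinearMap_apply, map_one, one_smul, one_smul] at e
    rw [← e, add_assoc, add_sub_cancel_left, ← Algebra.algebraMap_eq_smul_one]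
    exact add_mem (hε _) hR
  have h2 : a - c ∈ F n := by
    have e := congrArg (TensorProduct.lid K U) (H.counit_left a)
    change TensorProduct.lid K U (H.counit.toLinearMap.rTensor U (H.comul a)) = _ at e
    rw [hr', map_add, map_add, map_add, map_add, LinearMap.rTensor_tmul, LinearMap.rTensor_tmul,
      TensorProduct.lid_tmul, TensorProduct.lid_tmul, TensorProduct.lid_tmul,
      AlgHom.toLinearMap_apply, AlgHom.toLinearMap_apply, map_one, one_smul, one_smul] at e
    rw [← e, add_comm (_ • _), add_assoc, add_sub_cancel_left, ← Algebra.algebraMap_eq_smul_one]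
    exact add_mem (hε _) hl
  refine ⟨r - (⟨a - b, h1⟩ : F n) ⊗ₜ (⟨1, one_mem_wordFil n⟩ : F n) -
    (⟨1, one_mem_wordFil n⟩ : F n) ⊗ₜ (⟨a - c, h2⟩ : F n), ?_⟩
  rw [hr', map_sub, map_sub, TensorProduct.map_tmul, TensorProduct.map_tmul]
  change _ = _ + (_ - (a - b) ⊗ₜ[K] 1 - 1 ⊗ₜ[K] (a - c))
  rw [TensorProduct.sub_tmul, TensorProduct.tmul_sub]
  abel

/-- A coalgebra map which is injective on the span of `1` and the generators is injective. -/
theorem injective (h : IsPrimitivelyGenerated H x d) {B : Type*} [AddCommGroup B] [Module K B]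
    (α : U →ₗ[K] B) (Δ : B →ₗ[K] B ⊗[K] B)
    (hα : ∀ a, Δ (α a) = TensorProduct.map α α (H.comul a))
    (h1 : ∀ a ∈ wordFil K x (fun _ => 1) 1, α a = 0 → a = 0) : Function.Injective α := by
  have : CharZero K := algebraRat.charZero K
  have key : ∀ n, ∀ a ∈ wordFil K x (fun _ => 1) (n + 1), α a = 0 → a = 0 := by
    intro n
    induction n with
    | zero => exact h1
    | succ n ih =>
      intro a ha h0
      obtain ⟨r, hr⟩ := h.exists_comul_eq ha
      have hi : Function.Injective (α ∘ₗ (wordFil K x (fun _ => 1) (n + 1)).subtype) := by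
        rw [injective_iff_map_eq_zero]
        exact fun y hy => Subtype.ext (ih y y.2 hy)
      -- By induction `α` is injective on the lower piece, hence so is `α ⊗ α` on its tensor square.
      -- Since `α a = 0`, the remainder vanishes and `a` is primitive.
      have hr0 : r = 0 := by
        apply TensorProduct.map_injective_of_flat_flat _ _ hi hi
        rw [map_zero, TensorProduct.map_comp, LinearMap.comp_apply, ← add_right_inj
          (TensorProduct.map α α (a ⊗ₜ 1 + 1 ⊗ₜ a)), ← map_add, ← hr, ← hα, h0, map_zero, map_add,
          TensorProduct.map_tmul, TensorProduct.map_tmul, h0, TensorProduct.zero_tmul,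
          TensorProduct.tmul_zero, add_zero, add_zero]
      rw [hr0, map_zero, add_zero] at hr
      have hm := h.mul'_comul ha
      rw [hr, map_add, LinearMap.mul'_apply, LinearMap.mul'_apply, mul_one, one_mul, ← two_smul K a,
        ← sub_smul] at hm
      -- Comultiplication followed by multiplication is `2 a` on the primitive element `a`, and
      -- `2^(n+2) a` modulo the lower piece. In characteristic zero these factors differ, so `a`
      -- lies in the lower piece.
      have h2 : (2 : K) - 2 ^ (n + 1 + 1) ≠ 0 := by
        rw [sub_ne_zero]
        have : (2 : ℕ) ≠ 2 ^ (n + 1 + 1) := by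
          have := Nat.pow_lt_pow_right (a := 2) (by norm_num) (show 1 < n + 1 + 1 by omega)
          omega
        exact_mod_cast this
      exact ih a ((Submodule.smul_mem_iff _ h2).1 hm) h0
  rw [injective_iff_map_eq_zero]
  intro a ha
  obtain ⟨n, hn⟩ := exists_mem_wordFil (w := fun _ => 1) h.adjoin a
  exact key n a (wordFil_mono (Nat.le_succ n) hn) ha

end IsPrimitivelyGenerated

end Primitive

end SuperAlgebra

/-! ### The superbialgebra structure of the enveloping algebra -/

namespace Env

variable {N : ℕ}

/-- The homomorphism out of `U(𝔤)` extending a homomorphism of Lie superalgebras. -/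
def lift {A : Type*} [Ring A] [Algebra ℂ A] (f : twistedCurrent N →ₗ[ℂ] A)
    (hf : ∀ (a b : ZMod 2) (x y : twistedCurrent N),
      (x : Current N) ∈ degree ℂ (Current N) a → (y : Current N) ∈ degree ℂ (Current N) b →
      f x * f y - (-1 : ℤˣ) ^ (a * b) • (f y * f x) = f (twistedBracket a b x y)) : Env N →ₐ[ℂ] A :=
  RingQuot.liftAlgHom ℂ ⟨TensorAlgebra.lift ℂ f, by
    rintro _ _ ⟨a, b, x, y, hx, hy⟩
    rw [map_sub, map_mul, sign_map, map_mul]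
    simp only [TensorAlgebra.lift_ι_apply]
    exact hf a b x y hx hy⟩

theorem lift_ι {A : Type*} [Ring A] [Algebra ℂ A] (f : twistedCurrent N →ₗ[ℂ] A) (hf)
    (x : twistedCurrent N) : lift f hf (ι N x) = f x := by
  change RingQuot.liftAlgHom ℂ _ (RingQuot.mkAlgHom ℂ (EnvRel N) (TensorAlgebra.ι ℂ x)) = _
  rw [RingQuot.liftAlgHom_mkAlgHom_apply, TensorAlgebra.lift_ι_apply]

theorem adjoin_ι : Algebra.adjoin ℂ (Set.range (ι N)) = ⊤ := by
  have h : Set.range (ι N) = RingQuot.mkAlgHom ℂ (EnvRel N) '' Set.range (TensorAlgebra.ι ℂ) := by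
    rw [← Set.range_comp]
    rfl
  rw [h]
  refine (AlgHom.map_adjoin (RingQuot.mkAlgHom ℂ (EnvRel N)) _).symm.trans ?_
  rw [TensorAlgebra.adjoin_range_ι, Algebra.map_top]
  exact (AlgHom.range_eq_top _).2 (RingQuot.mkAlgHom_surjective ℂ (EnvRel N))

theorem parity_ι (x : twistedCurrent N) :
    parity (R := ℂ) (ι N x) = ι N (twistedParity N x) := parityHom_ι x

theorem ι_mem_degree {a : ZMod 2} {x : twistedCurrent N}
    (hx : (x : Current N) ∈ degree ℂ (Current N) a) : ι N x ∈ degree ℂ (Env N) a := by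
  rw [mem_degree, parity_ι, ← map_units_smul]
  congr 1
  refine Subtype.ext ?_
  rw [Current.coe_units_smul]
  exact hx

variable (N) in
/-- The map `x ↦ x ⊗ 1 + 1 ⊗ x`. -/
def primitive : twistedCurrent N →ₗ[ℂ] Env N ⊗[ℂ] Env N :=
  ((TensorProduct.mk ℂ (Env N) (Env N)).flip 1 + TensorProduct.mk ℂ (Env N) (Env N) 1) ∘ₗ ι N

theorem primitive_apply (x : twistedCurrent N) : primitive N x = ι N x ⊗ₜ 1 + 1 ⊗ₜ ι N x := rfl

/-- The mixed terms are `x ⊗ y` and `(-1)^(a b) y ⊗ x`. They cancel in the supercommutator, so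
primitive elements are closed under it. -/
theorem primitive_mul {a b : ZMod 2} {x y : Env N} (hx : x ∈ degree ℂ (Env N) a)
    (hy : y ∈ degree ℂ (Env N) b) :
    toSq ℂ (Env N) (x ⊗ₜ 1 + 1 ⊗ₜ x) * toSq ℂ (Env N) (y ⊗ₜ 1 + 1 ⊗ₜ y) =
      toSq ℂ (Env N) ((x * y) ⊗ₜ 1) + toSq ℂ (Env N) (x ⊗ₜ y) +
        ((-1 : ℤˣ) ^ (a * b) • toSq ℂ (Env N) (y ⊗ₜ x) + toSq ℂ (Env N) (1 ⊗ₜ (x * y))) := by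
  simp only [map_add, add_mul, mul_add]
  rw [toST_mul x one_mem_degree hy, toST_mul x one_mem_degree one_mem_degree,
    toST_mul 1 hx hy, toST_mul 1 hx one_mem_degree]
  simp only [zero_mul, mul_zero, uzpow_zero, one_smul, one_mul, mul_one]
  exact add_add_add_comm _ _ _ _

variable (N) in
/-- The comultiplication of `U(𝔤)`. -/
def comulHom : Env N →ₐ[ℂ] TensorSq ℂ (Env N) :=
  lift ((toSq ℂ (Env N)).toLinearMap ∘ₗ primitive N) fun a b x y hx hy => by
    simp only [LinearMap.comp_apply, LinearEquiv.coe_coe, primitive_apply]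
    rw [primitive_mul (ι_mem_degree hx) (ι_mem_degree hy),
      primitive_mul (ι_mem_degree hy) (ι_mem_degree hx), ← ι_bracket a b x y hx hy, mul_comm b a,
      smul_add, smul_add, smul_add, sign_smul_sign_smul, TensorProduct.sub_tmul,
      TensorProduct.tmul_sub, units_smul_tmul, tmul_units_smul, map_add, map_sub, map_sub,
      map_units_smul (toSq ℂ (Env N)), map_units_smul (toSq ℂ (Env N))]
    abel

theorem comulHom_ι (x : twistedCurrent N) :
    comulHom N (ι N x) = toSq ℂ (Env N) (ι N x ⊗ₜ 1 + 1 ⊗ₜ ι N x) := lift_ι _ _ x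

variable (N) in
/-- The counit of `U(𝔤)`. -/
def counit : Env N →ₐ[ℂ] ℂ := lift 0 fun a b x y hx hy => by simp

theorem counit_ι (x : twistedCurrent N) : counit N (ι N x) = 0 := lift_ι _ _ x

variable (N) in
/-- The superbialgebra structure of `U(𝔤)`. -/
def bialg : Bialg ℂ (Env N) :=
  Bialg.ofGenerators (comulHom N) (counit N) (Set.range (ι N)) adjoin_ι
    (by
      rintro _ ⟨x, rfl⟩
      rw [parity_ι, comulHom_ι, comulHom_ι, STensor.parity_toST, LinearMap.map_add,
        TensorProduct.map_tmul, TensorProduct.map_tmul]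
      simp only [AlgHom.toLinearMap_apply, map_one, parity_ι])
    (by
      rintro _ ⟨x, rfl⟩
      rw [parity_ι, counit_ι, counit_ι])
    (by
      rintro _ ⟨x, rfl⟩
      have h : ∀ x, ((toSq ℂ (Env N)).symm.toLinearMap ∘ₗ (comulHom N).toLinearMap) (ι N x) =
        ι N x ⊗ₜ 1 + 1 ⊗ₜ ι N x := fun x => congrArg (toSq ℂ (Env N)).symm (comulHom_ι x)
      have h1 : ((toSq ℂ (Env N)).symm.toLinearMap ∘ₗ (comulHom N).toLinearMap) 1 = 1 ⊗ₜ 1 :=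
        congrArg (toSq ℂ (Env N)).symm (map_one (comulHom N))
      rw [comulHom_ι, LinearEquiv.symm_apply_apply, map_add, map_add, map_add,
        LinearMap.rTensor_tmul, LinearMap.rTensor_tmul, LinearMap.lTensor_tmul,
        LinearMap.lTensor_tmul, h, h1, TensorProduct.add_tmul, map_add, TensorProduct.assoc_tmul,
        TensorProduct.assoc_tmul, TensorProduct.assoc_tmul, TensorProduct.tmul_add, add_assoc])
    (by
      rintro _ ⟨x, rfl⟩
      rw [comulHom_ι, LinearEquiv.symm_apply_apply, map_add, LinearMap.rTensor_tmul,
        LinearMap.rTensor_tmul, AlgHom.toLinearMap_apply, AlgHom.toLinearMap_apply, counit_ι,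
        map_one, TensorProduct.zero_tmul, zero_add])
    (by
      rintro _ ⟨x, rfl⟩
      rw [comulHom_ι, LinearEquiv.symm_apply_apply, map_add, LinearMap.lTensor_tmul,
        LinearMap.lTensor_tmul, AlgHom.toLinearMap_apply, AlgHom.toLinearMap_apply, counit_ι,
        map_one, TensorProduct.tmul_zero, add_zero])

theorem bialg_comul_ι (x : twistedCurrent N) :
    (bialg N).comul (ι N x) = ι N x ⊗ₜ 1 + 1 ⊗ₜ ι N x :=
  congrArg (toSq ℂ (Env N)).symm (comulHom_ι x)

/-- The homogeneous elements of `𝔤`, with their degrees. -/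
abbrev Homogeneous (N : ℕ) : Type :=
  {p : ZMod 2 × twistedCurrent N // (p.2 : Current N) ∈ degree ℂ (Current N) p.1}

theorem exists_homogeneous_add (x : twistedCurrent N) :
    ∃ y z : twistedCurrent N, (y : Current N) ∈ degree ℂ (Current N) 0 ∧
      (z : Current N) ∈ degree ℂ (Current N) 1 ∧ x = y + z := by
  obtain ⟨y, hy, z, hz, hy0, hz1, h⟩ := exists_homogeneous_parts
    (P := twistedCurrent N) (fun a ha => twistedCurrent_parity_mem ha) x.2
  exact ⟨⟨y, hy⟩, ⟨z, hz⟩, hy0, hz1, Subtype.ext h⟩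

theorem twistedBracket_mem_degree {a b : ZMod 2} {x y : twistedCurrent N}
    (hx : (x : Current N) ∈ degree ℂ (Current N) a) (hy : (y : Current N) ∈ degree ℂ (Current N) b) :
    (twistedBracket a b x y : Current N) ∈ degree ℂ (Current N) (a + b) :=
  sub_mem (mul_mem_degree hx hy) (units_smul_mem_degree _ (add_comm b a ▸ mul_mem_degree hy hx))

theorem isPrimitivelyGenerated (N : ℕ) : IsPrimitivelyGenerated (bialg N)
    (fun p : Homogeneous N => ι N p.1.2) (fun p => p.1.1) where
  mem_degree p := ι_mem_degree p.2
  adjoin := by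
    rw [eq_top_iff, ← adjoin_ι]
    refine Algebra.adjoin_le ?_
    rintro _ ⟨x, rfl⟩
    obtain ⟨y, z, hy, hz, rfl⟩ := exists_homogeneous_add x
    rw [map_add]
    exact add_mem (Algebra.subset_adjoin ⟨⟨(0, y), hy⟩, rfl⟩)
      (Algebra.subset_adjoin ⟨⟨(1, z), hz⟩, rfl⟩)
  comul p := bialg_comul_ι p.1.2
  comm p q := by
    rw [ι_bracket _ _ _ _ p.2 q.2]
    exact gen_mem_wordFil (R := ℂ) (x := fun p : Homogeneous N => ι N p.1.2) (w := fun _ => 1)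
      ⟨(_, _), twistedBracket_mem_degree p.2 q.2⟩

theorem exists_of_mem_wordFil_one {a : Env N}
    (ha : a ∈ wordFil ℂ (fun p : Homogeneous N => ι N p.1.2) (fun _ => 1) 1) :
    ∃ (c : ℂ) (x : twistedCurrent N), a = algebraMap ℂ (Env N) c + ι N x := by
  have key : wordFil ℂ (fun p : Homogeneous N => ι N p.1.2) (fun _ => 1) 1 ≤
      LinearMap.range (Algebra.linearMap ℂ (Env N)) ⊔ LinearMap.range (ι N) := by
    refine Submodule.span_le.2 ?_
    rintro _ ⟨l, hl, rfl⟩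
    match l with
    | [] => exact Submodule.mem_sup_left ⟨1, by simp⟩
    | [p] => exact Submodule.mem_sup_right ⟨p.1.2, by simp⟩
    | p :: q :: l => simp at hl
  obtain ⟨_, ⟨c, rfl⟩, _, ⟨x, rfl⟩, h⟩ := Submodule.mem_sup.1 (key ha)
  exact ⟨c, x, h.symm⟩

end Env

/-! ### The reduction of a superalgebra over `ℂ⟦h⟧` modulo `h` -/

section Reduction

variable (Y : Type*) [Ring Y] [Algebra ℂ⟦X⟧ Y] [SuperAlgebra ℂ⟦X⟧ Y]

/-- The two-sided ideal generated by `h`. -/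
def reductionIdeal : Ideal Y where
  carrier := {y | ∃ z, y = (PowerSeries.X : ℂ⟦X⟧) • z}
  zero_mem' := ⟨0, (smul_zero _).symm⟩
  add_mem' := by
    rintro _ _ ⟨y, rfl⟩ ⟨z, rfl⟩
    exact ⟨y + z, (smul_add _ _ _).symm⟩
  smul_mem' := by
    rintro a _ ⟨y, rfl⟩
    exact ⟨a * y, mul_smul_comm _ _ _⟩

instance : (reductionIdeal Y).IsTwoSided where
  mul_mem_of_left := by
    rintro _ b ⟨y, rfl⟩
    exact ⟨y * b, smul_mul_assoc _ _ _⟩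

/-- The quotient by `h`. -/
def Reduction : Type _ := Y ⧸ reductionIdeal Y

namespace Reduction

instance : Ring (Reduction Y) := inferInstanceAs (Ring (Y ⧸ reductionIdeal Y))

/-- The quotient map, as a ring homomorphism. -/
def mkHom : Y →+* Reduction Y := Ideal.Quotient.mk (reductionIdeal Y)

theorem mkHom_surjective : Function.Surjective (mkHom Y) := Ideal.Quotient.mk_surjective

instance : Algebra ℂ (Reduction Y) :=
  RingHom.toAlgebra' ((mkHom Y).comp ((algebraMap ℂ⟦X⟧ Y).comp PowerSeries.C)) fun c x => by
    obtain ⟨y, rfl⟩ := mkHom_surjective Y x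
    change mkHom Y _ * mkHom Y y = mkHom Y y * mkHom Y _
    rw [← map_mul, ← map_mul]
    congr 1
    exact Algebra.commutes _ _

variable {Y}

theorem mkHom_eq_zero_iff {y : Y} : mkHom Y y = 0 ↔ ∃ z, y = (PowerSeries.X : ℂ⟦X⟧) • z :=
  Ideal.Quotient.eq_zero_iff_mem

theorem mkHom_C_smul (c : ℂ) (y : Y) :
    mkHom Y ((PowerSeries.C c : ℂ⟦X⟧) • y) = c • mkHom Y y := by
  rw [Algebra.smul_def, map_mul, Algebra.smul_def]
  rfl

theorem exists_eq_C_add (f : ℂ⟦X⟧) :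
    ∃ g : ℂ⟦X⟧, f = PowerSeries.C (PowerSeries.constantCoeff f) + PowerSeries.X * g := by
  obtain ⟨g, hg⟩ := PowerSeries.X_dvd_iff.2
    (show PowerSeries.constantCoeff (f - PowerSeries.C (PowerSeries.constantCoeff f)) = 0 by simp)
  exact ⟨g, by rw [← hg]; ring⟩

variable (Y) in
/-- The quotient map, as a linear map over the evaluation at `h = 0`. -/
def mk : Y →ₛₗ[(PowerSeries.constantCoeff : ℂ⟦X⟧ →+* ℂ)] Reduction Y where
  toFun := mkHom Y
  map_add' := map_add _
  map_smul' f y := by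
    obtain ⟨g, hg⟩ := exists_eq_C_add f
    conv_lhs => rw [hg]
    rw [add_smul, map_add, mkHom_C_smul, mul_smul, mkHom_eq_zero_iff.2 ⟨_, rfl⟩, add_zero]

theorem mk_surjective : Function.Surjective (mk Y) := mkHom_surjective Y

theorem mk_eq_zero_iff {y : Y} : mk Y y = 0 ↔ ∃ z, y = (PowerSeries.X : ℂ⟦X⟧) • z :=
  mkHom_eq_zero_iff

theorem mk_mul (x y : Y) : mk Y (x * y) = mk Y x * mk Y y := map_mul (mkHom Y) x y

theorem mk_one : mk Y 1 = 1 := map_one (mkHom Y)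

end Reduction

/-- A map over the evaluation at `h = 0` factors through every surjective such map with kernel
generated by `h`. -/
theorem exists_linearMap_comp_eq {Y B M : Type*} [AddCommGroup Y] [Module ℂ⟦X⟧ Y] [AddCommGroup B]
    [Module ℂ B] [AddCommGroup M] [Module ℂ M]
    (q : Y →ₛₗ[(PowerSeries.constantCoeff : ℂ⟦X⟧ →+* ℂ)] B) (hq : Function.Surjective q)
    (hker : ∀ y, q y = 0 → ∃ z, y = (PowerSeries.X : ℂ⟦X⟧) • z)
    (f : Y →ₛₗ[(PowerSeries.constantCoeff : ℂ⟦X⟧ →+* ℂ)] M) :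
    ∃ F : B →ₗ[ℂ] M, ∀ y, F (q y) = f y := by
  have key : ∀ y y', q y = q y' → f y = f y' := fun y y' h => by
    obtain ⟨z, hz⟩ := hker (y - y') (by rw [map_sub, h, sub_self])
    rw [← sub_eq_zero, ← map_sub, hz, LinearMap.map_smulₛₗ, PowerSeries.constantCoeff_X, zero_smul]
  have hs : ∀ b, q (Function.surjInv hq b) = b := Function.surjInv_eq hq
  refine ⟨{ toFun := fun b => f (Function.surjInv hq b)
            map_add' := fun b b' => ?_
            map_smul' := fun c b => ?_ }, fun y => key _ _ (hs _)⟩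
  · rw [← map_add]
    exact key _ _ (by rw [hs, map_add, hs, hs])
  · have e : c • f (Function.surjInv hq b) = f ((PowerSeries.C c : ℂ⟦X⟧) • Function.surjInv hq b) := by
      rw [LinearMap.map_smulₛₗ, PowerSeries.constantCoeff_C]
    rw [RingHom.id_apply, e]
    exact key _ _ (by rw [hs, LinearMap.map_smulₛₗ, PowerSeries.constantCoeff_C, hs])

end Reduction

/-! ### The homomorphism from `U(𝔤)` to the reduction of `Y(𝔮_N, h)` -/

namespace Current

variable {N : ℕ} {B : Type*} [AddCommGroup B] [Module ℂ B]

/-- The linear map with `E i j u ^ n ↦ - (-1) ^ i g j i n / 2`. -/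
def extend (g : Idx N → Idx N → ℕ → B) : Current N →ₗ[ℂ] B :=
  ∑ i, ∑ j, ((-1 : ℤˣ) ^ i.2 • (-(1 / 2) : ℂ)) •
    (Polynomial.lsum (fun n => LinearMap.toSpanSingleton ℂ B (g j i n)) ∘ₗ
      Matrix.entryLinearMap ℂ ℂ[X] i j)

theorem extend_single (g : Idx N → Idx N → ℕ → B) (i j : Idx N) (p : ℂ[X]) :
    extend g (Matrix.single i j p) = ((-1 : ℤˣ) ^ i.2 • (-(1 / 2) : ℂ)) •
      Polynomial.lsum (fun n => LinearMap.toSpanSingleton ℂ B (g j i n)) p := by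
  simp only [extend, LinearMap.sum_apply, LinearMap.smul_apply, LinearMap.comp_apply,
    Matrix.entryLinearMap_apply]
  rw [Finset.sum_eq_single i, Finset.sum_eq_single j]
  · rw [Matrix.single_apply_same]
  · intro j' _ h
    rw [Matrix.single_apply_of_ne _ _ _ _ _ (by tauto), map_zero, smul_zero]
  · simp
  · intro i' _ h
    refine Finset.sum_eq_zero fun j' _ => ?_
    rw [Matrix.single_apply_of_ne _ _ _ _ _ (by tauto), map_zero, smul_zero]
  · simp

theorem lsum_X_pow (f : ℕ → B) (n : ℕ) :
    Polynomial.lsum (fun n => LinearMap.toSpanSingleton ℂ B (f n)) (Polynomial.X ^ n) = f n := by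
  rw [Polynomial.lsum_apply, ← Polynomial.monomial_one_right_eq_X_pow, Polynomial.sum_monomial_index]
  · simp
  · simp

/-- By the compatibility `hg`, the two matrix units in `F` contribute equally, which explains the
factor `1 / 2` in `extend`. -/
theorem extend_twistedF {g : Idx N → Idx N → ℕ → B}
    (hg : ∀ i j n, g (opp i) (opp j) n = (-1 : ℤˣ) ^ (n + 1) • g i j n) (i j : Idx N) (n : ℕ) :
    extend g (twistedF i j n) = -((-1 : ℤˣ) ^ i.2 • g j i n) := by
  rw [twistedF]
  dsimp only
  rw [neg_X_pow, map_add, extend_single, extend_single, map_units_smul, lsum_X_pow, lsum_X_pow, hg,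
    sign_opp, pow_succ, mul_neg_one, Units.neg_smul, Units.neg_smul, smul_neg, smul_neg,
    neg_smul, neg_neg, smul_smul ((-1 : ℤˣ) ^ n), Int.units_mul_self, one_smul]
  rcases Int.units_eq_one_or ((-1 : ℤˣ) ^ i.2) with h | h <;>
  · simp only [h, one_smul, Units.neg_smul]
    module

theorem extend_evalGen {g : Idx N → Idx N → ℕ → B}
    (hg : ∀ i j n, g (opp i) (opp j) n = (-1 : ℤˣ) ^ (n + 1) • g i j n) (i j : Idx N) (n : ℕ) :
    extend g (evalGen i j n) = g i j n := by
  have e : (evalGen i j n : Current N) = -((-1 : ℤˣ) ^ j.2 • (twistedF j i n : Current N)) := by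
    rw [evalGen, Submodule.coe_neg, coe_units_smul]
  rw [e, map_neg, map_units_smul, extend_twistedF hg, smul_neg, neg_neg, sign_smul_sign_smul]

theorem single_mem_degree (i j : Idx N) (p : ℂ[X]) :
    Matrix.single i j p ∈ degree ℂ (Current N) (i.2 + j.2) := by
  rw [mem_degree]
  refine Matrix.ext fun k l => ?_
  change (-1 : ℤˣ) ^ (k.2 + l.2) • Matrix.single i j p k l = ((-1 : ℤˣ) ^ (i.2 + j.2) •
    Matrix.single i j p : Current N) k l
  rw [Matrix.smul_apply]
  by_cases h : i = k ∧ j = l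
  · rw [h.1, h.2]
  · rw [Matrix.single_apply_of_ne _ _ _ _ _ h, smul_zero, smul_zero]

theorem evalGen_mem_degree (i j : Idx N) (n : ℕ) :
    (evalGen i j n : Current N) ∈ degree ℂ (Current N) (i.2 + j.2) := by
  have h : (opp j).2 + (opp i).2 = i.2 + j.2 := by
    have h2 : (1 : ZMod 2) + 1 = 0 := by decide
    simp only [opp]
    linear_combination h2
  refine neg_mem (SuperAlgebra.units_smul_mem _ _ (add_mem ?_ ?_))
  · rw [add_comm]
    exact single_mem_degree _ _ _
  · rw [← h]
    exact single_mem_degree _ _ _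

theorem coe_lsum_evalGen (i j : Idx N) (p : ℂ[X]) :
    ((Polynomial.lsum (fun n => LinearMap.toSpanSingleton ℂ (twistedCurrent N) (evalGen j i n)) p :
      twistedCurrent N) : Current N) = -((-1 : ℤˣ) ^ i.2 •
        (Matrix.single i j p + Matrix.single (opp i) (opp j) (p.comp (-Polynomial.X)))) := by
  induction p using Polynomial.induction_on' with
  | add p q hp hq =>
    rw [map_add, Submodule.coe_add, hp, hq, Matrix.single_add, Polynomial.add_comp,
      Matrix.single_add]
    simp only [smul_add]
    abel
  | monomial n c =>
    rw [← Polynomial.C_mul_X_pow_eq_monomial, ← Polynomial.smul_eq_C_mul, map_smul, lsum_X_pow,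
      Submodule.coe_smul, evalGen, Submodule.coe_neg, coe_units_smul, Polynomial.smul_comp,
      Polynomial.X_pow_comp, ← Matrix.smul_single, ← Matrix.smul_single, ← smul_add, twistedF,
      smul_neg, smul_comm c]

/-- The left side is the average of `x` and its transform under `η` and `u ↦ -u`, and elements of
`𝔤` are fixed by this transformation. In particular the `evalGen` span `𝔤`. -/
theorem extend_coe_evalGen (x : twistedCurrent N) :
    extend (fun i j n => (evalGen i j n : twistedCurrent N)) x = x := by
  refine Subtype.ext ?_
  have h : ∀ i j, (((-1 : ℤˣ) ^ i.2 • (-(1 / 2) : ℂ)) • (Polynomial.lsum (fun n =>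
      LinearMap.toSpanSingleton ℂ (twistedCurrent N) (evalGen j i n)) ((x : Current N) i j) :
      twistedCurrent N) : Current N) = (1 / 2 : ℂ) • (Matrix.single i j ((x : Current N) i j) +
        Matrix.single (opp i) (opp j) ((x : Current N) (opp i) (opp j))) := fun i j => by
    rw [coe_lsum_evalGen, x.2 i j]
    rcases Int.units_eq_one_or ((-1 : ℤˣ) ^ i.2) with h | h <;>
    · simp only [h, one_smul, Units.neg_smul]
      module
  simp only [extend, LinearMap.sum_apply, LinearMap.smul_apply, LinearMap.comp_apply,
    Matrix.entryLinearMap_apply, Submodule.coe_sum, Submodule.coe_smul, h]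
  have e : ∀ M : Current N, ∑ i, ∑ j, Matrix.single i j (M i j) = M := fun M =>
    (Matrix.matrix_eq_sum_single M).symm
  have e' : ∀ M : Current N, ∑ i, ∑ j, Matrix.single (opp i) (opp j) (M (opp i) (opp j)) = M :=
    fun M => by
      rw [sum_opp fun i => ∑ j, Matrix.single i (opp j) (M i (opp j))]
      refine Eq.trans (Finset.sum_congr rfl fun i _ => ?_) (e M)
      exact sum_opp fun j => Matrix.single i j (M i j)
  simp only [← Finset.smul_sum, Finset.sum_add_distrib, e, e']
  module

theorem mem_span_evalGen {a : ZMod 2} {x : twistedCurrent N}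
    (hx : (x : Current N) ∈ degree ℂ (Current N) a) :
    x ∈ Submodule.span ℂ {y | ∃ i j n, i.2 + j.2 = a ∧ y = evalGen (N := N) i j n} := by
  rw [← extend_coe_evalGen x]
  simp only [extend, LinearMap.sum_apply, LinearMap.smul_apply, LinearMap.comp_apply,
    Matrix.entryLinearMap_apply]
  refine sum_mem fun i _ => sum_mem fun j _ => Submodule.smul_mem _ _ ?_
  by_cases h : j.2 + i.2 = a
  · rw [Polynomial.lsum_apply]
    exact sum_mem fun n _ => Submodule.smul_mem _ _ (Submodule.subset_span ⟨j, i, n, h, rfl⟩)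
  · have h0 : (x : Current N) i j = 0 := by
      have e : (-1 : ℤˣ) ^ (i.2 + j.2) • (x : Current N) i j = (-1 : ℤˣ) ^ a • (x : Current N) i j :=
        congrFun (congrFun hx i) j
      have h' : a = i.2 + j.2 + 1 := by
        have key : ∀ a b : ZMod 2, b ≠ a → a = b + 1 := by decide
        exact key _ _ (add_comm i.2 j.2 ▸ h)
      rw [h', uzpow_add _ (i.2 + j.2), uzpow_one, mul_neg_one, Units.neg_smul, ← sub_eq_zero, sub_neg_eq_add,
        ← two_smul ℂ, smul_eq_zero_iff_right two_ne_zero] at e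
      rw [← sign_smul_sign_smul (i.2 + j.2) ((x : Current N) i j), e, smul_zero]
    rw [h0, map_zero]
    exact zero_mem _

end Current

/-! ### The classical limit of `Y(𝔮_N, h)` -/

/-- An even multiplicative semilinear map respects the signed product of the tensor squares. -/
theorem toSq_map_mul {R S A B : Type*} [CommRing R] [Algebra ℚ R] [CommRing S] [Algebra ℚ S]
    [Ring A] [Algebra R A] [SuperAlgebra R A] [Ring B] [Algebra S B] [SuperAlgebra S B]
    {σ : R →+* S} (f : A →ₛₗ[σ] B) (hf : ∀ a, f (parity (R := R) a) = parity (R := S) (f a))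
    (hm : ∀ x y, f (x * y) = f x * f y) (s t : TensorSq R A) :
    toSq S B (TensorProduct.map f f ((toSq R A).symm (s * t))) =
      toSq S B (TensorProduct.map f f ((toSq R A).symm s)) *
        toSq S B (TensorProduct.map f f ((toSq R A).symm t)) := by
  induction s using STensor.induction with
  | zero => simp only [zero_mul, map_zero]
  | add x y hx hy => simp only [add_mul, map_add, hx, hy]
  | tmul i j a ha b hb =>
    induction t using STensor.induction with
    | zero => simp only [mul_zero, map_zero]
    | add x y hx hy => simp only [mul_add, map_add, hx, hy]
    | tmul i' j' a' ha' b' hb' =>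
      rw [toST_mul a hb ha', map_units_smul, map_units_smul, map_units_smul,
        LinearEquiv.symm_apply_apply, LinearEquiv.symm_apply_apply, LinearEquiv.symm_apply_apply,
        TensorProduct.map_tmul, TensorProduct.map_tmul, TensorProduct.map_tmul, hm, hm]
      exact (toST_mul (f a) (map_mem_degree hf hb) (map_mem_degree hf ha') (f b')).symm

namespace Reduction

variable {Y : Type*} [Ring Y] [Algebra ℂ⟦X⟧ Y] [SuperAlgebra ℂ⟦X⟧ Y]

variable (Y) in
/-- The parity automorphism of the reduction. -/
def parityHom : Reduction Y →ₐ[ℂ] Reduction Y where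
  toRingHom := Ideal.Quotient.lift (reductionIdeal Y)
    ((mkHom Y).comp (parity (R := ℂ⟦X⟧) (A := Y) : Y →+* Y)) (by
      rintro _ ⟨y, rfl⟩
      refine mkHom_eq_zero_iff.2 ⟨parity (R := ℂ⟦X⟧) y, ?_⟩
      exact map_smul (parity (R := ℂ⟦X⟧) (A := Y)) _ _)
  commutes' c := by
    refine congrArg (mkHom Y) ?_
    exact AlgHom.commutes (parity (R := ℂ⟦X⟧) (A := Y)) _

theorem parityHom_mk (y : Y) : parityHom Y (mk Y y) = mk Y (parity (R := ℂ⟦X⟧) y) := rfl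

instance : SuperAlgebra ℂ (Reduction Y) where
  parity := parityHom Y
  parity_parity a := by
    obtain ⟨y, rfl⟩ := mk_surjective a
    rw [parityHom_mk, parityHom_mk, parity_parity]

theorem mk_parity (y : Y) : mk Y (parity (R := ℂ⟦X⟧) y) = parity (R := ℂ) (mk Y y) := rfl

end Reduction

theorem Current.hom_ext {N : ℕ} {M : Type*} [AddCommGroup M] [Module ℂ M]
    {f f' : twistedCurrent N →ₗ[ℂ] M}
    (h : ∀ i j n, f (Current.evalGen i j n) = f' (Current.evalGen i j n)) (x : twistedCurrent N) :
    f x = f' x := by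
  have key : ∀ a (x : twistedCurrent N), (x : Current N) ∈ degree ℂ (Current N) a → f x = f' x := by
    intro a x hx
    replace hx := Current.mem_span_evalGen hx
    induction hx using Submodule.span_induction with
    | mem x hx => obtain ⟨i, j, n, -, rfl⟩ := hx; exact h i j n
    | zero => rw [map_zero, map_zero]
    | add x y _ _ hx hy => rw [map_add, map_add, hx, hy]
    | smul c x _ hx => rw [map_smul, map_smul, hx]
  obtain ⟨y, z, hy, hz, rfl⟩ := Env.exists_homogeneous_add x
  rw [map_add, map_add, key 0 y hy, key 1 z hz]

theorem Current.signedComm_evalGen {N : ℕ} (i j k l : Idx N) (a b : ℕ) :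
    signedComm i j k l (Current.evalGen i j a : Current N) (Current.evalGen k l b) =
      bracketForm (fun i j n => (Current.evalGen i j n : Current N)) i j k l a b :=
  Current.evalGen_comm i j k l a b

/-! ### The comparison map from the enveloping algebra to the reduction. -/

namespace IsDeformedCurrent

variable {Y : Type*} [Ring Y] [Algebra ℂ⟦X⟧ Y] [SuperAlgebra ℂ⟦X⟧ Y] {N : ℕ}
  {H : HopfSuperalgebra ℂ⟦X⟧ Y} {g : Idx N → Idx N → ℕ → Y}

theorem mk_opp (hY : IsDeformedCurrent H g) (i j : Idx N) (n : ℕ) :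
    Reduction.mk Y (g (opp i) (opp j) n) = (-1 : ℤˣ) ^ (n + 1) • Reduction.mk Y (g i j n) := by
  rw [hY.gen_opp, map_units_smul]

theorem signedComm_mk (hY : IsDeformedCurrent H g) (i j k l : Idx N) (a b : ℕ) :
    signedComm i j k l (Reduction.mk Y (g i j a)) (Reduction.mk Y (g k l b)) =
      bracketForm (fun i j n => Reduction.mk Y (g i j n)) i j k l a b := by
  obtain ⟨y, hy⟩ := hY.comm i j k l a b
  rw [← map_bracketForm (Reduction.mk Y) g, ← add_zero (Reduction.mk Y (bracketForm _ _ _ _ _ _ _)),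
    ← Reduction.mk_eq_zero_iff.2 ⟨y, rfl⟩, ← map_add, ← hy, signedComm, signedComm, map_units_smul,
    map_sub, map_units_smul, Reduction.mk_mul, Reduction.mk_mul]

/-- The map from `𝔤` to the reduction. -/
def toReduction (hY : IsDeformedCurrent H g) : twistedCurrent N →ₗ[ℂ] Reduction Y :=
  Current.extend (fun i j n => Reduction.mk Y (g i j n)) ∘ₗ (twistedCurrent N).subtype

theorem toReduction_evalGen (hY : IsDeformedCurrent H g) (i j : Idx N) (n : ℕ) :
    hY.toReduction (Current.evalGen i j n) = Reduction.mk Y (g i j n) :=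
  Current.extend_evalGen hY.mk_opp i j n

/-- By bilinearity this concerns only the spanning elements `evalGen`. There both brackets are the
same `bracketForm`, in the reduction by `signedComm_mk` and in matrices by `evalGen_comm`. -/
theorem toReduction_bracket (hY : IsDeformedCurrent H g) (a b : ZMod 2) (x y : twistedCurrent N)
    (hx : (x : Current N) ∈ degree ℂ (Current N) a) (hy : (y : Current N) ∈ degree ℂ (Current N) b) :
    hY.toReduction x * hY.toReduction y
        - (-1 : ℤˣ) ^ (a * b) • (hY.toReduction y * hY.toReduction x) =
      hY.toReduction (twistedBracket a b x y) := by
  change _ = Current.extend (fun i j n => Reduction.mk Y (g i j n))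
    ((x : Current N) * y - (-1 : ℤˣ) ^ (a * b) • ((y : Current N) * x))
  replace hx := Current.mem_span_evalGen hx
  replace hy := Current.mem_span_evalGen hy
  induction hx using Submodule.span_induction with
  | zero => simp
  | add x x' _ _ hx hx' =>
    simp only [map_add, Submodule.coe_add, add_mul, mul_add, smul_add, add_sub_add_comm, hx, hx']
  | smul c x _ hx =>
    simp only [map_smul, Submodule.coe_smul, smul_mul_assoc, mul_smul_comm, smul_comm _ c,
      ← smul_sub, hx]
  | mem x hx =>
    obtain ⟨i, j, m, rfl, rfl⟩ := hx
    induction hy using Submodule.span_induction with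
    | zero => simp
    | add x x' _ _ hx hx' =>
      generalize (-1 : ℤˣ) ^ ((i.2 + j.2) * b) = e at hx hx' ⊢
      simp only [map_add, Submodule.coe_add, add_mul, mul_add, smul_add, add_sub_add_comm, hx, hx']
    | smul c x _ hx =>
      simp only [map_smul, Submodule.coe_smul, smul_mul_assoc, mul_smul_comm, smul_comm _ c,
        ← smul_sub, hx]
    | mem x hx =>
      obtain ⟨k, l, n, rfl, rfl⟩ := hx
      rw [hY.toReduction_evalGen, hY.toReduction_evalGen]
      have h1 := hY.signedComm_mk i j k l m n
      have h2 := congrArg (Current.extend fun i j n => Reduction.mk Y (g i j n))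
        (Current.signedComm_evalGen i j k l m n)
      rw [map_bracketForm] at h2
      simp only [Current.extend_evalGen (g := fun i j n => Reduction.mk Y (g i j n)) hY.mk_opp] at h2
      rw [← h1, signedComm, signedComm, map_units_smul] at h2
      -- The sign that `signedComm` puts in front is a unit and cancels.
      exact (MulAction.injective _ h2).symm

/-- The homomorphism from `U(𝔤)` to the reduction. -/
def envHom (hY : IsDeformedCurrent H g) : Env N →ₐ[ℂ] Reduction Y :=
  Env.lift hY.toReduction hY.toReduction_bracket

theorem envHom_ι (hY : IsDeformedCurrent H g) (x : twistedCurrent N) :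
    hY.envHom (Env.ι N x) = hY.toReduction x := Env.lift_ι _ _ x

theorem envHom_surjective (hY : IsDeformedCurrent H g) : Function.Surjective hY.envHom := by
  intro b
  obtain ⟨y, rfl⟩ := Reduction.mk_surjective b
  have hy : y ∈ Algebra.adjoin ℂ⟦X⟧ (Set.range fun x : YangianGen N => g x.1 x.2.1 x.2.2) := by
    rw [hY.adjoin]; trivial
  change _ ∈ hY.envHom.range
  induction hy using Algebra.adjoin_induction with
  | mem y hy =>
    obtain ⟨⟨i, j, n⟩, rfl⟩ := hy
    exact ⟨Env.ι N (Current.evalGen i j n), (hY.envHom_ι _).trans (hY.toReduction_evalGen i j n)⟩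
  | algebraMap f =>
    rw [Algebra.algebraMap_eq_smul_one, LinearMap.map_smulₛₗ, Reduction.mk_one]
    exact Subalgebra.smul_mem _ (one_mem _) _
  | add x y _ _ hx hy => rw [map_add]; exact add_mem hx hy
  | mul x y _ _ hx hy => rw [Reduction.mk_mul]; exact mul_mem hx hy

/-- Reduction of maps over the evaluation at `h = 0`. -/
theorem exists_comp_mk {M : Type*} [AddCommGroup M] [Module ℂ M]
    (f : Y →ₛₗ[(PowerSeries.constantCoeff : ℂ⟦X⟧ →+* ℂ)] M) :
    ∃ F : Reduction Y →ₗ[ℂ] M, ∀ y, F (Reduction.mk Y y) = f y :=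
  exists_linearMap_comp_eq (Reduction.mk Y) Reduction.mk_surjective
    (fun _ h => Reduction.mk_eq_zero_iff.1 h) f

theorem map_comulGen_eq {M : Type*} [Ring M] [Algebra ℂ M]
    (f : Y →ₛₗ[(PowerSeries.constantCoeff : ℂ⟦X⟧ →+* ℂ)] M) (h1 : f 1 = 1) (i j : Idx N) (n : ℕ) :
    TensorProduct.map f f (comulGen (PowerSeries.X : ℂ⟦X⟧) g i j n) =
      f (g i j n) ⊗ₜ 1 + 1 ⊗ₜ f (g i j n) := by
  rw [comulGen, map_add, map_add, LinearMap.map_smulₛₗ, PowerSeries.constantCoeff_X, zero_smul,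
    add_zero, TensorProduct.map_tmul, TensorProduct.map_tmul, h1]

/-- The comultiplication descends modulo `h`, and there the generators become primitive, because the
cross terms carry a factor `h`. Compatibility with `envHom` follows from agreement on the generators
of `U(𝔤)`. -/
theorem exists_comul_reduction (hY : IsDeformedCurrent H g) :
    ∃ Δ : Reduction Y →ₗ[ℂ] Reduction Y ⊗[ℂ] Reduction Y, ∀ a, Δ (hY.envHom a) =
      TensorProduct.map hY.envHom.toLinearMap hY.envHom.toLinearMap ((Env.bialg N).comul a) := by
  obtain ⟨Δ, hΔ⟩ := exists_comp_mk (Y := Y)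
    (TensorProduct.map (Reduction.mk Y) (Reduction.mk Y) ∘ₛₗ H.comul)
  have hΔ' : ∀ y, Δ (Reduction.mk Y y) =
    TensorProduct.map (Reduction.mk Y) (Reduction.mk Y) (H.comul y) := hΔ
  refine ⟨Δ, fun a => ?_⟩
  let F : Reduction Y →ₐ[ℂ] TensorSq ℂ (Reduction Y) :=
    AlgHom.ofLinearMap ((toSq ℂ (Reduction Y)).toLinearMap ∘ₗ Δ)
      (by
        change toSq ℂ (Reduction Y) (Δ 1) = 1
        have h1 : H.comul 1 = 1 ⊗ₜ 1 := (toSq ℂ⟦X⟧ Y).injective (by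
          rw [H.toSq_comul, map_one]; rfl)
        rw [← Reduction.mk_one, hΔ', h1, TensorProduct.map_tmul, Reduction.mk_one]
        rfl)
      (fun x y => by
        obtain ⟨x, rfl⟩ := Reduction.mk_surjective x
        obtain ⟨y, rfl⟩ := Reduction.mk_surjective y
        change toSq ℂ (Reduction Y) (Δ _) = toSq ℂ (Reduction Y) (Δ _) * toSq ℂ (Reduction Y) (Δ _)
        have hm : H.comul (x * y) = (toSq ℂ⟦X⟧ Y).symm (H.comulHom x * H.comulHom y) := by
          rw [LinearEquiv.eq_symm_apply, H.toSq_comul, map_mul]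
        rw [← Reduction.mk_mul, hΔ', hΔ', hΔ', hm, toSq_map_mul (Reduction.mk Y) Reduction.mk_parity
          Reduction.mk_mul, ← H.toSq_comul, ← H.toSq_comul, LinearEquiv.symm_apply_apply,
          LinearEquiv.symm_apply_apply])
  have hp : ∀ a, hY.envHom (parity (R := ℂ) a) = parity (R := ℂ) (hY.envHom a) := by
    have h : hY.envHom.comp parity = parity.comp hY.envHom :=
      AlgHom.ext_of_adjoin_eq_top Env.adjoin_ι (by
        rintro _ ⟨x, rfl⟩
        change hY.envHom (parity (R := ℂ) (Env.ι N x)) = parity (R := ℂ) (hY.envHom (Env.ι N x))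
        rw [Env.parity_ι, envHom_ι, envHom_ι]
        refine Current.hom_ext (f := hY.toReduction ∘ₗ twistedParity N)
          (f' := (parity (R := ℂ) (A := Reduction Y)).toLinearMap ∘ₗ hY.toReduction)
          (fun i j n => ?_) x
        change hY.toReduction (twistedParity N _) = parity (R := ℂ) (hY.toReduction _)
        have e : twistedParity N (Current.evalGen i j n) =
            (-1 : ℤˣ) ^ (i.2 + j.2) • Current.evalGen i j n := Subtype.ext (by
          rw [Current.coe_units_smul]
          exact mem_degree.1 (Current.evalGen_mem_degree i j n))
        rw [e, map_units_smul, toReduction_evalGen, ← Reduction.mk_parity,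
          mem_degree.1 (hY.gen_mem_degree i j n), map_units_smul])
    exact fun a => DFunLike.congr_fun h a
  have h : F.comp hY.envHom = (STensor.map hY.envHom hY.envHom hp hp).comp (Env.bialg N).comulHom :=
    AlgHom.ext_of_adjoin_eq_top Env.adjoin_ι (by
      rintro _ ⟨x, rfl⟩
      change toSq ℂ (Reduction Y) (Δ (hY.envHom (Env.ι N x))) =
        STensor.map hY.envHom hY.envHom hp hp (Env.comulHom N (Env.ι N x))
      rw [Env.comulHom_ι, STensor.map_toST, map_add, TensorProduct.map_tmul, TensorProduct.map_tmul,
        AlgHom.toLinearMap_apply, AlgHom.toLinearMap_apply, map_one, envHom_ι]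
      refine congrArg (toSq ℂ (Reduction Y)) ?_
      refine Current.hom_ext (f := Δ ∘ₗ hY.toReduction)
        (f' := ((TensorProduct.mk ℂ (Reduction Y) (Reduction Y)).flip 1 +
          TensorProduct.mk ℂ (Reduction Y) (Reduction Y) 1) ∘ₗ hY.toReduction) (fun i j n => ?_) x
      change Δ (hY.toReduction _) = hY.toReduction _ ⊗ₜ 1 + 1 ⊗ₜ hY.toReduction _
      rw [toReduction_evalGen, hΔ', hY.comul_gen, map_comulGen_eq _ Reduction.mk_one])
  exact congrArg (toSq ℂ (Reduction Y)).symm (DFunLike.congr_fun h a)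

/-- It is enough to treat `c + x` with a scalar `c` and `x` in `𝔤`. The reduced counit kills `𝔤` and
recovers `c`; the map from `detect` then recovers the coefficients of `x`. -/
theorem envHom_injective (hY : IsDeformedCurrent H g) : Function.Injective hY.envHom := by
  obtain ⟨Δ, hΔ⟩ := hY.exists_comul_reduction
  obtain ⟨ε, hε⟩ := exists_comp_mk (Y := Y)
    ((PowerSeries.constantCoeff : ℂ⟦X⟧ →+* ℂ).toSemilinearMap ∘ₛₗ H.counit.toLinearMap)
  obtain ⟨l, hl⟩ := hY.detect
  obtain ⟨L, hL⟩ := exists_comp_mk l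
  refine (Env.isPrimitivelyGenerated N).injective hY.envHom.toLinearMap Δ hΔ fun a ha h0 => ?_
  obtain ⟨c, x, rfl⟩ := Env.exists_of_mem_wordFil_one ha
  rw [AlgHom.toLinearMap_apply, map_add, AlgHom.commutes, envHom_ι] at h0
  have h1 : ε (hY.toReduction x) = 0 := by
    refine Current.hom_ext (f := ε ∘ₗ hY.toReduction) (f' := 0) (fun i j n => ?_) x
    change ε (hY.toReduction _) = 0
    rw [toReduction_evalGen, hε]
    change PowerSeries.constantCoeff (H.counit (g i j n)) = 0
    rw [hY.counit_gen, map_zero]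
  have h2 : L (hY.toReduction x) = Current.coeffs N x := by
    refine Current.hom_ext (f := L ∘ₗ hY.toReduction)
      (f' := Current.coeffs N ∘ₗ (twistedCurrent N).subtype) (fun i j n => ?_) x
    change L (hY.toReduction (Current.evalGen i j n)) = Current.coeffs N (Current.evalGen i j n)
    rw [toReduction_evalGen, hL, hl]
  have h3 : ε 1 = 1 := by
    rw [← Reduction.mk_one, hε]
    change PowerSeries.constantCoeff (H.counit 1) = 1
    rw [map_one, map_one]
  have hc : c = 0 := by
    have := congrArg ε h0
    rw [map_add, h1, add_zero, map_zero, Algebra.algebraMap_eq_smul_one, map_smul, h3, smul_eq_mul,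
      mul_one] at this
    exact this
  have hx : x = 0 := by
    have := congrArg L h0
    rw [hc, map_zero, zero_add, h2, map_zero] at this
    exact Subtype.ext (Current.coeffs_injective (this.trans (map_zero _).symm))
  rw [hc, hx, map_zero, map_zero, add_zero]

end IsDeformedCurrent

/-! ### Semilinear maps and triple tensor products -/

section Triple

variable {R S A B : Type*} [CommRing R] [Algebra ℚ R] [CommRing S] [Algebra ℚ S]
  [Ring A] [Algebra R A] [SuperAlgebra R A] [Ring B] [Algebra S B] [SuperAlgebra S B]
  {σ : R →+* S} {f : A →ₛₗ[σ] B}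

theorem flip₁₂_map (hf : ∀ a, f (parity (R := R) a) = parity (R := S) (f a))
    (t : A ⊗[R] (A ⊗[R] A)) :
    flip₁₂ S B (TensorProduct.map f (TensorProduct.map f f) t) =
      TensorProduct.map f (TensorProduct.map f f) (flip₁₂ R A t) := by
  induction t using homogeneous_tmul_induction₃ with
  | zero => simp only [map_zero]
  | add x y hx hy => simp only [map_add, hx, hy]
  | tmul i j k a ha b hb c hc =>
    rw [flip₁₂_tmul ha hb, TensorProduct.map_tmul, TensorProduct.map_tmul,
      flip₁₂_tmul (map_mem_degree hf ha) (map_mem_degree hf hb), map_units_smul,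
      TensorProduct.map_tmul, TensorProduct.map_tmul]

theorem flip₂₃_map (hf : ∀ a, f (parity (R := R) a) = parity (R := S) (f a))
    (t : A ⊗[R] (A ⊗[R] A)) :
    flip₂₃ S B (TensorProduct.map f (TensorProduct.map f f) t) =
      TensorProduct.map f (TensorProduct.map f f) (flip₂₃ R A t) := by
  induction t using homogeneous_tmul_induction₃ with
  | zero => simp only [map_zero]
  | add x y hx hy => simp only [map_add, hx, hy]
  | tmul i j k a ha b hb c hc =>
    rw [flip₂₃_tmul a hb hc, TensorProduct.map_tmul, TensorProduct.map_tmul,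
      flip₂₃_tmul (f a) (map_mem_degree hf hb) (map_mem_degree hf hc), map_units_smul,
      TensorProduct.map_tmul, TensorProduct.map_tmul]

theorem lTensor_map {D : A →ₗ[R] A ⊗[R] A} {D' : B →ₗ[S] B ⊗[S] B}
    (h : ∀ a, D' (f a) = TensorProduct.map f f (D a)) (t : A ⊗[R] A) :
    D'.lTensor B (TensorProduct.map f f t) =
      TensorProduct.map f (TensorProduct.map f f) (D.lTensor A t) := by
  induction t with
  | zero => simp only [map_zero]
  | add x y hx hy => simp only [map_add, hx, hy]
  | tmul a b =>
    rw [LinearMap.lTensor_tmul, TensorProduct.map_tmul, TensorProduct.map_tmul,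
      LinearMap.lTensor_tmul, h]

theorem assoc_rTensor_map {D : A →ₗ[R] A ⊗[R] A} {D' : B →ₗ[S] B ⊗[S] B}
    (h : ∀ a, D' (f a) = TensorProduct.map f f (D a)) (t : A ⊗[R] A) :
    TensorProduct.assoc S B B B (D'.rTensor B (TensorProduct.map f f t)) =
      TensorProduct.map f (TensorProduct.map f f)
        (TensorProduct.assoc R A A A (D.rTensor A t)) := by
  induction t with
  | zero => simp only [map_zero]
  | add x y hx hy => simp only [map_add, hx, hy]
  | tmul a b =>
    rw [LinearMap.rTensor_tmul, TensorProduct.map_tmul, LinearMap.rTensor_tmul, h]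
    generalize D a = s
    induction s with
    | zero => simp only [map_zero, TensorProduct.zero_tmul]
    | add x y hx hy => simp only [map_add, TensorProduct.add_tmul, hx, hy]
    | tmul c d => rfl

end Triple

/-! ### The quantisation -/

namespace IsDeformedCurrent

variable {Y : Type*} [Ring Y] [Algebra ℂ⟦X⟧ Y] [SuperAlgebra ℂ⟦X⟧ Y] {N : ℕ}
  {H : HopfSuperalgebra ℂ⟦X⟧ Y} {g : Idx N → Idx N → ℕ → Y}

/-- The classical limit. -/
def limit (hY : IsDeformedCurrent H g) :
    Y →ₛₗ[(PowerSeries.constantCoeff : ℂ⟦X⟧ →+* ℂ)] Env N :=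
  (LinearEquiv.ofBijective hY.envHom.toLinearMap
    ⟨hY.envHom_injective, hY.envHom_surjective⟩).symm.toLinearMap ∘ₛₗ Reduction.mk Y

theorem envHom_limit (hY : IsDeformedCurrent H g) (y : Y) :
    hY.envHom (hY.limit y) = Reduction.mk Y y :=
  (LinearEquiv.ofBijective hY.envHom.toLinearMap
    ⟨hY.envHom_injective, hY.envHom_surjective⟩).apply_symm_apply _

theorem limit_one (hY : IsDeformedCurrent H g) : hY.limit 1 = 1 :=
  hY.envHom_injective (by rw [envHom_limit, Reduction.mk_one, map_one])

theorem limit_mul (hY : IsDeformedCurrent H g) (x y : Y) :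
    hY.limit (x * y) = hY.limit x * hY.limit y :=
  hY.envHom_injective (by
    rw [envHom_limit, Reduction.mk_mul, map_mul hY.envHom, envHom_limit, envHom_limit])

theorem limit_gen (hY : IsDeformedCurrent H g) (i j : Idx N) (n : ℕ) :
    hY.limit (g i j n) = Env.ι N (Current.evalGen i j n) :=
  hY.envHom_injective (by rw [envHom_limit, envHom_ι, toReduction_evalGen])

theorem limit_surjective (hY : IsDeformedCurrent H g) : Function.Surjective hY.limit := fun a => by
  obtain ⟨y, hy⟩ := Reduction.mk_surjective (hY.envHom a)
  exact ⟨y, hY.envHom_injective ((hY.envHom_limit y).trans hy)⟩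

theorem limit_eq_zero_iff (hY : IsDeformedCurrent H g) (x : Y) :
    hY.limit x = 0 ↔ ∃ y, x = (PowerSeries.X : ℂ⟦X⟧) • y := by
  rw [← Reduction.mk_eq_zero_iff, ← envHom_limit hY, map_eq_zero_iff _ hY.envHom_injective]

theorem exists_comp_limit (hY : IsDeformedCurrent H g) {M : Type*} [AddCommGroup M] [Module ℂ M]
    (f : Y →ₛₗ[(PowerSeries.constantCoeff : ℂ⟦X⟧ →+* ℂ)] M) :
    ∃ F : Env N →ₗ[ℂ] M, ∀ y, F (hY.limit y) = f y :=
  exists_linearMap_comp_eq hY.limit hY.limit_surjective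
    (fun _ h => (hY.limit_eq_zero_iff _).1 h) f

/-- An induction principle for properties of elements of a deformation. -/
theorem induction (hY : IsDeformedCurrent H g) {P : Y → Prop} (one : P 1)
    (gen : ∀ i j n, P (g i j n)) (smul : ∀ (f : ℂ⟦X⟧) x, P x → P (f • x))
    (add : ∀ x y, P x → P y → P (x + y)) (mul : ∀ x y, P x → P y → P (x * y)) (x : Y) : P x := by
  have hx : x ∈ Algebra.adjoin ℂ⟦X⟧ (Set.range fun x : YangianGen N => g x.1 x.2.1 x.2.2) := by
    rw [hY.adjoin]; trivial
  induction hx using Algebra.adjoin_induction with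
  | mem y hy =>
    obtain ⟨⟨i, j, n⟩, rfl⟩ := hy
    exact gen i j n
  | algebraMap f =>
    rw [Algebra.algebraMap_eq_smul_one]
    exact smul f 1 one
  | add x y _ _ hx hy => exact add x y hx hy
  | mul x y _ _ hx hy => exact mul x y hx hy

theorem limit_parity (hY : IsDeformedCurrent H g) (x : Y) :
    hY.limit (parity (R := ℂ⟦X⟧) x) = parity (R := ℂ) (hY.limit x) := by
  induction x using hY.induction with
  | one => rw [map_one, limit_one, map_one]
  | gen i j n =>
    rw [mem_degree.1 (hY.gen_mem_degree i j n), map_units_smul, limit_gen,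
      mem_degree.1 (Env.ι_mem_degree (Current.evalGen_mem_degree i j n))]
  | smul f x hx => rw [map_smul, LinearMap.map_smulₛₗ, LinearMap.map_smulₛₗ, map_smul, hx]
  | add x y hx hy => rw [map_add, map_add, map_add, map_add, hx, hy]
  | mul x y hx hy => rw [map_mul, limit_mul, limit_mul, map_mul, hx, hy]

theorem map_limit_comul (hY : IsDeformedCurrent H g) (x : Y) :
    TensorProduct.map hY.limit hY.limit (H.comul x) = (Env.bialg N).comul (hY.limit x) := by
  induction x using hY.induction with
  | one =>
    have h1 : H.comul 1 = 1 ⊗ₜ 1 := (toSq ℂ⟦X⟧ Y).injective (by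
      rw [H.toSq_comul, map_one]; rfl)
    have h2 : (Env.bialg N).comul 1 = 1 ⊗ₜ 1 := (toSq ℂ (Env N)).injective (by
      rw [(Env.bialg N).toSq_comul, map_one]; rfl)
    rw [limit_one, h1, h2, TensorProduct.map_tmul, limit_one]
  | gen i j n =>
    rw [hY.comul_gen, map_comulGen_eq _ hY.limit_one, limit_gen, Env.bialg_comul_ι]
  | smul f x hx =>
    rw [map_smul, LinearMap.map_smulₛₗ, LinearMap.map_smulₛₗ, map_smul, hx]
  | add x y hx hy => rw [map_add, map_add, map_add, map_add, hx, hy]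
  | mul x y hx hy =>
    apply (toSq ℂ (Env N)).injective
    have hm : H.comul (x * y) = (toSq ℂ⟦X⟧ Y).symm (H.comulHom x * H.comulHom y) := by
      rw [LinearEquiv.eq_symm_apply, H.toSq_comul, map_mul]
    rw [hm, toSq_map_mul hY.limit hY.limit_parity hY.limit_mul, ← H.toSq_comul, ← H.toSq_comul,
      LinearEquiv.symm_apply_apply, LinearEquiv.symm_apply_apply, hx, hy, limit_mul,
      (Env.bialg N).toSq_comul, (Env.bialg N).toSq_comul, (Env.bialg N).toSq_comul, map_mul]

theorem constantCoeff_counit (hY : IsDeformedCurrent H g) (x : Y) :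
    PowerSeries.constantCoeff (H.counit x) = Env.counit N (hY.limit x) := by
  induction x using hY.induction with
  | one => rw [map_one, map_one, limit_one, map_one]
  | gen i j n => rw [hY.counit_gen, limit_gen, Env.counit_ι, map_zero]
  | smul f x hx => rw [map_smul, smul_eq_mul, map_mul, LinearMap.map_smulₛₗ, map_smul, hx, smul_eq_mul]
  | add x y hx hy => rw [map_add, map_add, map_add, map_add, hx, hy]
  | mul x y hx hy => rw [map_mul, map_mul, limit_mul, map_mul, hx, hy]

/-- The reduction of the antipode. -/
def limitAntipode (hY : IsDeformedCurrent H g) : Env N →ₗ[ℂ] Env N :=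
  (hY.exists_comp_limit (hY.limit ∘ₛₗ H.antipode)).choose

theorem limitAntipode_limit (hY : IsDeformedCurrent H g) (x : Y) :
    hY.limitAntipode (hY.limit x) = hY.limit (H.antipode x) :=
  (hY.exists_comp_limit (hY.limit ∘ₛₗ H.antipode)).choose_spec x

theorem limit_algebraMap (hY : IsDeformedCurrent H g) (f : ℂ⟦X⟧) :
    hY.limit (algebraMap ℂ⟦X⟧ Y f) = algebraMap ℂ (Env N) (PowerSeries.constantCoeff f) := by
  rw [Algebra.algebraMap_eq_smul_one, LinearMap.map_smulₛₗ, limit_one,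
    Algebra.algebraMap_eq_smul_one]

/-- The Hopf superalgebra structure of `U(𝔤)`. -/
def envHopf (hY : IsDeformedCurrent H g) : HopfSuperalgebra ℂ (Env N) where
  comulHom := (Env.bialg N).comulHom
  counit := (Env.bialg N).counit
  antipode := hY.limitAntipode
  comul := (Env.bialg N).comul
  toSq_comul := (Env.bialg N).toSq_comul
  comul_parity := (Env.bialg N).comul_parity
  counit_parity := (Env.bialg N).counit_parity
  antipode_parity a := by
    obtain ⟨x, rfl⟩ := hY.limit_surjective a
    rw [← limit_parity, limitAntipode_limit, H.antipode_parity, limit_parity, limitAntipode_limit]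
  coassoc := (Env.bialg N).comul_coassoc
  counit_left := (Env.bialg N).counit_left
  counit_right := (Env.bialg N).counit_right
  antipode_left a := by
    obtain ⟨x, rfl⟩ := hY.limit_surjective a
    have key : ∀ t : Y ⊗[ℂ⟦X⟧] Y, LinearMap.mul' ℂ (Env N) (hY.limitAntipode.rTensor (Env N)
        (TensorProduct.map hY.limit hY.limit t)) =
          hY.limit (LinearMap.mul' ℂ⟦X⟧ Y (H.antipode.rTensor Y t)) := fun t => by
      induction t with
      | zero => simp only [map_zero]
      | add s t hs ht => simp only [map_add, hs, ht]
      | tmul a b =>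
        rw [TensorProduct.map_tmul, LinearMap.rTensor_tmul, LinearMap.rTensor_tmul,
          LinearMap.mul'_apply, LinearMap.mul'_apply, limit_mul, limitAntipode_limit]
    rw [← map_limit_comul, key, H.antipode_left, limit_algebraMap, constantCoeff_counit]
    rfl
  antipode_right a := by
    obtain ⟨x, rfl⟩ := hY.limit_surjective a
    have key : ∀ t : Y ⊗[ℂ⟦X⟧] Y, LinearMap.mul' ℂ (Env N) (hY.limitAntipode.lTensor (Env N)
        (TensorProduct.map hY.limit hY.limit t)) =
          hY.limit (LinearMap.mul' ℂ⟦X⟧ Y (H.antipode.lTensor Y t)) := fun t => by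
      induction t with
      | zero => simp only [map_zero]
      | add s t hs ht => simp only [map_add, hs, ht]
      | tmul a b =>
        rw [TensorProduct.map_tmul, LinearMap.lTensor_tmul, LinearMap.lTensor_tmul,
          LinearMap.mul'_apply, LinearMap.mul'_apply, limit_mul, limitAntipode_limit]
    rw [← map_limit_comul, key, H.antipode_right, limit_algebraMap, constantCoeff_counit]
    rfl

/-- The antipode was obtained by reduction modulo `h`; its value on a primitive element is
nevertheless forced by the antipode axiom. -/
theorem isEnvelopingHopf (hY : IsDeformedCurrent H g) : IsEnvelopingHopf hY.envHopf := by
  intro x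
  refine ⟨Env.bialg_comul_ι x, Env.counit_ι x, ?_⟩
  have h := hY.envHopf.antipode_left (Env.ι N x)
  have h1 := hY.envHopf.antipode_left 1
  have e1 : hY.envHopf.comul 1 = 1 ⊗ₜ 1 := (toSq ℂ (Env N)).injective (by
      rw [hY.envHopf.toSq_comul, map_one]; rfl)
  rw [e1, LinearMap.rTensor_tmul, LinearMap.mul'_apply, mul_one, map_one hY.envHopf.counit,
    map_one (algebraMap ℂ (Env N))] at h1
  rw [show hY.envHopf.comul (Env.ι N x) = _ from Env.bialg_comul_ι x,
    show hY.envHopf.counit (Env.ι N x) = 0 from Env.counit_ι x, map_add, map_add,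
    LinearMap.rTensor_tmul, LinearMap.rTensor_tmul, LinearMap.mul'_apply, LinearMap.mul'_apply,
    mul_one, h1, one_mul, map_zero] at h
  exact eq_neg_of_add_eq_zero_left h

/-- The reduction of the cobracket. -/
def limitCobracket (hY : IsDeformedCurrent H g) : Env N →ₗ[ℂ] Env N ⊗[ℂ] Env N :=
  (hY.exists_comp_limit (TensorProduct.map hY.limit hY.limit ∘ₛₗ hY.cobracket)).choose

theorem limitCobracket_limit (hY : IsDeformedCurrent H g) (x : Y) :
    hY.limitCobracket (hY.limit x) = TensorProduct.map hY.limit hY.limit (hY.cobracket x) :=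
  (hY.exists_comp_limit (TensorProduct.map hY.limit hY.limit ∘ₛₗ hY.cobracket)).choose_spec x

/-- The difference `Δ - Δ°` is divisible by `h`, hence zero in the limit. -/
theorem flip_envHopf_comul (hY : IsDeformedCurrent H g) (a : Env N) :
    flip ℂ (Env N) (hY.envHopf.comul a) = hY.envHopf.comul a := by
  obtain ⟨x, rfl⟩ := hY.limit_surjective a
  change flip ℂ (Env N) ((Env.bialg N).comul _) = (Env.bialg N).comul _
  rw [← map_limit_comul, flip_map hY.limit hY.limit_parity, eq_comm, ← sub_eq_zero, ← map_sub,
    ← cocomm_apply, ← hY.X_smul_cobracket, LinearMap.map_smulₛₗ, PowerSeries.constantCoeff_X,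
    zero_smul]

theorem envHopf_comul_limit (hY : IsDeformedCurrent H g) (x : Y) :
    hY.envHopf.comul (hY.limit x) = TensorProduct.map hY.limit hY.limit (H.comul x) :=
  (hY.map_limit_comul x).symm

/-- The asymmetric rule `cobracket_mul` becomes the symmetric one because the limit is
cocommutative. -/
theorem limitCobracket_mul (hY : IsDeformedCurrent H g) (a b : Env N) :
    toSq ℂ (Env N) (hY.limitCobracket (a * b)) =
      toSq ℂ (Env N) (hY.limitCobracket a) * hY.envHopf.comulHom b +
        hY.envHopf.comulHom a * toSq ℂ (Env N) (hY.limitCobracket b) := by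
  obtain ⟨x, rfl⟩ := hY.limit_surjective a
  obtain ⟨y, rfl⟩ := hY.limit_surjective b
  have h := hY.cobracket_mul x y
  rw [← LinearEquiv.eq_symm_apply, map_add] at h
  rw [← limit_mul, limitCobracket_limit, h, map_add, map_add,
    toSq_map_mul hY.limit hY.limit_parity hY.limit_mul,
    toSq_map_mul hY.limit hY.limit_parity hY.limit_mul, ← H.toSq_comul,
    LinearEquiv.symm_apply_apply, LinearEquiv.symm_apply_apply, LinearEquiv.symm_apply_apply,
    LinearEquiv.symm_apply_apply, ← flip_map hY.limit hY.limit_parity, ← envHopf_comul_limit,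
    ← envHopf_comul_limit, flip_envHopf_comul, hY.envHopf.toSq_comul, hY.envHopf.toSq_comul,
    limitCobracket_limit, limitCobracket_limit]

/-- Since the limit map is surjective, even and compatible with the comultiplication and the
cobracket, each axiom is the image of the corresponding fact about the deformation. -/
theorem isCoPoisson (hY : IsDeformedCurrent H g) : IsCoPoisson hY.envHopf hY.limitCobracket where
  cocommutative := hY.flip_envHopf_comul
  map_parity a := by
    obtain ⟨x, rfl⟩ := hY.limit_surjective a
    rw [← limit_parity, limitCobracket_limit, limitCobracket_limit, hY.cobracket_parity]
    generalize hY.cobracket x = t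
    induction t with
    | zero => simp only [map_zero]
    | add s t hs ht => simp only [map_add, hs, ht]
    | tmul a b =>
      simp only [TensorProduct.map_tmul, AlgHom.toLinearMap_apply, limit_parity]
  antisymm a := by
    obtain ⟨x, rfl⟩ := hY.limit_surjective a
    rw [limitCobracket_limit, flip_map hY.limit hY.limit_parity, hY.flip_cobracket, map_neg]
  jacobi a := by
    obtain ⟨x, rfl⟩ := hY.limit_surjective a
    rw [limitCobracket_limit, lTensor_map hY.limitCobracket_limit]
    simp only [flip₁₂_map hY.limit_parity, flip₂₃_map hY.limit_parity]
    rw [← map_add, ← map_add, hY.cobracket_jacobi, map_zero]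
  leibniz a := by
    obtain ⟨x, rfl⟩ := hY.limit_surjective a
    rw [limitCobracket_limit, lTensor_map hY.envHopf_comul_limit, envHopf_comul_limit,
      assoc_rTensor_map hY.limitCobracket_limit, lTensor_map hY.limitCobracket_limit,
      flip₁₂_map hY.limit_parity, ← map_add, hY.cobracket_leibniz]
  map_mul := hY.limitCobracket_mul

theorem exists_cobracket (hY : IsDeformedCurrent H g) (x : Y) : ∃ D : Y ⊗[ℂ⟦X⟧] Y,
    (∀ D', (PowerSeries.X : ℂ⟦X⟧) • D' = H.comul x - flip ℂ⟦X⟧ Y (H.comul x) ↔ D' = D) ∧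
      TensorProduct.map hY.limit hY.limit D = hY.limitCobracket (hY.limit x) := by
  refine ⟨hY.cobracket x, fun D' => ⟨fun h => hY.regular ?_, ?_⟩, (hY.limitCobracket_limit x).symm⟩
  · exact h.trans (hY.X_smul_cobracket x).symm
  · rintro rfl
    exact hY.X_smul_cobracket x

theorem isQuantisation (hY : IsDeformedCurrent H g) :
    IsQuantisation hY.envHopf hY.limitCobracket H hY.limit where
  isCoPoisson := hY.isCoPoisson
  free := hY.free
  map_one := hY.limit_one
  map_mul := hY.limit_mul
  map_parity := hY.limit_parity
  surjective := hY.limit_surjective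
  eq_zero_iff := hY.limit_eq_zero_iff
  map_comul := hY.map_limit_comul
  map_counit := hY.constantCoeff_counit
  map_antipode x := (hY.limitAntipode_limit x).symm
  cobracket := hY.exists_cobracket

end IsDeformedCurrent

/-! ### The co-supercommutator -/

namespace Current

variable {N : ℕ}

theorem algebraMap_mem_degree (p : ℂ[X]) :
    algebraMap ℂ[X] (Current N) p ∈ degree ℂ (Current N) 0 := by
  rw [mem_degree, uzpow_zero, one_smul]
  refine Matrix.ext fun k l => ?_
  change (-1 : ℤˣ) ^ (k.2 + l.2) • algebraMap ℂ[X] (Current N) p k l = _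
  rw [Matrix.algebraMap_matrix_apply]
  split_ifs with h
  · rw [h, CharTwo.add_self_eq_zero, uzpow_zero, one_smul]
  · rw [smul_zero]

theorem ctmul_mul_ctmul {a b : ZMod 2} (x : Current N) {y : Current N}
    (hy : y ∈ degree ℂ (Current N) a) {z : Current N} (hz : z ∈ degree ℂ (Current N) b)
    (w : Current N) :
    ctmul x y * ctmul z w = (-1 : ℤˣ) ^ (a * b) • ctmul (x * z) (y * w) :=
  toST_mul x hy hz w

theorem ctmul_one_mul_ctmul (x z w : Current N) : ctmul x 1 * ctmul z w = ctmul (x * z) w := by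
  refine homogeneous_induction (R := ℂ) (P := fun z => ctmul x 1 * ctmul z w = ctmul (x * z) w)
    (fun y z hy hz => ?_) (fun i z hz => ?_) z
  · simp only [ctmul, TensorProduct.add_tmul, map_add, mul_add] at hy hz ⊢
    rw [hy, hz]
  · rw [ctmul_mul_ctmul x one_mem_degree hz w, zero_mul, uzpow_zero, one_smul, one_mul]

theorem ctmul_mul_one_ctmul (x y w : Current N) : ctmul x y * ctmul 1 w = ctmul x (y * w) := by
  refine homogeneous_induction (R := ℂ) (P := fun y => ctmul x y * ctmul 1 w = ctmul x (y * w))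
    (fun y z hy hz => ?_) (fun i z hz => ?_) y
  · simp only [ctmul, TensorProduct.tmul_add, map_add, add_mul] at hy hz ⊢
    rw [hy, hz]
  · rw [ctmul_mul_ctmul x hz one_mem_degree w, mul_zero, uzpow_zero, one_smul, mul_one]

/-- The embedding of the first tensor factor. -/
def inclLeft (N : ℕ) : Current N →ₐ[ℂ] TensorSq ℂ (Current N) :=
  AlgHom.ofLinearMap
    ((toSq ℂ (Current N)).toLinearMap ∘ₗ (TensorProduct.mk ℂ (Current N) (Current N)).flip 1)
    rfl (fun x y => (ctmul_one_mul_ctmul x y 1).symm)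

/-- The embedding of the second tensor factor. -/
def inclRight (N : ℕ) : Current N →ₐ[ℂ] TensorSq ℂ (Current N) :=
  AlgHom.ofLinearMap
    ((toSq ℂ (Current N)).toLinearMap ∘ₗ TensorProduct.mk ℂ (Current N) (Current N) 1)
    rfl (fun x y => (ctmul_mul_one_ctmul 1 x y).symm)

theorem inclLeft_mem_center (p : ℂ[X]) : inclLeft N (algebraMap ℂ[X] (Current N) p) ∈
    Subalgebra.center ℂ (TensorSq ℂ (Current N)) := by
  rw [Subalgebra.mem_center_iff]
  intro t
  refine STensor.induction (R := ℂ) (A := Current N) (B := Current N)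
    (P := fun t => t * inclLeft N (algebraMap ℂ[X] (Current N) p) =
      inclLeft N (algebraMap ℂ[X] (Current N) p) * t) ?_ ?_ ?_ t
  · rw [zero_mul, mul_zero]
  · intro x y hx hy
    rw [mul_add, add_mul, hx, hy]
  · intro i j x hx y hy
    change ctmul x y * ctmul _ 1 = ctmul _ 1 * ctmul x y
    rw [ctmul_one_mul_ctmul, ctmul_mul_ctmul x hy (algebraMap_mem_degree p), mul_zero, uzpow_zero,
      one_smul, mul_one, Algebra.commutes]

theorem inclRight_mem_center (p : ℂ[X]) : inclRight N (algebraMap ℂ[X] (Current N) p) ∈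
    Subalgebra.center ℂ (TensorSq ℂ (Current N)) := by
  rw [Subalgebra.mem_center_iff]
  intro t
  refine STensor.induction (R := ℂ) (A := Current N) (B := Current N)
    (P := fun t => t * inclRight N (algebraMap ℂ[X] (Current N) p) =
      inclRight N (algebraMap ℂ[X] (Current N) p) * t) ?_ ?_ ?_ t
  · rw [zero_mul, mul_zero]
  · intro x y hx hy
    rw [mul_add, add_mul, hx, hy]
  · intro i j x hx y hy
    change ctmul x y * ctmul 1 _ = ctmul 1 _ * ctmul x y
    rw [ctmul_mul_one_ctmul, ctmul_mul_ctmul 1 (algebraMap_mem_degree p) hx, zero_mul, uzpow_zero,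
      one_smul, one_mul, Algebra.commutes]

variable (N) in
/-- The centre of the tensor square. -/
def Scalars : Type := Subalgebra.center ℂ (TensorSq ℂ (Current N))

instance : CommRing (Scalars N) :=
  inferInstanceAs (CommRing (Subalgebra.center ℂ (TensorSq ℂ (Current N))))

variable (N) in
/-- The inclusion of the centre. -/
def scalarsVal : Scalars N →+* TensorSq ℂ (Current N) :=
  (Subalgebra.center ℂ (TensorSq ℂ (Current N))).val.toRingHom

instance : Algebra (Scalars N) (TensorSq ℂ (Current N)) :=
  (scalarsVal N).toAlgebra' fun c t => (Subalgebra.mem_center_iff.1 c.2 t).symm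

variable (N) in
/-- The polynomials in the first variable. -/
def scalarU : ℂ[X] →+* Scalars N :=
  (((inclLeft N).comp (Algebra.ofId ℂ[X] (Current N) |>.restrictScalars ℂ)).codRestrict
    (Subalgebra.center ℂ (TensorSq ℂ (Current N))) inclLeft_mem_center).toRingHom

variable (N) in
/-- The polynomials in the second variable. -/
def scalarV : ℂ[X] →+* Scalars N :=
  (((inclRight N).comp (Algebra.ofId ℂ[X] (Current N) |>.restrictScalars ℂ)).codRestrict
    (Subalgebra.center ℂ (TensorSq ℂ (Current N))) inclRight_mem_center).toRingHom

theorem scalarU_smul (p : ℂ[X]) (t : TensorSq ℂ (Current N)) :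
    scalarU N p • t = ctmul (algebraMap ℂ[X] (Current N) p) 1 * t := rfl

theorem scalarV_smul (p : ℂ[X]) (t : TensorSq ℂ (Current N)) :
    scalarV N p • t = ctmul 1 (algebraMap ℂ[X] (Current N) p) * t := rfl

/-- The matrix unit `E i j`. -/
abbrev unit (i j : Idx N) : Current N := Matrix.single i j 1

theorem single_eq (i j : Idx N) (p : ℂ[X]) :
    Matrix.single i j p = algebraMap ℂ[X] (Current N) p * unit i j := by
  rw [← Algebra.smul_def, Matrix.smul_single, smul_eq_mul, mul_one]

theorem ctmul_single (i j k l : Idx N) (p q : ℂ[X]) :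
    ctmul (Matrix.single i j p) (Matrix.single k l q) =
      (scalarU N p * scalarV N q) • ctmul (unit i j) (unit k l) := by
  rw [mul_smul, scalarV_smul, ctmul_mul_ctmul 1 (algebraMap_mem_degree q)
    (single_mem_degree i j 1), zero_mul, uzpow_zero, one_smul, one_mul, scalarU_smul,
    ctmul_one_mul_ctmul, ← single_eq, ← single_eq]

theorem ctmul_single_one (i j : Idx N) (p : ℂ[X]) :
    ctmul (Matrix.single i j p) 1 = scalarU N p • ctmul (unit i j) 1 := by
  rw [scalarU_smul, ctmul_one_mul_ctmul, ← single_eq]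

theorem ctmul_one_single (i j : Idx N) (p : ℂ[X]) :
    ctmul 1 (Matrix.single i j p) = scalarV N p • ctmul 1 (unit i j) := by
  rw [scalarV_smul, ctmul_mul_one_ctmul, ← single_eq]


theorem unit_mul_unit (a b c d : Idx N) :
    unit a b * unit c d = if b = c then unit a d else 0 := by
  split_ifs with h
  · rw [h, Matrix.single_mul_single_same, mul_one]
  · exact Matrix.single_mul_single_of_ne _ _ _ _ h _

theorem ctmul_zero_left (x : Current N) : ctmul 0 x = 0 := by
  rw [ctmul, TensorProduct.zero_tmul, map_zero]

theorem ctmul_zero_right (x : Current N) : ctmul x 0 = 0 := by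
  rw [ctmul, TensorProduct.tmul_zero, map_zero]

variable (N) in
/-- The numerator of the polar part at `u = v` of the `r`-matrix. -/
def polarSub : TensorSq ℂ (Current N) :=
  ∑ i : Idx N, ∑ j : Idx N, (-1 : ℤˣ) ^ j.2 • ctmul (unit i j) (unit j i)

variable (N) in
/-- The numerator of the polar part at `u = -v` of the `r`-matrix. -/
def polarAdd : TensorSq ℂ (Current N) :=
  ∑ i : Idx N, ∑ j : Idx N, (-1 : ℤˣ) ^ j.2 • ctmul (unit i j) (unit (opp j) (opp i))

/-- The product of `E j i ⊗ 1` and `polarSub`. -/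
def leftSub (i j : Idx N) : TensorSq ℂ (Current N) :=
  ∑ k : Idx N, (-1 : ℤˣ) ^ k.2 • ctmul (unit j k) (unit k i)

/-- The product of `polarSub` and `E j i ⊗ 1`. -/
def rightSub (i j : Idx N) : TensorSq ℂ (Current N) :=
  ∑ k : Idx N, (-1 : ℤˣ) ^ (j.2 + (j.2 + k.2) * (i.2 + j.2)) • ctmul (unit k i) (unit j k)

/-- The product of `E j i ⊗ 1` and `polarAdd`. -/
def leftAdd (i j : Idx N) : TensorSq ℂ (Current N) :=
  ∑ k : Idx N, (-1 : ℤˣ) ^ k.2 • ctmul (unit j k) (unit (opp k) (opp i))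

/-- The product of `polarAdd` and `E j i ⊗ 1`. -/
def rightAdd (i j : Idx N) : TensorSq ℂ (Current N) :=
  ∑ k : Idx N, (-1 : ℤˣ) ^ (j.2 + (j.2 + k.2) * (i.2 + j.2)) •
    ctmul (unit k i) (unit (opp j) (opp k))

theorem unit_tmul_mul_polarSub (i j : Idx N) :
    ctmul (unit j i) 1 * polarSub N = leftSub i j := by
  simp only [polarSub, leftSub, Finset.mul_sum, mul_units_smul, ctmul_one_mul_ctmul, unit_mul_unit]
  rw [Finset.sum_eq_single i]
  · simp
  · intro a _ h
    simp [h.symm, ctmul_zero_left]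
  · simp

theorem unit_tmul_mul_polarAdd (i j : Idx N) :
    ctmul (unit j i) 1 * polarAdd N = leftAdd i j := by
  simp only [polarAdd, leftAdd, Finset.mul_sum, mul_units_smul, ctmul_one_mul_ctmul, unit_mul_unit]
  rw [Finset.sum_eq_single i]
  · simp
  · intro a _ h
    simp [h.symm, ctmul_zero_left]
  · simp

/-- The value coincides with that in `unit_tmul_mul_polarSub`: `polarSub` intertwines the two
embeddings of the matrix units. Commutators with it are therefore proportional to `u^n - v^n`, which
removes the pole at `u = v`. -/
theorem polarSub_mul_tmul_unit (i j : Idx N) :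
    polarSub N * ctmul 1 (unit j i) = leftSub i j := by
  simp only [polarSub, leftSub, Finset.sum_mul, units_smul_mul, ctmul_mul_one_ctmul, unit_mul_unit]
  rw [Finset.sum_eq_single j]
  · simp
  · intro a _ h
    simp [h, ctmul_zero_right]
  · simp

/-- The indices become opposite, since `polarAdd` intertwines one embedding with the other twisted
by `η`. This pairs powers of `u` with powers of `-v` and removes the pole at `u = -v`. -/
theorem polarAdd_mul_tmul_unit (i j : Idx N) :
    polarAdd N * ctmul 1 (unit j i) = leftAdd (opp i) (opp j) := by
  simp only [polarAdd, leftAdd, Finset.sum_mul, units_smul_mul, ctmul_mul_one_ctmul, unit_mul_unit]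
  rw [Finset.sum_eq_single (opp j)]
  · simp [opp_opp]
  · intro a _ h
    have h' : opp a ≠ j := fun e => h (by rw [← e, opp_opp])
    simp [h', ctmul_zero_right]
  · simp

theorem polarSub_mul_unit_tmul (i j : Idx N) :
    polarSub N * ctmul (unit j i) 1 = rightSub i j := by
  simp only [polarSub, rightSub, Finset.sum_mul, units_smul_mul, ctmul_mul_ctmul _
    (single_mem_degree _ _ _) (single_mem_degree j i 1), unit_mul_unit, smul_smul, ← uzpow_add]
  refine Finset.sum_congr rfl fun k _ => ?_
  rw [Finset.sum_eq_single j]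
  · simp [add_comm i.2]
  · intro a _ h
    simp [h, ctmul_zero_left]
  · simp

theorem polarAdd_mul_unit_tmul (i j : Idx N) :
    polarAdd N * ctmul (unit j i) 1 = rightAdd i j := by
  simp only [polarAdd, rightAdd, Finset.sum_mul, units_smul_mul, ctmul_mul_ctmul _
    (single_mem_degree _ _ _) (single_mem_degree j i 1), unit_mul_unit, smul_smul, ← uzpow_add]
  refine Finset.sum_congr rfl fun k _ => ?_
  rw [Finset.sum_eq_single j]
  · have h : (opp j).2 + (opp k).2 = j.2 + k.2 := by
      have h2 : (1 : ZMod 2) + 1 = 0 := by decide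
      simp only [opp]
      linear_combination h2
    simp [add_comm i.2, h]
  · intro a _ h
    simp [h, ctmul_zero_left]
  · simp

theorem tmul_unit_mul_polarSub (i j : Idx N) :
    ctmul 1 (unit j i) * polarSub N = rightSub i j := by
  simp only [polarSub, rightSub, Finset.mul_sum, mul_units_smul, ctmul_mul_ctmul _
    (single_mem_degree _ _ _) (single_mem_degree _ _ 1), unit_mul_unit, smul_smul, ← uzpow_add]
  refine Finset.sum_congr rfl fun k _ => ?_
  rw [Finset.sum_eq_single i]
  · have h : ∀ a b c : ZMod 2, a + (b + a) * (c + a) = b + (b + c) * (a + b) := by decide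
    rw [if_pos rfl, h, one_mul]
  · intro a _ h
    rw [if_neg (Ne.symm h), ctmul_zero_right, smul_zero]
  · simp

theorem tmul_unit_mul_polarAdd (i j : Idx N) :
    ctmul 1 (unit j i) * polarAdd N = rightAdd (opp i) (opp j) := by
  simp only [polarAdd, rightAdd, Finset.mul_sum, mul_units_smul, ctmul_mul_ctmul _
    (single_mem_degree _ _ _) (single_mem_degree _ _ 1), unit_mul_unit, smul_smul, ← uzpow_add]
  refine Finset.sum_congr rfl fun k _ => ?_
  rw [Finset.sum_eq_single (opp i)]
  · have h : ∀ a b c : ZMod 2, a + 1 + (b + a) * (c + (a + 1)) =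
        b + 1 + (b + 1 + c) * (a + 1 + (b + 1)) := by decide
    rw [if_pos (opp_opp i).symm, one_mul, opp_opp]
    simp only [opp, h]
  · intro a _ h
    have h' : i ≠ opp a := fun e => h (by rw [e, opp_opp])
    simp [h', ctmul_zero_right]
  · simp

theorem rNumerator_eq : rNumerator N =
    (scalarU N Polynomial.X + scalarV N Polynomial.X) • polarSub N +
      (scalarU N Polynomial.X - scalarV N Polynomial.X) • polarAdd N := by
  rw [add_smul, sub_smul, scalarU_smul, scalarV_smul, scalarU_smul, scalarV_smul, rNumerator,
    add_mul, sub_mul]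
  rfl

theorem supercommutator_rNumerator (i j : Idx N) (n : ℕ) :
    (ctmul (twistedF j i n : Current N) 1 + ctmul 1 (twistedF j i n : Current N)) * rNumerator N
        - rNumerator N * (ctmul (twistedF j i n : Current N) 1
          + ctmul 1 (twistedF j i n : Current N)) =
      (scalarU N Polynomial.X + scalarV N Polynomial.X) •
          ((scalarU N Polynomial.X ^ n - scalarV N Polynomial.X ^ n) •
              (leftSub i j - rightSub i j) +
            ((-scalarU N Polynomial.X) ^ n - (-scalarV N Polynomial.X) ^ n) •
              (leftSub (opp i) (opp j) - rightSub (opp i) (opp j))) +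
        (scalarU N Polynomial.X - scalarV N Polynomial.X) •
          ((scalarU N Polynomial.X ^ n - (-scalarV N Polynomial.X) ^ n) •
              (leftAdd i j - rightAdd i j) +
            ((-scalarU N Polynomial.X) ^ n - scalarV N Polynomial.X ^ n) •
              (leftAdd (opp i) (opp j) - rightAdd (opp i) (opp j))) := by
  have e₁ : ctmul (twistedF j i n : Current N) 1 = scalarU N Polynomial.X ^ n • ctmul (unit j i) 1 +
      (-scalarU N Polynomial.X) ^ n • ctmul (unit (opp j) (opp i)) 1 := by
    rw [← map_neg, ← map_pow, ← map_pow, ← ctmul_single_one, ← ctmul_single_one, twistedF, ctmul,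
      ctmul, ctmul, ← map_add, ← TensorProduct.add_tmul]
  have e₂ : ctmul 1 (twistedF j i n : Current N) = scalarV N Polynomial.X ^ n • ctmul 1 (unit j i) +
      (-scalarV N Polynomial.X) ^ n • ctmul 1 (unit (opp j) (opp i)) := by
    rw [← map_neg, ← map_pow, ← map_pow, ← ctmul_one_single, ← ctmul_one_single, twistedF, ctmul,
      ctmul, ctmul, ← map_add, ← TensorProduct.tmul_add]
  rw [e₁, e₂, rNumerator_eq]
  generalize scalarU N Polynomial.X = u
  generalize scalarV N Polynomial.X = v
  simp only [mul_add, add_mul, smul_mul_assoc, mul_smul_comm, unit_tmul_mul_polarSub,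
    unit_tmul_mul_polarAdd, polarSub_mul_tmul_unit, polarAdd_mul_tmul_unit, polarSub_mul_unit_tmul,
    polarAdd_mul_unit_tmul, tmul_unit_mul_polarSub, tmul_unit_mul_polarAdd, opp_opp]
  module

theorem sum_antidiagonal_pow_mul {S : Type*} [CommRing S] (x y : S) (m : ℕ) :
    (x - y) * ∑ ab ∈ Finset.HasAntidiagonal.antidiagonal m, x ^ ab.1 * y ^ ab.2 =
      x ^ (m + 1) - y ^ (m + 1) := by
  rw [Finset.Nat.sum_antidiagonal_eq_sum_range_succ (fun a b => x ^ a * y ^ b), mul_comm]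
  exact geom_sum₂_mul x y (m + 1)

/-- The product of two elements `F` has four components, with powers of `±u` and `±v`. In each of
them `u² - v²` is factored so that one factor is the difference that telescopes the geometric sum.
-/
theorem sq_sub_sq_smul_sum (p q r s : Idx N) (m : ℕ) :
    (scalarU N Polynomial.X ^ 2 - scalarV N Polynomial.X ^ 2) •
        ∑ ab ∈ Finset.HasAntidiagonal.antidiagonal m,
          ctmul (twistedF p q ab.1 : Current N) (twistedF r s ab.2 : Current N) =
      (scalarU N Polynomial.X + scalarV N Polynomial.X) •
          ((scalarU N Polynomial.X ^ (m + 1) - scalarV N Polynomial.X ^ (m + 1)) •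
              ctmul (unit p q) (unit r s) -
            ((-scalarU N Polynomial.X) ^ (m + 1) - (-scalarV N Polynomial.X) ^ (m + 1)) •
              ctmul (unit (opp p) (opp q)) (unit (opp r) (opp s))) +
        (scalarU N Polynomial.X - scalarV N Polynomial.X) •
          ((scalarU N Polynomial.X ^ (m + 1) - (-scalarV N Polynomial.X) ^ (m + 1)) •
              ctmul (unit p q) (unit (opp r) (opp s)) -
            ((-scalarU N Polynomial.X) ^ (m + 1) - scalarV N Polynomial.X ^ (m + 1)) •
              ctmul (unit (opp p) (opp q)) (unit r s)) := by
  have e : ∀ a b : ℕ, ctmul (twistedF p q a : Current N) (twistedF r s b : Current N) =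
      (scalarU N Polynomial.X ^ a * scalarV N Polynomial.X ^ b) • ctmul (unit p q) (unit r s) +
      ((-scalarU N Polynomial.X) ^ a * (-scalarV N Polynomial.X) ^ b) •
        ctmul (unit (opp p) (opp q)) (unit (opp r) (opp s)) +
      (scalarU N Polynomial.X ^ a * (-scalarV N Polynomial.X) ^ b) •
        ctmul (unit p q) (unit (opp r) (opp s)) +
      ((-scalarU N Polynomial.X) ^ a * scalarV N Polynomial.X ^ b) •
        ctmul (unit (opp p) (opp q)) (unit r s) := fun a b => by
    simp only [← map_neg, ← map_pow, ← ctmul_single]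
    simp only [twistedF, ctmul, TensorProduct.add_tmul, TensorProduct.tmul_add, map_add]
    abel
  simp only [e, Finset.sum_add_distrib, ← Finset.sum_smul, smul_add, smul_smul]
  generalize scalarU N Polynomial.X = u
  generalize scalarV N Polynomial.X = v
  rw [show u ^ 2 - v ^ 2 = (u + v) * (u - v) by ring, mul_assoc, sum_antidiagonal_pow_mul,
    show (u + v) * (u - v) = -(u + v) * (-u - -v) by ring, mul_assoc (-(u + v)),
    sum_antidiagonal_pow_mul,
    show -(u + v) * (-u - -v) = (u - v) * (u - -v) by ring, mul_assoc (u - v),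
    sum_antidiagonal_pow_mul,
    show (u - v) * (u - -v) = -(u - v) * (-u - v) by ring, mul_assoc (-(u - v)),
    sum_antidiagonal_pow_mul]
  module

end Current

/-! ### Explicit cobracket on generators and its sums over the intermediate index. -/

namespace Current

variable {N : ℕ}

theorem sum_units_smul_smul (σ : Idx N → ℤˣ) (A B C D : Idx N → TensorSq ℂ (Current N))
    (c d c₁ c₂ c₃ c₄ : Scalars N) :
    ∑ k, σ k • (c • (c₁ • A k - c₂ • B k) + d • (c₃ • C k - c₄ • D k)) =
      c • (c₁ • ∑ k, σ k • A k - c₂ • ∑ k, σ k • B k) +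
        d • (c₃ • ∑ k, σ k • C k - c₄ • ∑ k, σ k • D k) := by
  simp only [Finset.smul_sum, ← Finset.sum_sub_distrib, ← Finset.sum_add_distrib]
  refine Finset.sum_congr rfl fun k _ => ?_
  rcases Int.units_eq_one_or (σ k) with h | h <;> simp only [h, one_smul, Units.neg_smul]
  all_goals module

theorem leftSub_eq (i j : Idx N) :
    ∑ k : Idx N, (-1 : ℤˣ) ^ (j.2 + k.2) • ctmul (unit j k) (unit k i) =
      (-1 : ℤˣ) ^ j.2 • leftSub i j := by
  simp only [leftSub, Finset.smul_sum, smul_smul, ← uzpow_add]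

theorem leftAdd_eq (i j : Idx N) :
    ∑ k : Idx N, (-1 : ℤˣ) ^ (j.2 + k.2) • ctmul (unit j k) (unit (opp k) (opp i)) =
      (-1 : ℤˣ) ^ j.2 • leftAdd i j := by
  simp only [leftAdd, Finset.smul_sum, smul_smul, ← uzpow_add]

/-- Replacing `k` by `opp k` shifts its parity by one, whence the minus sign. Such signs turn the
differences in `sq_sub_sq_smul_sum` into the sums in `supercommutator_rNumerator`. -/
theorem leftSub_opp (i j : Idx N) :
    ∑ k : Idx N, (-1 : ℤˣ) ^ (j.2 + k.2) • ctmul (unit (opp j) (opp k)) (unit (opp k) (opp i)) =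
      -((-1 : ℤˣ) ^ j.2 • leftSub (opp i) (opp j)) := by
  rw [leftSub, ← sum_opp fun k => (-1 : ℤˣ) ^ k.2 • ctmul (unit (opp j) k) (unit k (opp i))]
  simp only [Finset.smul_sum, smul_smul, sign_opp, Units.neg_smul, smul_neg,
    Finset.sum_neg_distrib, neg_neg, ← uzpow_add]

theorem leftAdd_opp (i j : Idx N) :
    ∑ k : Idx N, (-1 : ℤˣ) ^ (j.2 + k.2) • ctmul (unit (opp j) (opp k)) (unit k i) =
      -((-1 : ℤˣ) ^ j.2 • leftAdd (opp i) (opp j)) := by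
  rw [leftAdd, ← sum_opp fun k => (-1 : ℤˣ) ^ k.2 •
    ctmul (unit (opp j) k) (unit (opp k) (opp (opp i)))]
  simp only [Finset.smul_sum, smul_smul, sign_opp, Units.neg_smul, smul_neg,
    Finset.sum_neg_distrib, neg_neg, ← uzpow_add, opp_opp]

theorem sign_right (i j k : Idx N) :
    (-1 : ℤˣ) ^ ((i.2 + k.2) * (j.2 + k.2) + (j.2 + k.2)) =
      (-1 : ℤˣ) ^ j.2 * (-1 : ℤˣ) ^ (j.2 + (j.2 + k.2) * (i.2 + j.2)) := by
  rw [← uzpow_add]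
  congr 1
  generalize i.2 = a
  generalize j.2 = b
  generalize k.2 = c
  revert a b c
  decide

theorem sign_right_opp (i j k : Idx N) :
    (-1 : ℤˣ) ^ ((i.2 + k.2) * (j.2 + k.2) + (j.2 + k.2)) =
      -((-1 : ℤˣ) ^ j.2 *
        (-1 : ℤˣ) ^ ((opp j).2 + ((opp j).2 + (opp k).2) * ((opp i).2 + (opp j).2))) := by
  rw [← neg_mul, ← sign_opp, ← uzpow_add]
  congr 1
  simp only [opp]
  generalize i.2 = a
  generalize j.2 = b
  generalize k.2 = c
  revert a b c
  decide

theorem rightSub_eq (i j : Idx N) :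
    ∑ k : Idx N, (-1 : ℤˣ) ^ ((i.2 + k.2) * (j.2 + k.2) + (j.2 + k.2)) •
        ctmul (unit k i) (unit j k) = (-1 : ℤˣ) ^ j.2 • rightSub i j := by
  simp only [rightSub, Finset.smul_sum, smul_smul, sign_right]

theorem rightAdd_eq (i j : Idx N) :
    ∑ k : Idx N, (-1 : ℤˣ) ^ ((i.2 + k.2) * (j.2 + k.2) + (j.2 + k.2)) •
        ctmul (unit k i) (unit (opp j) (opp k)) = (-1 : ℤˣ) ^ j.2 • rightAdd i j := by
  simp only [rightAdd, Finset.smul_sum, smul_smul, sign_right]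

theorem rightSub_opp (i j : Idx N) :
    ∑ k : Idx N, (-1 : ℤˣ) ^ ((i.2 + k.2) * (j.2 + k.2) + (j.2 + k.2)) •
        ctmul (unit (opp k) (opp i)) (unit (opp j) (opp k)) =
      -((-1 : ℤˣ) ^ j.2 • rightSub (opp i) (opp j)) := by
  rw [rightSub, ← sum_opp fun k => (-1 : ℤˣ) ^ ((opp j).2 + ((opp j).2 + k.2) *
    ((opp i).2 + (opp j).2)) • ctmul (unit k (opp i)) (unit (opp j) k)]
  simp only [Finset.smul_sum, smul_smul, sign_right_opp, Units.neg_smul, Finset.sum_neg_distrib]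

theorem rightAdd_opp (i j : Idx N) :
    ∑ k : Idx N, (-1 : ℤˣ) ^ ((i.2 + k.2) * (j.2 + k.2) + (j.2 + k.2)) •
        ctmul (unit (opp k) (opp i)) (unit j k) =
      -((-1 : ℤˣ) ^ j.2 • rightAdd (opp i) (opp j)) := by
  rw [rightAdd, ← sum_opp fun k => (-1 : ℤˣ) ^ ((opp j).2 + ((opp j).2 + k.2) *
    ((opp i).2 + (opp j).2)) • ctmul (unit k (opp i)) (unit (opp (opp j)) (opp k))]
  simp only [Finset.smul_sum, smul_smul, sign_right_opp, Units.neg_smul, Finset.sum_neg_distrib,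
    opp_opp]

/-- The value of the co-supercommutator at `evalGen i j n`. -/
def cobracketGen (i j : Idx N) : ℕ → twistedCurrent N ⊗[ℂ] twistedCurrent N
  | 0 => 0
  | n + 1 => ∑ k : Idx N, ∑ ab ∈ Finset.HasAntidiagonal.antidiagonal n,
      ((-1 : ℤˣ) ^ ((i.2 + k.2) * (j.2 + k.2)) • (evalGen i k ab.1 ⊗ₜ evalGen k j ab.2) -
        evalGen k j ab.2 ⊗ₜ evalGen i k ab.1)

/-- This is the compatibility under which `extend` turns values on generators into a linear map on
`𝔤`. -/
theorem cobracketGen_opp (i j : Idx N) (n : ℕ) :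
    cobracketGen (opp i) (opp j) n = (-1 : ℤˣ) ^ (n + 1) • cobracketGen i j n := by
  match n with
  | 0 => rw [cobracketGen, cobracketGen, smul_zero]
  | n + 1 =>
    have h2 : (1 : ZMod 2) + 1 = 0 := by decide
    have h : ∀ i k : Idx N, (opp i).2 + (opp k).2 = i.2 + k.2 := fun i k => by
      simp only [opp]
      linear_combination h2
    have e : ∀ (i j k l : Idx N) (a b : ℕ), evalGen (opp i) (opp j) a ⊗ₜ[ℂ]
        evalGen (opp k) (opp l) b =
        (-1 : ℤˣ) ^ (a + 1 + (b + 1)) • (evalGen i j a ⊗ₜ[ℂ] evalGen k l b) := fun i j k l a b => by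
      rw [evalGen_opp, evalGen_opp, units_smul_tmul, tmul_units_smul, smul_smul, ← pow_add]
    rw [cobracketGen, cobracketGen, ← sum_opp]
    simp only [Finset.smul_sum]
    refine Finset.sum_congr rfl fun k _ => Finset.sum_congr rfl fun ab hab => ?_
    rw [Finset.HasAntidiagonal.mem_antidiagonal] at hab
    rw [h, h, e, e, show ab.1 + 1 + (ab.2 + 1) = n + 1 + 1 by omega,
      show ab.2 + 1 + (ab.1 + 1) = n + 1 + 1 by omega, smul_sub, smul_comm]

variable (N) in
/-- The co-supercommutator of `𝔤`. -/
def twistedCobracket : twistedCurrent N →ₗ[ℂ] twistedCurrent N ⊗[ℂ] twistedCurrent N :=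
  extend cobracketGen ∘ₗ (twistedCurrent N).subtype

theorem twistedCobracket_evalGen (i j : Idx N) (n : ℕ) :
    twistedCobracket N (evalGen i j n) = cobracketGen i j n :=
  extend_evalGen cobracketGen_opp i j n

theorem coe_evalGen (i j : Idx N) (n : ℕ) :
    (evalGen i j n : Current N) = -((-1 : ℤˣ) ^ j.2 • (twistedF j i n : Current N)) := by
  rw [evalGen, Submodule.coe_neg, coe_units_smul]

theorem ctmul_evalGen (i j k l : Idx N) (a b : ℕ) :
    ctmul (evalGen i j a : Current N) (evalGen k l b : Current N) = (-1 : ℤˣ) ^ (j.2 + l.2) •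
      ctmul (twistedF j i a : Current N) (twistedF l k b : Current N) := by
  rw [coe_evalGen, coe_evalGen, ctmul, TensorProduct.neg_tmul, TensorProduct.tmul_neg, neg_neg,
    units_smul_tmul, tmul_units_smul, smul_smul, ← uzpow_add, map_units_smul]
  rfl

theorem sq_sub_sq_mul (t : TensorSq ℂ (Current N)) : (varU N ^ 2 - varV N ^ 2) * t =
    (scalarU N Polynomial.X ^ 2 - scalarV N Polynomial.X ^ 2) • t := by
  rw [Algebra.smul_def, map_sub, map_pow, map_pow]
  rfl

theorem toSq_cobracketGen (i j : Idx N) (n : ℕ) :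
    toSq ℂ (Current N) (TensorProduct.map (twistedCurrent N).subtype (twistedCurrent N).subtype
        (cobracketGen i j (n + 1))) =
      ∑ k : Idx N, ((-1 : ℤˣ) ^ ((i.2 + k.2) * (j.2 + k.2) + (j.2 + k.2)) •
          ∑ ab ∈ Finset.HasAntidiagonal.antidiagonal n,
            ctmul (twistedF k i ab.1 : Current N) (twistedF j k ab.2 : Current N) -
        (-1 : ℤˣ) ^ (j.2 + k.2) • ∑ ab ∈ Finset.HasAntidiagonal.antidiagonal n,
            ctmul (twistedF j k ab.1 : Current N) (twistedF k i ab.2 : Current N)) := by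
  simp only [cobracketGen, map_sum, map_sub, map_units_smul, TensorProduct.map_tmul,
    Submodule.subtype_apply]
  refine Finset.sum_congr rfl fun k _ => ?_
  rw [Finset.sum_sub_distrib, Finset.smul_sum, Finset.smul_sum,
    ← Finset.Nat.sum_antidiagonal_swap (f := fun ab : ℕ × ℕ => (-1 : ℤˣ) ^ (j.2 + k.2) •
      ctmul (twistedF j k ab.1 : Current N) (twistedF k i ab.2 : Current N))]
  congr 1
  · refine Finset.sum_congr rfl fun ab _ => ?_
    rw [uzpow_add, mul_smul, add_comm j.2 k.2, ← ctmul_evalGen]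
    rfl
  · refine Finset.sum_congr rfl fun ab _ => ?_
    rw [← ctmul_evalGen]
    rfl

/-- Both sides are expanded in the same eight sums over `k`, four of left and four of right type,
with coefficients that are differences of powers. For `n = 0` these differences vanish, in
accordance with the value `0` of `cobracketGen`. -/
theorem sq_sub_sq_mul_toSq_cobracketGen (i j : Idx N) (n : ℕ) :
    (varU N ^ 2 - varV N ^ 2) * toSq ℂ (Current N)
        (TensorProduct.map (twistedCurrent N).subtype (twistedCurrent N).subtype
          (cobracketGen i j n)) =
      (ctmul (evalGen i j n : Current N) 1 + ctmul 1 (evalGen i j n : Current N)) * rNumerator N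
        - rNumerator N * (ctmul (evalGen i j n : Current N) 1
          + ctmul 1 (evalGen i j n : Current N)) := by
  have e₁ : ctmul (evalGen i j n : Current N) 1 + ctmul 1 (evalGen i j n : Current N) =
      -((-1 : ℤˣ) ^ j.2 • (ctmul (twistedF j i n : Current N) 1 +
        ctmul 1 (twistedF j i n : Current N))) := by
    rw [coe_evalGen, ctmul, ctmul, TensorProduct.neg_tmul, TensorProduct.tmul_neg, units_smul_tmul,
      tmul_units_smul, map_neg, map_neg, map_units_smul, map_units_smul, smul_add, neg_add]
    rfl
  rw [e₁, neg_mul, mul_neg, units_smul_mul, mul_units_smul, ← neg_sub', ← smul_sub,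
    supercommutator_rNumerator]
  match n with
  | 0 => simp [cobracketGen]
  | n + 1 =>
    rw [toSq_cobracketGen, sq_sub_sq_mul, Finset.smul_sum]
    simp_rw [smul_sub (scalarU N Polynomial.X ^ 2 - scalarV N Polynomial.X ^ 2)]
    rw [Finset.sum_sub_distrib]
    have e (σ : Idx N → ℤˣ) (f : Idx N → TensorSq ℂ (Current N)) :
        ∑ k, (scalarU N Polynomial.X ^ 2 - scalarV N Polynomial.X ^ 2) • σ k • f k =
          ∑ k, σ k • (scalarU N Polynomial.X ^ 2 - scalarV N Polynomial.X ^ 2) • f k :=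
      Finset.sum_congr rfl fun k _ => smul_comm _ _ _
    rw [e, e]
    simp_rw [sq_sub_sq_smul_sum]
    rw [sum_units_smul_smul, sum_units_smul_smul, leftSub_eq, leftAdd_eq, leftSub_opp, leftAdd_opp,
      rightSub_eq, rightAdd_eq, rightSub_opp, rightAdd_opp]
    rcases Int.units_eq_one_or ((-1 : ℤˣ) ^ j.2) with h | h <;>
    · simp only [h, one_smul, Units.neg_smul]
      module

theorem isTwistedCobracket_twistedCobracket : IsTwistedCobracket (twistedCobracket N) := fun x =>
  hom_ext
    (f := LinearMap.mulLeft ℂ (varU N ^ 2 - varV N ^ 2) ∘ₗ (toSq ℂ (Current N)).toLinearMap ∘ₗ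
      TensorProduct.map (twistedCurrent N).subtype (twistedCurrent N).subtype ∘ₗ twistedCobracket N)
    (f' := (LinearMap.mulRight ℂ (rNumerator N) - LinearMap.mulLeft ℂ (rNumerator N)) ∘ₗ
      ((inclLeft N).toLinearMap + (inclRight N).toLinearMap) ∘ₗ (twistedCurrent N).subtype)
    (fun i j n => by
      change (varU N ^ 2 - varV N ^ 2) * toSq ℂ (Current N) (TensorProduct.map _ _
        (twistedCobracket N (evalGen i j n))) = _
      rw [twistedCobracket_evalGen, sq_sub_sq_mul_toSq_cobracketGen]
      rfl) x

end Current

/-! ### Agreement of the reduced cobracket with the co-supercommutator. -/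

namespace IsDeformedCurrent

variable {N : ℕ} {Y : Type*} [Ring Y] [Algebra ℂ⟦X⟧ Y] [SuperAlgebra ℂ⟦X⟧ Y]
  {H : HopfSuperalgebra ℂ⟦X⟧ Y} {g : Idx N → Idx N → ℕ → Y}

/-- The sign produced by the flip equals the sign in the comultiplication, so the two cancel in the
flipped terms. -/
theorem cobracket_gen_succ (hY : IsDeformedCurrent H g) (i j : Idx N) (n : ℕ) :
    hY.cobracket (g i j (n + 1)) =
      ∑ k : Idx N, ∑ ab ∈ Finset.HasAntidiagonal.antidiagonal n,
        ((-1 : ℤˣ) ^ ((i.2 + k.2) * (j.2 + k.2)) • (g i k ab.1 ⊗ₜ g k j ab.2) -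
          g k j ab.2 ⊗ₜ g i k ab.1) := by
  rw [cobracket_gen, comulRest, matComul, map_sum, ← Finset.sum_sub_distrib]
  refine Finset.sum_congr rfl fun k _ => ?_
  rw [map_sum, ← Finset.sum_sub_distrib]
  refine Finset.sum_congr rfl fun ab _ => ?_
  rw [map_units_smul, flip_tmul (hY.gen_mem_degree _ _ _) (hY.gen_mem_degree _ _ _), smul_smul,
    ← uzpow_add, show (i.2 + k.2) * (j.2 + k.2) + (k.2 + j.2) * (i.2 + k.2) = 0 by
      rw [add_comm k.2 j.2, mul_comm (j.2 + k.2)]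
      exact CharTwo.add_self_eq_zero _, uzpow_zero, one_smul]

theorem limitCobracket_ι (hY : IsDeformedCurrent H g) (x : twistedCurrent N) :
    hY.limitCobracket (Env.ι N x) =
      TensorProduct.map (Env.ι N) (Env.ι N) (Current.twistedCobracket N x) :=
  Current.hom_ext (f := hY.limitCobracket ∘ₗ Env.ι N)
    (f' := TensorProduct.map (Env.ι N) (Env.ι N) ∘ₗ Current.twistedCobracket N) (fun i j n => by
      rw [LinearMap.comp_apply, LinearMap.comp_apply, Current.twistedCobracket_evalGen,
        ← hY.limit_gen, limitCobracket_limit]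
      match n with
      | 0 => rw [cobracket_gen, comulRest, map_zero, sub_zero, map_zero, Current.cobracketGen,
          map_zero]
      | n + 1 =>
        simp only [cobracket_gen_succ, Current.cobracketGen, map_sum, map_sub, map_units_smul,
          TensorProduct.map_tmul, limit_gen]) x

theorem isTwistedCoPoisson (hY : IsDeformedCurrent H g) :
    IsTwistedCoPoisson hY.envHopf hY.limitCobracket :=
  ⟨⟨_, Current.isTwistedCobracket_twistedCobracket, hY.limitCobracket_ι⟩, hY.limitCobracket_mul⟩

end IsDeformedCurrent

end

theorem proposition2p4 (N : ℕ) :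
    ∃ (HY : HopfSuperalgebra ℂ (Yangian N)) (Hh : HopfSuperalgebra ℂ⟦X⟧ (YangianH N))
      (HU : HopfSuperalgebra ℂ (Env N))
      (ψ : YangianH N →ₛₗ[(PowerSeries.constantCoeff : ℂ⟦X⟧ →+* ℂ)] Env N)
      (φ : Env N →ₗ[ℂ] Env N ⊗[ℂ] Env N),
      IsYangianHopf HY ∧ IsLinearExtension HY Hh ∧ IsEnvelopingHopf HU ∧
      IsTwistedCoPoisson HU φ ∧
      (∀ (i j : Idx N) (n : ℕ),
        ψ (YangianH.gen i j n) = -((-1 : ℤˣ) ^ j.2 • Env.ι N (twistedF j i n))) ∧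
      (∀ X : YangianH N, ∃ D : YangianH N ⊗[ℂ⟦X⟧] YangianH N,
        (∀ D', (PowerSeries.X : ℂ⟦X⟧) • D' =
          Hh.comul X - SuperAlgebra.flip ℂ⟦X⟧ (YangianH N) (Hh.comul X) ↔ D' = D) ∧
        TensorProduct.map ψ ψ D = φ (ψ X)) ∧
      IsQuantisation HU φ Hh ψ := by 
  obtain ⟨H, hext, hY⟩ := YangianH.exists_isDeformedCurrent N
  refine ⟨Yangian.hopf N, H, hY.envHopf, hY.limit, hY.limitCobracket, Yangian.isYangianHopf_hopf,
    hext, hY.isEnvelopingHopf, hY.isTwistedCoPoisson, fun i j n => ?_, hY.exists_cobracket,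
    hY.isQuantisation⟩
  rw [hY.limit_gen, Current.evalGen, map_neg, SuperAlgebra.map_units_smul]
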